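/- **Setting.** Each of finitely many parties $k\in\mathcal P$ has two settings $x\in\{0,1\}$ and two outcomes $a=\pm1$. A measurement system $A$ consists of Hilbert spaces $H'_k$ (of arbitrary dimension) and POVMs $(A^{(k)}_{a|x})_a$ on $H'_k$; put $K^{(k)}_x=A^{(k)}_{+1|x}-A^{(k)}_{-1|x}$. A Bell functional is a real tensor ${\sf B}=({\sf B}^{\vec a|\vec x})$, with Bell operator ${\sf B}[A]=\sum_{\vec a,\vec x}{\sf B}^{\vec a|\vec x}\bigotimes_kA^{(k)}_{a_k|x_k}$; it is *normalized* if $-\mathbb I\le{\sf B}[A]\le\mathbb I$ for all $A$. A *connector* is a family $({\sf C}_{b|y})_{b=\pm1,\,y=0,1}$ of Bell functionals such that $({\sf C}_{b|y}[A])_b$ is a POVM for all $y$ and all $A$. A *(qubit) connector complex* $\mathcal C=({\sf C},\bar A,V)$ consists of a connector ${\sf C}$, a measurement system $\bar A$ on $H_k=\mathbb C^2$ and a coisometry $V:\bigotimes_kH_k\to\mathbb C^2$ such that $(\bar M_{b|y})_b$, $\bar M_{b|y}:=V{\sf C}_{b|y}[\bar A]V^\dagger$, is a projective measurement for each $y$.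 *Full self-testing.* Let $\bar A$ be projective measurements on $H_k=\mathbb C^2$, $\bar\psi\in\bigotimes_kH_k$ a unit vector. A normalized Bell functional ${\sf B}$ *fully self-tests* $(\bar\psi,\bar A)$ if $\langle\bar\psi|{\sf B}[\bar A]|\bar\psi\rangle=1$, $\{f[\bar A]\bar\psi: f\text{ a tensor polynomial}\}=\bigotimes_kH_k$ (a tensor polynomial being a linear combination of products of operators $\bar A^{(k)}_{a|x}$ acting on one factor), and for every measurement system $A$ on Hilbert spaces $H'_k$ and unit vector $\psi\in\bigotimes_kH'_k$ with $\langle\psi|{\sf B}[A]|\psi\rangle=1$ there are orthonormal bases $(|i\rangle)_i$ of the $H_k$, orthonormal vectors $\psi(\vec i)\in\bigotimes_kH'_k$ with $\psi=\sum_{\vec i}\langle\vec i|\bar\psi\rangle\,\psi(\vec i)$, Hilbert spaces $J_k$, isometries $U_k:H'_k\to H_k\otimes J_k$ and a unit vector $|\mathrm{junk}\rangle\in\bigotimes_kJ_k$ such that for all $\vec a,\vec x,\vec i$ $$\Big(\bigotimes_kU_k\Big)\Big(\bigotimes_kA^{(k)}_{a_k|x_k}\Big)\psi(\vec i)=\Big(\bigotimes_k\bar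 A^{(k)}_{a_k|x_k}\Big)|\vec i\rangle\otimes|\mathrm{junk}\rangle .$$ A connector complex $\mathcal C$ is *fully self-testing* if there are real $\mu_{b|y}$ and a vector $\bar\psi$ in the range $I(\mathcal C)$ of $V^\dagger$ such that $\sum_{b,y}\mu_{b|y}{\sf C}_{b|y}$ fully self-tests $(\bar\psi,\bar A)$ and $I(\mathcal C)=\{f[{\sf C}[\bar A]]\bar\psi: f\text{ a polynomial}\}$. In that case we say that it is so *with* $(\mu,\bar\psi)$. *The complexes.* All are of the form ${\sf C}_{\pm|y}=\frac{\mathbb I\pm{\sf B}_y}2$, $\bar A^{(k)}_{\pm1|x}=\frac{\mathbb I\pm\bar K^{(k)}_x}2$, $V=|0\rangle\langle\phi_+|+|1\rangle\langle\phi_-|$, with the following data. 1. *CHSH–Tsirelson* $\mathcal C_{\rm Tsi}$ (two parties): $2\sqrt2\,{\sf B}_0=-K^{(1)}_0K^{(2)}_0+K^{(1)}_1K^{(2)}_0+K^{(1)}_0K^{(2)}_1+K^{(1)}_1K^{(2)}_1$, $2\sqrt2\,{\sf B}_1=K^{(1)}_0K^{(2)}_0+K^{(1)}_1K^{(2)}_0+K^{(1)}_0K^{(2)}_1-K^{(1)}_1K^{(2)}_1$;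 $\bar K^{(1)}_0=\sigma_3$, $\bar K^{(1)}_1=\sigma_1$, $\bar K^{(2)}_{0}=\frac{\sigma_3+\sigma_1}{\sqrt2}$, $\bar K^{(2)}_{1}=\frac{\sigma_3-\sigma_1}{\sqrt2}$; $\phi_+=\frac{|00\rangle+|11\rangle}{\sqrt2}$, $\phi_-=\frac{|01\rangle-|10\rangle}{\sqrt2}$. 2. *Tilted CHSH* $\mathcal C_{\rm Tilt}(\theta)$, $\theta\in\mathbb R$, $\theta\notin\frac\pi2\mathbb Z$ (two parties): with $\alpha=\frac{2\cos2\theta}{\sqrt{1+\sin^22\theta}}$ (which is $2(1+2\tan^22\theta)^{-1/2}$ if $\cos2\theta>0$), $\beta=\sqrt{8+2\alpha^2}$, $\mu=\arctan(\sin2\theta)$: $\beta{\sf B}_0=\alpha K^{(1)}_1-K^{(1)}_0K^{(2)}_0+K^{(1)}_1K^{(2)}_0+K^{(1)}_0K^{(2)}_1+K^{(1)}_1K^{(2)}_1$, $\beta{\sf B}_1=\alpha K^{(1)}_0+K^{(1)}_0K^{(2)}_0+K^{(1)}_1K^{(2)}_0+K^{(1)}_0K^{(2)}_1-K^{(1)}_1K^{(2)}_1$;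 $\bar K^{(1)}_0=\sigma_3$, $\bar K^{(1)}_1=\sigma_1$, $\bar K^{(2)}_{0}=\cos\mu\,\sigma_3+\sin\mu\,\sigma_1$, $\bar K^{(2)}_{1}=\cos\mu\,\sigma_3-\sin\mu\,\sigma_1$; $\phi_+=\cos\theta|00\rangle+\sin\theta|11\rangle$, $\phi_-=\sin\theta|01\rangle-\cos\theta|10\rangle$. 3. *WBC* $\mathcal C_{\rm WBC}(\theta,\varphi,\omega)$, real angles with $\cos(\theta+\varphi)\cos\varphi\cos(\theta+\omega)\cos\omega<0$ (two parties): with $\beta=\sin\theta\sin(\omega-\varphi)\sin(\theta+\varphi+\omega)$, $\beta{\sf B}_1=\cos(\theta+\varphi)\cos(\theta+\omega)\big(\cos\omega K^{(1)}_0K^{(2)}_0-\cos\varphi K^{(1)}_0K^{(2)}_1\big)+\cos\varphi\cos\omega\big(\cos(\theta+\varphi)K^{(1)}_1K^{(2)}_1-\cos(\theta+\omega)K^{(1)}_1K^{(2)}_0\big)$, and ${\sf B}_0$ is ${\sf B}_1$ with the settings $0,1$ of both parties exchanged; $\bar K^{(1)}_0=\sigma_1$, $\bar K^{(1)}_1=\cos\theta\sigma_1+\sin\theta\sigma_2$,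 $\bar K^{(2)}_0=\cos\varphi\sigma_1+\sin\varphi\sigma_2$, $\bar K^{(2)}_1=\cos\omega\sigma_1+\sin\omega\sigma_2$; $\phi_\pm=\frac{|00\rangle\pm i|11\rangle}{\sqrt2}$. 4. *BASTA* $\mathcal C_{\rm BASTA}(\mathcal G,v)$, $\mathcal G$ a connected graph with $q\ge2$ vertices (the parties) and edge set $\mathcal E$, $v$ a vertex, $n(i)$ the set of neighbours of $i$, $n_v=|n(v)|$, ${\sf EN}_i$ the set of vertices adjacent to both $v$ and $i$ or to neither: $\big((2\sqrt2-1)n_v+q-1\big){\sf B}_1=n_v(K^{(v)}_0+K^{(v)}_1)\prod_{i\in n(v)}K^{(i)}_1+\sum_{i\in n(v)}(K^{(v)}_0-K^{(v)}_1)K^{(i)}_0\prod_{v\ne j\in n(i)}K^{(j)}_1+\sum_{j\notin n(v)\cup\{v\}}K^{(j)}_0\prod_{k\in n(j)}K^{(k)}_1$, $2\sqrt2n_v{\sf B}_0=n_v(K^{(v)}_0-K^{(v)}_1)\prod_{i\ne v}K^{(i)}_1-\sum_{i\in n(v)}(K^{(v)}_0+K^{(v)}_1)K^{(i)}_0\prod_{j\in{\sf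 EN}_i}K^{(j)}_1$; $\bar K^{(v)}_{0}=\frac{\sigma_1+\sigma_3}{\sqrt2}$, $\bar K^{(v)}_{1}=\frac{\sigma_1-\sigma_3}{\sqrt2}$, $\bar K^{(j)}_0=\sigma_1$, $\bar K^{(j)}_1=\sigma_3$ for $j\ne v$; $\phi_+=2^{-q/2}\sum_{\vec x}(-1)^{\sum_{ij\in\mathcal E}x_ix_j}|\vec x\rangle$ (the graph state), $\phi_-=\sigma_3^{\otimes q}\phi_+$. *Contraction.* If $\bar M(\mathcal C_1)=\bar A^{(k)}(\mathcal C_2)$, the congruent contraction of $\mathcal C_1$ into leg $k$ of $\mathcal C_2$ has as connector the contraction of the output leg of ${\sf C}(\mathcal C_1)$ with the $k$-th input leg of ${\sf C}(\mathcal C_2)$, the measurements $\bar A(\mathcal C_1)$ and $\bar A^{(j)}(\mathcal C_2)$, $j\ne k$, and the coisometry $V(\mathcal C_2)(V(\mathcal C_1)\otimes\bigotimes_{j\ne k}\mathbb I^{(j)})$. A complex unitarily equivalent to $({\sf C},\bar A,V)$ is one of the form $({\sf C},(Q_k\bar A^{(k)}Q_k^\dagger)_k,WV\bigotimes_kQ_k^\dagger)$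 with unitaries $Q_k,W$. **Theorem.** (a) All the complexes $\mathcal C_{\rm Tsi}$, $\mathcal C_{\rm Tilt}(\theta)$, $\mathcal C_{\rm WBC}(\theta,\varphi,\omega)$, $\mathcal C_{\rm BASTA}(\mathcal G,v)$ above are fully self-testing connector complexes. (b) Let $\mathcal C$ be obtained from these complexes by finitely many unitary equivalences and congruent contractions along a tree, so that $\mathcal C$ is a tree network of them. Then $\mathcal C$ is a fully self-testing connector complex: the functional ${\sf C}_{+|1}(\mathcal C)-{\sf C}_{-|1}(\mathcal C)$ fully self-tests $\bar A(\mathcal C)$ and the qubit tree tensor network state of bond dimension 2 $V(\mathcal C)^\dagger\alpha$, where $\alpha=|0\rangle$, transformed by the unitaries $W$ that were applied at the root (so that the root tensor is the state $\phi_+$ of the root complex, up to local unitaries), and the complex is fully self-testing with $\mu_{\pm|1}=\pm1$, $\mu_{\pm|0}=0$ and this state. -/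

import Mathlib

universe u

open scoped ComplexOrder Matrix

namespace BellConnector

/-- A composite quantum system with parties `ι`: complex Hilbert spaces `H k` of arbitrary dimension
together with a Hilbert space `T` that is their Hilbert-space tensor product, `tmul u` being the
product vector `⨂ k, u k`. The three last fields determine `T` up to a unique unitary. -/
structure CompositeSystem (ι : Type) [Fintype ι] where
  H : ι → Type u
  [normedH : ∀ k, NormedAddCommGroup (H k)]
  [innerH : ∀ k, InnerProductSpace ℂ (H k)]
  [completeH : ∀ k, CompleteSpace (H k)]
  T : Type u
  [normedT : NormedAddCommGroup T]
  [innerT : InnerProductSpace ℂ T]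
  [completeT : CompleteSpace T]
  tmul : MultilinearMap ℂ H T
  inner_tmul : ∀ u v : ∀ k, H k, inner ℂ (tmul u) (tmul v) = ∏ k, inner ℂ (u k) (v k)
  dense_span : (Submodule.span ℂ (Set.range tmul)).topologicalClosure = ⊤

attribute [instance] CompositeSystem.normedH CompositeSystem.innerH CompositeSystem.completeH
  CompositeSystem.normedT CompositeSystem.innerT CompositeSystem.completeT

section TensorOperators

variable {ι : Type} [Fintype ι]

theorem gram_prod_bound {n : ℕ} (S S' : CompositeSystem.{u} ι)
    (A : ∀ k, S.H k →L[ℂ] S'.H k) (w : Fin n → ∀ k, S.H k) (s : Finset ι) :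
    (Matrix.of fun i j => ∏ k ∈ s, inner ℂ (A k (w i k)) (A k (w j k))).PosSemidef ∧
    (Matrix.of fun i j => ∏ k ∈ s, inner ℂ (w i k) (w j k)).PosSemidef ∧
    (Matrix.of fun i j => ((∏ k ∈ s, ‖A k‖ ^ 2 : ℝ) : ℂ) * ∏ k ∈ s, inner ℂ (w i k) (w j k)
      - ∏ k ∈ s, inner ℂ (A k (w i k)) (A k (w j k))).PosSemidef := by
  classical
  have hgram : ∀ {E : Type u} [NormedAddCommGroup E] [InnerProductSpace ℂ E] (v : Fin n → E),
      (Matrix.of fun i j => inner ℂ (v i) (v j)).PosSemidef := fun v =>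
    Matrix.posSemidef_gram ℂ v
  induction s using Finset.induction_on with
  | empty =>
    have h1 : (Matrix.of fun _ _ : Fin n => (1 : ℂ)).PosSemidef := by
      have := Matrix.posSemidef_vecMulVec_self_star (fun _ : Fin n => (1 : ℂ))
      convert! this using 1
      ext i j
      simp [Matrix.vecMulVec]
    refine ⟨by simpa using h1, by simpa using h1, ?_⟩
    have h0 := Matrix.PosSemidef.zero (n := Fin n) (R := ℂ)
    convert! h0 using 1
    ext i j
    simp
  | insert k s hk ih =>
    obtain ⟨ih1, ih2, ih3⟩ := ih
    have hA := hgram (fun i => A k (w i k))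
    have hw := hgram (fun i => w i k)
    have hd : (Matrix.of fun i j => ((‖A k‖ ^ 2 : ℝ) : ℂ) * inner ℂ (w i k) (w j k)
        - inner ℂ (A k (w i k)) (A k (w j k))).PosSemidef := by
      convert! Matrix.posSemidef_opNorm_smul_gram_sub_gram (𝕜 := ℂ) (fun i => w i k) (A k) using 1
    refine ⟨?_, ?_, ?_⟩
    · convert! hA.hadamard ih1 using 1
      ext i j
      simp [Finset.prod_insert hk]
    · convert! hw.hadamard ih2 using 1
      ext i j
      simp [Finset.prod_insert hk]
    · have hP : (0 : ℂ) ≤ ((∏ k ∈ s, ‖A k‖ ^ 2 : ℝ) : ℂ) := by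
        exact_mod_cast Finset.prod_nonneg fun k _ => sq_nonneg _
      convert! (hd.hadamard (ih2.smul hP)).add (hA.hadamard ih3) using 1
      ext i j
      simp [Finset.prod_insert hk]
      ring

theorem exists_tensorMap (S S' : CompositeSystem.{u} ι) (A : ∀ k, S.H k →L[ℂ] S'.H k) :
    ∃ F : S.T →L[ℂ] S'.T, ∀ u, F (S.tmul u) = S'.tmul fun k => A k (u k) := by
  classical
  let L : PiTensorProduct ℂ S.H →ₗ[ℂ] S.T := PiTensorProduct.lift S.tmul
  let L' : PiTensorProduct ℂ S.H →ₗ[ℂ] S'.T :=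
    PiTensorProduct.lift (S'.tmul.compLinearMap fun k => (A k).toLinearMap)
  have hL : ∀ u, L (PiTensorProduct.tprod ℂ u) = S.tmul u := fun u => by simp [L]
  have hL' : ∀ u, L' (PiTensorProduct.tprod ℂ u) = S'.tmul fun k => A k (u k) := fun u => by
    simp [L']
  have hdense : DenseRange L := by
    have hsub : Submodule.span ℂ (Set.range S.tmul) ≤ LinearMap.range L := by
      rw [Submodule.span_le]
      rintro _ ⟨u, rfl⟩
      exact ⟨_, hL u⟩
    have h1 : Dense ((Submodule.span ℂ (Set.range S.tmul) : Submodule ℂ S.T) : Set S.T) := by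
      rw [Submodule.dense_iff_topologicalClosure_eq_top]
      exact S.dense_span
    exact h1.mono hsub
  have hbound : ∃ C, ∀ x, ‖L' x‖ ≤ C * ‖L x‖ := by
    refine ⟨∏ k, ‖A k‖, fun x => ?_⟩
    have hx : x ∈ Submodule.span ℂ (Set.range (PiTensorProduct.tprod ℂ (s := S.H))) := by
      rw [PiTensorProduct.span_tprod_eq_top]
      trivial
    obtain ⟨n, c, g, rfl⟩ := Submodule.mem_span_set'.1 hx
    choose w hw using fun i => (g i).2
    have hps := (gram_prod_bound S S' A w Finset.univ).2.2.dotProduct_mulVec_nonneg c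
    have e : star c ⬝ᵥ ((Matrix.of fun i j => ((∏ k, ‖A k‖ ^ 2 : ℝ) : ℂ)
        * ∏ k, inner ℂ (w i k) (w j k) - ∏ k, inner ℂ (A k (w i k)) (A k (w j k))) *ᵥ c)
        = ((((∏ k, ‖A k‖) * ‖L (∑ i, c i • (g i).1)‖) ^ 2
          - ‖L' (∑ i, c i • (g i).1)‖ ^ 2 : ℝ) : ℂ) := by
      push_cast
      have e1 := inner_self_eq_norm_sq_to_K (𝕜 := ℂ) (L (∑ i, c i • (g i).1))
      have e2 := inner_self_eq_norm_sq_to_K (𝕜 := ℂ) (L' (∑ i, c i • (g i).1))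
      simp only [Complex.coe_algebraMap] at e1 e2
      rw [mul_pow, ← e1, ← e2, map_sum, map_sum]
      simp only [map_smul, ← hw, hL, hL', sum_inner, inner_sum, inner_smul_left, inner_smul_right,
        S.inner_tmul, S'.inner_tmul,
        dotProduct, Matrix.mulVec, Matrix.of_apply, Finset.mul_sum, ← Finset.sum_sub_distrib]
      rw [Finset.sum_comm]
      refine Finset.sum_congr rfl fun i _ => Finset.sum_congr rfl fun j _ => ?_
      simp only [Pi.star_apply, RCLike.star_def, Finset.prod_pow]
      ring
    rw [e] at hps
    have h2 : (0 : ℝ) ≤ ((∏ k, ‖A k‖) * ‖L (∑ i, c i • (g i).1)‖) ^ 2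
          - ‖L' (∑ i, c i • (g i).1)‖ ^ 2 := by exact_mod_cast hps
    exact le_of_sq_le_sq (by linarith)
      (mul_nonneg (Finset.prod_nonneg fun k _ => norm_nonneg _) (norm_nonneg _))
  refine ⟨L'.extendOfNorm L, fun u => ?_⟩
  rw [← hL, LinearMap.extendOfNorm_eq hdense hbound, hL']

/-- The bounded operator `⨂ k, A k` between the tensor products of two families of Hilbert spaces;
it is the only bounded operator with the property in `tensorMap_tmul`. -/
noncomputable def tensorMap (S S' : CompositeSystem.{u} ι) (A : ∀ k, S.H k →L[ℂ] S'.H k) :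
    S.T →L[ℂ] S'.T :=
  (exists_tensorMap S S' A).choose

theorem tensorMap_tmul (S S' : CompositeSystem.{u} ι) (A : ∀ k, S.H k →L[ℂ] S'.H k)
    (u : ∀ k, S.H k) : tensorMap S S' A (S.tmul u) = S'.tmul fun k => A k (u k) :=
  (exists_tensorMap S S' A).choose_spec u

end TensorOperators

/-! ### Bell functionals, connectors and their action on measurements

Every party has two settings `x : Fin 2` and two outcomes `a : Fin 2`; the outcome `0` stands for
`+1` and the outcome `1` for `-1`. In the real tensor of a Bell functional the first argument is the
list of outcomes, the second the list of settings. -/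

/-- The tensor `B^{a₁,…,a_q|x₁,…,x_q}`. -/
abbrev BellFunctional (ι : Type) : Type := (ι → Fin 2) → (ι → Fin 2) → ℝ

/-- The tensor `C_{b|y}^{a₁,…,a_q|x₁,…,x_q}`, written `C b y a x`. -/
abbrev Connector (ι : Type) : Type := Fin 2 → Fin 2 → BellFunctional ι

/-- Measurement operators on a family of Hilbert spaces: for every party `k` and setting `x` a POVM
`(op k a x)_a`, where `op k a x` is the effect of outcome `a`. -/
structure MeasurementSystem {ι : Type} [Fintype ι] (S : CompositeSystem.{u} ι) where
  op : ∀ k, Fin 2 → Fin 2 → S.H k →L[ℂ] S.H k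
  isPositive : ∀ k a x, (op k a x).IsPositive
  sum_op : ∀ k x, ∑ a, op k a x = 1

section Definitions

variable {ι : Type} [Fintype ι] [DecidableEq ι]

/-- The operator `⨂ k, A^{(k)}_{a_k|x_k}`. -/
noncomputable def MeasurementSystem.prodOp {S : CompositeSystem.{u} ι} (A : MeasurementSystem S)
    (a x : ι → Fin 2) : S.T →L[ℂ] S.T :=
  tensorMap S S fun k => A.op k (a k) (x k)

/-- The Bell operator `B[A]`. -/
noncomputable def MeasurementSystem.bellOp {S : CompositeSystem.{u} ι} (A : MeasurementSystem S)
    (B : BellFunctional ι) : S.T →L[ℂ] S.T :=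
  ∑ a, ∑ x, (B a x : ℂ) • A.prodOp a x

/-- `C` is a (normalized) connector: it maps every system of POVMs to a POVM for each `y`. -/
def IsConnector (C : Connector ι) : Prop :=
  ∀ (S : CompositeSystem.{u} ι) (A : MeasurementSystem S),
    (∀ b y, (A.bellOp (C b y)).IsPositive) ∧ ∀ y, ∑ b, A.bellOp (C b y) = 1

/-- The quantum Bell functional is normalized: `-1 ≤ B[A] ≤ 1` for all measurements. -/
def IsNormalized (B : BellFunctional ι) : Prop :=
  ∀ (S : CompositeSystem.{u} ι) (A : MeasurementSystem S),
    (1 - A.bellOp B).IsPositive ∧ (1 + A.bellOp B).IsPositive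

/-- Qubit operators. -/
abbrev QMat : Type := Matrix (Fin 2) (Fin 2) ℂ

/-- The operator `⨂ k, M k` on `⨂ k, ℂ²`, in the computational basis indexed by `ι → Fin 2`. -/
def tensorMatrix (M : ι → QMat) : Matrix (ι → Fin 2) (ι → Fin 2) ℂ :=
  Matrix.of fun i j => ∏ k, M k (i k) (j k)

/-- The Bell operator of qubit measurement operators `A k a x`. -/
def bellMatrix (A : ι → Fin 2 → Fin 2 → QMat) (B : BellFunctional ι) :
    Matrix (ι → Fin 2) (ι → Fin 2) ℂ :=
  ∑ a, ∑ x, (B a x : ℂ) • tensorMatrix fun k => A k (a k) (x k)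

/-- The operator `1 ⊗ … ⊗ M ⊗ … ⊗ 1` with `M` at party `k`. -/
def localMatrix (k : ι) (M : QMat) : Matrix (ι → Fin 2) (ι → Fin 2) ℂ :=
  tensorMatrix (Function.update (fun _ => 1) k M)

/-- The operators `f[A]`, `f` a tensor polynomial. -/
def tensorPolynomials (A : ι → Fin 2 → Fin 2 → QMat) :
    Subalgebra ℂ (Matrix (ι → Fin 2) (ι → Fin 2) ℂ) :=
  Algebra.adjoin ℂ {M | ∃ k a x, M = localMatrix k (A k a x)}

/-- The product vector `|i₁,…,i_q⟩` of local orthonormal bases `e k`. -/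
noncomputable def prodKet (e : ι → OrthonormalBasis (Fin 2) ℂ (EuclideanSpace ℂ (Fin 2)))
    (i : ι → Fin 2) : (ι → Fin 2) → ℂ :=
  fun j => ∏ k, e k (i k) (j k)

/-- For isometries `U k : H k → ℂ² ⊗ J k`, where `ℂ² ⊗ J k` is the Hilbert sum of two copies of
`J k`, the vector `(⨂ k, U k) φ` of `(⨂ k, ℂ²) ⊗ (⨂ k, J k)`, given by its components in
`⨂ k, J k` along the computational basis of `⨂ k, ℂ²`. -/
noncomputable def applyIsometries (S J : CompositeSystem.{u} ι)
    (U : ∀ k, S.H k →ₗᵢ[ℂ] PiLp 2 (fun _ : Fin 2 => J.H k)) (φ : S.T) : (ι → Fin 2) → J.T :=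
  fun i => tensorMap S J
    (fun k => (PiLp.proj 2 (fun _ : Fin 2 => J.H k) (i k) :
      PiLp 2 (fun _ : Fin 2 => J.H k) →L[ℂ] J.H k).comp (U k).toContinuousLinearMap) φ

/-- The normalized Bell functional `B` fully self-tests the qubit state `ψ'` and the projective qubit
measurements `A'`. The realizations are arbitrary: Hilbert spaces of any dimension, a unit vector
and POVMs that need not be projective. -/
structure FullySelfTests (B : BellFunctional ι) (ψ' : (ι → Fin 2) → ℂ)
    (A' : ι → Fin 2 → Fin 2 → QMat) : Prop where
  normalized : IsNormalized.{u} B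
  hermitian : ∀ k a x, (A' k a x).IsHermitian
  idempotent : ∀ k a x, A' k a x * A' k a x = A' k a x
  sum_eq_one : ∀ k x, ∑ a, A' k a x = 1
  unit_vector : star ψ' ⬝ᵥ ψ' = 1
  value_eq_one : star ψ' ⬝ᵥ (bellMatrix A' B *ᵥ ψ') = 1
  generates : {v | ∃ f ∈ tensorPolynomials A', v = f *ᵥ ψ'} = Set.univ
  rigid : ∀ (S : CompositeSystem.{u} ι) (A : MeasurementSystem S) (ψ : S.T),
    ‖ψ‖ = 1 → inner ℂ ψ (A.bellOp B ψ) = 1 →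
    ∃ (e : ι → OrthonormalBasis (Fin 2) ℂ (EuclideanSpace ℂ (Fin 2))) (Ψ : (ι → Fin 2) → S.T),
      Orthonormal ℂ Ψ ∧
      ψ = ∑ i, (star (prodKet e i) ⬝ᵥ ψ') • Ψ i ∧
      ∃ (J : CompositeSystem.{u} ι)
        (U : ∀ k, S.H k →ₗᵢ[ℂ] PiLp 2 (fun _ : Fin 2 => J.H k)) (junk : J.T),
        ‖junk‖ = 1 ∧
        ∀ a x i, applyIsometries S J U (A.prodOp a x (Ψ i)) =
          fun j => ((tensorMatrix fun k => A' k (a k) (x k)) *ᵥ prodKet e i) j • junk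

end Definitions

/-! ### Connector complexes -/

/-- The data of a connector complex on qubits: a connector, qubit measurement operators `meas k a x`,
and a linear map `V : ⨂ k, ℂ² → ℂ²`. -/
structure QubitComplex (ι : Type) where
  conn : Connector ι
  meas : ι → Fin 2 → Fin 2 → QMat
  V : Matrix (Fin 2) (ι → Fin 2) ℂ

namespace QubitComplex

section

variable {ι : Type} [Fintype ι] [DecidableEq ι]

/-- The output measurement `M_{b|y} = V C_{b|y}[A] V†`. -/
def outMeas (C : QubitComplex ι) (b y : Fin 2) : QMat :=
  C.V * bellMatrix C.meas (C.conn b y) * C.Vᴴ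

/-- `C` is a connector complex. -/
structure IsConnectorComplex (C : QubitComplex ι) : Prop where
  isConnector : IsConnector.{u} C.conn
  meas_posSemidef : ∀ k a x, (C.meas k a x).PosSemidef
  sum_meas : ∀ k x, ∑ a, C.meas k a x = 1
  coisometry : C.V * C.Vᴴ = 1
  out_hermitian : ∀ b y, (C.outMeas b y).IsHermitian
  out_idempotent : ∀ b y, C.outMeas b y * C.outMeas b y = C.outMeas b y
  sum_out : ∀ y, ∑ b, C.outMeas b y = 1

/-- The Bell functional `∑_{b,y} μ_{b|y} C_{b|y}`. -/
def functional (C : QubitComplex ι) (μ : Fin 2 → Fin 2 → ℝ) : BellFunctional ι :=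
  fun a x => ∑ b, ∑ y, μ b y * C.conn b y a x

/-- The operators `f[C[A]]`, `f` a polynomial. -/
def outPolynomials (C : QubitComplex ι) : Subalgebra ℂ (Matrix (ι → Fin 2) (ι → Fin 2) ℂ) :=
  Algebra.adjoin ℂ {M | ∃ b y, M = bellMatrix C.meas (C.conn b y)}

/-- `C` is a fully self-testing connector complex with weights `μ` and the state `V† α`, an element
of the invariant subspace, which is the range of `V†`. -/
structure FullySelfTestingWith (C : QubitComplex ι) (μ : Fin 2 → Fin 2 → ℝ) (α : Fin 2 → ℂ) :
    Prop where
  isConnectorComplex : IsConnectorComplex.{u} C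
  fullySelfTests : FullySelfTests.{u} (C.functional μ) (C.Vᴴ *ᵥ α) C.meas
  cyclic : {v | ∃ f ∈ C.outPolynomials, v = f *ᵥ (C.Vᴴ *ᵥ α)} = Set.range fun β => C.Vᴴ *ᵥ β

/-- `C` is a fully self-testing connector complex. -/
def IsFullySelfTesting (C : QubitComplex ι) : Prop :=
  ∃ (μ : Fin 2 → Fin 2 → ℝ) (α : Fin 2 → ℂ), FullySelfTestingWith.{u} C μ α

/-- The unitarily equivalent complex given by local unitaries `Q k` and a unitary `W`. -/
def conjugate (C : QubitComplex ι) (Q : ι → QMat) (W : QMat) : QubitComplex ι where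
  conn := C.conn
  meas := fun k a x => Q k * C.meas k a x * (Q k)ᴴ
  V := W * C.V * tensorMatrix fun k => (Q k)ᴴ

end

/-- Insert the value `c` at `k` into a family indexed by the other elements. -/
def plug {ι : Type} [DecidableEq ι] (k : ι) (c : Fin 2) (r : {j : ι // j ≠ k} → Fin 2) :
    ι → Fin 2 :=
  fun j => if h : j = k then c else r ⟨j, h⟩

/-- The contraction of the output leg of `C₁` with the input leg `k` of `C₂`. -/
def contract {ι₁ ι₂ : Type} [DecidableEq ι₂] (C₁ : QubitComplex ι₁) (C₂ : QubitComplex ι₂)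
    (k : ι₂) : QubitComplex ({j : ι₂ // j ≠ k} ⊕ ι₁) where
  conn := fun b y a x => ∑ a', ∑ x',
    C₂.conn b y (plug k a' fun j => a (.inl j)) (plug k x' fun j => x (.inl j)) *
      C₁.conn a' x' (fun l => a (.inr l)) (fun l => x (.inr l))
  meas := Sum.elim (fun j => C₂.meas j) C₁.meas
  V := Matrix.of fun o i => ∑ s,
    C₂.V o (plug k s fun j => i (.inl j)) * C₁.V s (fun l => i (.inr l))

/-- The contraction is congruent: `M_{b|y}(C₁) = A^{(k)}_{b|y}(C₂)`. -/
def Congruent {ι₁ ι₂ : Type} [Fintype ι₁] [DecidableEq ι₁] (C₁ : QubitComplex ι₁)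
    (C₂ : QubitComplex ι₂) (k : ι₂) : Prop :=
  ∀ b y, C₁.outMeas b y = C₂.meas k b y

end QubitComplex

/-! ### The construction of complexes from pairs of dichotomic Bell functionals -/

section Construction

variable {ι : Type} [Fintype ι] [DecidableEq ι]

/-- The functional `⨂ k, K^{(k)}_{s_k}`, where `K_x = A_{0|x} - A_{1|x}` and `s k = none` stands for
the identity operator at party `k`, written as `A_{0|0} + A_{1|0}`. -/
def correlator (s : ι → Option (Fin 2)) : BellFunctional ι := fun a x =>
  ∏ k, match s k with
    | some y => if x k = y then (-1) ^ (a k : ℕ) else 0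
    | none => if x k = 0 then 1 else 0

/-- The connector `C_{±|y} = (1 ± B_y) / 2`. -/
noncomputable def dichotomicConnector (B₀ B₁ : BellFunctional ι) : Connector ι := fun b y a x =>
  (correlator (fun _ => none) a x + (-1) ^ (b : ℕ) * (![B₀, B₁] y) a x) / 2

/-- The effects `A_{±|x} = (1 ± K_x) / 2`. -/
noncomputable def dichotomicMeas (K : ι → Fin 2 → QMat) : ι → Fin 2 → Fin 2 → QMat := fun k a x =>
  (2⁻¹ : ℂ) • (1 + ((-1) ^ (a : ℕ) : ℂ) • K k x)

/-- The complex with connector `(1 ± B_y) / 2`, measurements `(1 ± K_x) / 2` and coisometry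
`|0⟩⟨φ₊| + |1⟩⟨φ₋|`. -/
noncomputable def pauliComplex (B₀ B₁ : BellFunctional ι) (K : ι → Fin 2 → QMat)
    (φp φm : (ι → Fin 2) → ℂ) : QubitComplex ι where
  conn := dichotomicConnector B₀ B₁
  meas := dichotomicMeas K
  V := Matrix.of ![star φp, star φm]

end Construction

def σ₁ : QMat := !![0, 1; 1, 0]

def σ₂ : QMat := !![0, -Complex.I; Complex.I, 0]

def σ₃ : QMat := !![1, 0; 0, -1]

/-- The two-qubit computational basis vector `|i j⟩`. -/
def ket (i j : Fin 2) : (Fin 2 → Fin 2) → ℂ := Pi.single ![i, j] 1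

/-- The bipartite functional `K^{(1)}_x ⊗ K^{(2)}_y`. -/
def corr (x y : Fin 2) : BellFunctional (Fin 2) := correlator ![some x, some y]

/-- The bipartite functional `K^{(1)}_x ⊗ 1`. -/
def marg (x : Fin 2) : BellFunctional (Fin 2) := correlator ![some x, none]

/-- The CHSH-Tsirelson complex. -/
noncomputable def tsirelsonComplex : QubitComplex (Fin 2) :=
  pauliComplex
    ((2 * √2)⁻¹ • (-corr 0 0 + corr 1 0 + corr 0 1 + corr 1 1))
    ((2 * √2)⁻¹ • (corr 0 0 + corr 1 0 + corr 0 1 - corr 1 1))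
    ![![σ₃, σ₁], ![((√2)⁻¹ : ℝ) • (σ₃ + σ₁), ((√2)⁻¹ : ℝ) • (σ₃ - σ₁)]]
    (((√2)⁻¹ : ℝ) • (ket 0 0 + ket 1 1))
    (((√2)⁻¹ : ℝ) • (ket 0 1 - ket 1 0))

/-- `α(θ)`. Where `cos 2θ > 0` this is `2 (1 + 2 tan² 2θ)^{-1/2}`; the present form also gives the
limit value `0` at `cos 2θ = 0` and the sign that is right where `cos 2θ < 0`. -/
noncomputable def tiltAlpha (θ : ℝ) : ℝ := 2 * Real.cos (2 * θ) / √(1 + Real.sin (2 * θ) ^ 2)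

noncomputable def tiltBeta (θ : ℝ) : ℝ := √(8 + 2 * tiltAlpha θ ^ 2)

noncomputable def tiltMu (θ : ℝ) : ℝ := Real.arctan (Real.sin (2 * θ))

/-- The tilted CHSH complex. -/
noncomputable def tiltedComplex (θ : ℝ) : QubitComplex (Fin 2) :=
  pauliComplex
    ((tiltBeta θ)⁻¹ • (tiltAlpha θ • marg 1 - corr 0 0 + corr 1 0 + corr 0 1 + corr 1 1))
    ((tiltBeta θ)⁻¹ • (tiltAlpha θ • marg 0 + corr 0 0 + corr 1 0 + corr 0 1 - corr 1 1))
    ![![σ₃, σ₁],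
      ![Real.cos (tiltMu θ) • σ₃ + Real.sin (tiltMu θ) • σ₁,
        Real.cos (tiltMu θ) • σ₃ - Real.sin (tiltMu θ) • σ₁]]
    (Real.cos θ • ket 0 0 + Real.sin θ • ket 1 1)
    (Real.sin θ • ket 0 1 - Real.cos θ • ket 1 0)

noncomputable def wbcBeta (θ φ ω : ℝ) : ℝ :=
  Real.sin θ * Real.sin (ω - φ) * Real.sin (θ + φ + ω)

/-- The Wooltorton-Brown-Colbeck functional with the settings of each party permuted by `p`. -/
noncomputable def wbcFunctional (θ φ ω : ℝ) (p : Equiv.Perm (Fin 2)) : BellFunctional (Fin 2) :=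
  (wbcBeta θ φ ω)⁻¹ •
    ((Real.cos (θ + φ) * Real.cos (θ + ω)) •
        (Real.cos ω • corr (p 0) (p 0) - Real.cos φ • corr (p 0) (p 1)) +
      (Real.cos φ * Real.cos ω) •
        (Real.cos (θ + φ) • corr (p 1) (p 1) - Real.cos (θ + ω) • corr (p 1) (p 0)))

/-- The Wooltorton-Brown-Colbeck complex. -/
noncomputable def wbcComplex (θ φ ω : ℝ) : QubitComplex (Fin 2) :=
  pauliComplex
    (wbcFunctional θ φ ω (Equiv.swap 0 1))
    (wbcFunctional θ φ ω (Equiv.refl _))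
    ![![σ₁, Real.cos θ • σ₁ + Real.sin θ • σ₂],
      ![Real.cos φ • σ₁ + Real.sin φ • σ₂, Real.cos ω • σ₁ + Real.sin ω • σ₂]]
    (((√2)⁻¹ : ℝ) • (ket 0 0 + Complex.I • ket 1 1))
    (((√2)⁻¹ : ℝ) • (ket 0 0 - Complex.I • ket 1 1))

section Graph

variable {ι : Type} [Fintype ι] [DecidableEq ι]

open Classical in
/-- The set `n(v)` of neighbours. -/
noncomputable def nbrs (G : SimpleGraph ι) (v : ι) : Finset ι := {k | G.Adj v k}

/-- The functional `K^{(v)}_c ⊗ ⨂_{k ∈ n(v)} K^{(k)}_1`. -/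
noncomputable def stabString (G : SimpleGraph ι) (v : ι) (c : Fin 2) : BellFunctional ι :=
  correlator fun k => if k = v then some c else if k ∈ nbrs G v then some 1 else none

/-- The functional `K^{(v)}_c ⊗ K^{(i)}_0 ⊗ ⨂_{v ≠ k ∈ n(i)} K^{(k)}_1`. -/
noncomputable def nbrString (G : SimpleGraph ι) (v i : ι) (c : Fin 2) : BellFunctional ι :=
  correlator fun k => if k = v then some c else if k = i then some 0
    else if k ∈ nbrs G i then some 1 else none

/-- The functional `K^{(v)}_c ⊗ ⨂_{k ≠ v} K^{(k)}_1`. -/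
def fullString (v : ι) (c : Fin 2) : BellFunctional ι :=
  correlator fun k => if k = v then some c else some 1

/-- The functional `K^{(v)}_c ⊗ K^{(i)}_0 ⊗ ⨂_k K^{(k)}_1`, the last product over the vertices `k`
that are neighbours of both `v` and `i` or of neither. -/
noncomputable def evenNbrString (G : SimpleGraph ι) (v i : ι) (c : Fin 2) : BellFunctional ι :=
  correlator fun k => if k = v then some c else if k = i then some 0
    else if k ∈ nbrs G v ↔ k ∈ nbrs G i then some 1 else none

/-- The BASTA functional `B₁` of a graph with distinguished vertex `v`. -/
noncomputable def bastaB₁ (G : SimpleGraph ι) (v : ι) : BellFunctional ι :=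
  ((2 * √2 - 1) * (nbrs G v).card + Fintype.card ι - 1 : ℝ)⁻¹ •
    (((nbrs G v).card : ℝ) • (stabString G v 0 + stabString G v 1)
      + ∑ i ∈ nbrs G v, (nbrString G v i 0 - nbrString G v i 1)
      + ∑ j ∈ Finset.univ \ insert v (nbrs G v), stabString G j 0)

/-- The complementary BASTA functional `B₀`. -/
noncomputable def bastaB₀ (G : SimpleGraph ι) (v : ι) : BellFunctional ι :=
  (2 * √2 * (nbrs G v).card : ℝ)⁻¹ •
    (((nbrs G v).card : ℝ) • (fullString v 0 - fullString v 1)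
      - ∑ i ∈ nbrs G v, (evenNbrString G v i 0 + evenNbrString G v i 1))

open Classical in
/-- The number of edges of `G` with both ends in the support of the bit string `x`. -/
noncomputable def edgeCount (G : SimpleGraph ι) (x : ι → Fin 2) : ℕ :=
  Finset.card {e : Sym2 ι | e ∈ G.edgeSet ∧ ∀ k ∈ e, x k = 1}

/-- The graph state. -/
noncomputable def graphState (G : SimpleGraph ι) : (ι → Fin 2) → ℂ := fun x =>
  ((√(2 ^ Fintype.card ι))⁻¹ : ℝ) * (-1) ^ edgeCount G x

/-- The antigraph state. -/
noncomputable def antigraphState (G : SimpleGraph ι) : (ι → Fin 2) → ℂ := fun x =>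
  ((√(2 ^ Fintype.card ι))⁻¹ : ℝ) * (-1) ^ (edgeCount G x + ∑ k, (x k : ℕ))

/-- The BASTA complex of the graph `G` with distinguished vertex `v`. -/
noncomputable def bastaComplex (G : SimpleGraph ι) (v : ι) : QubitComplex ι :=
  pauliComplex (bastaB₀ G v) (bastaB₁ G v)
    (fun k => if k = v then
        ![((√2)⁻¹ : ℝ) • (σ₁ + σ₃), ((√2)⁻¹ : ℝ) • (σ₁ - σ₃)]
      else ![σ₁, σ₃])
    (graphState G) (antigraphState G)

end Graph

/-! ### Tree networks -/

/-- The weights of the functional `C_{+|1} - C_{-|1}`. -/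
def rootWeights : Fin 2 → Fin 2 → ℝ := ![![0, 1], ![0, -1]]

/-- `TreeNetwork C α`: the complex `C` is a congruently contracted tree of copies of the CHSH, tilted
CHSH, WBC and BASTA complexes (up to unitary equivalence at every stage), and `α` is the vector at
the output leg of the root whose image under `V†`, the adjoint of the contracted coisometry of `C`,
is the tensor network state with `φ₊` at the root. -/
inductive TreeNetwork : {ι : Type} → [Fintype ι] → [DecidableEq ι] → QubitComplex ι →
    (Fin 2 → ℂ) → Prop
  | tsirelson : TreeNetwork tsirelsonComplex ![1, 0]
  | tilted (θ : ℝ) (h : Real.sin (2 * θ) ≠ 0) : TreeNetwork (tiltedComplex θ) ![1, 0]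
  | wbc (θ φ ω : ℝ)
      (h : Real.cos (θ + φ) * Real.cos φ * Real.cos (θ + ω) * Real.cos ω < 0) :
      TreeNetwork (wbcComplex θ φ ω) ![1, 0]
  | basta {ι : Type} [Fintype ι] [DecidableEq ι] [Nontrivial ι] (G : SimpleGraph ι)
      (hG : G.Connected) (v : ι) : TreeNetwork (bastaComplex G v) ![1, 0]
  | conjugate {ι : Type} [Fintype ι] [DecidableEq ι] (C : QubitComplex ι) (α : Fin 2 → ℂ)
      (Q : ι → QMat) (W : QMat) (hQ : ∀ k, Q k ∈ Matrix.unitaryGroup (Fin 2) ℂ)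
      (hW : W ∈ Matrix.unitaryGroup (Fin 2) ℂ) :
      TreeNetwork C α → TreeNetwork (C.conjugate Q W) (W *ᵥ α)
  | contract {ι₁ ι₂ : Type} [Fintype ι₁] [DecidableEq ι₁] [Fintype ι₂] [DecidableEq ι₂]
      (C₁ : QubitComplex ι₁) (C₂ : QubitComplex ι₂) (α₁ α₂ : Fin 2 → ℂ) (k : ι₂)
      (hc : QubitComplex.Congruent C₁ C₂ k) :
      TreeNetwork C₁ α₁ → TreeNetwork C₂ α₂ → TreeNetwork (QubitComplex.contract C₁ C₂ k) α₂

end BellConnector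

/-! The proof replaces full self-testing by a stronger property, `QubitComplex.IsRigid`, about
commuting realizations (`CommSystem`): POVMs on one Hilbert space such that effects of different
parties commute, without any tensor factorization. Its core is that whenever the Bell operator
`C_{+|1}` fixes a unit vector `ψ`, there is an isometry `J` from the qubits into that space which
intertwines all measurement operators and maps `V†α` to `ψ`. Giving up the tensor product turns
contraction into substitution. By `bell_contract`, the Bell operator of a contracted connector is
the one of `C₂` in a realization whose party `k` measures the Bell operators of `C₁`, and this is
again a commuting realization.

Rigidity survives contraction (`IsRigid.contract_rigid`). Rigidity of `C₂` gives an embedding `J₂`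
of its qubits. For every basis state `|r⟩` of the legs other than `k`, rigidity of `C₁` applies to
the vector `J₂(|r⟩ ⊗ α₁)` and gives an embedding of the qubits of `C₁`. Schur's lemma makes these
embeddings orthogonal, and cyclicity of one vector under an irreducible algebra makes them
compatible with the other parties and with `J₂`, so they glue to one isometry. Unitary equivalence
only rotates the reference qubits.

Rigidity implies full self-testing (`IsRigid.fullySelfTestingWith`). In a tensor product of Hilbert
spaces the local matrix units `|0⟩⟨i|` are realized by operators on the local supports, and they
assemble into local isometries that extract the qubits and leave `J|0…0⟩` as junk.

It remains to treat the basic complexes. `pauliComplex_isRigid` reduces each to the action of `B₀`,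
`B₁` on `φ₊`, `φ₋`, to normalization in all commuting realizations, and to an embedding of every
maximizer of `B₁`. The embedding comes from `exists_embeds`: if on `ψ` each party's observables are
reflections with scalar anticommutator and can be replaced by operators commuting with that party,
then the qubit algebra acts on an invariant subspace containing `ψ`, and the Bell functionals that
fix `ψ` single out the qubit state.

These relations are read off from equality in norm or sum-of-squares bounds: `tilt_sos` for the
tilted CHSH operators (CHSH–Tsirelson is the case `θ = π/4`), `corr_sos` for the WBC operators. A
BASTA operator is a weighted average of CHSH operators and stabilizer strings, so at the maximum
every term is maximal; anticommutation then spreads from `v` along the edges of the connected graph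
(`StabRelations.anticommute`). -/

set_option linter.unusedSectionVars false

namespace BellConnector

/-! ### Products of commuting families -/

section CommutingProducts

variable {ι : Type} [Fintype ι] [DecidableEq ι] {R : Type*} [Ring R]

/-- The product of a finite family in a ring; the order of the factors is immaterial for families
whose members commute. -/
noncomputable def commProd (f : ι → R) : R := ((Finset.univ : Finset ι).toList.map f).prod

/-- The members of the family commute pairwise. -/
def PairwiseCommute (f : ι → R) : Prop := ∀ i j, i ≠ j → Commute (f i) (f j)

theorem PairwiseCommute.commute_all {f : ι → R} (hf : PairwiseCommute f) (i j : ι) :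
    Commute (f i) (f j) := by
  by_cases h : i = j
  · rw [h]
  · exact hf i j h

theorem commProd_eq_list {f : ι → R} (hf : PairwiseCommute f) (l : List ι) (hl : l.Nodup)
    (hm : ∀ i, i ∈ l) : commProd f = (l.map f).prod := by
  have hp : (Finset.univ : Finset ι).toList.Perm l := by
    rw [List.perm_ext_iff_of_nodup (Finset.nodup_toList _) hl]
    simp [hm]
  refine (hp.map f).prod_eq' ?_
  rw [List.pairwise_map]
  exact List.pairwise_of_forall fun i j => hf.commute_all i j

theorem PairwiseCommute.update {f : ι → R} (hf : PairwiseCommute f) (k : ι) {a : R}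
    (ha : ∀ j, j ≠ k → Commute a (f j)) : PairwiseCommute (Function.update f k a) := by
  intro i j hij
  by_cases hi : i = k
  · subst hi
    simpa [Function.update_of_ne (Ne.symm hij)] using ha j (Ne.symm hij)
  · by_cases hj : j = k
    · subst hj
      simpa [Function.update_of_ne hij] using (ha i hij).symm
    · simpa [Function.update_of_ne hi, Function.update_of_ne hj] using hf i j hij

theorem commProd_split {f : ι → R} (hf : PairwiseCommute f) (k : ι) :
    commProd f = f k * commProd (Function.update f k 1) := by
  have hm : ∀ i, i ∈ k :: ((Finset.univ : Finset ι).erase k).toList := by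
    intro i
    by_cases h : i = k <;> simp [h]
  have hn : (k :: ((Finset.univ : Finset ι).erase k).toList).Nodup := by
    simp [Finset.nodup_toList]
  rw [commProd_eq_list hf _ hn hm,
    commProd_eq_list (hf.update k fun j _ => Commute.one_left _) _ hn hm]
  simp only [List.map_cons, List.prod_cons, Function.update_self, one_mul]
  congr 2
  refine List.map_congr_left fun i hi => ?_
  rw [Function.update_of_ne]
  simp at hi
  exact hi

theorem commProd_update {f : ι → R} (hf : PairwiseCommute f) (k : ι) {a : R}
    (ha : ∀ j, j ≠ k → Commute a (f j)) :
    commProd (Function.update f k a) = a * commProd (Function.update f k 1) := by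
  rw [commProd_split (hf.update k ha) k]
  simp

theorem commProd_one : commProd (fun _ : ι => (1 : R)) = 1 := by
  simp [commProd]

theorem commProd_update_one (k : ι) (a : R) :
    commProd (Function.update (fun _ : ι => (1 : R)) k a) = a := by
  rw [commProd_update (f := fun _ => (1 : R)) (fun _ _ _ => Commute.one_left _) k
    (fun _ _ => Commute.one_right _), Function.update_eq_self, commProd_one, mul_one]

theorem commute_commProd {f : ι → R} {y : R} (h : ∀ k, Commute y (f k)) :
    Commute y (commProd f) := by
  refine Commute.list_prod_right _ _ ?_
  intro x hx
  obtain ⟨k, -, rfl⟩ := List.mem_map.1 hx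
  exact h k

theorem commProd_mul {f g : ι → R} (hf : PairwiseCommute f) (hg : PairwiseCommute g)
    (hfg : ∀ i j, i ≠ j → Commute (g i) (f j)) :
    commProd (fun k => f k * g k) = commProd f * commProd g := by
  have hfg' : PairwiseCommute fun k => f k * g k := fun i j hij =>
    ((hf i j hij).mul_right (hfg j i hij.symm).symm).mul_left ((hfg i j hij).mul_right (hg i j hij))
  have key : ∀ l : List ι, l.Nodup →
      (l.map fun k => f k * g k).prod = (l.map f).prod * (l.map g).prod := by
    intro l
    induction l with
    | nil => simp
    | cons a l ih =>
      intro hl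
      have hc : Commute (g a) (l.map f).prod := by
        refine Commute.list_prod_right _ _ ?_
        intro x hx
        obtain ⟨k, hk, rfl⟩ := List.mem_map.1 hx
        refine hfg a k ?_
        rintro rfl
        exact (List.nodup_cons.1 hl).1 hk
      simp only [List.map_cons, List.prod_cons, ih (List.nodup_cons.1 hl).2]
      rw [mul_assoc, ← mul_assoc (g a), hc.eq]
      noncomm_ring
  exact key _ (Finset.nodup_toList _)

theorem map_commProd {R' F : Type*} [Ring R'] [FunLike F R R'] [MonoidHomClass F R R'] (φ : F)
    (f : ι → R) : φ (commProd f) = commProd fun k => φ (f k) := by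
  simp [commProd, map_list_prod, Function.comp_def]

theorem commProd_mem {S : Submonoid R} {f : ι → R} (h : ∀ k, f k ∈ S) : commProd f ∈ S := by
  refine S.list_prod_mem ?_
  intro x hx
  obtain ⟨k, -, rfl⟩ := List.mem_map.1 hx
  exact h k

theorem commProd_sum {κ : Type} [Fintype κ] [DecidableEq κ] {f : κ ⊕ ι → R}
    (hf : PairwiseCommute f) :
    commProd f = commProd (fun k => f (.inl k)) * commProd fun k => f (.inr k) := by
  rw [commProd_eq_list hf ((Finset.univ : Finset κ).toList.map Sum.inl ++
    (Finset.univ : Finset ι).toList.map Sum.inr)]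
  · simp [commProd, Function.comp_def]
  · rw [List.nodup_append]
    refine ⟨(Finset.nodup_toList _).map Sum.inl_injective,
      (Finset.nodup_toList _).map Sum.inr_injective, ?_⟩
    simp
  · simp

theorem commProd_subtype {f : ι → R} (hf : PairwiseCommute f) (k : ι) :
    commProd f = f k * commProd fun j : {j : ι // j ≠ k} => f j := by
  rw [commProd_eq_list hf (k :: (Finset.univ : Finset {j : ι // j ≠ k}).toList.map Subtype.val)]
  · simp [commProd]
  · rw [List.nodup_cons]
    refine ⟨by simp, (Finset.nodup_toList _).map Subtype.val_injective⟩
  · intro i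
    by_cases h : i = k <;> simp [h]

variable [Algebra ℂ R]

/-- The product of the values of linear maps with commuting ranges, as a multilinear map. -/
noncomputable def commMultilinear {E : ι → Type*} [∀ k, AddCommMonoid (E k)]
    [∀ k, Module ℂ (E k)] (L : ∀ k, E k →ₗ[ℂ] R)
    (h : ∀ i j, i ≠ j → ∀ u v, Commute (L i u) (L j v)) : MultilinearMap ℂ E R where
  toFun u := commProd fun k => L k (u k)
  map_update_add' u k a b := by
    have hu : PairwiseCommute fun k => L k (u k) := fun i j hij => h i j hij _ _
    have key : ∀ c, (fun j => L j (Function.update u k c j))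
        = Function.update (fun j => L j (u j)) k (L k c) := by
      intro c
      ext j
      by_cases hj : j = k
      · subst hj; simp
      · simp [hj]
    simp only [key]
    rw [commProd_update hu k (fun j hj => h _ _ hj.symm _ _),
      commProd_update hu k (fun j hj => h _ _ hj.symm _ _),
      commProd_update hu k (fun j hj => h _ _ hj.symm _ _), map_add, add_mul]
  map_update_smul' u k c a := by
    have hu : PairwiseCommute fun k => L k (u k) := fun i j hij => h i j hij _ _
    have key : ∀ c, (fun j => L j (Function.update u k c j))
        = Function.update (fun j => L j (u j)) k (L k c) := by
      intro c
      ext j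
      by_cases hj : j = k
      · subst hj; simp
      · simp [hj]
    simp only [key]
    rw [commProd_update hu k (fun j hj => h _ _ hj.symm _ _),
      commProd_update hu k (fun j hj => h _ _ hj.symm _ _), map_smul, smul_mul_assoc]

theorem commMultilinear_apply {E : ι → Type*} [∀ k, AddCommMonoid (E k)]
    [∀ k, Module ℂ (E k)] (L : ∀ k, E k →ₗ[ℂ] R)
    (h : ∀ i j, i ≠ j → ∀ u v, Commute (L i u) (L j v)) (u : ∀ k, E k) :
    commMultilinear L h u = commProd fun k => L k (u k) := rfl

/-- Distributivity, with the product regarded as a multilinear map of its factors. It expands a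
product of observables into the sum over outcomes and settings encoded by a Bell tensor. -/
theorem commProd_sum_smul {α : Type*} [Fintype α] [DecidableEq α] (f : ι → α → R)
    (hf : ∀ i j, i ≠ j → ∀ u v, Commute (f i u) (f j v)) (c : ι → α → ℂ) :
    ∑ p : ι → α, (∏ k, c k (p k)) • commProd (fun k => f k (p k))
      = commProd fun k => ∑ a, c k a • f k a := by
  let L : ι → (α → ℂ) →ₗ[ℂ] R := fun k => Fintype.linearCombination ℂ (f k)
  have hL : ∀ i j, i ≠ j → ∀ u v, Commute (L i u) (L j v) := by
    intro i j hij u v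
    simp only [L, Fintype.linearCombination_apply]
    exact Commute.sum_left _ _ _ fun a _ => Commute.sum_right _ _ _ fun b _ =>
      ((hf i j hij a b).smul_left _).smul_right _
  have h1 := (commMultilinear L hL).map_sum (fun k (a : α) => c k a • (Pi.single a 1 : α → ℂ))
  simp only [commMultilinear_apply] at h1
  have h2 : ∀ k, L k (∑ a, c k a • (Pi.single a 1 : α → ℂ)) = ∑ a, c k a • f k a := by
    intro k
    simp [L, map_sum]
  simp only [h2] at h1
  rw [h1]
  refine Finset.sum_congr rfl fun p _ => ?_
  have h3 := (commMultilinear L hL).map_smul_univ (fun k => c k (p k))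
    (fun k => (Pi.single (p k) 1 : α → ℂ))
  simp only [commMultilinear_apply] at h3
  rw [h3]
  simp [L]

end CommutingProducts

/-! ### Bell elements of commuting families -/

section BellElements

variable {ι : Type} [Fintype ι] [DecidableEq ι] {R : Type*} [Ring R] [Algebra ℂ R]

/-- Operators that belong to different parties commute. -/
def Commuting (op : ι → Fin 2 → Fin 2 → R) : Prop :=
  ∀ i j, i ≠ j → ∀ a x b y, Commute (op i a x) (op j b y)

/-- The element `∑ B^{a|x} ∏ k, A^{(k)}_{a_k|x_k}` of an algebra. -/
noncomputable def bell (op : ι → Fin 2 → Fin 2 → R) (B : BellFunctional ι) : R :=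
  ∑ a, ∑ x, (B a x : ℂ) • commProd fun k => op k (a k) (x k)

/-- The observable `K_x`, or the identity. -/
def obs (op : ι → Fin 2 → Fin 2 → R) (k : ι) : Option (Fin 2) → R
  | none => 1
  | some x => op k 0 x - op k 1 x

theorem Commuting.pairwise {op : ι → Fin 2 → Fin 2 → R} (h : Commuting op) (a x : ι → Fin 2) :
    PairwiseCommute fun k => op k (a k) (x k) := fun i j hij => h i j hij _ _ _ _

theorem Commuting.obs_commute {op : ι → Fin 2 → Fin 2 → R} (h : Commuting op) {i j : ι}
    (hij : i ≠ j) (s t : Option (Fin 2)) : Commute (obs op i s) (obs op j t) := by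
  cases s <;> cases t <;> simp only [obs]
  · exact Commute.one_left _
  · exact Commute.one_left _
  · exact Commute.one_right _
  · exact ((h i j hij _ _ _ _).sub_right (h i j hij _ _ _ _)).sub_left
      ((h i j hij _ _ _ _).sub_right (h i j hij _ _ _ _))

theorem bell_add (op : ι → Fin 2 → Fin 2 → R) (B B' : BellFunctional ι) :
    bell op (B + B') = bell op B + bell op B' := by
  simp [bell, add_smul, Finset.sum_add_distrib]

theorem bell_smul (op : ι → Fin 2 → Fin 2 → R) (c : ℝ) (B : BellFunctional ι) :
    bell op (c • B) = (c : ℂ) • bell op B := by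
  simp [bell, mul_smul, Finset.smul_sum]

theorem bell_neg (op : ι → Fin 2 → Fin 2 → R) (B : BellFunctional ι) :
    bell op (-B) = -bell op B := by
  simp [bell]

theorem bell_sub (op : ι → Fin 2 → Fin 2 → R) (B B' : BellFunctional ι) :
    bell op (B - B') = bell op B - bell op B' := by
  rw [sub_eq_add_neg, bell_add, bell_neg, ← sub_eq_add_neg]

theorem bell_sum {κ : Type*} (s : Finset κ) (op : ι → Fin 2 → Fin 2 → R)
    (B : κ → BellFunctional ι) : bell op (∑ i ∈ s, B i) = ∑ i ∈ s, bell op (B i) := by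
  classical
  induction s using Finset.induction_on with
  | empty => simp [bell]
  | insert i s hi ih => rw [Finset.sum_insert hi, Finset.sum_insert hi, bell_add, ih]

theorem map_bell {R' : Type*} [Ring R'] [Algebra ℂ R'] (φ : R →ₐ[ℂ] R')
    (op : ι → Fin 2 → Fin 2 → R) (B : BellFunctional ι) :
    φ (bell op B) = bell (fun k a x => φ (op k a x)) B := by
  simp only [bell, map_sum, map_smul, map_commProd]

theorem bell_mem {S : Subalgebra ℂ R} {op : ι → Fin 2 → Fin 2 → R}
    (h : ∀ k a x, op k a x ∈ S) (B : BellFunctional ι) : bell op B ∈ S :=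
  sum_mem fun _ _ => sum_mem fun _ _ => S.smul_mem
    (commProd_mem (S := S.toSubsemiring.toSubmonoid) fun _ => h _ _ _) _

theorem commProd_prodMk {R' : Type*} [Ring R'] (f : ι → R) (g : ι → R') :
    commProd (fun k => (f k, g k)) = (commProd f, commProd g) :=
  Prod.ext (map_commProd (RingHom.fst R R') _) (map_commProd (RingHom.snd R R') _)

/-- A relation between elements of two algebras that survives sums, products and scalars is a
subalgebra of `R × R'`; once the measurement operators satisfy it, so do all Bell elements.
Intertwining relations are transported in this way below. -/
theorem bell_prodMk_mem {R' : Type*} [Ring R'] [Algebra ℂ R'] {S : Subalgebra ℂ (R × R')}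
    {op : ι → Fin 2 → Fin 2 → R} {op' : ι → Fin 2 → Fin 2 → R'}
    (h : ∀ k a x, (op k a x, op' k a x) ∈ S) (B : BellFunctional ι) :
    (bell op B, bell op' B) ∈ S := by
  have h1 := bell_mem h B
  have h2 : bell (fun k a x => (op k a x, op' k a x)) B = (bell op B, bell op' B) :=
    Prod.ext (map_bell (AlgHom.fst ℂ R R') _ _) (map_bell (AlgHom.snd ℂ R R') _ _)
  rwa [h2] at h1

theorem commute_bell {op : ι → Fin 2 → Fin 2 → R} {y : R} (h : ∀ k a x, Commute y (op k a x))
    (B : BellFunctional ι) : Commute y (bell op B) :=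
  Commute.sum_right _ _ _ fun _ _ => Commute.sum_right _ _ _ fun _ _ =>
    (commute_commProd fun _ => h _ _ _).smul_right _

theorem bell_correlator {op : ι → Fin 2 → Fin 2 → R} (hop : Commuting op)
    (hsum : ∀ k x, ∑ a, op k a x = 1) (s : ι → Option (Fin 2)) :
    bell op (correlator s) = commProd fun k => obs op k (s k) := by
  have h := commProd_sum_smul (fun k (p : Fin 2 × Fin 2) => op k p.1 p.2)
    (fun i j hij u v => hop i j hij _ _ _ _)
    (fun k p => match s k with
      | some y => if p.2 = y then (-1 : ℂ) ^ (p.1 : ℕ) else 0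
      | none => if p.2 = 0 then 1 else 0)
  -- The local factor of the tensor: the signs at the chosen setting produce `K_y`, and the identity
  -- is recovered as the sum of the two effects at setting `0`.
  have h2 : ∀ k, ∑ p : Fin 2 × Fin 2, (match s k with
      | some y => if p.2 = y then (-1 : ℂ) ^ (p.1 : ℕ) else 0
      | none => if p.2 = 0 then 1 else 0) • op k p.1 p.2 = obs op k (s k) := by
    intro k
    rw [Fintype.sum_prod_type]
    cases hs : s k with
    | none =>
      rw [obs, ← hsum k 0]
      simp
    | some y =>
      fin_cases y <;> simp [obs, sub_eq_add_neg]
  simp only [h2] at h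
  rw [← h, bell]
  rw [← (Equiv.arrowProdEquivProdArrow ι (fun _ => Fin 2) (fun _ => Fin 2)).symm.sum_comp,
    Fintype.sum_prod_type]
  refine Finset.sum_congr rfl fun a _ => Finset.sum_congr rfl fun x _ => ?_
  congr 1
  simp only [correlator, Equiv.arrowProdEquivProdArrow_symm_apply]
  push_cast
  refine Finset.prod_congr rfl fun k _ => ?_
  cases s k <;> simp <;> split_ifs <;> simp

end BellElements

/-! ### Tensor products of qubit operators -/

section TensorMatrix

variable {ι : Type} [Fintype ι] [DecidableEq ι]

theorem tensorMatrix_mul (M N : ι → QMat) :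
    tensorMatrix M * tensorMatrix N = tensorMatrix fun k => M k * N k := by
  ext i j
  simp only [tensorMatrix, Matrix.mul_apply, Matrix.of_apply, Finset.prod_univ_sum,
    Fintype.piFinset_univ, Finset.prod_mul_distrib]

theorem tensorMatrix_one : tensorMatrix (fun _ : ι => (1 : QMat)) = 1 := by
  ext i j
  simp only [tensorMatrix, Matrix.of_apply, Matrix.one_apply]
  by_cases h : i = j
  · simp [h]
  · obtain ⟨k, hk⟩ := Function.ne_iff.1 h
    rw [if_neg h]
    exact Finset.prod_eq_zero (Finset.mem_univ k) (if_neg hk)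

theorem tensorMatrix_conjTranspose (M : ι → QMat) :
    (tensorMatrix M)ᴴ = tensorMatrix fun k => (M k)ᴴ := by
  ext i j
  simp [tensorMatrix, Matrix.conjTranspose_apply]

theorem localMatrix_mul (k : ι) (M N : QMat) :
    localMatrix k M * localMatrix k N = localMatrix k (M * N) := by
  rw [localMatrix, localMatrix, localMatrix, tensorMatrix_mul]
  congr 1
  ext1 j
  by_cases h : j = k
  · subst h; simp
  · simp [h]

theorem localMatrix_one (k : ι) : localMatrix k (1 : QMat) = 1 := by
  rw [localMatrix, ← tensorMatrix_one]
  congr 1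
  exact Function.update_eq_self k (fun _ => (1 : QMat))

theorem localMatrix_conjTranspose (k : ι) (M : QMat) :
    (localMatrix k M)ᴴ = localMatrix k Mᴴ := by
  rw [localMatrix, localMatrix, tensorMatrix_conjTranspose]
  congr 1
  ext1 j
  by_cases h : j = k
  · subst h; simp
  · simp [h]

theorem tensorMatrix_update (M : ι → QMat) (k : ι) (X : QMat) (i j : ι → Fin 2) :
    tensorMatrix (Function.update M k X) i j
      = X (i k) (j k) * ∏ l ∈ Finset.univ.erase k, M l (i l) (j l) := by
  rw [tensorMatrix, Matrix.of_apply, ← Finset.mul_prod_erase _ _ (Finset.mem_univ k)]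
  simp only [Function.update_self]
  congr 1
  refine Finset.prod_congr rfl fun l hl => ?_
  rw [Function.update_of_ne (Finset.ne_of_mem_erase hl)]

theorem localMatrix_add (k : ι) (M N : QMat) :
    localMatrix k (M + N) = localMatrix k M + localMatrix k N := by
  ext i j
  simp [localMatrix, tensorMatrix_update, add_mul]

theorem localMatrix_smul (k : ι) (c : ℂ) (M : QMat) :
    localMatrix k (c • M) = c • localMatrix k M := by
  ext i j
  simp [localMatrix, tensorMatrix_update, mul_assoc]

/-- `localMatrix k` as a homomorphism of algebras. -/
noncomputable def localHom (k : ι) : QMat →ₐ[ℂ] Matrix (ι → Fin 2) (ι → Fin 2) ℂ :=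
  AlgHom.ofLinearMap
    { toFun := localMatrix k
      map_add' := localMatrix_add k
      map_smul' := localMatrix_smul k } (localMatrix_one k)
    (fun M N => (localMatrix_mul k M N).symm)

theorem localHom_apply (k : ι) (M : QMat) : localHom k M = localMatrix k M := rfl

theorem localMatrix_commute {i j : ι} (hij : i ≠ j) (M N : QMat) :
    Commute (localMatrix i M) (localMatrix j N) := by
  rw [Commute, SemiconjBy, localMatrix, localMatrix, tensorMatrix_mul, tensorMatrix_mul]
  congr 1
  ext1 l
  by_cases hi : l = i
  · subst hi; simp [hij]
  · by_cases hj : l = j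
    · subst hj; simp [hi]
    · simp [hi, hj]

theorem commuting_localMatrix (A : ι → Fin 2 → Fin 2 → QMat) :
    Commuting fun k a x => localMatrix k (A k a x) :=
  fun _ _ hij _ _ _ _ => localMatrix_commute hij _ _

theorem commProd_localMatrix (M : ι → QMat) :
    commProd (fun k => localMatrix k (M k)) = tensorMatrix M := by
  have key : ∀ l : List ι, l.Nodup → (l.map fun k => localMatrix k (M k)).prod
      = tensorMatrix fun k => if k ∈ l then M k else 1 := by
    intro l
    induction l with
    | nil => simp [tensorMatrix_one]
    | cons a l ih =>
      intro hl
      obtain ⟨ha, hl⟩ := List.nodup_cons.1 hl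
      rw [List.map_cons, List.prod_cons, ih hl, localMatrix, tensorMatrix_mul]
      congr 1
      ext1 k
      by_cases hk : k = a
      · subst hk; simp [ha]
      · simp [hk]
  rw [commProd, key _ (Finset.nodup_toList _)]
  simp

theorem bellMatrix_eq_bell (A : ι → Fin 2 → Fin 2 → QMat) (B : BellFunctional ι) :
    bellMatrix A B = bell (fun k a x => localMatrix k (A k a x)) B := by
  simp [bellMatrix, bell, commProd_localMatrix]

theorem tensorMatrix_single (i j : ι → Fin 2) :
    tensorMatrix (fun k => Matrix.single (i k) (j k) (1 : ℂ)) = Matrix.single i j 1 := by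
  ext p q
  simp only [tensorMatrix, Matrix.of_apply, Matrix.single_apply]
  by_cases h : i = p ∧ j = q
  · simp [h.1, h.2]
  · rw [if_neg h]
    have : ∃ k, ¬(i k = p k ∧ j k = q k) := by
      by_contra hc
      push Not at hc
      exact h ⟨funext fun k => (hc k).1, funext fun k => (hc k).2⟩
    obtain ⟨k, hk⟩ := this
    exact Finset.prod_eq_zero (Finset.mem_univ k) (if_neg hk)

/-- Irreducible local operators generate all operators. -/
theorem tensorPolynomials_eq_top {A : ι → Fin 2 → Fin 2 → QMat}
    (h : ∀ k, Algebra.adjoin ℂ {M | ∃ a x, M = A k a x} = ⊤) : tensorPolynomials A = ⊤ := by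
  have h1 : ∀ k M, localMatrix k M ∈ tensorPolynomials A := by
    intro k M
    have hM : M ∈ Algebra.adjoin ℂ {M | ∃ a x, M = A k a x} := by rw [h k]; trivial
    have h2 : Algebra.adjoin ℂ {M | ∃ a x, M = A k a x}
        ≤ (tensorPolynomials A).comap (localHom k) := by
      refine Algebra.adjoin_le ?_
      rintro _ ⟨a, x, rfl⟩
      exact Algebra.subset_adjoin ⟨k, a, x, rfl⟩
    exact h2 hM
  -- A matrix unit of the tensor product is the product of local matrix units.
  have h3 : ∀ i j, Matrix.single i j (1 : ℂ) ∈ tensorPolynomials A := by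
    intro i j
    rw [← tensorMatrix_single, ← commProd_localMatrix]
    exact commProd_mem (S := (tensorPolynomials A).toSubsemiring.toSubmonoid) fun k => h1 _ _
  rw [eq_top_iff]
  intro M _
  rw [Matrix.matrix_eq_sum_single M]
  refine sum_mem fun i _ => sum_mem fun j _ => ?_
  have : Matrix.single i j (M i j) = M i j • Matrix.single i j (1 : ℂ) := by
    simp [Matrix.smul_single]
  rw [this]
  exact (tensorPolynomials A).smul_mem (h3 i j) _

end TensorMatrix

/-! ### Bell elements of contractions -/

section Contraction

variable {ι₁ ι₂ : Type} [Fintype ι₁] [DecidableEq ι₁] [Fintype ι₂] [DecidableEq ι₂]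
  {R : Type*} [Ring R] [Algebra ℂ R]

/-- The operators seen by the connector `C₂` when `C₁` is plugged into its leg `k`. -/
noncomputable def composite (op : {j : ι₂ // j ≠ k} ⊕ ι₁ → Fin 2 → Fin 2 → R) (C₁ : Connector ι₁) :
    ι₂ → Fin 2 → Fin 2 → R :=
  fun j a x => if h : j = k then bell (fun l => op (.inr l)) (C₁ a x) else op (.inl ⟨j, h⟩) a x

variable {k : ι₂} {op : {j : ι₂ // j ≠ k} ⊕ ι₁ → Fin 2 → Fin 2 → R} {C₁ : Connector ι₁}

theorem composite_self (a x : Fin 2) :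
    composite op C₁ k a x = bell (fun l => op (.inr l)) (C₁ a x) := by
  simp [composite]

theorem composite_of_ne (j : {j : ι₂ // j ≠ k}) (a x : Fin 2) :
    composite op C₁ j a x = op (.inl j) a x := by
  simp [composite, j.2]

theorem Commuting.composite (hop : Commuting op) : Commuting (composite op C₁) := by
  have hb : ∀ (j : {j : ι₂ // j ≠ k}) a x b y,
      Commute (op (.inl j) a x) (bell (fun l => op (.inr l)) (C₁ b y)) := fun j a x b y =>
    commute_bell (fun l c z => hop _ _ (by simp) _ _ _ _) _
  intro i j hij a x b y
  by_cases hi : i = k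
  · subst hi
    lift j to {j : ι₂ // j ≠ i} using hij.symm
    rw [composite_self, composite_of_ne]
    exact (hb _ _ _ _ _).symm
  · lift i to {j : ι₂ // j ≠ k} using hi
    by_cases hj : j = k
    · subst hj
      rw [composite_self, composite_of_ne]
      exact hb _ _ _ _ _
    · lift j to {j : ι₂ // j ≠ k} using hj
      rw [composite_of_ne, composite_of_ne]
      exact hop _ _ (fun h => hij (by rw [Sum.inl.inj h])) _ _ _ _

theorem plug_self (c : Fin 2) (r : {j : ι₂ // j ≠ k} → Fin 2) : QubitComplex.plug k c r k = c := by
  simp [QubitComplex.plug]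

theorem plug_of_ne (c : Fin 2) (r : {j : ι₂ // j ≠ k} → Fin 2) (j : {j : ι₂ // j ≠ k}) :
    QubitComplex.plug k c r j = r j := by
  simp [QubitComplex.plug, j.2]

/-- Splitting off the value at `k`. -/
def plugEquiv (k : ι₂) : Fin 2 × ({j : ι₂ // j ≠ k} → Fin 2) ≃ (ι₂ → Fin 2) where
  toFun p := QubitComplex.plug k p.1 p.2
  invFun f := (f k, fun j => f j)
  left_inv p := by
    ext
    · simp [plug_self]
    · simp [plug_of_ne]
  right_inv f := by
    ext j
    by_cases h : j = k
    · subst h; simp [plug_self]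
    · simp [QubitComplex.plug, h]

theorem sum_plug {M : Type*} [AddCommMonoid M] (k : ι₂) (f : (ι₂ → Fin 2) → M) :
    ∑ i, f i = ∑ c, ∑ r, f (QubitComplex.plug k c r) := by
  rw [← (plugEquiv k).sum_comp, Fintype.sum_prod_type]
  rfl

theorem sum_sumElim {κ : Type} [Fintype κ] [DecidableEq κ] {M : Type*} [AddCommMonoid M]
    (f : (κ ⊕ ι₁ → Fin 2) → M) : ∑ i, f i = ∑ r, ∑ l, f (Sum.elim r l) := by
  rw [← (Equiv.sumArrowEquivProdArrow κ ι₁ (Fin 2)).symm.sum_comp, Fintype.sum_prod_type]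
  rfl

theorem sum_reorder {α β γ δ ε ζ M : Type*} [Fintype α] [Fintype β] [Fintype γ] [Fintype δ]
    [Fintype ε] [Fintype ζ] [AddCommMonoid M] (f : α → β → γ → δ → ε → ζ → M) :
    ∑ a, ∑ b, ∑ c, ∑ d, ∑ e, ∑ g, f a b c d e g
      = ∑ e, ∑ a, ∑ g, ∑ c, ∑ b, ∑ d, f a b c d e g := by
  simp only [← Fintype.sum_prod_type']
  exact Fintype.sum_equiv
    ⟨fun p => (p.2.2.2.2.1, p.1, p.2.2.2.2.2, p.2.2.1, p.2.1, p.2.2.2.1),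
      fun q => (q.2.1, q.2.2.2.2.1, q.2.2.2.1, q.2.2.2.2.2, q.1, q.2.2.1),
      fun _ => rfl, fun _ => rfl⟩ _ _ fun _ => rfl

/-- Contracting tensors amounts to substituting operators: in each product for `C₂` the factor at
`k` is split off and expanded as a Bell element of `C₁`, after which both sides are the same sixfold
sum in different orders. This identity drives the induction over the tree. -/
theorem bell_contract (hop : Commuting op) (C₁ : QubitComplex ι₁) (C₂ : QubitComplex ι₂)
    (b y : Fin 2) : bell op ((QubitComplex.contract C₁ C₂ k).conn b y)
      = bell (composite op C₁.conn) (C₂.conn b y) := by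
  have e1 : ∀ a x : ι₂ → Fin 2, commProd (fun j => composite op C₁.conn j (a j) (x j))
      = commProd (fun j : {j : ι₂ // j ≠ k} => op (.inl j) (a j) (x j)) *
        bell (fun l => op (.inr l)) (C₁.conn (a k) (x k)) := by
    intro a x
    rw [commProd_subtype ((hop.composite).pairwise a x) k]
    simp only [composite_self, composite_of_ne]
    refine (Commute.eq ?_)
    exact commute_commProd fun j => (commute_bell (fun l c z => hop _ _ (by simp) _ _ _ _) _).symm
  have e2 : ∀ a x : {j : ι₂ // j ≠ k} ⊕ ι₁ → Fin 2, commProd (fun j => op j (a j) (x j))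
      = commProd (fun j : {j : ι₂ // j ≠ k} => op (.inl j) (a (.inl j)) (x (.inl j))) *
        commProd (fun l => op (.inr l) (a (.inr l)) (x (.inr l))) := fun a x =>
    commProd_sum (hop.pairwise a x)
  rw [bell, bell, sum_plug k, sum_sumElim]
  simp only [sum_plug k, sum_sumElim, e1, e2, Sum.elim_inl, Sum.elim_inr, plug_self, plug_of_ne,
    QubitComplex.contract]
  simp only [bell, Finset.mul_sum, Finset.smul_sum, mul_smul_comm, smul_smul]
  push_cast
  simp only [Finset.sum_smul]
  rw [sum_reorder]

end Contraction

/-! ### Commuting realizations -/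

/-- POVMs on one Hilbert space such that the effects of different parties commute. -/
structure CommSystem (ι : Type) (T : Type u) [NormedAddCommGroup T] [InnerProductSpace ℂ T] where
  op : ι → Fin 2 → Fin 2 → T →L[ℂ] T
  isPositive : ∀ k a x, (op k a x).IsPositive
  sum_op : ∀ k x, ∑ a, op k a x = 1
  comm : Commuting op

section Intertwiners

variable {n : Type*} [Fintype n] [DecidableEq n] {T : Type u} [NormedAddCommGroup T]
  [InnerProductSpace ℂ T]

/-- The pairs of operators that are intertwined by a linear map. -/
def intertwined (J : (n → ℂ) →ₗ[ℂ] T) : Subalgebra ℂ (Matrix n n ℂ × (T →L[ℂ] T)) where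
  carrier := {p | ∀ v, p.2 (J v) = J (p.1 *ᵥ v)}
  mul_mem' {p q} hp hq v := by
    rw [Prod.snd_mul, mul_apply_eq_comp, hq, hp, Prod.fst_mul, Matrix.mulVec_mulVec]
  add_mem' {p q} hp hq v := by
    rw [Prod.snd_add, add_apply, hq, hp, Prod.fst_add, Matrix.add_mulVec,
      map_add]
  algebraMap_mem' c v := by
    simp [Algebra.algebraMap_eq_smul_one, Matrix.smul_mulVec]

theorem exists_mulVec_eq {α : n → ℂ} (hα : α ≠ 0) (v : n → ℂ) : ∃ M : Matrix n n ℂ, M *ᵥ α = v := by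
  obtain ⟨i, hi⟩ := Function.ne_iff.1 hα
  refine ⟨Matrix.vecMulVec v (Pi.single i (α i)⁻¹), ?_⟩
  rw [Matrix.vecMulVec_mulVec]
  ext j
  have : α i ≠ 0 := hi
  simp [this]

/-- A nonzero vector is cyclic for an irreducible algebra, so two maps that agree on it and carry
each generator to the same operator `O` agree everywhere. -/
theorem linearMap_eq_of_intertwines {S : Set (Matrix n n ℂ)} (hS : Algebra.adjoin ℂ S = ⊤)
    {F G : (n → ℂ) →ₗ[ℂ] T}
    (h : ∀ M ∈ S, ∃ O : T →ₗ[ℂ] T, ∀ v, O (F v) = F (M *ᵥ v) ∧ O (G v) = G (M *ᵥ v))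
    {α : n → ℂ} (hα : α ≠ 0) (hFG : F α = G α) : F = G := by
  have key : ∀ M ∈ Algebra.adjoin ℂ S, ∀ v, F v = G v → F (M *ᵥ v) = G (M *ᵥ v) := by
    intro M hM
    induction hM using Algebra.adjoin_induction with
    | mem M hM =>
      intro v hv
      obtain ⟨O, hO⟩ := h M hM
      rw [← (hO v).1, ← (hO v).2, hv]
    | algebraMap c => intro v hv; simp [Algebra.algebraMap_eq_smul_one, Matrix.smul_mulVec, hv]
    | add M N _ _ hM hN => intro v hv; rw [Matrix.add_mulVec, map_add, map_add, hM v hv, hN v hv]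
    | mul M N _ _ hM hN => intro v hv; rw [← Matrix.mulVec_mulVec]; exact hM _ (hN v hv)
  ext1 i
  ext1
  obtain ⟨M, hM⟩ := exists_mulVec_eq hα (Pi.single i 1)
  have := key M (by rw [hS]; trivial) α hFG
  simpa [hM] using this

/-- Schur's lemma: a sesquilinear form that is invariant under an irreducible set is a multiple of
the standard one. -/
theorem sesqForm_eq_of_invariant {S : Set (Matrix n n ℂ)} (hS : Algebra.adjoin ℂ S = ⊤)
    {F G : (n → ℂ) →ₗ[ℂ] T}
    (h : ∀ M ∈ S, ∀ v w, inner ℂ (F (M *ᵥ v)) (G w) = inner ℂ (F v) (G (Mᴴ *ᵥ w)))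
    {α : n → ℂ} (hα : star α ⬝ᵥ α = 1) (v w : n → ℂ) :
    inner ℂ (F v) (G w) = inner ℂ (F α) (G α) * (star v ⬝ᵥ w) := by
  have key : ∀ M ∈ Algebra.adjoin ℂ S, ∀ v w,
      inner ℂ (F (M *ᵥ v)) (G w) = inner ℂ (F v) (G (Mᴴ *ᵥ w)) := by
    intro M hM
    induction hM using Algebra.adjoin_induction with
    | mem M hM => exact h M hM
    | algebraMap c =>
      intro v w
      simp [Algebra.algebraMap_eq_smul_one, Matrix.smul_mulVec, mul_comm]
    | add M N _ _ hM hN =>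
      intro v w
      rw [Matrix.conjTranspose_add, Matrix.add_mulVec, Matrix.add_mulVec, map_add, map_add,
        inner_add_left, inner_add_right, hM, hN]
    | mul M N _ _ hM hN =>
      intro v w
      rw [← Matrix.mulVec_mulVec, hM, hN, Matrix.conjTranspose_mul, Matrix.mulVec_mulVec]
  have hall : ∀ (M : Matrix n n ℂ) v w,
      inner ℂ (F (M *ᵥ v)) (G w) = inner ℂ (F v) (G (Mᴴ *ᵥ w)) := fun M =>
    key M (by rw [hS]; trivial)
  -- By irreducibility the invariance extends to `|v⟩⟨α|`, which sends `α` to `v` and whose adjoint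
  -- sends `w` to `⟨v|w⟩ α`.
  have h1 := hall (Matrix.vecMulVec v (star α)) α w
  rw [Matrix.vecMulVec_mulVec, hα] at h1
  simp only [MulOpposite.op_one, one_smul] at h1
  rw [h1, Matrix.conjTranspose_vecMulVec, star_star, Matrix.vecMulVec_mulVec]
  simp [mul_comm]

end Intertwiners

namespace QubitComplex

variable {ι : Type} [Fintype ι] [DecidableEq ι]

/-- `J` is an isometric embedding of qubits into a commuting realization that intertwines the qubit
measurements with the given ones. -/
structure Embeds {T : Type u} [NormedAddCommGroup T] [InnerProductSpace ℂ T]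
    (meas : ι → Fin 2 → Fin 2 → QMat) (A : CommSystem ι T) (J : ((ι → Fin 2) → ℂ) →ₗ[ℂ] T) :
    Prop where
  inner_eq : ∀ v w, inner ℂ (J v) (J w) = star v ⬝ᵥ w
  op_apply : ∀ k a x v, A.op k a x (J v) = J (localMatrix k (meas k a x) *ᵥ v)

/-- A connector complex that is rigid in the sense of commuting operators. -/
structure IsRigid (C : QubitComplex ι) (α : Fin 2 → ℂ) : Prop where
  meas_hermitian : ∀ k a x, (C.meas k a x).IsHermitian
  meas_idempotent : ∀ k a x, C.meas k a x * C.meas k a x = C.meas k a x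
  sum_meas : ∀ k x, ∑ a, C.meas k a x = 1
  meas_irreducible : ∀ k, Algebra.adjoin ℂ {M | ∃ a x, M = C.meas k a x} = ⊤
  coisometry : C.V * C.Vᴴ = 1
  unit_vector : star α ⬝ᵥ α = 1
  out_hermitian : ∀ b y, (C.outMeas b y).IsHermitian
  out_idempotent : ∀ b y, C.outMeas b y * C.outMeas b y = C.outMeas b y
  sum_out : ∀ y, ∑ b, C.outMeas b y = 1
  out_irreducible : Algebra.adjoin ℂ {M | ∃ b y, M = C.outMeas b y} = ⊤
  invariant : ∀ b y, bellMatrix C.meas (C.conn b y) * C.Vᴴ = C.Vᴴ * C.outMeas b y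
  value : C.outMeas 0 1 *ᵥ α = α
  conn_isPositive : ∀ (T : Type u) [NormedAddCommGroup T] [InnerProductSpace ℂ T] [CompleteSpace T]
    (A : CommSystem ι T) (b y : Fin 2), (bell A.op (C.conn b y)).IsPositive
  sum_conn : ∀ (T : Type u) [NormedAddCommGroup T] [InnerProductSpace ℂ T] [CompleteSpace T]
    (A : CommSystem ι T) (y : Fin 2), ∑ b, bell A.op (C.conn b y) = 1
  rigid : ∀ (T : Type u) [NormedAddCommGroup T] [InnerProductSpace ℂ T] [CompleteSpace T]
    (A : CommSystem ι T) (ψ : T), ‖ψ‖ = 1 → bell A.op (C.conn 0 1) ψ = ψ →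
    ∃ J, Embeds C.meas A J ∧ J (C.Vᴴ *ᵥ α) = ψ

theorem Embeds.bell_apply {T : Type u} [NormedAddCommGroup T] [InnerProductSpace ℂ T]
    {meas : ι → Fin 2 → Fin 2 → QMat} {A : CommSystem ι T} {J : ((ι → Fin 2) → ℂ) →ₗ[ℂ] T}
    (h : Embeds meas A J) (B : BellFunctional ι) (v : (ι → Fin 2) → ℂ) :
    bell A.op B (J v) = J (bellMatrix meas B *ᵥ v) := by
  rw [bellMatrix_eq_bell]
  exact bell_prodMk_mem (S := intertwined J) (fun k a x => h.op_apply k a x) B v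

/-! ### Unitary equivalence -/

theorem bellMatrix_conjugate (C : QubitComplex ι) (Q : ι → QMat) (W : QMat) (B : BellFunctional ι) :
    bellMatrix (C.conjugate Q W).meas B
      = tensorMatrix Q * bellMatrix C.meas B * tensorMatrix fun k => (Q k)ᴴ := by
  simp only [bellMatrix, Finset.mul_sum, Finset.sum_mul, mul_smul_comm, smul_mul_assoc,
    tensorMatrix_mul, conjugate]

theorem tensorMatrix_unitary {Q : ι → QMat} (hQ : ∀ k, Q k ∈ Matrix.unitaryGroup (Fin 2) ℂ) :
    (tensorMatrix fun k => (Q k)ᴴ) * tensorMatrix Q = 1 := by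
  rw [tensorMatrix_mul, ← tensorMatrix_one]
  congr 1
  ext1 k
  exact Matrix.mem_unitaryGroup_iff'.1 (hQ k)

theorem conjugate_V_conjTranspose (C : QubitComplex ι) (Q : ι → QMat) (W : QMat) :
    (C.conjugate Q W).Vᴴ = tensorMatrix Q * C.Vᴴ * Wᴴ := by
  simp [conjugate, Matrix.conjTranspose_mul, tensorMatrix_conjTranspose, Matrix.mul_assoc]

theorem outMeas_conjugate (C : QubitComplex ι) {Q : ι → QMat} {W : QMat}
    (hQ : ∀ k, Q k ∈ Matrix.unitaryGroup (Fin 2) ℂ) (b y : Fin 2) :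
    (C.conjugate Q W).outMeas b y = W * C.outMeas b y * Wᴴ := by
  have h := tensorMatrix_unitary hQ
  rw [outMeas, bellMatrix_conjugate C Q W, conjugate_V_conjTranspose, outMeas]
  simp only [conjugate]
  calc _ = W * C.V * ((tensorMatrix fun k => (Q k)ᴴ) * tensorMatrix Q) *
        bellMatrix C.meas (C.conn b y) * ((tensorMatrix fun k => (Q k)ᴴ) * tensorMatrix Q) *
        C.Vᴴ * Wᴴ := by simp only [Matrix.mul_assoc]
    _ = _ := by rw [h]; simp only [Matrix.mul_assoc, Matrix.mul_one]

theorem adjoin_conj_eq_top {Q : QMat} (hQ : Q ∈ Matrix.unitaryGroup (Fin 2) ℂ)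
    {f : Fin 2 → Fin 2 → QMat} (h : Algebra.adjoin ℂ {M | ∃ a x, M = f a x} = ⊤) :
    Algebra.adjoin ℂ {M | ∃ a x, M = Q * f a x * Qᴴ} = ⊤ := by
  have h1 : Q * Qᴴ = 1 := Matrix.mem_unitaryGroup_iff.1 hQ
  have h2 : Qᴴ * Q = 1 := Matrix.mem_unitaryGroup_iff'.1 hQ
  have key : ∀ M ∈ Algebra.adjoin ℂ {M | ∃ a x, M = f a x},
      Q * M * Qᴴ ∈ Algebra.adjoin ℂ {M | ∃ a x, M = Q * f a x * Qᴴ} := by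
    intro M hM
    induction hM using Algebra.adjoin_induction with
    | mem M hM =>
      obtain ⟨a, x, rfl⟩ := hM
      exact Algebra.subset_adjoin ⟨a, x, rfl⟩
    | algebraMap c =>
      rw [Algebra.algebraMap_eq_smul_one, mul_smul_comm, mul_one, smul_mul_assoc, h1]
      exact Subalgebra.smul_mem _ (one_mem _) _
    | add M N _ _ hM hN => rw [mul_add, add_mul]; exact add_mem hM hN
    | mul M N _ _ hM hN =>
      have : Q * (M * N) * Qᴴ = (Q * M * Qᴴ) * (Q * N * Qᴴ) := by
        calc Q * (M * N) * Qᴴ = Q * M * 1 * N * Qᴴ := by simp only [mul_assoc, one_mul]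
          _ = _ := by rw [← h2]; simp only [mul_assoc]
      rw [this]
      exact mul_mem hM hN
  rw [eq_top_iff]
  intro M _
  have h3 := key (Qᴴ * M * Q) (by rw [h]; trivial)
  have : Q * (Qᴴ * M * Q) * Qᴴ = M := by
    calc _ = (Q * Qᴴ) * M * (Q * Qᴴ) := by simp only [mul_assoc]
      _ = M := by rw [h1, one_mul, mul_one]
  rwa [this] at h3

theorem conj_idempotent {Q M : QMat} (hQ : Q ∈ Matrix.unitaryGroup (Fin 2) ℂ) (h : M * M = M) :
    (Q * M * Qᴴ) * (Q * M * Qᴴ) = Q * M * Qᴴ := by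
  have h2 : Qᴴ * Q = 1 := Matrix.mem_unitaryGroup_iff'.1 hQ
  calc _ = Q * M * (Qᴴ * Q) * M * Qᴴ := by simp only [mul_assoc]
    _ = Q * (M * M) * Qᴴ := by rw [h2]; simp only [mul_assoc, one_mul]
    _ = _ := by rw [h]

theorem conj_sum {Q : QMat} {f : Fin 2 → QMat} (hQ : Q ∈ Matrix.unitaryGroup (Fin 2) ℂ)
    (h : ∑ a, f a = 1) : ∑ a, Q * f a * Qᴴ = 1 := by
  rw [← Finset.sum_mul, ← Finset.mul_sum, h, mul_one]
  exact Matrix.mem_unitaryGroup_iff.1 hQ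

theorem star_mulVec_dotProduct {m n : Type*} [Fintype m] [Fintype n] (M : Matrix m n ℂ)
    (v w : n → ℂ) :
    star (M *ᵥ v) ⬝ᵥ (M *ᵥ w) = star v ⬝ᵥ ((Mᴴ * M) *ᵥ w) := by
  rw [Matrix.star_mulVec, ← Matrix.mulVec_mulVec, Matrix.dotProduct_mulVec,
    Matrix.dotProduct_mulVec, ← Matrix.dotProduct_mulVec, Matrix.dotProduct_mulVec]

theorem IsRigid.conjugate {C : QubitComplex ι} {α : Fin 2 → ℂ} (h : IsRigid.{u} C α) {Q : ι → QMat}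
    {W : QMat} (hQ : ∀ k, Q k ∈ Matrix.unitaryGroup (Fin 2) ℂ)
    (hW : W ∈ Matrix.unitaryGroup (Fin 2) ℂ) : IsRigid.{u} (C.conjugate Q W) (W *ᵥ α) := by
  have hW1 : W * Wᴴ = 1 := Matrix.mem_unitaryGroup_iff.1 hW
  have hW2 : Wᴴ * W = 1 := Matrix.mem_unitaryGroup_iff'.1 hW
  have hQ2 := tensorMatrix_unitary hQ
  have hQ1 : tensorMatrix Q * (tensorMatrix fun k => (Q k)ᴴ) = 1 := by
    rw [tensorMatrix_mul, ← tensorMatrix_one]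
    congr 1
    ext1 k
    exact Matrix.mem_unitaryGroup_iff.1 (hQ k)
  refine ⟨?_, ?_, ?_, ?_, ?_, ?_, ?_, ?_, ?_, ?_, ?_, ?_, h.conn_isPositive, h.sum_conn, ?_⟩
  · intro k a x
    exact Matrix.isHermitian_mul_mul_conjTranspose _ (h.meas_hermitian k a x)
  · intro k a x
    exact conj_idempotent (hQ k) (h.meas_idempotent k a x)
  · intro k x
    exact conj_sum (hQ k) (h.sum_meas k x)
  · intro k
    exact adjoin_conj_eq_top (hQ k) (h.meas_irreducible k)
  · rw [conjugate_V_conjTranspose]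
    calc W * C.V * (tensorMatrix fun k => (Q k)ᴴ) * (tensorMatrix Q * C.Vᴴ * Wᴴ)
        = W * C.V * ((tensorMatrix fun k => (Q k)ᴴ) * tensorMatrix Q) * C.Vᴴ * Wᴴ := by
          simp only [Matrix.mul_assoc]
      _ = W * (C.V * C.Vᴴ) * Wᴴ := by rw [hQ2]; simp only [Matrix.mul_assoc, Matrix.one_mul]
      _ = 1 := by rw [h.coisometry, mul_one, hW1]
  · rw [star_mulVec_dotProduct, hW2, Matrix.one_mulVec, h.unit_vector]
  · intro b y
    rw [outMeas_conjugate C hQ]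
    exact Matrix.isHermitian_mul_mul_conjTranspose _ (h.out_hermitian b y)
  · intro b y
    rw [outMeas_conjugate C hQ]
    exact conj_idempotent hW (h.out_idempotent b y)
  · intro y
    simp only [outMeas_conjugate C hQ]
    exact conj_sum hW (h.sum_out y)
  · simp only [outMeas_conjugate C hQ]
    exact adjoin_conj_eq_top hW h.out_irreducible
  · intro b y
    rw [outMeas_conjugate C hQ, bellMatrix_conjugate C Q W, conjugate_V_conjTranspose]
    calc _ = tensorMatrix Q * bellMatrix C.meas (C.conn b y) *
          ((tensorMatrix fun k => (Q k)ᴴ) * tensorMatrix Q) * C.Vᴴ * Wᴴ := by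
          simp only [Matrix.mul_assoc]; rfl
      _ = tensorMatrix Q * (bellMatrix C.meas (C.conn b y) * C.Vᴴ) * Wᴴ := by
          rw [hQ2]; simp only [Matrix.mul_assoc, Matrix.one_mul]
      _ = tensorMatrix Q * C.Vᴴ * (1 : QMat) * C.outMeas b y * Wᴴ := by
          rw [h.invariant]; simp only [Matrix.mul_assoc, Matrix.one_mul]
      _ = _ := by rw [← hW2]; simp only [Matrix.mul_assoc]
  · rw [outMeas_conjugate C hQ, Matrix.mulVec_mulVec, Matrix.mul_assoc, hW2, Matrix.mul_one,
      ← Matrix.mulVec_mulVec, h.value]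
  · intro T _ _ _ A ψ hψ hval
    obtain ⟨J, hJ, hJα⟩ := h.rigid T A ψ hψ hval
    -- The realization is the same and only the reference qubits are rotated, hence the old
    -- embedding is precomposed with `⨂ Q†`.
    refine ⟨J ∘ₗ (tensorMatrix fun k => (Q k)ᴴ).mulVecLin, ⟨?_, ?_⟩, ?_⟩
    · intro v w
      simp only [LinearMap.comp_apply, Matrix.mulVecLin_apply, hJ.inner_eq]
      rw [star_mulVec_dotProduct, tensorMatrix_conjTranspose]
      simp only [Matrix.conjTranspose_conjTranspose]
      rw [hQ1, Matrix.one_mulVec]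
    · intro k a x v
      simp only [LinearMap.comp_apply, Matrix.mulVecLin_apply, hJ.op_apply, Matrix.mulVec_mulVec]
      congr 2
      rw [localMatrix, localMatrix, tensorMatrix_mul, tensorMatrix_mul]
      congr 1
      ext1 j
      have h2 : (Q j)ᴴ * Q j = 1 := Matrix.mem_unitaryGroup_iff'.1 (hQ j)
      by_cases hj : j = k
      · subst hj
        simp only [Function.update_self, QubitComplex.conjugate]
        rw [← mul_assoc, ← mul_assoc, h2, one_mul]
      · simp [hj]
    · rw [conjugate_V_conjTranspose]
      simp only [LinearMap.comp_apply, Matrix.mulVecLin_apply, Matrix.mulVec_mulVec]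
      rw [← hJα]
      congr 2
      calc _ = ((tensorMatrix fun k => (Q k)ᴴ) * tensorMatrix Q) * C.Vᴴ * (Wᴴ * W) := by
            simp only [Matrix.mul_assoc]
        _ = _ := by rw [hQ2, hW2, Matrix.mul_one, Matrix.one_mul]

end QubitComplex

/-! ### Contraction -/

section Blocks

variable {I ρ σ : Type*} [Fintype I] [DecidableEq I] [Fintype ρ] [DecidableEq ρ] [Fintype σ]
  [DecidableEq σ]

/-- The isometry `u ↦ |r⟩ ⊗ u`, where `e` splits the basis of the whole space. -/
def insertMatrix (e : I ≃ ρ × σ) (r : ρ) : Matrix I σ ℂ :=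
  Matrix.of fun i s => if e i = (r, s) then 1 else 0

theorem mul_insertMatrix_apply {m : Type*} (e : I ≃ ρ × σ) (r : ρ) (M : Matrix m I ℂ) (i : m)
    (s : σ) : (M * insertMatrix e r) i s = M i (e.symm (r, s)) := by
  simp [Matrix.mul_apply, insertMatrix, ← Equiv.eq_symm_apply]

theorem mul_insertMatrix_conjTranspose_apply {m : Type*} (e : I ≃ ρ × σ) (r : ρ)
    (M : Matrix m σ ℂ) (i : m) (j : I) :
    (M * (insertMatrix e r)ᴴ) i j = if (e j).1 = r then M i (e j).2 else 0 := by
  rw [Matrix.mul_apply]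
  have : ∀ s, e j = (r, s) ↔ (e j).1 = r ∧ (e j).2 = s := fun s => Prod.ext_iff
  by_cases h : (e j).1 = r <;>
    simp [insertMatrix, Matrix.conjTranspose_apply, this, h, apply_ite]

theorem insertMatrix_conjTranspose_mul (e : I ≃ ρ × σ) (r r' : ρ) :
    (insertMatrix e r)ᴴ * insertMatrix e r' = if r = r' then 1 else 0 := by
  ext s s'
  rw [mul_insertMatrix_apply]
  by_cases h : r = r'
  · subst h
    simp [insertMatrix, Matrix.conjTranspose_apply, Matrix.one_apply, eq_comm, apply_ite]
  · simp [insertMatrix, Matrix.conjTranspose_apply, h, eq_comm]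

theorem sum_insertMatrix_mul (e : I ≃ ρ × σ) :
    ∑ r, insertMatrix e r * (insertMatrix e r)ᴴ = 1 := by
  ext i j
  simp only [Matrix.sum_apply, mul_insertMatrix_conjTranspose_apply]
  simp only [Finset.sum_ite_eq, Finset.mem_univ, if_true]
  simp [insertMatrix, Matrix.one_apply]

theorem matrix_ext_insertMatrix {m : Type*} (e : I ≃ ρ × σ) {M N : Matrix m I ℂ}
    (h : ∀ r, M * insertMatrix e r = N * insertMatrix e r) : M = N := by
  ext i j
  have := congrFun (congrFun (h (e j).1) i) (e j).2
  simpa [mul_insertMatrix_apply] using this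

/-- The hypothesis says that `M = 1 ⊗ Y` in the splitting `e`; the companion
`mul_insertMatrix_of_left` is for `M = X ⊗ 1`. Identities on the whole space can then be checked on
the blocks `|r⟩ ⊗ u`. -/
theorem mul_insertMatrix_of_right (e : I ≃ ρ × σ) {M : Matrix I I ℂ} {Y : Matrix σ σ ℂ}
    (h : ∀ i j, M i j = if (e i).1 = (e j).1 then Y (e i).2 (e j).2 else 0) (r : ρ) :
    M * insertMatrix e r = insertMatrix e r * Y := by
  ext i s
  rw [mul_insertMatrix_apply, h, Matrix.mul_apply]
  have : ∀ s, e i = (r, s) ↔ (e i).1 = r ∧ (e i).2 = s := fun s => Prod.ext_iff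
  by_cases hr : (e i).1 = r <;> simp [insertMatrix, this, hr]

theorem mul_insertMatrix_of_left (e : I ≃ ρ × σ) {M : Matrix I I ℂ} {X : Matrix ρ ρ ℂ}
    (h : ∀ i j, M i j = if (e i).2 = (e j).2 then X (e i).1 (e j).1 else 0) (r : ρ) :
    M * insertMatrix e r = ∑ r', X r' r • insertMatrix e r' := by
  ext i s
  rw [mul_insertMatrix_apply, h, Matrix.sum_apply]
  have : ∀ r, e i = (r, s) ↔ (e i).1 = r ∧ (e i).2 = s := fun s => Prod.ext_iff
  by_cases hs : (e i).2 = s <;> simp [insertMatrix, this, hs]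

/-- The pairs of matrices that are intertwined by a matrix. -/
def matrixIntertwined (G : Matrix I σ ℂ) : Subalgebra ℂ (Matrix σ σ ℂ × Matrix I I ℂ) where
  carrier := {p | p.2 * G = G * p.1}
  mul_mem' {p q} hp hq := by
    simp only [Set.mem_ofPred_eq] at hp hq ⊢
    rw [Prod.snd_mul, Prod.fst_mul, Matrix.mul_assoc, hq, ← Matrix.mul_assoc, hp, Matrix.mul_assoc]
  add_mem' {p q} hp hq := by
    simp only [Set.mem_ofPred_eq] at hp hq ⊢
    rw [Prod.snd_add, Prod.fst_add, Matrix.add_mul, hp, hq, Matrix.mul_add]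
  algebraMap_mem' c := by
    simp [Algebra.algebraMap_eq_smul_one]

theorem mem_matrixIntertwined {G : Matrix I σ ℂ} {p : Matrix σ σ ℂ × Matrix I I ℂ} :
    p ∈ matrixIntertwined G ↔ p.2 * G = G * p.1 := Iff.rfl

theorem bell_mul_of_intertwines {ι : Type} [Fintype ι] [DecidableEq ι]
    {op : ι → Fin 2 → Fin 2 → Matrix σ σ ℂ} {op' : ι → Fin 2 → Fin 2 → Matrix I I ℂ}
    {G : Matrix I σ ℂ} (h : ∀ k a x, op' k a x * G = G * op k a x) (B : BellFunctional ι) :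
    bell op' B * G = G * bell op B := by
  have key : (bell op B, bell op' B) ∈ matrixIntertwined G :=
    bell_prodMk_mem (S := matrixIntertwined G) (op := op) (op' := op') (fun k a x => h k a x) B
  exact mem_matrixIntertwined.1 key

end Blocks

theorem localMatrix_apply {ι : Type} [Fintype ι] [DecidableEq ι] (k : ι) (M : QMat)
    (i j : ι → Fin 2) :
    localMatrix k M i j = if ∀ l, l ≠ k → i l = j l then M (i k) (j k) else 0 := by
  rw [localMatrix, tensorMatrix_update]
  by_cases h : ∀ l, l ≠ k → i l = j l
  · rw [if_pos h, Finset.prod_eq_one, mul_one]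
    intro l hl
    rw [Matrix.one_apply, if_pos (h l (Finset.ne_of_mem_erase hl))]
  · rw [if_neg h]
    push Not at h
    obtain ⟨l, hl, hne⟩ := h
    rw [Finset.prod_eq_zero (Finset.mem_erase.2 ⟨hl, Finset.mem_univ l⟩), mul_zero]
    rw [Matrix.one_apply, if_neg hne]

namespace QubitComplex

variable {ι₁ ι₂ : Type} [Fintype ι₁] [DecidableEq ι₁] [Fintype ι₂] [DecidableEq ι₂]

/-- The splitting of the basis of `⨂ j, ℂ²` at the leg `k`. -/
def legSplit (k : ι₂) : (ι₂ → Fin 2) ≃ ({j : ι₂ // j ≠ k} → Fin 2) × Fin 2 :=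
  (plugEquiv k).symm.trans (Equiv.prodComm _ _)

theorem legSplit_apply (k : ι₂) (i : ι₂ → Fin 2) : legSplit k i = (fun j => i j.1, i k) := rfl

/-- The splitting of the basis for a disjoint union of two sets of parties. -/
def sumSplit (κ ι₁ : Type) : (κ ⊕ ι₁ → Fin 2) ≃ (κ → Fin 2) × (ι₁ → Fin 2) :=
  Equiv.sumArrowEquivProdArrow κ ι₁ (Fin 2)

theorem sumSplit_apply {κ : Type} (i : κ ⊕ ι₁ → Fin 2) :
    sumSplit κ ι₁ i = (fun j => i (.inl j), fun l => i (.inr l)) := rfl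

theorem localMatrix_inr_mul_insert {κ : Type} [Fintype κ] [DecidableEq κ] (l : ι₁) (M : QMat)
    (r : κ → Fin 2) : localMatrix (Sum.inr l : κ ⊕ ι₁) M * insertMatrix (sumSplit κ ι₁) r
      = insertMatrix (sumSplit κ ι₁) r * localMatrix l M := by
  refine mul_insertMatrix_of_right _ (fun i j => ?_) r
  simp only [localMatrix_apply, sumSplit_apply, ← ite_and]
  refine if_congr ?_ rfl rfl
  simp [funext_iff]

theorem localMatrix_inl_mul_insert {κ : Type} [Fintype κ] [DecidableEq κ] (j : κ) (M : QMat)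
    (r : κ → Fin 2) : localMatrix (Sum.inl j : κ ⊕ ι₁) M * insertMatrix (sumSplit κ ι₁) r
      = ∑ r', localMatrix j M r' r • insertMatrix (sumSplit κ ι₁) r' := by
  refine mul_insertMatrix_of_left _ (fun i j => ?_) r
  simp only [localMatrix_apply, sumSplit_apply, ← ite_and]
  refine if_congr ?_ rfl rfl
  simp [funext_iff, and_comm]

theorem localMatrix_self_mul_insert (k : ι₂) (M : QMat) (r : {j : ι₂ // j ≠ k} → Fin 2) :
    localMatrix k M * insertMatrix (legSplit k) r = insertMatrix (legSplit k) r * M := by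
  refine mul_insertMatrix_of_right _ (fun i j => ?_) r
  simp only [localMatrix_apply, legSplit_apply]
  refine if_congr ?_ rfl rfl
  simp [funext_iff]

theorem localMatrix_ne_mul_insert (k : ι₂) (j : {j : ι₂ // j ≠ k}) (M : QMat)
    (r : {j : ι₂ // j ≠ k} → Fin 2) :
    localMatrix (j : ι₂) M * insertMatrix (legSplit k) r
      = ∑ r', localMatrix j M r' r • insertMatrix (legSplit k) r' := by
  refine mul_insertMatrix_of_left _ (fun i i' => ?_) r
  simp only [localMatrix_apply, legSplit_apply, ← ite_and]
  refine if_congr ?_ rfl rfl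
  constructor
  · intro h
    exact ⟨h k (Ne.symm j.2), fun l hl => h l fun hh => hl (Subtype.ext hh)⟩
  · rintro ⟨h1, h2⟩ l hl
    by_cases hlk : l = k
    · rw [hlk, h1]
    · exact h2 ⟨l, hlk⟩ fun hh => hl (congrArg Subtype.val hh)

variable {C₁ : QubitComplex ι₁} {C₂ : QubitComplex ι₂} {k : ι₂}

/-- The isometry `V₁† ⊗ 1` that replaces the leg `k` by the legs of `C₁`. -/
noncomputable def legIsometry (C₁ : QubitComplex ι₁) (k : ι₂) :
    Matrix ({j : ι₂ // j ≠ k} ⊕ ι₁ → Fin 2) (ι₂ → Fin 2) ℂ :=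
  ∑ r, insertMatrix (sumSplit {j : ι₂ // j ≠ k} ι₁) r * C₁.Vᴴ * (insertMatrix (legSplit k) r)ᴴ

theorem legIsometry_mul_insert (C₁ : QubitComplex ι₁) (k : ι₂) (r : {j : ι₂ // j ≠ k} → Fin 2) :
    legIsometry C₁ k * insertMatrix (legSplit k) r
      = insertMatrix (sumSplit {j : ι₂ // j ≠ k} ι₁) r * C₁.Vᴴ := by
  rw [legIsometry, Matrix.sum_mul, Finset.sum_eq_single r]
  · rw [Matrix.mul_assoc, insertMatrix_conjTranspose_mul, if_pos rfl, Matrix.mul_one]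
  · intro r' _ hr
    rw [Matrix.mul_assoc, insertMatrix_conjTranspose_mul, if_neg hr, Matrix.mul_zero]
  · simp

theorem legIsometry_isometry (h : C₁.V * C₁.Vᴴ = 1) (k : ι₂) :
    (legIsometry C₁ k)ᴴ * legIsometry C₁ k = 1 := by
  have h1 : (legIsometry C₁ k)ᴴ
      = ∑ r, insertMatrix (legSplit k) r * C₁.V *
        (insertMatrix (sumSplit {j : ι₂ // j ≠ k} ι₁) r)ᴴ := by
    rw [legIsometry, Matrix.conjTranspose_sum]
    simp [Matrix.conjTranspose_mul, Matrix.mul_assoc]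
  refine matrix_ext_insertMatrix (legSplit k) fun r => ?_
  rw [Matrix.mul_assoc, legIsometry_mul_insert, h1, Matrix.sum_mul, Finset.sum_eq_single r]
  · rw [← Matrix.mul_assoc, Matrix.mul_assoc (insertMatrix (legSplit k) r * C₁.V),
      insertMatrix_conjTranspose_mul, if_pos rfl, Matrix.mul_one, Matrix.mul_assoc, h,
      Matrix.mul_one, Matrix.one_mul]
  · intro r' _ hr
    rw [← Matrix.mul_assoc, Matrix.mul_assoc (insertMatrix (legSplit k) r' * C₁.V),
      insertMatrix_conjTranspose_mul, if_neg hr, Matrix.mul_zero, Matrix.zero_mul]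
  · simp

theorem contract_V (C₁ : QubitComplex ι₁) (C₂ : QubitComplex ι₂) (k : ι₂) :
    (contract C₁ C₂ k).Vᴴ = legIsometry C₁ k * C₂.Vᴴ := by
  rw [← Matrix.conjTranspose_inj, Matrix.conjTranspose_conjTranspose, Matrix.conjTranspose_mul,
    Matrix.conjTranspose_conjTranspose, legIsometry, Matrix.conjTranspose_sum, Matrix.mul_sum]
  ext o i
  simp only [Matrix.conjTranspose_mul, Matrix.conjTranspose_conjTranspose, ← Matrix.mul_assoc,
    Matrix.sum_apply]
  simp only [mul_insertMatrix_conjTranspose_apply]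
  simp only [Finset.sum_ite_eq, Finset.mem_univ, if_true]
  rw [Matrix.mul_apply]
  simp only [mul_insertMatrix_apply]
  rfl

/-- At the leg `k`, invariance of the range of `V₁†` turns the Bell operator of `C₁` into its output
measurement, which congruence identifies with the measurement of `C₂`. The other legs are untouched
by `V₁† ⊗ 1`. -/
theorem contract_meas_intertwined (hinv : ∀ b y, bellMatrix C₁.meas (C₁.conn b y) * C₁.Vᴴ
      = C₁.Vᴴ * C₁.outMeas b y) (hc : Congruent C₁ C₂ k) (B : BellFunctional ι₂) :
    bell (composite (fun l a x => localMatrix l ((contract C₁ C₂ k).meas l a x)) C₁.conn) B *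
      legIsometry C₁ k = legIsometry C₁ k * bellMatrix C₂.meas B := by
  rw [bellMatrix_eq_bell]
  refine bell_mul_of_intertwines (fun j a x => ?_) B
  refine matrix_ext_insertMatrix (legSplit k) fun r => ?_
  rw [Matrix.mul_assoc, legIsometry_mul_insert, Matrix.mul_assoc]
  by_cases hj : j = k
  · subst hj
    rw [localMatrix_self_mul_insert, ← Matrix.mul_assoc, ← Matrix.mul_assoc, legIsometry_mul_insert,
      composite_self, Matrix.mul_assoc _ _ (C₂.meas _ _ _), ← hc a x, ← hinv, bellMatrix_eq_bell,
      ← Matrix.mul_assoc]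
    congr 1
    exact bell_mul_of_intertwines
      (fun l a x => localMatrix_inr_mul_insert l (C₁.meas l a x) r) _
  · lift j to {j : ι₂ // j ≠ k} using hj
    rw [localMatrix_ne_mul_insert, composite_of_ne, ← Matrix.mul_assoc,
      localMatrix_inl_mul_insert, Matrix.sum_mul, Matrix.mul_sum]
    refine Finset.sum_congr rfl fun r' _ => ?_
    rw [Matrix.mul_smul, legIsometry_mul_insert, Matrix.smul_mul]
    rfl

theorem bellMatrix_contract (hinv : ∀ b y, bellMatrix C₁.meas (C₁.conn b y) * C₁.Vᴴ
      = C₁.Vᴴ * C₁.outMeas b y) (hc : Congruent C₁ C₂ k) (b y : Fin 2) :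
    bellMatrix (contract C₁ C₂ k).meas ((contract C₁ C₂ k).conn b y) * legIsometry C₁ k
      = legIsometry C₁ k * bellMatrix C₂.meas (C₂.conn b y) := by
  rw [← contract_meas_intertwined hinv hc, bellMatrix_eq_bell,
    bell_contract (commuting_localMatrix _)]

/-- With `L = legIsometry C₁ k` the contracted coisometry is `V₂ L†`; moving `L` past the Bell
operator leaves `L†L = 1`. -/
theorem outMeas_contract (hinv : ∀ b y, bellMatrix C₁.meas (C₁.conn b y) * C₁.Vᴴ
      = C₁.Vᴴ * C₁.outMeas b y) (hV : C₁.V * C₁.Vᴴ = 1) (hc : Congruent C₁ C₂ k) (b y : Fin 2) :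
    (contract C₁ C₂ k).outMeas b y = C₂.outMeas b y := by
  have hV' : (contract C₁ C₂ k).V = C₂.V * (legIsometry C₁ k)ᴴ := by
    rw [← Matrix.conjTranspose_inj, contract_V, Matrix.conjTranspose_mul,
      Matrix.conjTranspose_conjTranspose]
  rw [outMeas, outMeas, contract_V, Matrix.mul_assoc, ← Matrix.mul_assoc (bellMatrix _ _),
    bellMatrix_contract hinv hc, hV', Matrix.mul_assoc, Matrix.mul_assoc (legIsometry C₁ k),
    ← Matrix.mul_assoc (legIsometry C₁ k)ᴴ, legIsometry_isometry hV, Matrix.one_mul,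
    Matrix.mul_assoc]

/-- The parties of `C₁` in a realization of the contraction. -/
def rightSystem {κ : Type} {T : Type u} [NormedAddCommGroup T] [InnerProductSpace ℂ T]
    (A : CommSystem (κ ⊕ ι₁) T) : CommSystem ι₁ T where
  op l := A.op (.inr l)
  isPositive _ := A.isPositive _
  sum_op _ := A.sum_op _
  comm _ _ h := A.comm _ _ fun hh => h (Sum.inr.inj hh)

/-- The realization of `C₂` in which the party `k` measures by means of `C₁`. -/
noncomputable def compositeSystem {α : Fin 2 → ℂ} (h : IsRigid.{u} C₁ α) {T : Type u}
    [NormedAddCommGroup T] [InnerProductSpace ℂ T] [CompleteSpace T]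
    (A : CommSystem ({j : ι₂ // j ≠ k} ⊕ ι₁) T) : CommSystem ι₂ T where
  op := composite A.op C₁.conn
  isPositive j a x := by
    by_cases hj : j = k
    · subst hj
      rw [composite_self]
      exact h.conn_isPositive T (rightSystem A) a x
    · lift j to {j : ι₂ // j ≠ k} using hj
      rw [composite_of_ne]
      exact A.isPositive _ _ _
  sum_op j x := by
    by_cases hj : j = k
    · subst hj
      simp only [composite_self]
      exact h.sum_conn T (rightSystem A) x
    · lift j to {j : ι₂ // j ≠ k} using hj
      simp only [composite_of_ne]
      exact A.sum_op _ _
  comm := A.comm.composite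

/-- Rigidity is used twice. First `C₂`, in the composite realization, yields `J₂`. Then `C₁`, in the
realization by its own parties, yields an isometry `J₁ r` for each basis state `r` of the remaining
legs of `C₂`. The required embedding sends `|r⟩ ⊗ u` to `J₁ r u`; the work lies in showing that the
`J₁ r` form a coherent, orthogonal family. -/
theorem IsRigid.contract_rigid {α₁ α₂ : Fin 2 → ℂ} (h₁ : IsRigid.{u} C₁ α₁)
    (h₂ : IsRigid.{u} C₂ α₂) (hc : Congruent C₁ C₂ k) {T : Type u}
    [NormedAddCommGroup T] [InnerProductSpace ℂ T] [CompleteSpace T]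
    (A : CommSystem ({j : ι₂ // j ≠ k} ⊕ ι₁) T) (ψ : T) (hψ : ‖ψ‖ = 1)
    (hval : bell A.op ((contract C₁ C₂ k).conn 0 1) ψ = ψ) :
    ∃ J, Embeds (contract C₁ C₂ k).meas A J ∧ J ((contract C₁ C₂ k).Vᴴ *ᵥ α₂) = ψ := by
  rw [bell_contract A.comm] at hval
  obtain ⟨J₂, hJ₂, hJ₂α⟩ := h₂.rigid T (compositeSystem h₁ A) ψ hψ hval
  have hα₁ : α₁ ≠ 0 := by
    rintro rfl
    simpa using h₁.unit_vector
  -- the action of the operators on the image of `J₂`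
  have hk : ∀ a x r β, bell (rightSystem A).op (C₁.conn a x)
      (J₂ (insertMatrix (legSplit k) r *ᵥ β))
      = J₂ (insertMatrix (legSplit k) r *ᵥ (C₁.outMeas a x *ᵥ β)) := by
    intro a x r β
    have := hJ₂.op_apply k a x (insertMatrix (legSplit k) r *ᵥ β)
    rw [Matrix.mulVec_mulVec, localMatrix_self_mul_insert, ← hc a x, ← Matrix.mulVec_mulVec] at this
    rw [← this]
    simp only [compositeSystem, composite_self]
    rfl
  have hj : ∀ (j : {j : ι₂ // j ≠ k}) a x r β, A.op (.inl j) a x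
      (J₂ (insertMatrix (legSplit k) r *ᵥ β))
      = ∑ r', localMatrix j (C₂.meas j a x) r' r • J₂ (insertMatrix (legSplit k) r' *ᵥ β) := by
    intro j a x r β
    have := hJ₂.op_apply j a x (insertMatrix (legSplit k) r *ᵥ β)
    rw [Matrix.mulVec_mulVec, localMatrix_ne_mul_insert, Matrix.sum_mulVec, map_sum] at this
    simp only [compositeSystem, composite_of_ne, Matrix.smul_mulVec, map_smul] at this
    exact this
  have hin : ∀ r r' β β', inner ℂ (J₂ (insertMatrix (legSplit k) r *ᵥ β))
      (J₂ (insertMatrix (legSplit k) r' *ᵥ β')) = if r = r' then star β ⬝ᵥ β' else 0 := by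
    intro r r' β β'
    rw [hJ₂.inner_eq, Matrix.star_mulVec, ← Matrix.dotProduct_mulVec, Matrix.mulVec_mulVec,
      insertMatrix_conjTranspose_mul]
    split_ifs <;> simp
  have hnorm : ∀ r, ‖J₂ (insertMatrix (legSplit k) r *ᵥ α₁)‖ = 1 := by
    intro r
    have := hin r r α₁ α₁
    rw [if_pos rfl, h₁.unit_vector, inner_self_eq_norm_sq_to_K] at this
    have h2 : ‖J₂ (insertMatrix (legSplit k) r *ᵥ α₁)‖ ^ 2 = 1 := Complex.ofReal_injective (by simpa using this)
    exact (pow_eq_one_iff_of_nonneg (norm_nonneg _) two_ne_zero).1 h2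
  -- `C_{+|1}` of `C₁` acts on these vectors as its output effect acts on `α₁`, and that effect
  -- fixes `α₁`; so each of them is a maximizer for `C₁`.
  choose J₁ hJ₁ hJ₁α using fun r => h₁.rigid T (rightSystem A)
    (J₂ (insertMatrix (legSplit k) r *ᵥ α₁)) (hnorm r) (by rw [hk, h₁.value])
  have hVα : C₁.Vᴴ *ᵥ α₁ ≠ 0 := by
    intro h0
    have : C₁.V *ᵥ (C₁.Vᴴ *ᵥ α₁) = α₁ := by rw [Matrix.mulVec_mulVec, h₁.coisometry,
      Matrix.one_mulVec]
    rw [h0, Matrix.mulVec_zero] at this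
    exact hα₁ this.symm
  have hirr := tensorPolynomials_eq_top h₁.meas_irreducible
  -- orthogonality of the ranges of the isometries `J₁ r`
  have horth : ∀ r r' v w, inner ℂ (J₁ r v) (J₁ r' w) = if r = r' then star v ⬝ᵥ w else 0 := by
    intro r r' v w
    have hunit : star (C₁.Vᴴ *ᵥ α₁) ⬝ᵥ (C₁.Vᴴ *ᵥ α₁) = 1 := by
      rw [star_mulVec_dotProduct, Matrix.conjTranspose_conjTranspose, h₁.coisometry,
        Matrix.one_mulVec, h₁.unit_vector]
    rw [sesqForm_eq_of_invariant hirr (F := J₁ r) (G := J₁ r') ?_ hunit, hJ₁α, hJ₁α, hin,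
      h₁.unit_vector]
    · split_ifs <;> simp
    · rintro M ⟨l, a, x, rfl⟩ v w
      rw [localMatrix_conjTranspose, (h₁.meas_hermitian l a x).eq, ← (hJ₁ r).op_apply,
        ← (hJ₁ r').op_apply]
      exact ((rightSystem A).isPositive l a x).isSymmetric _ _
  -- the operators of the other parties permute the isometries `J₁ r`
  have hrest : ∀ (j : {j : ι₂ // j ≠ k}) a x r v, A.op (.inl j) a x (J₁ r v)
      = ∑ r', localMatrix j (C₂.meas j a x) r' r • J₁ r' v := by
    intro j a x r
    have : (A.op (.inl j) a x : T →ₗ[ℂ] T) ∘ₗ J₁ r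
        = ∑ r', localMatrix j (C₂.meas j a x) r' r • J₁ r' := by
      -- Operators of the remaining parties commute with those of `C₁`, so both sides intertwine the
      -- latter; it suffices to compare them at `V₁†α₁`, where `J₁` reduces to `J₂`.
      refine linearMap_eq_of_intertwines hirr ?_ hVα ?_
      · rintro M ⟨l, b, y, rfl⟩
        refine ⟨(rightSystem A).op l b y, fun v => ⟨?_, ?_⟩⟩
        · simp only [LinearMap.comp_apply, ContinuousLinearMap.coe_coe, ← (hJ₁ r).op_apply]
          have hcm := A.comm (.inr l) (.inl j) (by simp) b y a x
          exact DFunLike.congr_fun hcm.eq (J₁ r v)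
        · simp only [LinearMap.sum_apply, LinearMap.smul_apply, map_sum, map_smul,
            ContinuousLinearMap.coe_coe, (hJ₁ _).op_apply]
      · simp only [LinearMap.comp_apply, ContinuousLinearMap.coe_coe, LinearMap.sum_apply,
          LinearMap.smul_apply, hJ₁α, hj]
    intro v
    simpa using DFunLike.congr_fun this v
  -- compatibility of `J₁` with `J₂`
  have hcompat : ∀ r β, J₁ r (C₁.Vᴴ *ᵥ β) = J₂ (insertMatrix (legSplit k) r *ᵥ β) := by
    intro r
    have : J₁ r ∘ₗ C₁.Vᴴ.mulVecLin = J₂ ∘ₗ (insertMatrix (legSplit k) r).mulVecLin := by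
      -- Here the irreducible algebra is the one generated by the output measurements of `C₁`,
      -- acting on the single contracted leg.
      refine linearMap_eq_of_intertwines h₁.out_irreducible ?_ hα₁ ?_
      · rintro M ⟨b, y, rfl⟩
        refine ⟨(bell (rightSystem A).op (C₁.conn b y) : T →L[ℂ] T), fun v => ⟨?_, ?_⟩⟩
        · simp only [LinearMap.comp_apply, ContinuousLinearMap.coe_coe, (hJ₁ r).bell_apply,
            Matrix.mulVecLin_apply, Matrix.mulVec_mulVec, h₁.invariant]
        · simp only [LinearMap.comp_apply, ContinuousLinearMap.coe_coe, Matrix.mulVecLin_apply, hk]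
      · simpa using hJ₁α r
    intro β
    simpa using DFunLike.congr_fun this β
  set E := insertMatrix (sumSplit {j : ι₂ // j ≠ k} ι₁) with hEdef
  have hE : ∀ v, v = ∑ r, E r *ᵥ ((E r)ᴴ *ᵥ v) := by
    intro v
    have := congrArg (fun M => M *ᵥ v) (sum_insertMatrix_mul (sumSplit {j : ι₂ // j ≠ k} ι₁))
    simp only [Matrix.sum_mulVec, Matrix.one_mulVec, ← Matrix.mulVec_mulVec] at this
    exact this.symm
  -- The family is glued along the splitting of the basis: the component of a vector at `|r⟩` is
  -- sent through `J₁ r`.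
  let J : (({j : ι₂ // j ≠ k} ⊕ ι₁ → Fin 2) → ℂ) →ₗ[ℂ] T := ∑ r, J₁ r ∘ₗ (E r)ᴴ.mulVecLin
  have hJ : ∀ v, J v = ∑ r, J₁ r ((E r)ᴴ *ᵥ v) := fun v => by simp [J]
  have hJE : ∀ r u, J (E r *ᵥ u) = J₁ r u := by
    intro r u
    rw [hJ, Finset.sum_eq_single r]
    · rw [Matrix.mulVec_mulVec, insertMatrix_conjTranspose_mul, if_pos rfl, Matrix.one_mulVec]
    · intro r' _ hr
      rw [Matrix.mulVec_mulVec, insertMatrix_conjTranspose_mul, if_neg hr, Matrix.zero_mulVec,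
        map_zero]
    · simp
  refine ⟨J, ⟨?_, ?_⟩, ?_⟩
  · intro v w
    rw [hJ, hJ, sum_inner]
    simp only [inner_sum, horth, Finset.sum_ite_eq, Finset.mem_univ, if_true]
    conv_rhs => rw [hE w]
    rw [dotProduct_sum]
    refine Finset.sum_congr rfl fun r _ => ?_
    rw [star_mulVec_dotProduct, Matrix.conjTranspose_conjTranspose, Matrix.mulVec_mulVec]
  · intro l a x v
    rw [hE v, map_sum, map_sum, Matrix.mulVec_sum, map_sum]
    refine Finset.sum_congr rfl fun r _ => ?_
    rw [hJE]
    cases l with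
    | inl j =>
      rw [hrest, Matrix.mulVec_mulVec _ _ (E r), hEdef, localMatrix_inl_mul_insert, ← hEdef, Matrix.sum_mulVec,
        map_sum]
      refine Finset.sum_congr rfl fun r' _ => ?_
      rw [Matrix.smul_mulVec, map_smul, hJE]
      rfl
    | inr l =>
      rw [Matrix.mulVec_mulVec _ _ (E r), hEdef, localMatrix_inr_mul_insert, ← hEdef, ← Matrix.mulVec_mulVec, hJE]
      exact (hJ₁ r).op_apply l a x _
  · have hfin : J ∘ₗ (legIsometry C₁ k).mulVecLin = J₂ := by
      refine LinearMap.ext fun v => ?_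
      have hv := congrArg (fun M => M *ᵥ v) (sum_insertMatrix_mul (legSplit k))
      simp only [Matrix.sum_mulVec, Matrix.one_mulVec, ← Matrix.mulVec_mulVec] at hv
      rw [← hv, map_sum, map_sum]
      refine Finset.sum_congr rfl fun r _ => ?_
      rw [← hcompat, LinearMap.comp_apply, Matrix.mulVecLin_apply, Matrix.mulVec_mulVec,
        legIsometry_mul_insert, ← Matrix.mulVec_mulVec, hJE]
    rw [contract_V, ← Matrix.mulVec_mulVec, ← hJ₂α, ← hfin]
    rfl

theorem IsRigid.contract {α₁ α₂ : Fin 2 → ℂ} (h₁ : IsRigid.{u} C₁ α₁) (h₂ : IsRigid.{u} C₂ α₂)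
    (hc : Congruent C₁ C₂ k) : IsRigid.{u} (contract C₁ C₂ k) α₂ := by
  have hout := outMeas_contract h₁.invariant h₁.coisometry hc
  refine ⟨?_, ?_, ?_, ?_, ?_, h₂.unit_vector, ?_, ?_, ?_, ?_, ?_, ?_, ?_, ?_, ?_⟩
  · rintro (j | l) a x
    · exact h₂.meas_hermitian j a x
    · exact h₁.meas_hermitian l a x
  · rintro (j | l) a x
    · exact h₂.meas_idempotent j a x
    · exact h₁.meas_idempotent l a x
  · rintro (j | l) x
    · exact h₂.sum_meas j x
    · exact h₁.sum_meas l x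
  · rintro (j | l)
    · exact h₂.meas_irreducible j
    · exact h₁.meas_irreducible l
  · rw [← Matrix.conjTranspose_inj, Matrix.conjTranspose_mul, contract_V,
      Matrix.conjTranspose_mul, Matrix.conjTranspose_conjTranspose, Matrix.mul_assoc,
      ← Matrix.mul_assoc (legIsometry C₁ k)ᴴ, legIsometry_isometry h₁.coisometry, Matrix.one_mul,
      h₂.coisometry, Matrix.conjTranspose_one]
  · intro b y
    rw [hout]
    exact h₂.out_hermitian b y
  · intro b y
    rw [hout]
    exact h₂.out_idempotent b y
  · intro y
    simp only [hout]
    exact h₂.sum_out y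
  · simp only [hout]
    exact h₂.out_irreducible
  · intro b y
    rw [hout, contract_V, ← Matrix.mul_assoc, bellMatrix_contract h₁.invariant hc, Matrix.mul_assoc,
      h₂.invariant, Matrix.mul_assoc]
  · rw [hout]
    exact h₂.value
  · intro T _ _ _ A b y
    rw [bell_contract A.comm]
    exact h₂.conn_isPositive T (compositeSystem h₁ A) b y
  · intro T _ _ _ A y
    simp only [bell_contract A.comm]
    exact h₂.sum_conn T (compositeSystem h₁ A) y
  · intro T _ _ _ A ψ hψ hval
    exact h₁.contract_rigid h₂ hc A ψ hψ hval

end QubitComplex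

/-! ### Tensor products of Hilbert spaces as commuting realizations -/

section TensorModel

variable {ι : Type} [Fintype ι] [DecidableEq ι]

theorem CompositeSystem.dense (S : CompositeSystem.{u} ι) :
    Dense ((Submodule.span ℂ (Set.range S.tmul) : Submodule ℂ S.T) : Set S.T) := by
  rw [Submodule.dense_iff_topologicalClosure_eq_top]
  exact S.dense_span

theorem CompositeSystem.clm_ext (S : CompositeSystem.{u} ι) {F : Type*} [NormedAddCommGroup F]
    [NormedSpace ℂ F] {f g : S.T →L[ℂ] F} (h : ∀ u, f (S.tmul u) = g (S.tmul u)) : f = g := by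
  refine ContinuousLinearMap.ext_on S.dense ?_
  rintro _ ⟨u, rfl⟩
  exact h u

theorem CompositeSystem.eq_of_inner_tmul (S : CompositeSystem.{u} ι) {Φ Ψ : S.T}
    (h : ∀ u, inner ℂ (S.tmul u) Φ = inner ℂ (S.tmul u) Ψ) : Φ = Ψ := by
  have h1 : innerSL ℂ Φ = innerSL ℂ Ψ := by
    refine S.clm_ext fun u => ?_
    rw [innerSL_apply_apply, innerSL_apply_apply, ← inner_conj_symm, h, inner_conj_symm]
  refine ext_inner_right ℂ fun v => ?_
  simpa using DFunLike.congr_fun h1 v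

theorem inner_tensorMap (S : CompositeSystem.{u} ι) (A : ∀ k, S.H k →L[ℂ] S.H k) (Φ Ψ : S.T) :
    inner ℂ (tensorMap S S (fun k => star (A k)) Φ) Ψ = inner ℂ Φ (tensorMap S S A Ψ) := by
  have h1 : ∀ u, star (tensorMap S S A) (S.tmul u) = tensorMap S S (fun k => star (A k))
      (S.tmul u) := by
    intro u
    refine S.eq_of_inner_tmul fun w => ?_
    rw [ContinuousLinearMap.star_eq_adjoint, ContinuousLinearMap.adjoint_inner_right,
      tensorMap_tmul, tensorMap_tmul, S.inner_tmul, S.inner_tmul]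
    refine Finset.prod_congr rfl fun k _ => ?_
    rw [ContinuousLinearMap.star_eq_adjoint, ContinuousLinearMap.adjoint_inner_right]
  rw [← S.clm_ext h1, ContinuousLinearMap.star_eq_adjoint, ContinuousLinearMap.adjoint_inner_left]

/-- The operator `1 ⊗ … ⊗ X ⊗ … ⊗ 1` with `X` at party `k`. -/
noncomputable def localOp (S : CompositeSystem.{u} ι) (k : ι) (X : S.H k →L[ℂ] S.H k) :
    S.T →L[ℂ] S.T :=
  tensorMap S S (Function.update (fun _ => 1) k X)

variable (S : CompositeSystem.{u} ι) (k : ι)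

theorem localOp_tmul (X : S.H k →L[ℂ] S.H k) (u : ∀ k, S.H k) :
    localOp S k X (S.tmul u) = S.tmul (Function.update u k (X (u k))) := by
  rw [localOp, tensorMap_tmul]
  congr 1
  ext1 j
  by_cases h : j = k
  · subst h; simp
  · simp [h]

theorem localOp_mul (X Y : S.H k →L[ℂ] S.H k) :
    localOp S k (X * Y) = localOp S k X * localOp S k Y := by
  refine S.clm_ext fun u => ?_
  rw [mul_apply_eq_comp]
  simp [localOp_tmul]

theorem localOp_one : localOp S k (1 : S.H k →L[ℂ] S.H k) = 1 := by
  refine S.clm_ext fun u => ?_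
  simp [localOp_tmul]

theorem localOp_add (X Y : S.H k →L[ℂ] S.H k) :
    localOp S k (X + Y) = localOp S k X + localOp S k Y := by
  refine S.clm_ext fun u => ?_
  simp [localOp_tmul]

theorem localOp_smul (c : ℂ) (X : S.H k →L[ℂ] S.H k) :
    localOp S k (c • X) = c • localOp S k X := by
  refine S.clm_ext fun u => ?_
  simp [localOp_tmul]

theorem inner_localOp_star (X : S.H k →L[ℂ] S.H k) (Φ Ψ : S.T) :
    inner ℂ (localOp S k (star X) Φ) Ψ = inner ℂ Φ (localOp S k X Ψ) := by
  rw [localOp, localOp, ← inner_tensorMap]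
  congr 3
  ext1 j
  by_cases h : j = k
  · subst h; simp
  · simp [h]

theorem localOp_star (X : S.H k →L[ℂ] S.H k) : localOp S k (star X) = star (localOp S k X) := by
  ext1 Φ
  refine ext_inner_right ℂ fun Ψ => ?_
  rw [inner_localOp_star, ContinuousLinearMap.star_eq_adjoint,
    ContinuousLinearMap.adjoint_inner_left]

/-- `localOp` as a homomorphism of algebras. -/
noncomputable def localOpHom : (S.H k →L[ℂ] S.H k) →ₐ[ℂ] (S.T →L[ℂ] S.T) :=
  AlgHom.ofLinearMap
    { toFun := localOp S k
      map_add' := localOp_add S k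
      map_smul' := localOp_smul S k } (localOp_one S k) (localOp_mul S k)

theorem localOpHom_apply (X : S.H k →L[ℂ] S.H k) : localOpHom S k X = localOp S k X := rfl

/-- Positivity passes to the tensor product through a factorization `X = Y*Y`, since `localOp`
respects products and adjoints. -/
theorem localOp_isPositive {X : S.H k →L[ℂ] S.H k} (hX : X.IsPositive) :
    (localOp S k X).IsPositive := by
  rw [← ContinuousLinearMap.nonneg_iff_isPositive] at hX
  obtain ⟨Y, rfl⟩ := CStarAlgebra.nonneg_iff_eq_star_mul_self.1 hX
  rw [localOp_mul, localOp_star]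
  exact ContinuousLinearMap.isPositive_adjoint_comp_self _

theorem localOp_commute {i j : ι} (hij : i ≠ j) (X : S.H i →L[ℂ] S.H i) (Y : S.H j →L[ℂ] S.H j) :
    Commute (localOp S i X) (localOp S j Y) := by
  refine S.clm_ext fun u => ?_
  rw [mul_apply_eq_comp, mul_apply_eq_comp]
  simp only [localOp_tmul]
  rw [Function.update_comm hij, Function.update_of_ne hij, Function.update_of_ne hij.symm]

theorem commProd_localOp (X : ∀ k, S.H k →L[ℂ] S.H k) :
    commProd (fun k => localOp S k (X k)) = tensorMap S S X := by
  have key : ∀ l : List ι, l.Nodup → (l.map fun k => localOp S k (X k)).prod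
      = tensorMap S S fun k => if k ∈ l then X k else 1 := by
    intro l
    induction l with
    | nil =>
      intro _
      refine S.clm_ext fun u => ?_
      simp [tensorMap_tmul]
    | cons a l ih =>
      intro hl
      obtain ⟨ha, hl⟩ := List.nodup_cons.1 hl
      rw [List.map_cons, List.prod_cons, ih hl]
      refine S.clm_ext fun u => ?_
      rw [mul_apply_eq_comp, tensorMap_tmul, localOp_tmul, tensorMap_tmul]
      congr 1
      ext1 k
      by_cases hk : k = a
      · subst hk; simp [ha]
      · simp [hk]
  rw [commProd, key _ (Finset.nodup_toList _)]
  simp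

/-- The commuting realization given by a measurement system. -/
noncomputable def MeasurementSystem.toComm {S : CompositeSystem.{u} ι} (A : MeasurementSystem S) :
    CommSystem ι S.T where
  op k a x := localOp S k (A.op k a x)
  isPositive k a x := localOp_isPositive S k (A.isPositive k a x)
  sum_op k x := by
    simp only [← localOpHom_apply, ← map_sum, A.sum_op, map_one]
  comm _ _ hij _ _ _ _ := localOp_commute S hij _ _

theorem MeasurementSystem.prodOp_eq {S : CompositeSystem.{u} ι} (A : MeasurementSystem S)
    (a x : ι → Fin 2) : A.prodOp a x = commProd fun k => A.toComm.op k (a k) (x k) :=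
  (commProd_localOp S _).symm

theorem MeasurementSystem.bellOp_eq {S : CompositeSystem.{u} ι} (A : MeasurementSystem S)
    (B : BellFunctional ι) : A.bellOp B = bell A.toComm.op B := by
  simp [bellOp, bell, A.prodOp_eq]

theorem norm_tmul (u : ∀ k, S.H k) : ‖S.tmul u‖ = ∏ k, ‖u k‖ := by
  have h := S.inner_tmul u u
  simp only [inner_self_eq_norm_sq_to_K] at h
  have h2 : ‖S.tmul u‖ ^ 2 = (∏ k, ‖u k‖) ^ 2 := by
    rw [← Finset.prod_pow]
    exact Complex.ofReal_injective (by simpa using h)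
  exact (pow_left_inj₀ (norm_nonneg _) (Finset.prod_nonneg fun _ _ => norm_nonneg _)
    two_ne_zero).1 h2

/-- The bounded operator that inserts a vector at party `k` into a product vector. -/
noncomputable def insertVector (u : ∀ k, S.H k) : S.H k →L[ℂ] S.T :=
  (S.tmul.toLinearMap u k).mkContinuous (∏ j ∈ Finset.univ.erase k, ‖u j‖) fun w => by
    rw [MultilinearMap.toLinearMap_apply, norm_tmul, ← Finset.mul_prod_erase _ _ (Finset.mem_univ k),
      mul_comm, Function.update_self]
    refine le_of_eq ?_
    congr 1
    refine Finset.prod_congr rfl fun j hj => ?_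
    rw [Function.update_of_ne (Finset.ne_of_mem_erase hj)]

theorem insertVector_apply (u : ∀ k, S.H k) (w : S.H k) :
    insertVector S k u w = S.tmul (Function.update u k w) := rfl

/-- If an operator at party `k` annihilates `Φ`, it annihilates the local support of `Φ` at `k`. -/
theorem apply_adjoint_insertVector {N : S.H k →L[ℂ] S.H k} {Φ : S.T} (h : localOp S k N Φ = 0)
    (u : ∀ k, S.H k) : N (ContinuousLinearMap.adjoint (insertVector S k u) Φ) = 0 := by
  refine ext_inner_left ℂ fun w => ?_
  rw [← ContinuousLinearMap.adjoint_inner_left, ContinuousLinearMap.adjoint_inner_right,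
    insertVector_apply, inner_zero_right]
  have h1 : S.tmul (Function.update u k (ContinuousLinearMap.adjoint N w))
      = localOp S k (star N) (S.tmul (Function.update u k w)) := by
    rw [localOp_tmul]
    simp [ContinuousLinearMap.star_eq_adjoint]
  rw [h1, inner_localOp_star, h, inner_zero_right]

/-- The vectors in the hypothesis are the partial inner products of `Φ` with product vectors of the
other parties. If all of them lie in `K`, inner products of `Φ` with product vectors do not see the
projection onto `K`. -/
theorem localOp_starProjection_eq_self {K : Submodule ℂ (S.H k)} [K.HasOrthogonalProjection]
    {Φ : S.T} (h : ∀ u, ContinuousLinearMap.adjoint (insertVector S k u) Φ ∈ K) :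
    localOp S k K.starProjection Φ = Φ := by
  refine S.eq_of_inner_tmul fun u => ?_
  have hs : star K.starProjection = K.starProjection := K.starProjection_isSymmetric.isSelfAdjoint
  rw [← inner_localOp_star, hs, localOp_tmul, ← insertVector_apply,
    ← ContinuousLinearMap.adjoint_inner_right, Submodule.inner_starProjection_left_eq_right,
    Submodule.starProjection_eq_self_iff.2 (h u), ContinuousLinearMap.adjoint_inner_right,
    insertVector_apply, Function.update_eq_self]

end TensorModel

/-! ### Local isometries -/

section LocalIsometries

variable {ι : Type} [Fintype ι] [DecidableEq ι] {S : CompositeSystem.{u} ι}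
  {A : MeasurementSystem S} {meas : ι → Fin 2 → Fin 2 → QMat} {J : ((ι → Fin 2) → ℂ) →ₗ[ℂ] S.T}

/-- Every qubit operator at `k` is a polynomial in the measurement operators there, and the same
polynomial in the operators on `S.H k` realizes it. The adjoint is carried along because the
isometry below is verified through products `X* X`. -/
theorem exists_localOp_lift (hJ : QubitComplex.Embeds meas A.toComm J)
    (hherm : ∀ k a x, (meas k a x).IsHermitian) (k : ι)
    (hirr : Algebra.adjoin ℂ {M | ∃ a x, M = meas k a x} = ⊤) (M : QMat) :
    ∃ X : S.H k →L[ℂ] S.H k, (∀ v, localOp S k X (J v) = J (localMatrix k M *ᵥ v)) ∧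
      ∀ v, localOp S k (star X) (J v) = J (localMatrix k Mᴴ *ᵥ v) := by
  have hM : M ∈ Algebra.adjoin ℂ {M | ∃ a x, M = meas k a x} := by rw [hirr]; trivial
  induction hM using Algebra.adjoin_induction with
  | mem M hM =>
    obtain ⟨a, x, rfl⟩ := hM
    refine ⟨A.op k a x, hJ.op_apply k a x, ?_⟩
    rw [(hherm k a x).eq, (A.isPositive k a x).isSelfAdjoint.star_eq]
    exact hJ.op_apply k a x
  | algebraMap c =>
    refine ⟨algebraMap ℂ _ c, fun v => ?_, fun v => ?_⟩
    · rw [← localOpHom_apply, ← localHom_apply, AlgHom.commutes, AlgHom.commutes]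
      simp [Algebra.algebraMap_eq_smul_one, Matrix.smul_mulVec]
    · have h1 : star (algebraMap ℂ (S.H k →L[ℂ] S.H k) c) = algebraMap ℂ _ (star c) := by
        rw [algebraMap_star_comm]
      have h2 : (algebraMap ℂ QMat c)ᴴ = algebraMap ℂ QMat (star c) := by
        rw [algebraMap_star_comm, Matrix.star_eq_conjTranspose]
      rw [h1, h2, ← localOpHom_apply, ← localHom_apply, AlgHom.commutes, AlgHom.commutes]
      simp [Algebra.algebraMap_eq_smul_one, Matrix.smul_mulVec]
  | add M N _ _ hM hN =>
    obtain ⟨X, hX1, hX2⟩ := hM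
    obtain ⟨Y, hY1, hY2⟩ := hN
    refine ⟨X + Y, fun v => ?_, fun v => ?_⟩
    · rw [localOp_add, add_apply, hX1, hY1, localMatrix_add, Matrix.add_mulVec, map_add]
    · rw [star_add, localOp_add, add_apply, hX2, hY2, Matrix.conjTranspose_add, localMatrix_add,
        Matrix.add_mulVec, map_add]
  | mul M N _ _ hM hN =>
    obtain ⟨X, hX1, hX2⟩ := hM
    obtain ⟨Y, hY1, hY2⟩ := hN
    refine ⟨X * Y, fun v => ?_, fun v => ?_⟩
    · rw [localOp_mul, mul_apply_eq_comp, hY1, hX1, ← localMatrix_mul, Matrix.mulVec_mulVec]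
    · rw [star_mul, localOp_mul, mul_apply_eq_comp, hX2, hY2, Matrix.conjTranspose_mul,
        ← localMatrix_mul, Matrix.mulVec_mulVec]

/-- The local isometry that extracts the qubit of party `k`. -/
theorem exists_localIsometry (hJ : QubitComplex.Embeds meas A.toComm J)
    (hherm : ∀ k a x, (meas k a x).IsHermitian) (k : ι)
    (hirr : Algebra.adjoin ℂ {M | ∃ a x, M = meas k a x} = ⊤) :
    ∃ U : S.H k →ₗᵢ[ℂ] PiLp 2 (fun _ : Fin 2 => S.H k), ∀ i v,
      localOp S k ((PiLp.proj 2 (fun _ : Fin 2 => S.H k) i :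
        PiLp 2 (fun _ : Fin 2 => S.H k) →L[ℂ] S.H k).comp U.toContinuousLinearMap) (J v)
        = J (localMatrix k (Matrix.single 0 i 1) *ᵥ v) := by
  choose X hX hXs using exists_localOp_lift hJ hherm k hirr
  -- `K` consists of the vectors killed by every local operator that kills the range of `J`. It is
  -- closed and contains the local supports of all `J v`; relations that hold on the range of `J`
  -- hold exactly on `K`.
  let K : Submodule ℂ (S.H k) :=
    ⨅ N : {N : S.H k →L[ℂ] S.H k // ∀ v, localOp S k N (J v) = 0}, LinearMap.ker (N.1 : S.H k →ₗ[ℂ] S.H k)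
  have hKmem : ∀ w, w ∈ K ↔ ∀ N : S.H k →L[ℂ] S.H k, (∀ v, localOp S k N (J v) = 0) → N w = 0 := by
    intro w
    simp [K, Submodule.mem_iInf]
  have hKc : IsClosed (K : Set (S.H k)) := by
    have : (K : Set (S.H k)) = ⋂ N : {N : S.H k →L[ℂ] S.H k // ∀ v, localOp S k N (J v) = 0},
        {w | N.1 w = 0} := by
      ext w
      simp [hKmem]
    rw [this]
    exact isClosed_iInter fun N => isClosed_eq N.1.continuous continuous_const
  have : CompleteSpace K := hKc.completeSpace_coe
  let P := K.starProjection
  have hP : ∀ v, localOp S k P (J v) = J v := by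
    intro v
    refine localOp_starProjection_eq_self S k fun u => ?_
    rw [hKmem]
    exact fun N hN => apply_adjoint_insertVector S k (hN v) u
  have hXK : ∀ M w, w ∈ K → X M w ∈ K := by
    intro M w hw
    rw [hKmem] at hw ⊢
    intro N hN
    refine hw (N * X M) fun v => ?_
    rw [localOp_mul, mul_apply_eq_comp, hX, hN]
  let e : Fin 2 → QMat := fun i => Matrix.single 0 i 1
  -- With `e i = |0⟩⟨i|` one has `e₀†e₀ + e₁†e₁ = 1`, so the two lifted operators are the components
  -- of an isometry on `K`.
  have hiso : ∀ w ∈ K, ‖X (e 0) w‖ ^ 2 + ‖X (e 1) w‖ ^ 2 = ‖w‖ ^ 2 := by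
    intro w hw
    have h0 := (hKmem w).1 hw (star (X (e 0)) * X (e 0) + star (X (e 1)) * X (e 1) + (-1 : ℂ) • 1) (by
      intro v
      rw [localOp_add, localOp_add, localOp_smul, localOp_one, localOp_mul, localOp_mul]
      rw [add_apply, add_apply, mul_apply_eq_comp, mul_apply_eq_comp, hX, hX, hXs, hXs,
        Matrix.mulVec_mulVec, Matrix.mulVec_mulVec, localMatrix_mul, localMatrix_mul]
      have : J (localMatrix k ((e 0)ᴴ * e 0) *ᵥ v) + J (localMatrix k ((e 1)ᴴ * e 1) *ᵥ v) = J v := by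
        rw [← map_add, ← Matrix.add_mulVec, ← localMatrix_add]
        have : (e 0)ᴴ * e 0 + (e 1)ᴴ * e 1 = 1 := by
          ext i j
          fin_cases i <;> fin_cases j <;> simp [e]
        rw [this, localMatrix_one, Matrix.one_mulVec]
      rw [this]
      simp)
    have h1 : star (X (e 0)) (X (e 0) w) + star (X (e 1)) (X (e 1) w) = w := by
      rw [add_apply, add_apply, mul_apply_eq_comp, mul_apply_eq_comp] at h0
      simpa [add_neg_eq_zero] using h0
    have h2 := congrArg (fun z => inner ℂ z w) h1
    simp only [inner_add_left, ContinuousLinearMap.star_eq_adjoint,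
      ContinuousLinearMap.adjoint_inner_left, inner_self_eq_norm_sq_to_K] at h2
    exact Complex.ofReal_injective (by simpa using h2)
  -- On the orthogonal complement of `K` the identity is put into component `0`. This makes the map
  -- isometric on all of `S.H k`; it is orthogonal to the other contribution because `X (e 0)`
  -- preserves `K`.
  let Y : Fin 2 → S.H k →L[ℂ] S.H k := ![X (e 0) * P + (1 + (-1 : ℂ) • P), X (e 1) * P]
  let L : S.H k →ₗ[ℂ] PiLp 2 (fun _ : Fin 2 => S.H k) :=
    (WithLp.linearEquiv 2 ℂ (Fin 2 → S.H k)).symm.toLinearMap ∘ₗ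
      LinearMap.pi fun i => (Y i : S.H k →ₗ[ℂ] S.H k)
  have hL : ∀ w i, L w i = Y i w := fun w i => rfl
  have hnorm : ∀ w, ‖L w‖ = ‖w‖ := by
    intro w
    have hw : ‖L w‖ ^ 2 = ‖w‖ ^ 2 := by
      rw [PiLp.norm_sq_eq_of_L2, Fin.sum_univ_two, hL, hL]
      have hPw : P w ∈ K := K.starProjection_apply_mem w
      have hort : w - P w ∈ Kᗮ := K.sub_starProjection_mem_orthogonal w
      have e0 : Y 0 w = X (e 0) (P w) + (w - P w) := by
        change (X (e 0) * P + (1 + (-1 : ℂ) • P)) w = _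
        rw [add_apply, add_apply, mul_apply_eq_comp]
        simp [sub_eq_add_neg]
      have e1 : Y 1 w = X (e 1) (P w) := rfl
      have p1 := norm_add_sq_eq_norm_sq_add_norm_sq_of_inner_eq_zero (𝕜 := ℂ) _ _
        (Submodule.inner_right_of_mem_orthogonal (hXK (e 0) _ hPw) hort)
      have p2 := norm_add_sq_eq_norm_sq_add_norm_sq_of_inner_eq_zero (𝕜 := ℂ) _ _
        (Submodule.inner_right_of_mem_orthogonal hPw hort)
      rw [add_sub_cancel] at p2
      have p3 := hiso _ hPw
      rw [e0, e1]
      nlinarith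
    exact (pow_left_inj₀ (norm_nonneg _) (norm_nonneg _) two_ne_zero).1 hw
  refine ⟨⟨L, hnorm⟩, fun i v => ?_⟩
  · have hcomp : ((PiLp.proj 2 (fun _ : Fin 2 => S.H k) i :
        PiLp 2 (fun _ : Fin 2 => S.H k) →L[ℂ] S.H k).comp
          (LinearIsometry.toContinuousLinearMap ⟨L, hnorm⟩)) = Y i := by
      ext w
      exact hL w i
    rw [hcomp]
    have hi : i = 0 ∨ i = 1 := by fin_cases i <;> simp
    rcases hi with rfl | rfl
    · change localOp S k (X (e 0) * P + (1 + (-1 : ℂ) • P)) (J v) = _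
      rw [localOp_add, localOp_mul, localOp_add, localOp_smul, localOp_one, add_apply, add_apply,
        mul_apply_eq_comp, hP, hX]
      simp [hP, e]
    · change localOp S k (X (e 1) * P) (J v) = _
      rw [localOp_mul, mul_apply_eq_comp, hP, hX]

/-- The component at `i` of the product isometry acts on the range of `J` as `|0…0⟩⟨i|`, hence gives
`v i` times the fixed vector `J|0…0⟩`. The junk spaces may be taken to be the original spaces. -/
theorem exists_applyIsometries_eq (hJ : QubitComplex.Embeds meas A.toComm J)
    (hherm : ∀ k a x, (meas k a x).IsHermitian)
    (hirr : ∀ k, Algebra.adjoin ℂ {M | ∃ a x, M = meas k a x} = ⊤) :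
    ∃ U : ∀ k, S.H k →ₗᵢ[ℂ] PiLp 2 (fun _ : Fin 2 => S.H k), ∀ v,
      applyIsometries S S U (J v) = fun i => v i • J (Pi.single 0 1) := by
  choose U hU using fun k => exists_localIsometry hJ hherm k (hirr k)
  refine ⟨U, fun v => ?_⟩
  ext1 i
  rw [applyIsometries, ← commProd_localOp]
  have h : (commProd fun k => localMatrix k (Matrix.single 0 (i k) (1 : ℂ)),
      commProd fun k => localOp S k ((PiLp.proj 2 (fun _ : Fin 2 => S.H k) (i k) :
        PiLp 2 (fun _ : Fin 2 => S.H k) →L[ℂ] S.H k).comp (U k).toContinuousLinearMap))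
      ∈ intertwined J := by
    rw [← commProd_prodMk]
    exact commProd_mem (S := (intertwined J).toSubsemiring.toSubmonoid) fun k v => hU k (i k) v
  rw [h v]
  have h2 : (commProd fun k => localMatrix k (Matrix.single 0 (i k) (1 : ℂ)))
      = Matrix.single 0 i 1 := by
    rw [commProd_localMatrix, ← tensorMatrix_single]
    rfl
  change J ((commProd fun k => localMatrix k (Matrix.single 0 (i k) (1 : ℂ))) *ᵥ v) = _
  rw [h2, ← map_smul]
  congr 1
  ext j
  by_cases hj : j = 0 <;>
    simp [Matrix.mulVec, dotProduct, Matrix.single_apply, hj, eq_comm]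

end LocalIsometries

namespace QubitComplex

/-! ### Full self-testing from rigidity -/

variable {ι : Type} [Fintype ι] [DecidableEq ι]

theorem bell_functional {R : Type*} [Ring R] [Algebra ℂ R] (C : QubitComplex ι)
    (op : ι → Fin 2 → Fin 2 → R) :
    bell op (C.functional rootWeights) = bell op (C.conn 0 1) - bell op (C.conn 1 1) := by
  rw [← bell_sub]
  congr 1
  ext a x
  simp [functional, rootWeights, Fin.sum_univ_two, sub_eq_add_neg]

theorem prodKet_basisFun (i : ι → Fin 2) :
    prodKet (fun _ => EuclideanSpace.basisFun (Fin 2) ℂ) i = Pi.single i 1 := by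
  ext j
  simp only [prodKet, EuclideanSpace.basisFun_apply]
  by_cases h : j = i
  · subst h; simp
  · obtain ⟨k, hk⟩ := Function.ne_iff.1 h
    rw [Pi.single_eq_of_ne h, Finset.prod_eq_zero (Finset.mem_univ k)]
    simp [hk]

/-- Writing `1 - B = Y*Y`, the expectation of `1 - B` in `ψ` is `‖Yψ‖²`; if it vanishes, so does `(1
- B)ψ`. -/
theorem eq_self_of_inner_eq_one {T : Type u} [NormedAddCommGroup T] [InnerProductSpace ℂ T]
    [CompleteSpace T] {B : T →L[ℂ] T} (h1 : (1 - B).IsPositive) {ψ : T} (hψ : ‖ψ‖ = 1)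
    (h : inner ℂ ψ (B ψ) = 1) : B ψ = ψ := by
  have h0 : inner ℂ ψ ((1 - B) ψ) = 0 := by
    rw [sub_apply, inner_sub_right, h]
    simp [inner_self_eq_norm_sq_to_K, hψ]
  rw [← ContinuousLinearMap.nonneg_iff_isPositive] at h1
  obtain ⟨Y, hY⟩ := CStarAlgebra.nonneg_iff_eq_star_mul_self.1 h1
  rw [hY, mul_apply_eq_comp, ContinuousLinearMap.star_eq_adjoint,
    ContinuousLinearMap.adjoint_inner_right, inner_self_eq_zero] at h0
  have h2 : (1 - B) ψ = 0 := by
    rw [hY, mul_apply_eq_comp, h0, map_zero]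
  rw [sub_apply, sub_eq_zero] at h2
  exact h2.symm

/-- A tensor product realization is a commuting one, so rigidity embeds the qubits globally;
`exists_applyIsometries_eq` makes the embedding local. The clauses on generated subspaces hold
because a nonzero vector is cyclic for the full matrix algebra. -/
theorem IsRigid.fullySelfTestingWith {C : QubitComplex ι} {α : Fin 2 → ℂ} (h : IsRigid.{u} C α) :
    FullySelfTestingWith.{u} C rootWeights α := by
  have hα : α ≠ 0 := by
    rintro rfl
    simpa using h.unit_vector
  have hunit : star (C.Vᴴ *ᵥ α) ⬝ᵥ (C.Vᴴ *ᵥ α) = 1 := by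
    rw [star_mulVec_dotProduct, Matrix.conjTranspose_conjTranspose, h.coisometry,
      Matrix.one_mulVec, h.unit_vector]
  have hVα : C.Vᴴ *ᵥ α ≠ 0 := by
    intro h0
    simp [h0] at hunit
  -- Since `C_{+|1} + C_{-|1} = 1`, the functional `B = C_{+|1} - C_{-|1}` satisfies `1 ∓ B = 2
  -- C_{∓|1}`: its normalization is positivity of the connector, and value `1` means being fixed by
  -- `C_{+|1}`.
  have hsub : ∀ (S : CompositeSystem.{u} ι) (A : MeasurementSystem S),
      1 - A.bellOp (C.functional rootWeights) = (2 : ℂ) • bell A.toComm.op (C.conn 1 1) ∧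
      1 + A.bellOp (C.functional rootWeights) = (2 : ℂ) • bell A.toComm.op (C.conn 0 1) := by
    intro S A
    rw [A.bellOp_eq, bell_functional, ← h.sum_conn S.T A.toComm 1, Fin.sum_univ_two, two_smul,
      two_smul]
    constructor <;> abel
  have hnorm : IsNormalized.{u} (C.functional rootWeights) := by
    intro S A
    rw [(hsub S A).1, (hsub S A).2]
    exact ⟨(h.conn_isPositive S.T A.toComm 1 1).smul_of_nonneg zero_le_two,
      (h.conn_isPositive S.T A.toComm 0 1).smul_of_nonneg zero_le_two⟩
  refine ⟨⟨?_, ?_, h.sum_meas, h.coisometry, h.out_hermitian, h.out_idempotent, h.sum_out⟩,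
    ⟨hnorm, h.meas_hermitian, h.meas_idempotent, h.sum_meas, hunit, ?_, ?_, ?_⟩, ?_⟩
  · intro S A
    simp only [A.bellOp_eq]
    exact ⟨h.conn_isPositive S.T A.toComm, h.sum_conn S.T A.toComm⟩
  · intro k a x
    have := Matrix.posSemidef_conjTranspose_mul_self (C.meas k a x)
    rwa [(h.meas_hermitian k a x).eq, h.meas_idempotent k a x] at this
  · have hout : C.outMeas 1 1 *ᵥ α = 0 := by
      have h1 := congrArg (fun M => M *ᵥ α) (h.sum_out 1)
      simp only [Fin.sum_univ_two, Matrix.add_mulVec, h.value, Matrix.one_mulVec] at h1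
      exact left_eq_add.1 h1.symm
    rw [bellMatrix_eq_bell, bell_functional, ← bellMatrix_eq_bell, ← bellMatrix_eq_bell,
      Matrix.mulVec_mulVec, Matrix.sub_mul, h.invariant, h.invariant, Matrix.sub_mulVec,
      ← Matrix.mulVec_mulVec, ← Matrix.mulVec_mulVec, h.value, hout, Matrix.mulVec_zero, sub_zero,
      hunit]
  · rw [tensorPolynomials_eq_top h.meas_irreducible, Set.eq_univ_iff_forall]
    intro v
    obtain ⟨M, hM⟩ := exists_mulVec_eq hVα v
    exact ⟨M, trivial, hM.symm⟩
  · intro S A ψ hψ hval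
    have hB := eq_self_of_inner_eq_one (hnorm S A).1 hψ hval
    have hC : bell A.toComm.op (C.conn 0 1) ψ = ψ := by
      have h1 := DFunLike.congr_fun (hsub S A).2 ψ
      rw [add_apply, hB] at h1
      simp only [one_apply_eq_self, two_smul] at h1
      have h2 : (2 : ℂ) • ψ = (2 : ℂ) • bell A.toComm.op (C.conn 0 1) ψ := by
        rw [two_smul, two_smul]; exact h1
      exact (smul_right_injective _ (two_ne_zero (α := ℂ)) h2).symm
    obtain ⟨J, hJ, hJα⟩ := h.rigid S.T A.toComm ψ hψ hC
    obtain ⟨U, hU⟩ := exists_applyIsometries_eq hJ h.meas_hermitian h.meas_irreducible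
    -- The computational bases suffice, with `ψ(i) = J|i⟩`, junk spaces equal to the realization
    -- itself, and junk vector `J|0…0⟩`.
    refine ⟨fun _ => EuclideanSpace.basisFun (Fin 2) ℂ, fun i => J (Pi.single i 1), ?_, ?_, S, U,
      J (Pi.single 0 1), ?_, ?_⟩
    · rw [orthonormal_iff_ite]
      intro i j
      rw [hJ.inner_eq]
      simp [Pi.single_apply, eq_comm]
    · simp only [prodKet_basisFun]
      rw [← hJα]
      conv_lhs => rw [pi_eq_sum_univ' (C.Vᴴ *ᵥ α)]
      rw [map_sum]
      refine Finset.sum_congr rfl fun i _ => ?_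
      rw [map_smul]
      congr 1
      simp
    · have h1 := hJ.inner_eq (Pi.single 0 1) (Pi.single 0 1)
      rw [inner_self_eq_norm_sq_to_K] at h1
      have h2 : ‖J (Pi.single 0 1)‖ ^ 2 = 1 := Complex.ofReal_injective (by simpa using h1)
      exact (pow_eq_one_iff_of_nonneg (norm_nonneg _) two_ne_zero).1 h2
    · intro a x i
      rw [prodKet_basisFun, ← hU, A.prodOp_eq]
      congr 1
      rw [← commProd_localMatrix]
      have hmem : (commProd fun k => localMatrix k (C.meas k (a k) (x k)),
          commProd fun k => A.toComm.op k (a k) (x k)) ∈ intertwined J := by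
        rw [← commProd_prodMk]
        exact commProd_mem (S := (intertwined J).toSubsemiring.toSubmonoid)
          fun k v => hJ.op_apply k _ _ v
      exact hmem _
  -- Polynomials in the Bell operators preserve the range of `V†` and act there as polynomials in
  -- the output measurements; by irreducibility of the latter, every operator on the output qubit
  -- arises (`hpoly'`).
  · have hpoly : ∀ f ∈ C.outPolynomials, ∃ g : QMat, f * C.Vᴴ = C.Vᴴ * g := by
      intro f hf
      induction hf using Algebra.adjoin_induction with
      | mem f hf =>
        obtain ⟨b, y, rfl⟩ := hf
        exact ⟨_, h.invariant b y⟩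
      | algebraMap c => exact ⟨c • 1, by simp [Algebra.algebraMap_eq_smul_one]⟩
      | add f f' _ _ hf hf' =>
        obtain ⟨g, hg⟩ := hf
        obtain ⟨g', hg'⟩ := hf'
        exact ⟨g + g', by rw [Matrix.add_mul, hg, hg', Matrix.mul_add]⟩
      | mul f f' _ _ hf hf' =>
        obtain ⟨g, hg⟩ := hf
        obtain ⟨g', hg'⟩ := hf'
        exact ⟨g * g', by rw [Matrix.mul_assoc, hg', ← Matrix.mul_assoc, hg, Matrix.mul_assoc]⟩
    have hpoly' : ∀ g : QMat, ∃ f ∈ C.outPolynomials, f * C.Vᴴ = C.Vᴴ * g := by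
      intro g
      have hg : g ∈ Algebra.adjoin ℂ {M | ∃ b y, M = C.outMeas b y} := by
        rw [h.out_irreducible]; trivial
      induction hg using Algebra.adjoin_induction with
      | mem g hg =>
        obtain ⟨b, y, rfl⟩ := hg
        exact ⟨_, Algebra.subset_adjoin ⟨b, y, rfl⟩, h.invariant b y⟩
      | algebraMap c =>
        exact ⟨algebraMap ℂ _ c, Subalgebra.algebraMap_mem _ _,
          by simp [Algebra.algebraMap_eq_smul_one]⟩
      | add g g' _ _ hg hg' =>
        obtain ⟨f, hf, hfg⟩ := hg
        obtain ⟨f', hf', hfg'⟩ := hg'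
        exact ⟨f + f', add_mem hf hf', by rw [Matrix.add_mul, hfg, hfg', Matrix.mul_add]⟩
      | mul g g' _ _ hg hg' =>
        obtain ⟨f, hf, hfg⟩ := hg
        obtain ⟨f', hf', hfg'⟩ := hg'
        exact ⟨f * f', mul_mem hf hf', by
          rw [Matrix.mul_assoc, hfg', ← Matrix.mul_assoc, hfg, Matrix.mul_assoc]⟩
    ext v
    constructor
    · rintro ⟨f, hf, rfl⟩
      obtain ⟨g, hg⟩ := hpoly f hf
      exact ⟨g *ᵥ α, by
        change C.Vᴴ *ᵥ (g *ᵥ α) = _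
        rw [Matrix.mulVec_mulVec, Matrix.mulVec_mulVec, hg]⟩
    · rintro ⟨β, rfl⟩
      obtain ⟨g, rfl⟩ := exists_mulVec_eq hα β
      obtain ⟨f, hf, hfg⟩ := hpoly' g
      refine ⟨f, hf, ?_⟩
      change C.Vᴴ *ᵥ (g *ᵥ α) = _
      rw [Matrix.mulVec_mulVec, Matrix.mulVec_mulVec, hfg]

end QubitComplex

/-! ### Representations of qubit algebras -/

section Representations

variable {R : Type*} [Ring R] [Algebra ℂ R]

/-- The quaternion basis generated by two reflections whose anticommutator is a scalar. -/
def reflectionBasis {b₀ b₁ : R} {κ : ℂ} (h₀ : b₀ * b₀ = 1) (h₁ : b₁ * b₁ = 1)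
    (h : b₀ * b₁ + b₁ * b₀ = (2 * κ) • 1) : QuaternionAlgebra.Basis R (1 : ℂ) 0 (1 - κ ^ 2) where
  i := b₀
  j := b₁ - κ • b₀
  k := b₀ * (b₁ - κ • b₀)
  i_mul_i := by simp [h₀]
  j_mul_j := by
    have : (b₁ - κ • b₀) * (b₁ - κ • b₀)
        = b₁ * b₁ - κ • (b₀ * b₁ + b₁ * b₀) + (κ ^ 2) • (b₀ * b₀) := by
      simp only [mul_sub, sub_mul, smul_mul_assoc, mul_smul_comm]
      module
    rw [this, h₀, h₁, h]
    module
  i_mul_j := rfl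
  j_mul_i := by
    have : (b₁ - κ • b₀) * b₀ = (b₀ * b₁ + b₁ * b₀) - b₀ * b₁ - κ • (b₀ * b₀) := by
      simp only [sub_mul, smul_mul_assoc]
      abel
    rw [this, h, mul_sub, mul_smul_comm, h₀]
    module

/-- Two reflections with scalar anticommutator satisfy the relations of a quaternion algebra: `b₁ -
κ b₀` anticommutes with `b₀` and has square `1 - κ²`. The quaternion algebra maps onto `QMat` by
irreducibility, and bijectively since both have dimension four; so these relations present `QMat`
and determine a representation. -/
theorem exists_algHom_of_reflections {a₀ a₁ : QMat} {b₀ b₁ : R} {κ : ℂ}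
    (ha₀ : a₀ * a₀ = 1) (ha₁ : a₁ * a₁ = 1) (ha : a₀ * a₁ + a₁ * a₀ = (2 * κ) • 1)
    (hirr : Algebra.adjoin ℂ {a₀, a₁} = ⊤)
    (hb₀ : b₀ * b₀ = 1) (hb₁ : b₁ * b₁ = 1) (hb : b₀ * b₁ + b₁ * b₀ = (2 * κ) • 1) :
    ∃ ρ : QMat →ₐ[ℂ] R, ρ a₀ = b₀ ∧ ρ a₁ = b₁ := by
  let p := (reflectionBasis ha₀ ha₁ ha).liftHom
  let q := (reflectionBasis hb₀ hb₁ hb).liftHom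
  have hp : ∀ z : QuaternionAlgebra ℂ 1 0 (1 - κ ^ 2), p z = algebraMap ℂ _ z.re + z.imI • a₀ +
      z.imJ • (a₁ - κ • a₀) + z.imK • (a₀ * (a₁ - κ • a₀)) := fun z => rfl
  have hq : ∀ z : QuaternionAlgebra ℂ 1 0 (1 - κ ^ 2), q z = algebraMap ℂ _ z.re + z.imI • b₀ +
      z.imJ • (b₁ - κ • b₀) + z.imK • (b₀ * (b₁ - κ • b₀)) := fun z => rfl
  let z₀ : QuaternionAlgebra ℂ 1 0 (1 - κ ^ 2) := ⟨0, 1, 0, 0⟩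
  let z₁ : QuaternionAlgebra ℂ 1 0 (1 - κ ^ 2) := ⟨0, κ, 1, 0⟩
  have hp₀ : p z₀ = a₀ := by simp [hp, z₀]
  have hp₁ : p z₁ = a₁ := by simp [hp, z₁]
  have hq₀ : q z₀ = b₀ := by simp [hq, z₀]
  have hq₁ : q z₁ = b₁ := by simp [hq, z₁]
  have hsurj : Function.Surjective p := by
    rw [← AlgHom.range_eq_top, eq_top_iff, ← hirr]
    refine Algebra.adjoin_le ?_
    rintro _ (rfl | rfl)
    · exact ⟨z₀, hp₀⟩
    · exact ⟨z₁, hp₁⟩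
  have hrank : Module.finrank ℂ (QuaternionAlgebra ℂ 1 0 (1 - κ ^ 2)) = Module.finrank ℂ QMat := by
    rw [QuaternionAlgebra.finrank_eq_four, Module.finrank_matrix]
    simp
  have hinj : Function.Injective p :=
    (LinearMap.injective_iff_surjective_of_finrank_eq_finrank (f := p.toLinearMap) hrank).2 hsurj
  let e := AlgEquiv.ofBijective p ⟨hinj, hsurj⟩
  refine ⟨q.comp e.symm.toAlgHom, ?_, ?_⟩
  · have : e.symm a₀ = z₀ := by rw [AlgEquiv.symm_apply_eq]; exact hp₀.symm
    change q (e.symm a₀) = b₀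
    rw [this, hq₀]
  · have : e.symm a₁ = z₁ := by rw [AlgEquiv.symm_apply_eq]; exact hp₁.symm
    change q (e.symm a₁) = b₁
    rw [this, hq₁]

variable {ι : Type} [Fintype ι] [DecidableEq ι]

/-- Commuting representations of the local algebras extend to the tensor product. -/
theorem exists_tensorHom (ρ : ι → QMat →ₐ[ℂ] R)
    (hρ : ∀ i j, i ≠ j → ∀ M N, Commute (ρ i M) (ρ j N)) :
    ∃ τ : Matrix (ι → Fin 2) (ι → Fin 2) ℂ →ₐ[ℂ] R, ∀ k M, τ (localMatrix k M) = ρ k M := by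
  let F : MultilinearMap ℂ (fun _ : ι => QMat) R :=
    commMultilinear (fun k => (ρ k).toLinearMap) fun i j hij M N => hρ i j hij M N
  have hF : ∀ M, F M = commProd fun k => ρ k (M k) := fun M => rfl
  have hmul : ∀ M N : ι → QMat, F M * F N = F fun k => M k * N k := by
    intro M N
    simp only [hF, map_mul]
    exact (commProd_mul (fun i j hij => hρ i j hij _ _) (fun i j hij => hρ i j hij _ _)
      (fun i j hij => hρ i j hij _ _)).symm
  -- The products of represented local matrix units satisfy the multiplication rules of global
  -- matrix units, which is all that is needed to define `τ`.
  let E : (ι → Fin 2) → (ι → Fin 2) → R := fun i j => F fun k => Matrix.single (i k) (j k) 1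
  have hE : ∀ i j j' l, E i j * E j' l = if j = j' then E i l else 0 := by
    intro i j j' l
    rw [hmul]
    by_cases h : j = j'
    · subst h
      simp [E]
    · obtain ⟨k, hk⟩ := Function.ne_iff.1 h
      rw [if_neg h]
      refine F.map_coord_zero k ?_
      exact Matrix.single_mul_single_of_ne _ _ _ _ hk _
  let P : Matrix (ι → Fin 2) (ι → Fin 2) ℂ →ₗ[ℂ] R :=
    { toFun := fun M => ∑ i, ∑ j, M i j • E i j
      map_add' := fun M N => by simp [add_smul, Finset.sum_add_distrib]
      map_smul' := fun c M => by simp [Finset.smul_sum, mul_smul] }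
  have hP : ∀ M, P M = ∑ i, ∑ j, M i j • E i j := fun M => rfl
  have htensor : ∀ N : ι → QMat, P (tensorMatrix N) = F N := by
    intro N
    have h1 : N = fun k => ∑ p : Fin 2 × Fin 2, N k p.1 p.2 • Matrix.single p.1 p.2 (1 : ℂ) := by
      ext1 k
      conv_lhs => rw [Matrix.matrix_eq_sum_single (N k)]
      rw [Fintype.sum_prod_type]
      simp [Matrix.smul_single]
    conv_rhs => rw [h1, F.map_sum]
    rw [← (Equiv.arrowProdEquivProdArrow ι (fun _ => Fin 2) (fun _ => Fin 2)).symm.sum_comp,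
      Fintype.sum_prod_type, hP]
    refine Finset.sum_congr rfl fun i _ => Finset.sum_congr rfl fun j _ => ?_
    rw [F.map_smul_univ]
    rfl
  refine ⟨AlgHom.ofLinearMap P ?_ ?_, fun k M => ?_⟩
  · rw [← tensorMatrix_one, htensor, hF]
    simp [commProd_one]
  · intro M N
    rw [hP, hP, hP, Finset.sum_mul]
    refine Finset.sum_congr rfl fun i _ => ?_
    simp only [Finset.sum_mul, Finset.mul_sum, smul_mul_smul_comm, hE, Matrix.mul_apply,
      Finset.sum_smul]
    rw [Finset.sum_comm]
    refine Finset.sum_congr rfl fun j _ => ?_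
    rw [Finset.sum_comm]
    simp
  · change P (localMatrix k M) = _
    rw [localMatrix, htensor, hF]
    have : (fun j => ρ j (Function.update (fun _ => (1 : QMat)) k M j))
        = Function.update (fun _ => (1 : R)) k (ρ k M) := by
      ext1 j
      by_cases hj : j = k
      · subst hj; simp
      · simp [hj]
    rw [this, commProd_update_one]

end Representations

/-! ### A criterion for rigidity -/

section Criterion

variable {ι : Type} [Fintype ι] [DecidableEq ι] {T : Type u} [NormedAddCommGroup T]
  [InnerProductSpace ℂ T]

/-- The observable `K_x` of party `k`. -/
def CommSystem.K (A : CommSystem ι T) (k : ι) (x : Fin 2) : T →L[ℂ] T := A.op k 0 x - A.op k 1 x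

theorem CommSystem.op_eq (A : CommSystem ι T) (k : ι) (a x : Fin 2) :
    A.op k a x = (2⁻¹ : ℂ) • (1 + ((-1) ^ (a : ℕ) : ℂ) • A.K k x) := by
  have h := A.sum_op k x
  rw [Fin.sum_univ_two] at h
  rw [← h, CommSystem.K]
  have ha : a = 0 ∨ a = 1 := by fin_cases a <;> simp
  rcases ha with rfl | rfl
  · simp only [Fin.val_zero, pow_zero, one_smul]
    module
  · simp only [Fin.val_one, pow_one]
    module

theorem CommSystem.K_commute (A : CommSystem ι T) {i j : ι} (hij : i ≠ j) (x y : Fin 2) :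
    Commute (A.K i x) (A.K j y) :=
  A.comm.obs_commute hij (some x) (some y)

theorem adjoin_dichotomicMeas {Kb : ι → Fin 2 → QMat} {k : ι}
    (h : Algebra.adjoin ℂ {Kb k 0, Kb k 1} = ⊤) :
    Algebra.adjoin ℂ {M | ∃ a x, M = dichotomicMeas Kb k a x} = ⊤ := by
  rw [eq_top_iff, ← h]
  have hx : ∀ x, Kb k x ∈ Algebra.adjoin ℂ {M | ∃ a x, M = dichotomicMeas Kb k a x} := by
    intro x
    have : Kb k x = dichotomicMeas Kb k 0 x - dichotomicMeas Kb k 1 x := by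
      simp only [dichotomicMeas, Fin.val_zero, Fin.val_one, pow_zero, pow_one]
      module
    rw [this]
    exact sub_mem (Algebra.subset_adjoin ⟨0, x, rfl⟩) (Algebra.subset_adjoin ⟨1, x, rfl⟩)
  refine Algebra.adjoin_le ?_
  rintro _ (rfl | rfl)
  · exact hx 0
  · exact hx 1

theorem dichotomicMeas_isHermitian {Kb : ι → Fin 2 → QMat} (h : ∀ k x, (Kb k x).IsHermitian)
    (k : ι) (a x : Fin 2) : (dichotomicMeas Kb k a x).IsHermitian := by
  rw [Matrix.IsHermitian, dichotomicMeas]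
  simp [Matrix.conjTranspose_smul, (h k x).eq]

/-- A state on which the observables of each party satisfy the relations of the qubit observables,
and act as operators that commute with that party, is the image of the qubit state that is
determined by the values of Bell functionals. -/
theorem exists_embeds (A : CommSystem ι T) {ψ : T} (hψ : ‖ψ‖ = 1) {Kb : ι → Fin 2 → QMat}
    (hherm : ∀ k x, (Kb k x).IsHermitian) (hsq : ∀ k x, Kb k x * Kb k x = 1) {κ : ι → ℂ}
    (hanti : ∀ k, Kb k 0 * Kb k 1 + Kb k 1 * Kb k 0 = (2 * κ k) • 1)
    (hirr : ∀ k, Algebra.adjoin ℂ {Kb k 0, Kb k 1} = ⊤)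
    (hswap : ∀ k x, ∃ P : T →L[ℂ] T, (∀ y, Commute P (A.K k y)) ∧ A.K k x ψ = P ψ)
    (hsq' : ∀ k x, A.K k x (A.K k x ψ) = ψ)
    (hanti' : ∀ k, A.K k 0 (A.K k 1 ψ) + A.K k 1 (A.K k 0 ψ) = (2 * κ k) • ψ)
    {ψ' : (ι → Fin 2) → ℂ} (hψ' : star ψ' ⬝ᵥ ψ' = 1)
    (hfix : ∀ v : (ι → Fin 2) → ℂ, (∀ B : BellFunctional ι, bell A.op B ψ = ψ →
      bellMatrix (dichotomicMeas Kb) B *ᵥ v = v) → ∃ c : ℂ, v = c • ψ') :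
    ∃ J, QubitComplex.Embeds (dichotomicMeas Kb) A J ∧ J ψ' = ψ := by
  -- A vector `Pψ` with `P` commuting with party `k` inherits from `ψ` every relation among the
  -- observables of `k`. The intersection `W` over `k` is where all parties satisfy their relations
  -- at once.
  let W' : ι → Submodule ℂ T := fun k =>
    { carrier := {v | ∃ P : T →L[ℂ] T, (∀ y, Commute P (A.K k y)) ∧ v = P ψ}
      zero_mem' := ⟨0, fun y => Commute.zero_left _, by simp⟩
      add_mem' := by
        rintro _ _ ⟨P, hP, rfl⟩ ⟨Q, hQ, rfl⟩
        exact ⟨P + Q, fun y => (hP y).add_left (hQ y), rfl⟩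
      smul_mem' := by
        rintro c _ ⟨P, hP, rfl⟩
        exact ⟨c • P, fun y => (hP y).smul_left c, rfl⟩ }
  let W : Submodule ℂ T := ⨅ k, W' k
  have hW : ∀ v, v ∈ W ↔ ∀ k, ∃ P : T →L[ℂ] T, (∀ y, Commute P (A.K k y)) ∧ v = P ψ := by
    intro v
    exact Submodule.mem_iInf _
  have hψW : ψ ∈ W := (hW ψ).2 fun k => ⟨1, fun y => Commute.one_left _, rfl⟩
  have hKW : ∀ l x, ∀ v ∈ W, A.K l x v ∈ W := by
    intro l x v hv
    rw [hW] at hv ⊢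
    intro k
    obtain ⟨P, hP, rfl⟩ := hv k
    by_cases hlk : l = k
    · subst hlk
      -- An observable of the party itself is moved to the right onto `ψ` and exchanged for `Q`, so
      -- that `K (Pψ) = PQψ` again has the required form.
      obtain ⟨Q, hQ, hQψ⟩ := hswap l x
      refine ⟨P * Q, fun y => (hP y).mul_left (hQ y), ?_⟩
      rw [mul_apply_eq_comp, ← hQψ]
      exact (DFunLike.congr_fun (hP x).eq ψ).symm
    · exact ⟨A.K l x * P, fun y => (A.K_commute hlk x y).mul_left (hP y), rfl⟩
  have hrel : ∀ k, ∀ v ∈ W, (∀ x, A.K k x (A.K k x v) = v) ∧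
      A.K k 0 (A.K k 1 v) + A.K k 1 (A.K k 0 v) = (2 * κ k) • v := by
    intro k v hv
    obtain ⟨P, hP, rfl⟩ := (hW v).1 hv k
    have hc : ∀ y w, A.K k y (P w) = P (A.K k y w) := fun y w =>
      (DFunLike.congr_fun (hP y).eq w).symm
    refine ⟨fun x => by rw [hc, hc, hsq'], ?_⟩
    rw [hc, hc, hc, hc, ← map_add, hanti', map_smul]
  let kW : ι → Fin 2 → Module.End ℂ W := fun k x =>
    (A.K k x : T →ₗ[ℂ] T).restrict (hKW k x)
  have hkW : ∀ k x (w : W), ((kW k x w : W) : T) = A.K k x w := fun k x w => rfl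
  have h1 : ∀ k, ∃ ρ : QMat →ₐ[ℂ] Module.End ℂ W, ρ (Kb k 0) = kW k 0 ∧ ρ (Kb k 1) = kW k 1 := by
    intro k
    refine exists_algHom_of_reflections (hsq k 0) (hsq k 1) (hanti k) (hirr k) ?_ ?_ ?_
    · ext w
      exact (hrel k w w.2).1 0
    · ext w
      exact (hrel k w w.2).1 1
    · ext w
      exact (hrel k w w.2).2
  choose ρ hρ₀ hρ₁ using h1
  have hρ : ∀ k x, ρ k (Kb k x) = kW k x := by
    intro k x
    have hx : x = 0 ∨ x = 1 := by fin_cases x <;> simp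
    rcases hx with rfl | rfl
    · exact hρ₀ k
    · exact hρ₁ k
  have hρc : ∀ i j, i ≠ j → ∀ M N, Commute (ρ i M) (ρ j N) := by
    intro i j hij M N
    have hk : ∀ x y, Commute (kW i x) (kW j y) := by
      intro x y
      ext w
      exact DFunLike.congr_fun (A.K_commute hij x y).eq (w : T)
    have hM : M ∈ Algebra.adjoin ℂ {Kb i 0, Kb i 1} := by rw [hirr]; trivial
    have hN : N ∈ Algebra.adjoin ℂ {Kb j 0, Kb j 1} := by rw [hirr]; trivial
    have step : ∀ x, Commute (kW i x) (ρ j N) := by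
      intro x
      induction hN using Algebra.adjoin_induction with
      | mem N hN =>
        rcases hN with rfl | rfl
        · rw [hρ]; exact hk _ _
        · rw [hρ]; exact hk _ _
      | algebraMap c => rw [AlgHom.commutes]; exact Algebra.commutes' c _ |>.symm
      | add _ _ _ _ h h' => rw [map_add]; exact h.add_right h'
      | mul _ _ _ _ h h' => rw [map_mul]; exact h.mul_right h'
    induction hM using Algebra.adjoin_induction with
    | mem M hM =>
      rcases hM with rfl | rfl
      · rw [hρ]; exact step _
      · rw [hρ]; exact step _
    | algebraMap c => rw [AlgHom.commutes]; exact Algebra.commutes' c _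
    | add _ _ _ _ h h' => rw [map_add]; exact h.add_left h'
    | mul _ _ _ _ h h' => rw [map_mul]; exact h.mul_left h'
  obtain ⟨τ, hτ⟩ := exists_tensorHom ρ hρc
  have hτop : ∀ k a x (w : W),
      ((τ (localMatrix k (dichotomicMeas Kb k a x)) w : W) : T) = A.op k a x w := by
    intro k a x w
    rw [hτ, A.op_eq, dichotomicMeas, map_smul, map_add, map_smul, hρ, map_one]
    simp [hkW]
  have hirr' := tensorPolynomials_eq_top fun k => adjoin_dichotomicMeas (hirr k)
  -- The representation `τ` respects adjoints, because it does so on the hermitian generators. This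
  -- is what makes `J` isometric.
  have hadj : ∀ (M : Matrix (ι → Fin 2) (ι → Fin 2) ℂ) (v w : W),
      inner ℂ (τ M v) w = inner ℂ v (τ Mᴴ w) := by
    intro M
    have hM : M ∈ tensorPolynomials (dichotomicMeas Kb) := by rw [hirr']; trivial
    induction hM using Algebra.adjoin_induction with
    | mem M hM =>
      obtain ⟨k, a, x, rfl⟩ := hM
      intro v w
      rw [localMatrix_conjTranspose, (dichotomicMeas_isHermitian hherm k a x).eq,
        Submodule.coe_inner, Submodule.coe_inner, hτop, hτop]
      exact (A.isPositive k a x).inner_left_eq_inner_right _ _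
    | algebraMap c =>
      intro v w
      have h2 : (algebraMap ℂ (Matrix (ι → Fin 2) (ι → Fin 2) ℂ) c)ᴴ = algebraMap ℂ _ (star c) := by
        rw [algebraMap_star_comm, Matrix.star_eq_conjTranspose]
      rw [h2, AlgHom.commutes, AlgHom.commutes]
      simp [Algebra.algebraMap_eq_smul_one, mul_comm]
    | add M N _ _ hM hN =>
      intro v w
      rw [Matrix.conjTranspose_add, map_add, map_add, LinearMap.add_apply, LinearMap.add_apply,
        inner_add_left, inner_add_right, hM, hN]
    | mul M N _ _ hM hN =>
      intro v w
      rw [Matrix.conjTranspose_mul, map_mul, map_mul, Module.End.mul_apply, Module.End.mul_apply,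
        hM, hN]
  let ψW : W := ⟨ψ, hψW⟩
  have hbell : ∀ (B : BellFunctional ι), bell A.op B ψ = ψ →
      τ (bellMatrix (dichotomicMeas Kb) B) ψW = ψW := by
    intro B hB
    let S : Subalgebra ℂ (Matrix (ι → Fin 2) (ι → Fin 2) ℂ × (T →L[ℂ] T)) :=
      { carrier := {p | ∀ w : W, ((τ p.1 w : W) : T) = p.2 w}
        mul_mem' := fun {p q} hp hq w => by
          rw [Prod.fst_mul, map_mul, Module.End.mul_apply, hp, hq, Prod.snd_mul, mul_apply_eq_comp]
        add_mem' := fun {p q} hp hq w => by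
          rw [Prod.fst_add, map_add, LinearMap.add_apply, Submodule.coe_add, hp, hq, Prod.snd_add,
            add_apply]
        algebraMap_mem' := fun c w => by
          rw [Prod.algebraMap_apply, AlgHom.commutes]
          simp [Algebra.algebraMap_eq_smul_one] }
    have hmem : (bell (fun k a x => localMatrix k (dichotomicMeas Kb k a x)) B, bell A.op B) ∈ S :=
      bell_prodMk_mem (S := S) (fun k a x w => hτop k a x w) B
    rw [bellMatrix_eq_bell]
    refine Subtype.ext ?_
    rw [hmem ψW]
    exact hB
  -- the components of `ψ` in the multiplicity space
  let η : (ι → Fin 2) → W := fun j => τ (Matrix.single 0 j 1) ψW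
  let η₀ : W := ∑ l, star (ψ' l) • η l
  have hη : ∀ j, η j = ψ' j • η₀ := by
    intro j
    refine ext_inner_left ℂ fun ξ => ?_
    -- As `η j` is `|0⟩⟨j|` applied to `ψ`, a Bell operator that fixes `ψ` has a matrix fixing the
    -- vector of components `⟨ξ, η j⟩`. By `hfix` this vector is a multiple of `ψ'`: under `τ`, `ψ`
    -- is the product of `ψ'` with one multiplicity vector `η₀`.
    have hv : ∀ B : BellFunctional ι, bell A.op B ψ = ψ →
        bellMatrix (dichotomicMeas Kb) B *ᵥ (fun j => inner ℂ ξ (η j))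
          = fun j => inner ℂ ξ (η j) := by
      intro B hB
      ext i
      have hN : ∑ j, bellMatrix (dichotomicMeas Kb) B i j • Matrix.single (0 : ι → Fin 2) j (1 : ℂ)
          = Matrix.single 0 i 1 * bellMatrix (dichotomicMeas Kb) B := by
        ext p q
        rw [Matrix.sum_apply]
        by_cases hp : p = 0
        · subst hp
          simp [Matrix.single_apply]
        · simp [Ne.symm hp, Matrix.mul_apply]
      calc (bellMatrix (dichotomicMeas Kb) B *ᵥ fun j => inner ℂ ξ (η j)) i
          = inner ℂ ξ (τ (∑ j, bellMatrix (dichotomicMeas Kb) B i j •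
              Matrix.single (0 : ι → Fin 2) j (1 : ℂ)) ψW) := by
            rw [map_sum, LinearMap.sum_apply, inner_sum]
            simp only [Matrix.mulVec, dotProduct, η, map_smul, LinearMap.smul_apply, inner_smul_right]
        _ = inner ℂ ξ (η i) := by
            rw [hN, map_mul, Module.End.mul_apply, hbell B hB]
    obtain ⟨c, hc⟩ := hfix _ hv
    have hc' : ∀ j, inner ℂ ξ (η j) = c * ψ' j := fun j => congrFun hc j
    have h0 : inner ℂ ξ η₀ = c := by
      simp only [η₀, inner_sum, inner_smul_right, hc']
      calc ∑ l, star (ψ' l) * (c * ψ' l) = c * (star ψ' ⬝ᵥ ψ') := by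
            rw [dotProduct, Finset.mul_sum]
            refine Finset.sum_congr rfl fun l _ => ?_
            simp only [Pi.star_apply]
            ring
        _ = c := by rw [hψ', mul_one]
    rw [inner_smul_right, h0, hc', mul_comm]
  -- Resolving the identity into `|j⟩⟨0| |0⟩⟨j|` and using `η j = ψ' j • η₀` shows that the
  -- projector onto the reference state fixes `ψ`.
  have hproj : τ (Matrix.vecMulVec ψ' (star ψ')) ψW = ψW := by
    have e1 : Matrix.vecMulVec ψ' (star ψ') = (∑ j, ψ' j • Matrix.single j (0 : ι → Fin 2) (1 : ℂ)) *
        ∑ l, star (ψ' l) • Matrix.single (0 : ι → Fin 2) l (1 : ℂ) := by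
      rw [Finset.sum_mul_sum, Matrix.matrix_eq_sum_single (Matrix.vecMulVec ψ' (star ψ'))]
      refine Finset.sum_congr rfl fun i _ => Finset.sum_congr rfl fun j _ => ?_
      simp [Matrix.vecMulVec_apply, Matrix.smul_single]
    have e2 : (1 : Matrix (ι → Fin 2) (ι → Fin 2) ℂ)
        = ∑ j, Matrix.single j (0 : ι → Fin 2) (1 : ℂ) * Matrix.single (0 : ι → Fin 2) j (1 : ℂ) := by
      simp only [Matrix.single_mul_single_same, mul_one]
      ext p q
      rw [Matrix.sum_apply]
      simp [Matrix.single_apply, Matrix.one_apply, ite_and]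
    have e3 : ψW = ∑ j, ψ' j • τ (Matrix.single j (0 : ι → Fin 2) (1 : ℂ)) η₀ := by
      calc ψW = τ 1 ψW := by simp
        _ = _ := by
          rw [e2, map_sum, LinearMap.sum_apply]
          refine Finset.sum_congr rfl fun j _ => ?_
          rw [map_mul, Module.End.mul_apply]
          change τ _ (η j) = _
          rw [hη, map_smul]
    conv_rhs => rw [e3]
    rw [e1, map_mul, Module.End.mul_apply, map_sum, map_sum, LinearMap.sum_apply]
    refine Finset.sum_congr rfl fun j _ => ?_
    rw [map_smul, LinearMap.smul_apply]
    congr 2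
    rw [LinearMap.sum_apply]
    refine Finset.sum_congr rfl fun l _ => ?_
    rw [map_smul, LinearMap.smul_apply]
  -- The embedding replaces the reference state by an arbitrary `φ`: it applies `|φ⟩⟨ψ'|` to `ψ`.
  let J : ((ι → Fin 2) → ℂ) →ₗ[ℂ] T :=
    { toFun := fun φ => (τ (Matrix.vecMulVec φ (star ψ')) ψW : W)
      map_add' := fun φ φ' => by
        rw [Matrix.add_vecMulVec, map_add, LinearMap.add_apply, Submodule.coe_add]
      map_smul' := fun c φ => by
        rw [Matrix.smul_vecMulVec, map_smul, LinearMap.smul_apply, Submodule.coe_smul,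
          RingHom.id_apply] }
  refine ⟨J, ⟨fun v w => ?_, fun k a x v => ?_⟩, ?_⟩
  · change inner ℂ ((τ (Matrix.vecMulVec v (star ψ')) ψW : W) : T)
      ((τ (Matrix.vecMulVec w (star ψ')) ψW : W) : T) = _
    rw [← Submodule.coe_inner, hadj, ← Module.End.mul_apply, ← map_mul,
      Matrix.conjTranspose_vecMulVec, star_star, Matrix.vecMulVec_mul_vecMulVec]
    rw [Matrix.vecMulVec_smul, map_smul, LinearMap.smul_apply, hproj, inner_smul_right,
      Submodule.coe_inner, inner_self_eq_norm_sq_to_K, hψ]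
    simp
  · change A.op k a x ((τ (Matrix.vecMulVec v (star ψ')) ψW : W) : T) = _
    rw [← hτop, ← Module.End.mul_apply, ← map_mul, Matrix.mul_vecMulVec]
    rfl
  · change ((τ (Matrix.vecMulVec ψ' (star ψ')) ψW : W) : T) = ψ
    rw [hproj]

end Criterion

/-! ### Complexes of dichotomic functionals -/

/-- The projectors `(1 ± σ₃)/2` are the diagonal matrix units; placed on both sides of `N` they
isolate its off-diagonal entries. -/
theorem eq_top_of_sigma_three_mem {S : Subalgebra ℂ QMat} (h : σ₃ ∈ S) {N : QMat} (hN : N ∈ S)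
    (h₀₁ : N 0 1 ≠ 0) (h₁₀ : N 1 0 ≠ 0) : S = ⊤ := by
  have e₀ : Matrix.single 0 0 (1 : ℂ) ∈ S := by
    have : Matrix.single 0 0 (1 : ℂ) = (2⁻¹ : ℂ) • (1 + σ₃) := by
      ext i j
      fin_cases i <;> fin_cases j <;> (simp [σ₃]; try norm_num)
    rw [this]
    exact S.smul_mem (add_mem (one_mem _) h) _
  have e₁ : Matrix.single 1 1 (1 : ℂ) ∈ S := by
    have : Matrix.single 1 1 (1 : ℂ) = (2⁻¹ : ℂ) • (1 - σ₃) := by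
      ext i j
      fin_cases i <;> fin_cases j <;> (simp [σ₃]; try norm_num)
    rw [this]
    exact S.smul_mem (sub_mem (one_mem _) h) _
  have e₀₁ : Matrix.single 0 1 (1 : ℂ) ∈ S := by
    have : Matrix.single 0 1 (1 : ℂ)
        = (N 0 1)⁻¹ • (Matrix.single 0 0 (1 : ℂ) * N * Matrix.single 1 1 (1 : ℂ)) := by
      ext i j
      fin_cases i <;> fin_cases j <;> simp [h₀₁]
    rw [this]
    exact S.smul_mem (mul_mem (mul_mem e₀ hN) e₁) _
  have e₁₀ : Matrix.single 1 0 (1 : ℂ) ∈ S := by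
    have : Matrix.single 1 0 (1 : ℂ)
        = (N 1 0)⁻¹ • (Matrix.single 1 1 (1 : ℂ) * N * Matrix.single 0 0 (1 : ℂ)) := by
      ext i j
      fin_cases i <;> fin_cases j <;> simp [h₁₀]
    rw [this]
    exact S.smul_mem (mul_mem (mul_mem e₁ hN) e₀) _
  refine eq_top_iff.2 fun M _ => ?_
  have : M = M 0 0 • Matrix.single 0 0 (1 : ℂ) + M 0 1 • Matrix.single 0 1 (1 : ℂ)
      + M 1 0 • Matrix.single 1 0 (1 : ℂ) + M 1 1 • Matrix.single 1 1 (1 : ℂ) := by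
    ext i j
    fin_cases i <;> fin_cases j <;> simp
  rw [this]
  exact add_mem (add_mem (add_mem (S.smul_mem e₀ _) (S.smul_mem e₀₁ _)) (S.smul_mem e₁₀ _))
    (S.smul_mem e₁ _)

section Dichotomic

variable {ι : Type} [Fintype ι] [DecidableEq ι]

theorem dichotomicMeas_idempotent {Kb : ι → Fin 2 → QMat} (h : ∀ k x, Kb k x * Kb k x = 1)
    (k : ι) (a x : Fin 2) :
    dichotomicMeas Kb k a x * dichotomicMeas Kb k a x = dichotomicMeas Kb k a x := by
  have ha : a = 0 ∨ a = 1 := by fin_cases a <;> simp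
  rcases ha with rfl | rfl
  · simp only [dichotomicMeas, Fin.val_zero, pow_zero, smul_mul_smul_comm, mul_add, add_mul, one_mul,
      mul_one, h, one_smul]
    module
  · simp only [dichotomicMeas, Fin.val_one, pow_one, mul_add, add_mul, one_mul,
      mul_one, h, smul_mul_assoc, mul_smul_comm]
    module

theorem sum_dichotomicMeas (Kb : ι → Fin 2 → QMat) (k : ι) (x : Fin 2) :
    ∑ a, dichotomicMeas Kb k a x = 1 := by
  simp only [Fin.sum_univ_two, dichotomicMeas, Fin.val_zero, Fin.val_one, pow_zero, pow_one]
  module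

theorem bell_dichotomicConnector {R : Type*} [Ring R] [Algebra ℂ R] {op : ι → Fin 2 → Fin 2 → R}
    (hop : Commuting op) (hsum : ∀ k x, ∑ a, op k a x = 1) (B₀ B₁ : BellFunctional ι)
    (b y : Fin 2) : bell op (dichotomicConnector B₀ B₁ b y)
      = (2⁻¹ : ℂ) • (1 + ((-1) ^ (b : ℕ) : ℂ) • bell op (![B₀, B₁] y)) := by
  have h1 : dichotomicConnector B₀ B₁ b y
      = (2⁻¹ : ℝ) • (correlator (fun _ => none) + ((-1) ^ (b : ℕ) : ℝ) • ![B₀, B₁] y) := by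
    ext a x
    simp only [dichotomicConnector, Pi.smul_apply, Pi.add_apply, smul_eq_mul]
    ring
  have h2 : bell op (correlator fun _ => none) = 1 := by
    rw [bell_correlator hop hsum]
    exact commProd_one
  rw [h1, bell_smul, bell_add, bell_smul, h2]
  push_cast
  rfl

theorem sum_localMatrix {meas : ι → Fin 2 → Fin 2 → QMat} (h : ∀ k x, ∑ a, meas k a x = 1) (k : ι)
    (x : Fin 2) : ∑ a, localMatrix k (meas k a x) = 1 := by
  rw [Fin.sum_univ_two, ← localMatrix_add, ← Fin.sum_univ_two (fun a => meas k a x), h,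
    localMatrix_one]

/-- The output observables of a dichotomic complex in the basis `φ₊, φ₋`. -/
def outObs (a : ℝ) (b : ℂ) : Fin 2 → QMat := ![!![(a : ℂ), star b; b, -(a : ℂ)], σ₃]

/-- In the basis `φ₊, φ₋` the output observables are `σ₃` for `B₁` and `!![a, b*; b, -a]` for `B₀`.
The relation `hab` makes the latter a reflection, and `b ≠ 0` makes the pair irreducible. What
remains specific to a complex is normalization and the embedding of maximizers of `B₁`. -/
theorem pauliComplex_isRigid {B₀ B₁ : BellFunctional ι} {Kb : ι → Fin 2 → QMat}
    {φp φm : (ι → Fin 2) → ℂ} (hherm : ∀ k x, (Kb k x).IsHermitian)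
    (hsq : ∀ k x, Kb k x * Kb k x = 1) (hirr : ∀ k, Algebra.adjoin ℂ {Kb k 0, Kb k 1} = ⊤)
    (hpp : star φp ⬝ᵥ φp = 1) (hmm : star φm ⬝ᵥ φm = 1) (hpm : star φp ⬝ᵥ φm = 0)
    (h1p : bellMatrix (dichotomicMeas Kb) B₁ *ᵥ φp = φp)
    (h1m : bellMatrix (dichotomicMeas Kb) B₁ *ᵥ φm = -φm)
    (a : ℝ) (b : ℂ) (hb : b ≠ 0) (hab : (a : ℂ) ^ 2 + b * star b = 1)
    (h0p : bellMatrix (dichotomicMeas Kb) B₀ *ᵥ φp = (a : ℂ) • φp + b • φm)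
    (h0m : bellMatrix (dichotomicMeas Kb) B₀ *ᵥ φm = star b • φp - (a : ℂ) • φm)
    (hnorm : ∀ (T : Type u) [NormedAddCommGroup T] [InnerProductSpace ℂ T] [CompleteSpace T]
      (A : CommSystem ι T) (y : Fin 2), (1 - bell A.op (![B₀, B₁] y)).IsPositive ∧
        (1 + bell A.op (![B₀, B₁] y)).IsPositive)
    (hrigid : ∀ (T : Type u) [NormedAddCommGroup T] [InnerProductSpace ℂ T] [CompleteSpace T]
      (A : CommSystem ι T) (ψ : T), ‖ψ‖ = 1 → bell A.op B₁ ψ = ψ →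
      ∃ J, QubitComplex.Embeds (dichotomicMeas Kb) A J ∧ J φp = ψ) :
    QubitComplex.IsRigid.{u} (pauliComplex B₀ B₁ Kb φp φm) ![1, 0] := by
  set C := pauliComplex B₀ B₁ Kb φp φm with hC
  have hV : C.Vᴴ = Matrix.of fun i (o : Fin 2) => (![φp, φm] o) i := by
    ext i o
    fin_cases o <;> simp [hC, pauliComplex, Matrix.conjTranspose_apply]
  have hVV : C.V * C.Vᴴ = 1 := by
    have hmp : star φm ⬝ᵥ φp = 0 := by
      rw [Matrix.star_dotProduct, hpm, star_zero]
    rw [hV]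
    ext i j
    have : (C.V * Matrix.of fun i (o : Fin 2) => (![φp, φm] o) i) i j
        = star (![φp, φm] i) ⬝ᵥ ![φp, φm] j := by
      fin_cases i <;> rfl
    rw [this]
    fin_cases i <;> fin_cases j <;> simp [hpp, hmm, hpm, hmp]
  have hB : ∀ y, bellMatrix C.meas (![B₀, B₁] y) * C.Vᴴ = C.Vᴴ * outObs a b y := by
    intro y
    have hy : y = 0 ∨ y = 1 := by fin_cases y <;> simp
    rw [hV]
    ext i o
    have e1 : (bellMatrix C.meas (![B₀, B₁] y) * Matrix.of fun i (o : Fin 2) => (![φp, φm] o) i) i o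
        = (bellMatrix (dichotomicMeas Kb) (![B₀, B₁] y) *ᵥ (![φp, φm] o)) i := rfl
    rw [e1, Matrix.mul_apply, Fin.sum_univ_two]
    rcases hy with rfl | rfl
    · fin_cases o
      · simp [h0p, outObs, mul_comm]
      · simp [h0m, outObs, mul_comm, sub_eq_add_neg]
    · fin_cases o
      · simp [h1p, outObs, σ₃]
      · simp [h1m, outObs, σ₃]
  have hmeas : ∀ k x, ∑ a, C.meas k a x = 1 := fun k x => sum_dichotomicMeas Kb k x
  have hconn : ∀ b y, bellMatrix C.meas (C.conn b y)
      = (2⁻¹ : ℂ) • (1 + ((-1) ^ (b : ℕ) : ℂ) • bellMatrix C.meas (![B₀, B₁] y)) := by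
    intro b y
    rw [bellMatrix_eq_bell, bellMatrix_eq_bell]
    exact bell_dichotomicConnector (commuting_localMatrix _) (sum_localMatrix hmeas) B₀ B₁ b y
  let E : Fin 2 → Fin 2 → QMat := fun b' y => dichotomicMeas (fun _ : Unit => outObs a b) () b' y
  have hE : ∀ b' y, bellMatrix C.meas (C.conn b' y) * C.Vᴴ = C.Vᴴ * E b' y := by
    intro b' y
    rw [hconn]
    simp only [E, dichotomicMeas, Matrix.smul_mul, Matrix.add_mul, Matrix.one_mul, hB, Matrix.mul_smul,
      Matrix.mul_add, Matrix.mul_one]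
  have hout : ∀ b' y, C.outMeas b' y = E b' y := by
    intro b' y
    rw [QubitComplex.outMeas, Matrix.mul_assoc, hE, ← Matrix.mul_assoc, hVV, Matrix.one_mul]
  have hoh : ∀ (k : Unit) y, (outObs a b y).IsHermitian := by
    intro _ y
    have hy : y = 0 ∨ y = 1 := by fin_cases y <;> simp
    rcases hy with rfl | rfl <;> ext i j <;> fin_cases i <;> fin_cases j <;> simp [outObs, σ₃]
  have hos : ∀ (k : Unit) y, outObs a b y * outObs a b y = 1 := by
    intro _ y
    have hy : y = 0 ∨ y = 1 := by fin_cases y <;> simp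
    have hab' : (a : ℂ) * a + b * star b = 1 := by rw [← hab, sq]
    simp only [RCLike.star_def] at hab'
    rcases hy with rfl | rfl <;> ext i j <;> fin_cases i <;> fin_cases j <;>
      simp [outObs, σ₃, Matrix.mul_apply, Fin.sum_univ_two] <;>
      first | ring1 | linear_combination hab'
  refine
    { meas_hermitian := dichotomicMeas_isHermitian hherm
      meas_idempotent := dichotomicMeas_idempotent hsq
      sum_meas := hmeas
      meas_irreducible := fun k => adjoin_dichotomicMeas (hirr k)
      coisometry := hVV
      unit_vector := by simp [dotProduct, Fin.sum_univ_two]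
      out_hermitian := fun b' y => by
        rw [hout]; exact dichotomicMeas_isHermitian (Kb := fun _ : Unit => outObs a b) hoh () b' y
      out_idempotent := fun b' y => by
        rw [hout]; exact dichotomicMeas_idempotent (Kb := fun _ : Unit => outObs a b) hos () b' y
      sum_out := fun y => by
        simp only [hout]; exact sum_dichotomicMeas (fun _ : Unit => outObs a b) () y
      out_irreducible := ?_
      invariant := fun b' y => by rw [hout, hE]
      value := ?_
      conn_isPositive := ?_
      sum_conn := ?_
      rigid := ?_ }
  · simp only [hout]
    refine adjoin_dichotomicMeas (Kb := fun _ : Unit => outObs a b) (k := ()) ?_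
    have h3 : σ₃ ∈ Algebra.adjoin ℂ {outObs a b 0, outObs a b 1} :=
      Algebra.subset_adjoin (Or.inr rfl)
    refine eq_top_of_sigma_three_mem h3 (Algebra.subset_adjoin (Or.inl rfl)) ?_ ?_
    · simpa [outObs] using hb
    · simpa [outObs] using hb
  · rw [hout]
    ext i
    fin_cases i <;> simp [E, dichotomicMeas, outObs, σ₃, Matrix.mulVec, dotProduct,
      Fin.sum_univ_two] <;> norm_num
  · intro T _ _ _ A b' y
    change (bell A.op (dichotomicConnector B₀ B₁ b' y)).IsPositive
    rw [bell_dichotomicConnector A.comm A.sum_op]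
    have h2 : (0 : ℂ) ≤ 2⁻¹ := by simp
    have hb' : b' = 0 ∨ b' = 1 := by fin_cases b' <;> simp
    rcases hb' with rfl | rfl
    · simpa using (hnorm T A y).2.smul_of_nonneg h2
    · simpa [sub_eq_add_neg] using (hnorm T A y).1.smul_of_nonneg h2
  · intro T _ _ _ A y
    change ∑ b', bell A.op (dichotomicConnector B₀ B₁ b' y) = 1
    simp only [bell_dichotomicConnector A.comm A.sum_op, Fin.sum_univ_two, Fin.val_zero, Fin.val_one,
      pow_zero, pow_one]
    module
  · intro T _ _ _ A ψ hψ h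
    have hα : C.Vᴴ *ᵥ ![1, 0] = φp := by
      rw [hV]
      ext i
      simp [Matrix.mulVec, dotProduct]
    rw [hα]
    refine hrigid T A ψ hψ ?_
    change bell A.op (dichotomicConnector B₀ B₁ 0 1) ψ = ψ at h
    rw [bell_dichotomicConnector A.comm A.sum_op] at h
    have h2 : bell A.op B₁ ψ = (2 : ℂ) • ((2⁻¹ : ℂ) • (ψ + bell A.op B₁ ψ)) - ψ := by module
    rw [h2]
    have h3 : (2⁻¹ : ℂ) • (ψ + bell A.op B₁ ψ) = ψ := by simpa using h
    rw [h3]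
    module

end Dichotomic

/-! ### Observables -/

section Observables

variable {T : Type u} [NormedAddCommGroup T] [InnerProductSpace ℂ T] [CompleteSpace T]

/-- A self-adjoint contraction. -/
structure IsObservable (K : T →L[ℂ] T) : Prop where
  isSelfAdjoint : IsSelfAdjoint K
  nonneg : 0 ≤ 1 - K * K

theorem IsObservable.symm {K : T →L[ℂ] T} (h : IsObservable K) (v w : T) :
    inner ℂ (K v) w = inner ℂ v (K w) := h.isSelfAdjoint.isSymmetric v w

theorem IsObservable.neg {K : T →L[ℂ] T} (h : IsObservable K) : IsObservable (-K) :=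
  ⟨h.isSelfAdjoint.neg, by simpa using h.nonneg⟩

theorem IsObservable.one : IsObservable (1 : T →L[ℂ] T) := ⟨.one _, by simp⟩

/-- The contraction property follows from `1 - (KL)² = (1 - K²) + K(1 - L²)K`. -/
theorem IsObservable.mul {K L : T →L[ℂ] T} (hK : IsObservable K) (hL : IsObservable L)
    (h : Commute K L) : IsObservable (K * L) := by
  refine ⟨(hK.isSelfAdjoint.commute_iff hL.isSelfAdjoint).1 h, ?_⟩
  have e : 1 - K * L * (K * L) = (1 - K * K) + star K * (1 - L * L) * K := by
    rw [hK.isSelfAdjoint.star_eq]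
    have h1 : K * L * (K * L) = K * (L * L) * K := by
      rw [mul_assoc, mul_assoc, mul_assoc, h.eq]
    rw [h1]
    noncomm_ring
  rw [e]
  exact add_nonneg hK.nonneg (star_left_conjugate_nonneg hL.nonneg K)

theorem IsObservable.norm_le {K : T →L[ℂ] T} (h : IsObservable K) (v : T) : ‖K v‖ ≤ ‖v‖ := by
  have h1 := ((ContinuousLinearMap.nonneg_iff_isPositive _).1 h.nonneg).re_inner_nonneg_left v
  rw [sub_apply, mul_apply_eq_comp, inner_sub_left, h.symm] at h1
  simp only [one_apply_eq_self, inner_self_eq_norm_sq_to_K, map_sub] at h1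
  norm_cast at h1
  exact le_of_sq_le_sq (by linarith) (norm_nonneg v)

/-- By symmetry `‖K²v - v‖² = ‖K²v‖² - 2‖Kv‖² + ‖v‖²`, which is at most `0` if `K` preserves the
norm of `v`. Saturated bounds thus make observables act as reflections. -/
theorem IsObservable.apply_apply {K : T →L[ℂ] T} (h : IsObservable K) {v : T} (hv : ‖K v‖ = ‖v‖) :
    K (K v) = v := by
  have h1 : ‖K (K v) - v‖ ^ 2 ≤ 0 := by
    rw [@norm_sub_sq ℂ, h.symm, inner_self_eq_norm_sq, hv]
    have := h.norm_le (K v)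
    rw [hv] at this
    nlinarith [norm_nonneg (K (K v)), norm_nonneg v]
  exact sub_eq_zero.1 (norm_eq_zero.1 (pow_eq_zero_iff two_ne_zero |>.1 (le_antisymm h1 (sq_nonneg _))))

/-- For a dichotomic POVM `1 - K² = 4 A₊A₋`, a product of commuting positive operators. -/
theorem CommSystem.isObservable {ι : Type} (A : CommSystem ι T) (k : ι) (x : Fin 2) :
    IsObservable (A.K k x) := by
  have h := A.sum_op k x
  rw [Fin.sum_univ_two] at h
  have h0 := (ContinuousLinearMap.nonneg_iff_isPositive _).2 (A.isPositive k 0 x)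
  have h1 := (ContinuousLinearMap.nonneg_iff_isPositive _).2 (A.isPositive k 1 x)
  refine ⟨(A.isPositive k 0 x).isSelfAdjoint.sub (A.isPositive k 1 x).isSelfAdjoint, ?_⟩
  have hc : A.op k 1 x = 1 - A.op k 0 x := by rw [← h]; abel
  have hcomm : Commute (A.op k 0 x) (A.op k 1 x) := by
    rw [hc]
    exact (Commute.one_right _).sub_right (Commute.refl _)
  have e : 1 - A.K k x * A.K k x = (4 : ℕ) • (A.op k 0 x * A.op k 1 x) := by
    rw [CommSystem.K, hc]
    noncomm_ring
  rw [e]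
  exact nsmul_nonneg (hcomm.mul_nonneg h0 h1) 4

theorem isPositive_of_norm_le {B : T →L[ℂ] T} (hB : IsSelfAdjoint B) (h : ∀ v, ‖B v‖ ≤ ‖v‖) :
    (1 - B).IsPositive ∧ (1 + B).IsPositive := by
  have h1 : ∀ v, |RCLike.re (inner ℂ (B v) v)| ≤ ‖v‖ ^ 2 := fun v =>
    (RCLike.abs_re_le_norm _).trans ((norm_inner_le_norm _ _).trans (by
      rw [sq]; exact mul_le_mul_of_nonneg_right (h v) (norm_nonneg v)))
  constructor
  · refine ContinuousLinearMap.isPositive_def'.2 ⟨(IsSelfAdjoint.one _).sub hB, fun v => ?_⟩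
    rw [ContinuousLinearMap.reApplyInnerSelf_apply, sub_apply, inner_sub_left, map_sub,
      one_apply_eq_self, inner_self_eq_norm_sq]
    linarith [(abs_le.1 (h1 v)).2]
  · refine ContinuousLinearMap.isPositive_def'.2 ⟨(IsSelfAdjoint.one _).add hB, fun v => ?_⟩
    rw [ContinuousLinearMap.reApplyInnerSelf_apply, add_apply, inner_add_left, map_add,
      one_apply_eq_self, inner_self_eq_norm_sq]
    linarith [(abs_le.1 (h1 v)).1]

theorem apply_eq_zero_of_nonneg {P : T →L[ℂ] T} (hP : 0 ≤ P) {v : T}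
    (h : RCLike.re (inner ℂ (P v) v) ≤ 0) : P v = 0 := by
  obtain ⟨Y, rfl⟩ := CStarAlgebra.nonneg_iff_eq_star_mul_self.1 hP
  rw [mul_apply_eq_comp, ContinuousLinearMap.star_eq_adjoint,
    ContinuousLinearMap.adjoint_inner_left, inner_self_eq_norm_sq] at h
  have h0 : Y v = 0 :=
    norm_eq_zero.1 (pow_eq_zero_iff two_ne_zero |>.1 (le_antisymm h (sq_nonneg _)))
  rw [mul_apply_eq_comp, h0, map_zero]

theorem re_inner_nonneg {P : T →L[ℂ] T} (hP : 0 ≤ P) (v : T) : 0 ≤ RCLike.re (inner ℂ (P v) v) :=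
  ((ContinuousLinearMap.nonneg_iff_isPositive _).1 hP).re_inner_nonneg_left v

end Observables

/-! ### The tilted CHSH operator -/

section Tilted

variable {T : Type u} [NormedAddCommGroup T] [InnerProductSpace ℂ T] [CompleteSpace T]

theorem ofReal_smul_nonneg {c : ℝ} (hc : 0 ≤ c) {P : T →L[ℂ] T} (hP : 0 ≤ P) :
    0 ≤ (c : ℂ) • P :=
  (ContinuousLinearMap.nonneg_iff_isPositive _).2
    (((ContinuousLinearMap.nonneg_iff_isPositive _).1 hP).smul_of_nonneg
      (Complex.zero_le_real.2 hc))

theorem IsObservable.one_add_nonneg {K : T →L[ℂ] T} (h : IsObservable K) : 0 ≤ 1 + K :=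
  (ContinuousLinearMap.nonneg_iff_isPositive _).2
    (isPositive_of_norm_le h.isSelfAdjoint h.norm_le).2

/-- The tilted CHSH operator, not normalized. -/
def tiltOp (a : ℝ) (A L : Fin 2 → T →L[ℂ] T) : T →L[ℂ] T :=
  (a : ℂ) • A 0 + A 0 * L 0 + A 1 * L 0 + A 0 * L 1 - A 1 * L 1

/-- The operator that vanishes on maximizers of the tilted CHSH operator. -/
def tiltSlack (a : ℝ) (A L : Fin 2 → T →L[ℂ] T) : T →L[ℂ] T :=
  (a : ℂ) • A 1 - A 1 * (L 0 + L 1) - A 0 * (L 0 - L 1)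

/-- The local weight in the decomposition of the tilted CHSH operator into squares. -/
def tiltWeight (a : ℝ) (L : Fin 2 → T →L[ℂ] T) : T →L[ℂ] T :=
  ((a : ℂ) ^ 2 + 4) • 1 + (2 * a : ℂ) • (L 0 + L 1)

/-- For reflections the right side vanishes, so that the squares of the tilted operator and of
`tiltSlack` add up to `8 + 2a²`. For general observables each correction carries a defect `1 - A²`
or `1 - L²`, and is nonnegative for `|a| < 2`. -/
theorem tilt_sos (a : ℝ) {A L : Fin 2 → T →L[ℂ] T} (hc : ∀ x y, Commute (A x) (L y)) :
    (8 + 2 * (a : ℂ) ^ 2) • (1 : T →L[ℂ] T) - tiltOp a A L * tiltOp a A L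
        - tiltSlack a A L * tiltSlack a A L
      = (1 - A 0 * A 0) * tiltWeight a L + (1 - A 1 * A 1) * tiltWeight (-a) L
        + (2 : ℂ) • ((A 0 + A 1) * (1 - L 0 * L 0) * (A 0 + A 1))
        + (2 : ℂ) • ((A 0 - A 1) * (1 - L 1 * L 1) * (A 0 - A 1)) := by
  have c : ∀ x y, L y * A x = A x * L y := fun x y => (hc x y).eq.symm
  have c' : ∀ x y Z, L y * (A x * Z) = A x * (L y * Z) := fun x y Z => by
    rw [← mul_assoc, c, mul_assoc]
  simp only [tiltOp, tiltSlack, tiltWeight, mul_add, add_mul, mul_sub, sub_mul, smul_mul_assoc,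
    mul_smul_comm, mul_one, one_mul, mul_assoc, c, c']
  push_cast
  module

/-- As `-1 ≤ L_y ≤ 1`, the weight is at least `a² + 4 - 4|a| = (2 - |a|)²`. The strict bound is
needed to cancel the weight at a maximizer. -/
theorem exists_tiltWeight_ge {a : ℝ} (ha : |a| < 2) {L : Fin 2 → T →L[ℂ] T}
    (hL : ∀ y, IsObservable (L y)) : ∃ δ : ℝ, 0 < δ ∧ 0 ≤ tiltWeight a L - (δ : ℂ) • 1 := by
  obtain ⟨h1, h2⟩ := abs_lt.1 ha
  rcases le_total 0 a with h | h
  · refine ⟨(2 - a) ^ 2, by nlinarith, ?_⟩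
    have e : tiltWeight a L - (((2 - a) ^ 2 : ℝ) : ℂ) • 1
        = ((2 * a : ℝ) : ℂ) • ((1 + L 0) + (1 + L 1)) := by
      rw [tiltWeight]; push_cast; module
    rw [e]
    exact ofReal_smul_nonneg (by linarith) (add_nonneg (hL 0).one_add_nonneg (hL 1).one_add_nonneg)
  · refine ⟨(2 + a) ^ 2, by nlinarith, ?_⟩
    have e : tiltWeight a L - (((2 + a) ^ 2 : ℝ) : ℂ) • 1
        = ((-(2 * a) : ℝ) : ℂ) • ((1 + -L 0) + (1 + -L 1)) := by
      rw [tiltWeight]; push_cast; module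
    rw [e]
    exact ofReal_smul_nonneg (by linarith)
      (add_nonneg (hL 0).neg.one_add_nonneg (hL 1).neg.one_add_nonneg)

/-- The four terms of the decomposition into squares are nonnegative. -/
theorem tilt_terms_nonneg {a : ℝ} (ha : |a| < 2) {A L : Fin 2 → T →L[ℂ] T}
    (hA : ∀ x, IsObservable (A x)) (hL : ∀ y, IsObservable (L y))
    (hc : ∀ x y, Commute (A x) (L y)) :
    0 ≤ (1 - A 0 * A 0) * tiltWeight a L ∧ 0 ≤ (1 - A 1 * A 1) * tiltWeight (-a) L ∧
    0 ≤ (2 : ℂ) • ((A 0 + A 1) * (1 - L 0 * L 0) * (A 0 + A 1)) ∧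
    0 ≤ (2 : ℂ) • ((A 0 - A 1) * (1 - L 1 * L 1) * (A 0 - A 1)) := by
  have hw : ∀ b : ℝ, |b| < 2 → 0 ≤ tiltWeight b L := by
    intro b hb
    obtain ⟨δ, hδ, h⟩ := exists_tiltWeight_ge hb hL
    have := add_nonneg h (ofReal_smul_nonneg hδ.le (zero_le_one (α := T →L[ℂ] T)))
    simpa using this
  have hcw : ∀ x (b : ℝ), Commute (1 - A x * A x) (tiltWeight b L) := by
    intro x b
    have h1 : ∀ y, Commute (1 - A x * A x) (L y) := fun y =>
      (Commute.one_left _).sub_left ((hc x y).mul_left (hc x y))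
    exact ((Commute.one_right _).smul_right _).add_right (((h1 0).add_right (h1 1)).smul_right _)
  have h2 : ∀ P : T →L[ℂ] T, 0 ≤ P → 0 ≤ (2 : ℂ) • P := fun P hP => by
    simpa using ofReal_smul_nonneg (c := 2) (by norm_num) hP
  refine ⟨(hcw 0 a).mul_nonneg (hA 0).nonneg (hw a ha),
    (hcw 1 (-a)).mul_nonneg (hA 1).nonneg (hw _ (by rwa [abs_neg])), h2 _ ?_, h2 _ ?_⟩
  · have h := ((hA 0).isSelfAdjoint.add (hA 1).isSelfAdjoint).star_eq
    simpa [h] using star_left_conjugate_nonneg (hL 0).nonneg (A 0 + A 1)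
  · have h := ((hA 0).isSelfAdjoint.sub (hA 1).isSelfAdjoint).star_eq
    simpa [h] using star_left_conjugate_nonneg (hL 1).nonneg (A 0 - A 1)

theorem tiltOp_isSelfAdjoint (a : ℝ) {A L : Fin 2 → T →L[ℂ] T}
    (hA : ∀ x, IsObservable (A x)) (hL : ∀ y, IsObservable (L y))
    (hc : ∀ x y, Commute (A x) (L y)) : IsSelfAdjoint (tiltOp a A L) := by
  have h : ∀ x y, IsSelfAdjoint (A x * L y) := fun x y =>
    ((hA x).isSelfAdjoint.commute_iff (hL y).isSelfAdjoint).1 (hc x y)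
  have ha : IsSelfAdjoint (a : ℂ) := Complex.conj_ofReal a
  exact ((((ha.smul (hA 0).isSelfAdjoint).add (h 0 0)).add (h 1 0)).add (h 0 1)).sub (h 1 1)

theorem tiltSlack_isSelfAdjoint (a : ℝ) {A L : Fin 2 → T →L[ℂ] T}
    (hA : ∀ x, IsObservable (A x)) (hL : ∀ y, IsObservable (L y))
    (hc : ∀ x y, Commute (A x) (L y)) : IsSelfAdjoint (tiltSlack a A L) := by
  have h : ∀ x y, IsSelfAdjoint (A x * L y) := fun x y =>
    ((hA x).isSelfAdjoint.commute_iff (hL y).isSelfAdjoint).1 (hc x y)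
  have ha : IsSelfAdjoint (a : ℂ) := Complex.conj_ofReal a
  rw [tiltSlack, mul_add, mul_sub]
  exact ((ha.smul (hA 1).isSelfAdjoint).sub ((h 1 0).add (h 1 1))).sub ((h 0 0).sub (h 0 1))

theorem norm_sq_of_isSelfAdjoint {B : T →L[ℂ] T} (hB : IsSelfAdjoint B) (v : T) :
    RCLike.re (inner ℂ ((B * B) v) v) = ‖B v‖ ^ 2 := by
  have h : inner ℂ (B (B v)) v = inner ℂ (B v) (B v) := hB.isSymmetric (B v) v
  rw [mul_apply_eq_comp, h, inner_self_eq_norm_sq]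

theorem re_inner_ofReal_smul (c : ℝ) (v : T) :
    RCLike.re (inner ℂ ((c : ℂ) • v) v) = c * ‖v‖ ^ 2 := by
  rw [inner_smul_left, Complex.conj_ofReal, ← inner_self_eq_norm_sq (𝕜 := ℂ) v]
  exact Complex.re_ofReal_mul _ _

theorem tilt_sos_apply {a : ℝ} {A L : Fin 2 → T →L[ℂ] T}
    (hA : ∀ x, IsObservable (A x)) (hL : ∀ y, IsObservable (L y))
    (hc : ∀ x y, Commute (A x) (L y)) (v : T) :
    (8 + 2 * a ^ 2) * ‖v‖ ^ 2 - ‖tiltOp a A L v‖ ^ 2 - ‖tiltSlack a A L v‖ ^ 2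
      = RCLike.re (inner ℂ (((1 - A 0 * A 0) * tiltWeight a L) v) v)
        + RCLike.re (inner ℂ (((1 - A 1 * A 1) * tiltWeight (-a) L) v) v)
        + RCLike.re (inner ℂ (((2 : ℂ) • ((A 0 + A 1) * (1 - L 0 * L 0) * (A 0 + A 1))) v) v)
        + RCLike.re (inner ℂ (((2 : ℂ) • ((A 0 - A 1) * (1 - L 1 * L 1) * (A 0 - A 1))) v) v) := by
  have h := congrArg (fun B : T →L[ℂ] T => RCLike.re (inner ℂ (B v) v)) (tilt_sos a hc)
  simp only [add_apply, sub_apply, inner_add_left, inner_sub_left, map_add, map_sub] at h ⊢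
  rw [norm_sq_of_isSelfAdjoint (tiltOp_isSelfAdjoint a hA hL hc),
    norm_sq_of_isSelfAdjoint (tiltSlack_isSelfAdjoint a hA hL hc)] at h
  rw [← h]
  have e : (8 + 2 * (a : ℂ) ^ 2) = ((8 + 2 * a ^ 2 : ℝ) : ℂ) := by push_cast; rfl
  rw [e, smul_apply, one_apply_eq_self, re_inner_ofReal_smul]

theorem tiltOp_norm_le {a : ℝ} (ha : |a| < 2) {A L : Fin 2 → T →L[ℂ] T}
    (hA : ∀ x, IsObservable (A x)) (hL : ∀ y, IsObservable (L y))
    (hc : ∀ x y, Commute (A x) (L y)) (v : T) : ‖tiltOp a A L v‖ ≤ √(8 + 2 * a ^ 2) * ‖v‖ := by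
  obtain ⟨h1, h2, h3, h4⟩ := tilt_terms_nonneg ha hA hL hc
  have h := tilt_sos_apply (a := a) hA hL hc v
  have := re_inner_nonneg h1 v
  have := re_inner_nonneg h2 v
  have := re_inner_nonneg h3 v
  have := re_inner_nonneg h4 v
  refine le_of_sq_le_sq ?_ (by positivity)
  rw [mul_pow, Real.sq_sqrt (by positivity)]
  linarith [sq_nonneg ‖tiltSlack a A L v‖]

theorem apply_eq_zero_of_sub_nonneg {P : T →L[ℂ] T} {δ : ℝ} (hδ : 0 < δ)
    (hP : 0 ≤ P - (δ : ℂ) • 1) {w : T} (hw : P w = 0) : w = 0 := by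
  have h := re_inner_nonneg hP w
  rw [sub_apply, hw, smul_apply, one_apply_eq_self, inner_sub_left, inner_zero_left, map_sub,
    re_inner_ofReal_smul, map_zero] at h
  have h0 : ‖w‖ ^ 2 ≤ 0 := by nlinarith
  exact norm_eq_zero.1 (pow_eq_zero_iff two_ne_zero |>.1 (le_antisymm h0 (sq_nonneg _)))

/-- The relations that hold on a maximizer of the tilted CHSH operator. -/
structure TiltRelations (a b : ℂ) (A L : Fin 2 → T →L[ℂ] T) (ψ : T) : Prop where
  sq : ∀ x, A x (A x ψ) = ψ
  anti : A 0 (A 1 ψ) + A 1 (A 0 ψ) = 0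
  sq' : ∀ y, L y (L y ψ) = ψ
  anti' : L 0 (L 1 ψ) + L 1 (L 0 ψ) = (b ^ 2 / 4 - 2) • ψ
  apply_zero : A 0 ψ = (2 / b) • (L 0 + L 1) ψ
  apply_one : A 1 ψ = (b ^ 2 / 4 - a ^ 2)⁻¹ •
    ((b / 2) • (L 0 - L 1) ψ + (2 * a / b) • (L 0 + L 1) ((L 0 - L 1) ψ))
  apply_add : (L 0 + L 1) ψ = (b / 2) • A 0 ψ
  apply_sub : (L 0 - L 1) ψ = (b / 2) • A 1 ψ - a • A 1 (A 0 ψ)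

/-- At a maximizer the nonnegative terms of `tilt_sos` sum to zero, so each vanishes. For Bob this
only shows that `1 - L_y²` kills `(A₀ ± A₁)ψ`, not yet `ψ` itself. -/
theorem tilt_slack_eq {a : ℝ} (ha : |a| < 2) {A L : Fin 2 → T →L[ℂ] T}
    (hA : ∀ x, IsObservable (A x)) (hL : ∀ y, IsObservable (L y))
    (hc : ∀ x y, Commute (A x) (L y)) {ψ : T}
    (h : tiltOp a A L ψ = ((√(8 + 2 * a ^ 2) : ℝ) : ℂ) • ψ) :
    tiltSlack a A L ψ = 0 ∧ (∀ x, A x (A x ψ) = ψ) ∧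
    (A 0 + A 1) (L 0 (L 0 ψ)) = (A 0 + A 1) ψ ∧ (A 0 - A 1) (L 1 (L 1 ψ)) = (A 0 - A 1) ψ := by
  obtain ⟨h1, h2, h3, h4⟩ := tilt_terms_nonneg ha hA hL hc
  have hs := tilt_sos_apply (a := a) hA hL hc ψ
  have hn : ‖tiltOp a A L ψ‖ ^ 2 = (8 + 2 * a ^ 2) * ‖ψ‖ ^ 2 := by
    rw [h, norm_smul, Complex.norm_real, Real.norm_of_nonneg (Real.sqrt_nonneg _), mul_pow,
      Real.sq_sqrt (by positivity)]
  have i1 := re_inner_nonneg h1 ψ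
  have i2 := re_inner_nonneg h2 ψ
  have i3 := re_inner_nonneg h3 ψ
  have i4 := re_inner_nonneg h4 ψ
  have i0 := sq_nonneg ‖tiltSlack a A L ψ‖
  have z1 := apply_eq_zero_of_nonneg h1 (v := ψ) (by linarith)
  have z2 := apply_eq_zero_of_nonneg h2 (v := ψ) (by linarith)
  have comm : ∀ x y w, L y (A x w) = A x (L y w) := fun x y w =>
    (DFunLike.congr_fun (hc x y).eq w).symm
  have slack : ∀ (X K : T →L[ℂ] T), IsSelfAdjoint X → IsObservable K →
      RCLike.re (inner ℂ (((2 : ℂ) • (X * (1 - K * K) * X)) ψ) ψ) ≤ 0 → (1 - K * K) (X ψ) = 0 := by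
    intro X K hX hK hle
    refine apply_eq_zero_of_nonneg hK.nonneg ?_
    have e : inner ℂ ((X * (1 - K * K) * X) ψ) ψ = inner ℂ ((1 - K * K) (X ψ)) (X ψ) :=
      hX.isSymmetric _ _
    rw [smul_apply, inner_smul_left, e] at hle
    have : RCLike.re ((starRingEnd ℂ) 2 * inner ℂ ((1 - K * K) (X ψ)) (X ψ))
        = 2 * RCLike.re (inner ℂ ((1 - K * K) (X ψ)) (X ψ)) := by simp
    linarith
  refine ⟨?_, ?_, ?_, ?_⟩
  · have : ‖tiltSlack a A L ψ‖ ^ 2 = 0 := by linarith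
    exact norm_eq_zero.1 (pow_eq_zero_iff two_ne_zero |>.1 this)
  · have key : ∀ x (c : ℝ), |c| < 2 → ((1 - A x * A x) * tiltWeight c L) ψ = 0 →
        A x (A x ψ) = ψ := by
      intro x c hc' hz
      obtain ⟨δ, hδ, hδ'⟩ := exists_tiltWeight_ge hc' hL
      have : tiltWeight c L ((1 - A x * A x) ψ) = 0 := by
        rw [← hz]
        simp only [tiltWeight, mul_apply_eq_comp, add_apply, sub_apply, smul_apply, map_add, map_sub,
          map_smul, comm, one_apply_eq_self]
        module
      have := apply_eq_zero_of_sub_nonneg hδ hδ' this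
      rw [sub_apply, sub_eq_zero] at this
      exact this.symm
    intro x
    have hx : x = 0 ∨ x = 1 := by fin_cases x <;> simp
    rcases hx with rfl | rfl
    · exact key 0 a ha z1
    · exact key 1 (-a) (by rwa [abs_neg]) z2
  · have := slack _ _ ((hA 0).isSelfAdjoint.add (hA 1).isSelfAdjoint) (hL 0) (by linarith)
    rw [sub_apply, sub_eq_zero] at this
    simp only [one_apply_eq_self, mul_apply_eq_comp, add_apply, map_add, comm] at this ⊢
    exact this.symm
  · have := slack _ _ ((hA 0).isSelfAdjoint.sub (hA 1).isSelfAdjoint) (hL 1) (by linarith)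
    rw [sub_apply, sub_eq_zero] at this
    simp only [one_apply_eq_self, mul_apply_eq_comp, sub_apply, map_sub, comm] at this ⊢
    exact this.symm

/-- With `S = L₀ + L₁` and `D = L₀ - L₁` the maximality and slack equations read `aA₀ψ + A₀Sψ + A₁Dψ
= bψ` and `aA₁ψ = A₁Sψ + A₀Dψ`. Elimination yields `S²ψ`, then `A₀ψ` and `Dψ`, then anticommutation
of the `A_x`. Only after that can `L_y²ψ = ψ` be derived. Divisions use `b ≠ 0` and `b²/4 - a² = (4
- a²)/2 ≠ 0`. -/
theorem tilt_relations {a : ℝ} (ha : |a| < 2) {A L : Fin 2 → T →L[ℂ] T}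
    (hA : ∀ x, IsObservable (A x)) (hL : ∀ y, IsObservable (L y))
    (hc : ∀ x y, Commute (A x) (L y)) {ψ : T}
    (h : tiltOp a A L ψ = ((√(8 + 2 * a ^ 2) : ℝ) : ℂ) • ψ) :
    TiltRelations (a : ℂ) ((√(8 + 2 * a ^ 2) : ℝ) : ℂ) A L ψ := by
  obtain ⟨hN, hsq, hX, hY⟩ := tilt_slack_eq ha hA hL hc h
  have hb2 : (((√(8 + 2 * a ^ 2) : ℝ) : ℂ)) ^ 2 = 8 + 2 * (a : ℂ) ^ 2 := by
    rw [← Complex.ofReal_pow, Real.sq_sqrt (by positivity)]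
    push_cast
    rfl
  have hb0 : ((√(8 + 2 * a ^ 2) : ℝ) : ℂ) ≠ 0 := by
    rw [Complex.ofReal_ne_zero]
    positivity
  have ha4 : (4 - (a : ℂ) ^ 2) ≠ 0 := by
    have : 4 - a ^ 2 ≠ 0 := by nlinarith [abs_lt.1 ha]
    exact_mod_cast this
  generalize ((√(8 + 2 * a ^ 2) : ℝ) : ℂ) = b at h hb2 hb0 ⊢
  have hba : b ^ 2 / 4 - (a : ℂ) ^ 2 ≠ 0 := by
    have : b ^ 2 / 4 - (a : ℂ) ^ 2 = (4 - (a : ℂ) ^ 2) / 2 := by rw [hb2]; ring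
    rw [this]
    exact div_ne_zero ha4 two_ne_zero
  have comm : ∀ x y w, L y (A x w) = A x (L y w) := fun x y w =>
    (DFunLike.congr_fun (hc x y).eq w).symm
  -- The two defect equations for Bob are added; this combination replaces `L_y²ψ = ψ`, which is not
  -- available yet.
  have hL4 : A 0 (L 0 (L 0 ψ)) + A 1 (L 0 (L 0 ψ)) + A 0 (L 1 (L 1 ψ)) - A 1 (L 1 (L 1 ψ))
      = (2 : ℂ) • A 0 ψ := by
    simp only [add_apply, sub_apply] at hX hY
    linear_combination (norm := module) hX + hY
  obtain ⟨S, hS⟩ : ∃ S, S = L 0 + L 1 := ⟨_, rfl⟩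
  obtain ⟨D, hD⟩ : ∃ D, D = L 0 - L 1 := ⟨_, rfl⟩
  have cS : ∀ x w, S (A x w) = A x (S w) := fun x w => by simp [hS, comm]
  have cD : ∀ x w, D (A x w) = A x (D w) := fun x w => by simp [hD, comm]
  have hI' : (a : ℂ) • A 0 ψ + A 0 (S ψ) + A 1 (D ψ) = b • ψ := by
    rw [← h]
    simp only [tiltOp, hS, hD, add_apply, sub_apply, smul_apply, mul_apply_eq_comp, map_add, map_sub]
    abel
  have hN' : (a : ℂ) • A 1 ψ - A 1 (S ψ) - A 0 (D ψ) = 0 := by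
    rw [← hN]
    simp only [tiltSlack, hS, hD, add_apply, sub_apply, smul_apply, mul_apply_eq_comp, map_add,
      map_sub]
  have hSD : A 0 (S (S ψ)) + A 0 (D (D ψ)) + A 1 (S (D ψ)) + A 1 (D (S ψ)) = (4 : ℂ) • A 0 ψ := by
    simp only [hS, hD, add_apply, sub_apply, map_add, map_sub]
    linear_combination (norm := module) (2 : ℂ) • hL4
  -- Applying `S` to the first equation and `D` to the second, and adding `a` times the first,
  -- eliminates `A₁`.
  have hP : A 0 ((4 + (a : ℂ) ^ 2) • ψ + (2 * a : ℂ) • S ψ) = b • (S ψ + (a : ℂ) • ψ) := by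
    have h1 := congrArg S hI'
    have h2 := congrArg D hN'
    simp only [map_add, map_sub, map_smul, map_zero, cS, cD] at h1 h2 ⊢
    linear_combination (norm := module) h1 - h2 + (a : ℂ) • hI' - hSD
  have hQ : (4 + (a : ℂ) ^ 2) • ψ + (2 * a : ℂ) • S ψ = b • A 0 (S ψ + (a : ℂ) • ψ) := by
    have h1 := congrArg (A 0) hP
    simp only [map_add, map_smul, ← cS, hsq] at h1 ⊢
    exact h1
  -- Between `hP`, `hQ` and their images under `S` the observable `A₀` drops out, leaving a multiple
  -- `4 - a²` of the claim.
  have hS2 : S (S ψ) = (b ^ 2 / 4) • ψ := by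
    have h1 := congrArg S hQ
    have h2 := congrArg S hP
    have h3 : (4 - (a : ℂ) ^ 2) • (S (S ψ) - (b ^ 2 / 4) • ψ) = 0 := by
      simp only [map_add, map_smul, cS] at h1 h2 hP hQ ⊢
      rw [hb2]
      have hb2' : b * b = 8 + 2 * (a : ℂ) ^ 2 := by rw [← hb2, sq]
      linear_combination (norm := module) (-(4 + (a : ℂ) ^ 2) / 2) • hQ - (a : ℂ) • h1 - (b / 2) • h2
        - (a * b / 2 : ℂ) • hP - ((1 / 2 : ℂ) * hb2') • (S (S ψ) + (2 * a : ℂ) • S ψ + ((a : ℂ) ^ 2) • ψ)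
    exact sub_eq_zero.1 ((smul_eq_zero.1 h3).resolve_left ha4)
  have hA0 : A 0 ψ = (2 / b) • S ψ := by
    have h1 := congrArg S hQ
    have h3 : (b ^ 2 / 4 - (a : ℂ) ^ 2) • (b • A 0 ψ - (2 : ℂ) • S ψ) = 0 := by
      simp only [map_add, map_smul, cS, hS2] at h1 hQ ⊢
      have hb2' : 8 + 2 * (a : ℂ) ^ 2 = b ^ 2 := hb2.symm
      linear_combination (norm := module) (a : ℂ) • hQ - h1 + ((1 / 2 : ℂ) * hb2') • (S ψ - (a : ℂ) • ψ)
    have h4 := sub_eq_zero.1 ((smul_eq_zero.1 h3).resolve_left hba)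
    have h5 : A 0 ψ = b⁻¹ • (b • A 0 ψ) := by rw [smul_smul, inv_mul_cancel₀ hb0, one_smul]
    rw [h5, h4, smul_smul]
    congr 1
    ring
  have hSψ : S ψ = (b / 2) • A 0 ψ := by
    rw [hA0, smul_smul, div_mul_div_cancel₀ two_ne_zero, div_self hb0, one_smul]
  have hDψ : D ψ = (b / 2) • A 1 ψ - (a : ℂ) • A 1 (A 0 ψ) := by
    have h1 : A 1 (D ψ) = (b / 2) • ψ - (a : ℂ) • A 0 ψ := by
      rw [hSψ, map_smul, hsq] at hI'
      linear_combination (norm := module) hI'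
    have h2 := congrArg (A 1) h1
    rwa [← cD, ← cD, hsq, map_sub, map_smul, map_smul] at h2
  -- The anticommutator vector `w` satisfies `S²w = (b²/4)w` and `(b²/4)w = aSw`, hence `(b²/4)(b²/4
  -- - a²)w = 0`.
  have hanti : A 0 (A 1 ψ) + A 1 (A 0 ψ) = 0 := by
    obtain ⟨w, hw⟩ : ∃ w, w = A 0 (A 1 ψ) + A 1 (A 0 ψ) := ⟨_, rfl⟩
    have h1 : S w = (b / 2) • (A 0 (A 1 (A 0 ψ)) + A 1 ψ) := by
      rw [hw, map_add, cS, cS, cS, cS, hSψ]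
      simp only [map_smul, hsq, smul_add]
    have h2 : S (S w) = (b ^ 2 / 4) • w := by
      simp only [hw, map_add, cS, hS2, map_smul, smul_add]
    have h3 : (b ^ 2 / 4) • w = (a : ℂ) • S w := by
      have h4 := congrArg (A 0) hDψ
      rw [hSψ] at hN'
      simp only [map_sub, map_smul] at h4 hN'
      rw [h1, hw]
      linear_combination (norm := module) (-(b / 2)) • hN' - (b / 2) • h4
    have h4 := congrArg S h3
    rw [map_smul, map_smul, h2] at h4
    have h5 : ((b ^ 2 / 4) * (b ^ 2 / 4 - (a : ℂ) ^ 2)) • w = 0 := by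
      linear_combination (norm := module) (b ^ 2 / 4) • h3 + (a : ℂ) • h4
    rw [← hw]
    exact (smul_eq_zero.1 h5).resolve_left
      (mul_ne_zero (div_ne_zero (pow_ne_zero 2 hb0) four_ne_zero) hba)
  -- On the vectors `L_y²ψ - ψ` anticommutation gives `(A₀ ± A₁)² = 2`, so `A₀ ± A₁` can be
  -- cancelled.
  have hL2 : ∀ y, L y (L y ψ) = ψ := by
    have h0 : ∀ w, w = L 0 (L 0 ψ) - ψ → (A 0 + A 1) w = 0 → w = 0 := by
      intro w hw h0
      have h1 := congrArg (A 0 + A 1) h0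
      simp only [add_apply, map_add, map_zero, hw, map_sub, ← comm, hsq] at h1
      have h2 := congrArg (fun u => L 0 (L 0 u)) hanti
      simp only [map_add, map_zero] at h2
      have h3 : (2 : ℂ) • w = 0 := by
        rw [hw]
        linear_combination (norm := module) h1 - h2 + hanti
      exact (smul_eq_zero.1 h3).resolve_left two_ne_zero
    have h1 : ∀ w, w = L 1 (L 1 ψ) - ψ → (A 0 - A 1) w = 0 → w = 0 := by
      intro w hw h0
      have h1 := congrArg (A 0 - A 1) h0
      simp only [sub_apply, map_zero, hw, map_sub, ← comm, hsq] at h1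
      have h2 := congrArg (fun u => L 1 (L 1 u)) hanti
      simp only [map_add, map_zero] at h2
      have h3 : (2 : ℂ) • w = 0 := by
        rw [hw]
        linear_combination (norm := module) h1 + h2 - hanti
      exact (smul_eq_zero.1 h3).resolve_left two_ne_zero
    intro y
    have hy : y = 0 ∨ y = 1 := by fin_cases y <;> simp
    rcases hy with rfl | rfl
    · exact sub_eq_zero.1 (h0 _ rfl (by rw [map_sub, hX, sub_self]))
    · exact sub_eq_zero.1 (h1 _ rfl (by rw [map_sub, hY, sub_self]))
  refine ⟨hsq, hanti, hL2, ?_, by rw [← hS]; exact hA0, ?_, by rw [← hS]; exact hSψ,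
    by rw [← hD]; exact hDψ⟩
  · have h1 := hS2
    simp only [hS, add_apply, map_add, hL2] at h1
    linear_combination (norm := module) h1
  · rw [← hS, ← hD]
    have h2 : S (S (A 1 ψ)) = (b ^ 2 / 4) • A 1 ψ := by rw [cS, cS, hS2, map_smul]
    have h3 : A 1 (A 0 ψ) = (2 / b) • S (A 1 ψ) := by rw [cS, hSψ, map_smul, smul_smul,
      div_mul_div_cancel₀ hb0, div_self two_ne_zero, one_smul]
    have h4 : (b ^ 2 / 4 - (a : ℂ) ^ 2) • A 1 ψ
        = (b / 2) • D ψ + (2 * a / b) • S (D ψ) := by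
      rw [hDψ, h3]
      simp only [map_sub, map_smul, h2]
      match_scalars <;> field_simp <;> ring
    rw [← h4, smul_smul, inv_mul_cancel₀ hba, one_smul]

end Tilted

/-! ### Correlators of qubit observables -/

section Correlators

variable {ι : Type} [Fintype ι] [DecidableEq ι]

/-- The qubit observable of a party in a correlator. -/
def qubitObs (Kb : ι → Fin 2 → QMat) (k : ι) : Option (Fin 2) → QMat
  | none => 1
  | some x => Kb k x

theorem bellMatrix_correlator (Kb : ι → Fin 2 → QMat) (s : ι → Option (Fin 2)) :
    bellMatrix (dichotomicMeas Kb) (correlator s) = tensorMatrix fun k => qubitObs Kb k (s k) := by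
  rw [bellMatrix_eq_bell, bell_correlator (commuting_localMatrix _)
    (sum_localMatrix (sum_dichotomicMeas Kb)), ← commProd_localMatrix]
  congr 1
  ext1 k
  cases h : s k with
  | none => simp [obs, qubitObs, localMatrix_one]
  | some x =>
    have e : Kb k x = dichotomicMeas Kb k 0 x + (-1 : ℂ) • dichotomicMeas Kb k 1 x := by
      simp only [dichotomicMeas, Fin.val_zero, Fin.val_one, pow_zero, pow_one]
      module
    simp only [obs, qubitObs]
    rw [e, localMatrix_add, localMatrix_smul]
    module

theorem bellMatrix_add (M : ι → Fin 2 → Fin 2 → QMat) (B B' : BellFunctional ι) :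
    bellMatrix M (B + B') = bellMatrix M B + bellMatrix M B' := by
  simp only [bellMatrix_eq_bell, bell_add]

theorem bellMatrix_sub (M : ι → Fin 2 → Fin 2 → QMat) (B B' : BellFunctional ι) :
    bellMatrix M (B - B') = bellMatrix M B - bellMatrix M B' := by
  simp only [bellMatrix_eq_bell, bell_sub]

theorem bellMatrix_smul (M : ι → Fin 2 → Fin 2 → QMat) (c : ℝ) (B : BellFunctional ι) :
    bellMatrix M (c • B) = (c : ℂ) • bellMatrix M B := by
  simp only [bellMatrix_eq_bell, bell_smul]

theorem bellMatrix_sum {κ : Type*} (s : Finset κ) (M : ι → Fin 2 → Fin 2 → QMat)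
    (B : κ → BellFunctional ι) : bellMatrix M (∑ i ∈ s, B i) = ∑ i ∈ s, bellMatrix M (B i) := by
  simp only [bellMatrix_eq_bell, bell_sum]

end Correlators

/-! ### Components of two-qubit vectors and two-party correlators -/

section Bipartite

theorem sum_fin_two_arrow {E : Type*} [AddCommMonoid E] (f : (Fin 2 → Fin 2) → E) :
    ∑ i, f i = ∑ k, ∑ l, f ![k, l] := by
  rw [← Fintype.sum_prod_type', ← (finTwoArrowEquiv (Fin 2)).symm.sum_comp]
  rfl

theorem corr_mulVec (Kb : Fin 2 → Fin 2 → QMat) (x y : Fin 2) (v : (Fin 2 → Fin 2) → ℂ)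
    (i j : Fin 2) : (bellMatrix (dichotomicMeas Kb) (corr x y) *ᵥ v) ![i, j]
      = ∑ k, ∑ l, Kb 0 x i k * Kb 1 y j l * v ![k, l] := by
  rw [corr, bellMatrix_correlator, Matrix.mulVec, dotProduct, sum_fin_two_arrow]
  simp [tensorMatrix, qubitObs]

theorem marg_mulVec (Kb : Fin 2 → Fin 2 → QMat) (x : Fin 2) (v : (Fin 2 → Fin 2) → ℂ)
    (i j : Fin 2) : (bellMatrix (dichotomicMeas Kb) (marg x) *ᵥ v) ![i, j]
      = ∑ k, Kb 0 x i k * v ![k, j] := by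
  rw [marg, bellMatrix_correlator, Matrix.mulVec, dotProduct, sum_fin_two_arrow]
  fin_cases j <;> simp [tensorMatrix, qubitObs, Fin.sum_univ_two, Matrix.one_apply]

theorem ext_fin_two {v w : (Fin 2 → Fin 2) → ℂ} (h₀₀ : v ![0, 0] = w ![0, 0])
    (h₀₁ : v ![0, 1] = w ![0, 1]) (h₁₀ : v ![1, 0] = w ![1, 0]) (h₁₁ : v ![1, 1] = w ![1, 1]) :
    v = w := by
  have h : ∀ i j, v ![i, j] = w ![i, j] := by
    intro i j
    fin_cases i <;> fin_cases j <;> assumption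
  ext i
  have e : i = ![i 0, i 1] := by
    ext k
    fin_cases k <;> rfl
  rw [e]
  exact h _ _

theorem ket_apply (i j k l : Fin 2) : ket i j ![k, l] = if i = k ∧ j = l then 1 else 0 := by
  have : (![k, l] = ![i, j]) ↔ (i = k ∧ j = l) := by
    constructor
    · intro h
      exact ⟨(congrFun h 0).symm, (congrFun h 1).symm⟩
    · rintro ⟨rfl, rfl⟩
      rfl
  simp only [ket, Pi.single_apply, this]

theorem dotProduct_fin_two_arrow (v w : (Fin 2 → Fin 2) → ℂ) :
    star v ⬝ᵥ w = star (v ![0, 0]) * w ![0, 0] + star (v ![0, 1]) * w ![0, 1]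
      + star (v ![1, 0]) * w ![1, 0] + star (v ![1, 1]) * w ![1, 1] := by
  rw [dotProduct, sum_fin_two_arrow]
  simp only [Fin.sum_univ_two, Pi.star_apply]
  ring

variable {T : Type u} [NormedAddCommGroup T] [InnerProductSpace ℂ T]

theorem CommSystem.bell_corr (A : CommSystem (Fin 2) T) (x y : Fin 2) :
    bell A.op (corr x y) = A.K 0 x * A.K 1 y := by
  rw [corr, bell_correlator A.comm A.sum_op,
    commProd_eq_list (fun i j hij => A.comm.obs_commute hij _ _) [0, 1] (by decide)
      (by intro k; fin_cases k <;> simp)]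
  simp [obs, CommSystem.K]

theorem CommSystem.bell_marg (A : CommSystem (Fin 2) T) (x : Fin 2) :
    bell A.op (marg x) = A.K 0 x := by
  rw [marg, bell_correlator A.comm A.sum_op,
    commProd_eq_list (fun i j hij => A.comm.obs_commute hij _ _) [0, 1] (by decide)
      (by intro k; fin_cases k <;> simp)]
  simp [obs, CommSystem.K]

end Bipartite

/-! ### The tilted CHSH complexes -/

section TiltedComplex

theorem adjoin_eq_top_of_sigma_three {N : QMat} (h₀₁ : N 0 1 ≠ 0) (h₁₀ : N 1 0 ≠ 0) :
    Algebra.adjoin ℂ {σ₃, N} = ⊤ :=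
  eq_top_of_sigma_three_mem (Algebra.subset_adjoin (Or.inl rfl))
    (Algebra.subset_adjoin (Or.inr rfl)) h₀₁ h₁₀

theorem adjoin_add_sub {c s : ℂ} (hc : c ≠ 0) (hs : s ≠ 0) (M N : QMat) :
    Algebra.adjoin ℂ {c • M + s • N, c • M - s • N} = Algebra.adjoin ℂ {M, N} := by
  refine le_antisymm (Algebra.adjoin_le ?_) (Algebra.adjoin_le ?_)
  · have hM : M ∈ Algebra.adjoin ℂ {M, N} := Algebra.subset_adjoin (Or.inl rfl)
    have hN : N ∈ Algebra.adjoin ℂ {M, N} := Algebra.subset_adjoin (Or.inr rfl)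
    rintro _ (rfl | rfl)
    · exact add_mem (Subalgebra.smul_mem _ hM _) (Subalgebra.smul_mem _ hN _)
    · exact sub_mem (Subalgebra.smul_mem _ hM _) (Subalgebra.smul_mem _ hN _)
  · have hp : c • M + s • N ∈ Algebra.adjoin ℂ {c • M + s • N, c • M - s • N} :=
      Algebra.subset_adjoin (Or.inl rfl)
    have hm : c • M - s • N ∈ Algebra.adjoin ℂ {c • M + s • N, c • M - s • N} :=
      Algebra.subset_adjoin (Or.inr rfl)
    have e₁ : M = (2 * c)⁻¹ • ((c • M + s • N) + (c • M - s • N)) := by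
      match_scalars <;> field_simp <;> ring
    have e₂ : N = (2 * s)⁻¹ • ((c • M + s • N) - (c • M - s • N)) := by
      match_scalars <;> field_simp <;> ring
    have hM : M ∈ Algebra.adjoin ℂ {c • M + s • N, c • M - s • N} := by
      have := Subalgebra.smul_mem _ (add_mem hp hm) (2 * c)⁻¹
      rwa [← e₁] at this
    have hN : N ∈ Algebra.adjoin ℂ {c • M + s • N, c • M - s • N} := by
      have := Subalgebra.smul_mem _ (sub_mem hp hm) (2 * s)⁻¹
      rwa [← e₂] at this
    rintro _ (rfl | rfl)
    · exact hM
    · exact hN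

theorem abs_tiltAlpha_lt {θ : ℝ} (h : Real.sin (2 * θ) ≠ 0) : |tiltAlpha θ| < 2 := by
  have h1 : 0 < Real.sin (2 * θ) ^ 2 := by positivity
  have h2 := Real.sin_sq_add_cos_sq (2 * θ)
  refine abs_lt_of_sq_lt_sq ?_ two_pos.le
  rw [tiltAlpha, div_pow, Real.sq_sqrt (by positivity), div_lt_iff₀ (by positivity)]
  nlinarith

theorem tiltBeta_eq (θ : ℝ) : tiltBeta θ = 4 / √(1 + Real.sin (2 * θ) ^ 2) := by
  rw [tiltBeta, Real.sqrt_eq_iff_mul_self_eq (by positivity) (by positivity), tiltAlpha, div_pow,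
    div_mul_div_comm, Real.mul_self_sqrt (by positivity), Real.sq_sqrt (by positivity)]
  have h2 := Real.sin_sq_add_cos_sq (2 * θ)
  field_simp
  nlinarith

theorem tiltBeta_pos (θ : ℝ) : 0 < tiltBeta θ := by
  rw [tiltBeta_eq]; positivity

theorem tiltBeta_inv_mul_alpha (θ : ℝ) :
    (tiltBeta θ)⁻¹ * tiltAlpha θ = Real.cos (2 * θ) / 2 := by
  rw [tiltBeta_eq, tiltAlpha]
  have : √(1 + Real.sin (2 * θ) ^ 2) ≠ 0 := by positivity
  field_simp
  ring

theorem tiltBeta_inv_mul_cos (θ : ℝ) : (tiltBeta θ)⁻¹ * Real.cos (tiltMu θ) = 1 / 4 := by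
  rw [tiltBeta_eq, tiltMu, Real.cos_arctan]
  have : √(1 + Real.sin (2 * θ) ^ 2) ≠ 0 := by positivity
  field_simp

theorem tiltBeta_inv_mul_sin (θ : ℝ) :
    (tiltBeta θ)⁻¹ * Real.sin (tiltMu θ) = Real.sin (2 * θ) / 4 := by
  rw [tiltBeta_eq, tiltMu, Real.sin_arctan]
  have : √(1 + Real.sin (2 * θ) ^ 2) ≠ 0 := by positivity
  field_simp

/-- The qubit observables of the tilted CHSH complex. -/
noncomputable def tiltObs (θ : ℝ) : Fin 2 → Fin 2 → QMat :=
  ![![σ₃, σ₁],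
    ![Real.cos (tiltMu θ) • σ₃ + Real.sin (tiltMu θ) • σ₁,
      Real.cos (tiltMu θ) • σ₃ - Real.sin (tiltMu θ) • σ₁]]

noncomputable def tiltB₀ (θ : ℝ) : BellFunctional (Fin 2) :=
  (tiltBeta θ)⁻¹ • (tiltAlpha θ • marg 1 - corr 0 0 + corr 1 0 + corr 0 1 + corr 1 1)

noncomputable def tiltB₁ (θ : ℝ) : BellFunctional (Fin 2) :=
  (tiltBeta θ)⁻¹ • (tiltAlpha θ • marg 0 + corr 0 0 + corr 1 0 + corr 0 1 - corr 1 1)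

/-- Dividing by `β` simplifies all coefficients: `B₁` becomes `½(cos 2θ σ₃⊗1 + σ₃⊗σ₃ + sin 2θ
σ₁⊗σ₁)`. -/
theorem tiltB₁_mulVec (θ : ℝ) (v : (Fin 2 → Fin 2) → ℂ) (i j : Fin 2) :
    (bellMatrix (dichotomicMeas (tiltObs θ)) (tiltB₁ θ) *ᵥ v) ![i, j]
      = (2⁻¹ : ℂ) * ((Real.cos (2 * θ) : ℂ) * (∑ k, σ₃ i k * v ![k, j])
        + ∑ k, ∑ l, σ₃ i k * σ₃ j l * v ![k, l]
        + (Real.sin (2 * θ) : ℂ) * ∑ k, ∑ l, σ₁ i k * σ₁ j l * v ![k, l]) := by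
  have e1 : ((tiltBeta θ)⁻¹ : ℂ) * tiltAlpha θ = Real.cos (2 * θ) / 2 := by
    exact_mod_cast tiltBeta_inv_mul_alpha θ
  have e2 : ((tiltBeta θ)⁻¹ : ℂ) * Real.cos (tiltMu θ) = 1 / 4 := by
    have := congrArg Complex.ofReal (tiltBeta_inv_mul_cos θ)
    push_cast at this ⊢
    exact this
  have e3 : ((tiltBeta θ)⁻¹ : ℂ) * Real.sin (tiltMu θ) = Real.sin (2 * θ) / 4 := by
    exact_mod_cast tiltBeta_inv_mul_sin θ
  simp only [tiltB₁, bellMatrix_smul, bellMatrix_add, bellMatrix_sub, Matrix.smul_mulVec,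
    Matrix.add_mulVec, Matrix.sub_mulVec, Pi.smul_apply, Pi.add_apply, Pi.sub_apply, corr_mulVec,
    marg_mulVec, smul_eq_mul, Fin.sum_univ_two, tiltObs, Matrix.cons_val_zero, Matrix.cons_val_one,
    Matrix.add_apply, Matrix.sub_apply, Matrix.smul_apply, Complex.real_smul, Complex.ofReal_inv]
  linear_combination (σ₃ i 0 * v ![0, j] + σ₃ i 1 * v ![1, j]) * e1
    + 2 * (σ₃ i 0 * σ₃ j 0 * v ![0, 0] + σ₃ i 0 * σ₃ j 1 * v ![0, 1] + σ₃ i 1 * σ₃ j 0 * v ![1, 0]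
      + σ₃ i 1 * σ₃ j 1 * v ![1, 1]) * e2
    + 2 * (σ₁ i 0 * σ₁ j 0 * v ![0, 0] + σ₁ i 0 * σ₁ j 1 * v ![0, 1] + σ₁ i 1 * σ₁ j 0 * v ![1, 0]
      + σ₁ i 1 * σ₁ j 1 * v ![1, 1]) * e3

theorem tiltB₀_mulVec (θ : ℝ) (v : (Fin 2 → Fin 2) → ℂ) (i j : Fin 2) :
    (bellMatrix (dichotomicMeas (tiltObs θ)) (tiltB₀ θ) *ᵥ v) ![i, j]
      = (2⁻¹ : ℂ) * ((Real.cos (2 * θ) : ℂ) * (∑ k, σ₁ i k * v ![k, j])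
        + ∑ k, ∑ l, σ₁ i k * σ₃ j l * v ![k, l]
        - (Real.sin (2 * θ) : ℂ) * ∑ k, ∑ l, σ₃ i k * σ₁ j l * v ![k, l]) := by
  have e1 : ((tiltBeta θ)⁻¹ : ℂ) * tiltAlpha θ = Real.cos (2 * θ) / 2 := by
    exact_mod_cast tiltBeta_inv_mul_alpha θ
  have e2 : ((tiltBeta θ)⁻¹ : ℂ) * Real.cos (tiltMu θ) = 1 / 4 := by
    have := congrArg Complex.ofReal (tiltBeta_inv_mul_cos θ)
    push_cast at this ⊢
    exact this
  have e3 : ((tiltBeta θ)⁻¹ : ℂ) * Real.sin (tiltMu θ) = Real.sin (2 * θ) / 4 := by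
    exact_mod_cast tiltBeta_inv_mul_sin θ
  simp only [tiltB₀, bellMatrix_smul, bellMatrix_add, bellMatrix_sub, Matrix.smul_mulVec,
    Matrix.add_mulVec, Matrix.sub_mulVec, Pi.smul_apply, Pi.add_apply, Pi.sub_apply, corr_mulVec,
    marg_mulVec, smul_eq_mul, Fin.sum_univ_two, tiltObs, Matrix.cons_val_zero, Matrix.cons_val_one,
    Matrix.add_apply, Matrix.sub_apply, Matrix.smul_apply, Complex.real_smul, Complex.ofReal_inv]
  linear_combination (σ₁ i 0 * v ![0, j] + σ₁ i 1 * v ![1, j]) * e1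
    + 2 * (σ₁ i 0 * σ₃ j 0 * v ![0, 0] + σ₁ i 0 * σ₃ j 1 * v ![0, 1] + σ₁ i 1 * σ₃ j 0 * v ![1, 0]
      + σ₁ i 1 * σ₃ j 1 * v ![1, 1]) * e2
    - 2 * (σ₃ i 0 * σ₁ j 0 * v ![0, 0] + σ₃ i 0 * σ₁ j 1 * v ![0, 1] + σ₃ i 1 * σ₁ j 0 * v ![1, 0]
      + σ₃ i 1 * σ₁ j 1 * v ![1, 1]) * e3

noncomputable def tiltPlus (θ : ℝ) : (Fin 2 → Fin 2) → ℂ :=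
  Real.cos θ • ket 0 0 + Real.sin θ • ket 1 1

noncomputable def tiltMinus (θ : ℝ) : (Fin 2 → Fin 2) → ℂ :=
  Real.sin θ • ket 0 1 - Real.cos θ • ket 1 0

theorem tiltPlus_apply (θ : ℝ) (i j : Fin 2) : tiltPlus θ ![i, j] =
    if i = j then (if i = 0 then (Real.cos θ : ℂ) else (Real.sin θ : ℂ)) else 0 := by
  simp only [tiltPlus, Pi.add_apply, Pi.smul_apply, ket_apply, Complex.real_smul]
  fin_cases i <;> fin_cases j <;> simp

theorem tiltMinus_apply (θ : ℝ) (i j : Fin 2) : tiltMinus θ ![i, j] =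
    if i = j then 0 else (if i = 0 then (Real.sin θ : ℂ) else -(Real.cos θ : ℂ)) := by
  simp only [tiltMinus, Pi.sub_apply, Pi.smul_apply, ket_apply, Complex.real_smul]
  fin_cases i <;> fin_cases j <;> simp

theorem tiltObs_isHermitian (θ : ℝ) (k x : Fin 2) : (tiltObs θ k x).IsHermitian := by
  ext i j
  fin_cases k <;> fin_cases x <;> fin_cases i <;> fin_cases j <;> 
    simp [tiltObs, σ₁, σ₃, -Complex.ofReal_cos, -Complex.ofReal_sin]

theorem tiltObs_mul_self (θ : ℝ) (k x : Fin 2) : tiltObs θ k x * tiltObs θ k x = 1 := by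
  have h : (Real.cos (tiltMu θ) : ℂ) * Real.cos (tiltMu θ)
      + Real.sin (tiltMu θ) * Real.sin (tiltMu θ) = 1 := by
    have := Real.cos_sq_add_sin_sq (tiltMu θ)
    rw [sq, sq] at this
    exact_mod_cast this
  ext i j
  fin_cases k <;> fin_cases x <;> fin_cases i <;> fin_cases j <;>
    simp [tiltObs, σ₁, σ₃, Matrix.mul_apply, Fin.sum_univ_two, -Complex.ofReal_cos,
      -Complex.ofReal_sin] <;> first | ring1 | linear_combination h

theorem tiltObs_anticommutator (θ : ℝ) (k : Fin 2) :
    tiltObs θ k 0 * tiltObs θ k 1 + tiltObs θ k 1 * tiltObs θ k 0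
      = (2 * ![0, ((tiltBeta θ : ℂ) ^ 2 / 4 - 2) / 2] k) • (1 : QMat) := by
  have h : 2 * ((Real.cos (tiltMu θ) : ℂ) * Real.cos (tiltMu θ)
      - Real.sin (tiltMu θ) * Real.sin (tiltMu θ)) = (tiltBeta θ : ℂ) ^ 2 / 4 - 2 := by
    have h1 : 2 * (Real.cos (tiltMu θ) * Real.cos (tiltMu θ)
        - Real.sin (tiltMu θ) * Real.sin (tiltMu θ)) = tiltBeta θ ^ 2 / 4 - 2 := by
      rw [tiltBeta_eq, tiltMu, Real.cos_arctan, Real.sin_arctan, div_mul_div_comm, div_mul_div_comm,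
        div_pow, Real.mul_self_sqrt (by positivity), Real.sq_sqrt (by positivity)]
      field_simp
      ring
    exact_mod_cast congrArg Complex.ofReal h1
  ext i j
  fin_cases k <;> fin_cases i <;> fin_cases j <;>
    simp [tiltObs, σ₁, σ₃, -Complex.ofReal_cos,
      -Complex.ofReal_sin] <;> first | ring1 | linear_combination h

theorem sin_tiltMu_ne_zero {θ : ℝ} (h : Real.sin (2 * θ) ≠ 0) : Real.sin (tiltMu θ) ≠ 0 := by
  rw [tiltMu, Real.sin_arctan]
  positivity

theorem cos_tiltMu_ne_zero (θ : ℝ) : Real.cos (tiltMu θ) ≠ 0 := (Real.cos_arctan_pos _).ne'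

theorem tiltObs_irreducible {θ : ℝ} (h : Real.sin (2 * θ) ≠ 0) (k : Fin 2) :
    Algebra.adjoin ℂ {tiltObs θ k 0, tiltObs θ k 1} = ⊤ := by
  have h0 : Algebra.adjoin ℂ {σ₃, σ₁} = ⊤ :=
    adjoin_eq_top_of_sigma_three (by simp [σ₁]) (by simp [σ₁])
  have hk : k = 0 ∨ k = 1 := by fin_cases k <;> simp
  rcases hk with rfl | rfl
  · exact h0
  · have e := adjoin_add_sub (Complex.ofReal_ne_zero.2 (cos_tiltMu_ne_zero θ))
      (Complex.ofReal_ne_zero.2 (sin_tiltMu_ne_zero h)) σ₃ σ₁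
    rw [h0] at e
    exact e

theorem tilt_trig (θ : ℝ) : (Real.cos θ : ℂ) * Real.cos θ + Real.sin θ * Real.sin θ = 1 ∧
    (Real.cos (2 * θ) : ℂ) = Real.cos θ * Real.cos θ - Real.sin θ * Real.sin θ ∧
    (Real.sin (2 * θ) : ℂ) = 2 * Real.sin θ * Real.cos θ := by
  refine ⟨?_, ?_, ?_⟩
  · have := Real.cos_sq_add_sin_sq θ
    rw [sq, sq] at this
    exact_mod_cast this
  · have h1 := Real.cos_two_mul θ
    have h2 := Real.cos_sq_add_sin_sq θ
    have : Real.cos (2 * θ) = Real.cos θ * Real.cos θ - Real.sin θ * Real.sin θ := by nlinarith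
    rw [this]
    push_cast
    rfl
  · rw [Real.sin_two_mul]
    push_cast
    rfl

/-- The operator preserves the spans of `|00⟩, |11⟩` and of `|01⟩, |10⟩`, with eigenvalues `1, 0` on
the first and `0, -1` on the second. So `1` is a simple eigenvalue, with eigenvector `φ₊`. -/
theorem tiltB₁_fixed {θ : ℝ} (h : Real.sin (2 * θ) ≠ 0) {v : (Fin 2 → Fin 2) → ℂ}
    (hv : bellMatrix (dichotomicMeas (tiltObs θ)) (tiltB₁ θ) *ᵥ v = v) :
    v = ((Real.cos θ : ℂ) * v ![0, 0] + Real.sin θ * v ![1, 1]) • tiltPlus θ := by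
  obtain ⟨h1, h2, h3⟩ := tilt_trig θ
  have e : ∀ i j, (bellMatrix (dichotomicMeas (tiltObs θ)) (tiltB₁ θ) *ᵥ v) ![i, j] = v ![i, j] :=
    fun i j => congrFun hv _
  have e00 := e 0 0
  have e01 := e 0 1
  have e10 := e 1 0
  have e11 := e 1 1
  rw [tiltB₁_mulVec, h2, h3] at e00 e01 e10 e11
  simp [σ₁, σ₃, Fin.sum_univ_two, -Complex.ofReal_cos, -Complex.ofReal_sin] at e00 e01 e10 e11
  have hs : (Real.sin θ : ℂ) ≠ 0 := by
    rw [Complex.ofReal_ne_zero]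
    intro h0
    rw [Real.sin_two_mul, h0] at h
    simp at h
  generalize hcθ : (Real.cos θ : ℂ) = c at *
  generalize hsθ : (Real.sin θ : ℂ) = s at *
  -- The `|00⟩` equation is `sin θ` times this relation, and `sin θ ≠ 0` as `sin 2θ ≠ 0`.
  have k1 : c * v ![1, 1] = s * v ![0, 0] := by
    refine mul_left_cancel₀ hs ?_
    linear_combination e00 - (1 / 2) * v ![0, 0] * h1
  have k2 : v ![0, 1] = 0 := by
    linear_combination (-1 / 4) * (c * c - s * s + 3) * e01 - (1 / 4) * (2 * s * c) * e10
      + (1 / 8) * v ![0, 1] * (c * c + s * s + 1) * h1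
  have k3 : v ![1, 0] = 0 := by
    linear_combination (-1 / 4) * (2 * s * c) * e01 + (1 / 4) * (c * c - s * s - 3) * e10
      + (1 / 8) * v ![1, 0] * (c * c + s * s + 1) * h1
  refine ext_fin_two ?_ ?_ ?_ ?_
  · simp only [Pi.smul_apply, tiltPlus_apply, smul_eq_mul, if_true, hcθ]
    linear_combination -v ![0, 0] * h1 - s * k1
  · simpa [tiltPlus_apply] using k2
  · simpa [tiltPlus_apply] using k3
  · simp only [Pi.smul_apply, tiltPlus_apply, smul_eq_mul, if_true, one_ne_zero, if_false, hsθ]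
    linear_combination -v ![1, 1] * h1 + c * k1

theorem CommSystem.bell_tiltB₁ {T : Type u} [NormedAddCommGroup T] [InnerProductSpace ℂ T]
    [CompleteSpace T] (A : CommSystem (Fin 2) T) (θ : ℝ) :
    bell A.op (tiltB₁ θ) = ((tiltBeta θ)⁻¹ : ℂ) • tiltOp (tiltAlpha θ) (A.K 0) (A.K 1) := by
  simp only [tiltB₁, bell_smul, bell_add, bell_sub, A.bell_corr, A.bell_marg, tiltOp,
    Complex.ofReal_inv]

/-- `B₀` is the same tilted operator with Alice's pair `(K₀, K₁)` replaced by `(K₁, -K₀)`, so its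
norm bound needs no separate argument. -/
theorem CommSystem.bell_tiltB₀ {T : Type u} [NormedAddCommGroup T] [InnerProductSpace ℂ T]
    [CompleteSpace T] (A : CommSystem (Fin 2) T) (θ : ℝ) :
    bell A.op (tiltB₀ θ)
      = ((tiltBeta θ)⁻¹ : ℂ) • tiltOp (tiltAlpha θ) ![A.K 0 1, -A.K 0 0] (A.K 1) := by
  simp only [tiltB₀, bell_smul, bell_add, bell_sub, A.bell_corr, A.bell_marg, tiltOp,
    Complex.ofReal_inv, Matrix.cons_val_zero, Matrix.cons_val_one, neg_mul]
  congr 1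
  abel

theorem tiltOp_normalized {T : Type u} [NormedAddCommGroup T] [InnerProductSpace ℂ T]
    [CompleteSpace T] {θ : ℝ} (h : Real.sin (2 * θ) ≠ 0) {A L : Fin 2 → T →L[ℂ] T}
    (hA : ∀ x, IsObservable (A x)) (hL : ∀ y, IsObservable (L y))
    (hc : ∀ x y, Commute (A x) (L y)) :
    (1 - ((tiltBeta θ)⁻¹ : ℂ) • tiltOp (tiltAlpha θ) A L).IsPositive ∧
      (1 + ((tiltBeta θ)⁻¹ : ℂ) • tiltOp (tiltAlpha θ) A L).IsPositive := by
  have hβ := tiltBeta_pos θ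
  refine isPositive_of_norm_le ?_ fun v => ?_
  · have : IsSelfAdjoint ((tiltBeta θ)⁻¹ : ℂ) := by
      rw [← Complex.ofReal_inv]
      exact Complex.conj_ofReal _
    exact this.smul (tiltOp_isSelfAdjoint _ hA hL hc)
  · have h1 := tiltOp_norm_le (abs_tiltAlpha_lt h) hA hL hc v
    rw [smul_apply, norm_smul, norm_inv, Complex.norm_real, Real.norm_of_nonneg hβ.le,
      inv_mul_le_iff₀ hβ]
    exact h1

theorem tiltedComplex_isRigid {θ : ℝ} (h : Real.sin (2 * θ) ≠ 0) :
    QubitComplex.IsRigid.{u} (tiltedComplex θ) ![1, 0] := by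
  obtain ⟨h1, h2, h3⟩ := tilt_trig θ
  have hβ := tiltBeta_pos θ
  have hβ0 : (tiltBeta θ : ℂ) ≠ 0 := Complex.ofReal_ne_zero.2 hβ.ne'
  have hpp : star (tiltPlus θ) ⬝ᵥ tiltPlus θ = 1 := by
    rw [dotProduct_fin_two_arrow]
    simpa [tiltPlus_apply, -Complex.ofReal_cos, -Complex.ofReal_sin] using h1
  -- The constants `0` and `-1` record that `B₀` exchanges `φ₊` and `φ₋` up to the sign `-1`.
  refine pauliComplex_isRigid (B₀ := tiltB₀ θ) (B₁ := tiltB₁ θ) (Kb := tiltObs θ)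
    (φp := tiltPlus θ) (φm := tiltMinus θ) (tiltObs_isHermitian θ) (tiltObs_mul_self θ)
    (tiltObs_irreducible h) hpp ?_ ?_ ?_ ?_ 0 (-1) (by simp) (by simp) ?_ ?_ ?_ ?_
  · rw [dotProduct_fin_two_arrow]
    simp [tiltMinus_apply, -Complex.ofReal_cos, -Complex.ofReal_sin]
    linear_combination h1
  · rw [dotProduct_fin_two_arrow]
    simp [tiltPlus_apply, tiltMinus_apply]
  · apply ext_fin_two <;> rw [tiltB₁_mulVec, h2, h3] <;>
      simp [tiltPlus_apply, σ₁, σ₃, Fin.sum_univ_two, -Complex.ofReal_cos, -Complex.ofReal_sin]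
    · linear_combination ((Real.cos θ : ℂ) / 2) * h1
    · linear_combination ((Real.sin θ : ℂ) / 2) * h1
  · apply ext_fin_two <;> rw [tiltB₁_mulVec, h2, h3] <;>
      simp [tiltMinus_apply, σ₁, σ₃, Fin.sum_univ_two, -Complex.ofReal_cos, -Complex.ofReal_sin]
    · linear_combination (-(Real.sin θ : ℂ) / 2) * h1
    · linear_combination ((Real.cos θ : ℂ) / 2) * h1
  · apply ext_fin_two <;> rw [tiltB₀_mulVec, h2, h3] <;>
      simp [tiltPlus_apply, tiltMinus_apply, σ₁, σ₃, Fin.sum_univ_two, -Complex.ofReal_cos,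
        -Complex.ofReal_sin]
    · linear_combination (-(Real.sin θ : ℂ) / 2) * h1
    · linear_combination ((Real.cos θ : ℂ) / 2) * h1
  · apply ext_fin_two <;> rw [tiltB₀_mulVec, h2, h3] <;>
      simp [tiltPlus_apply, tiltMinus_apply, σ₁, σ₃, Fin.sum_univ_two, -Complex.ofReal_cos,
        -Complex.ofReal_sin]
    · linear_combination (-(Real.cos θ : ℂ) / 2) * h1
    · linear_combination (-(Real.sin θ : ℂ) / 2) * h1
  · intro T _ _ _ A y
    have hy : y = 0 ∨ y = 1 := by fin_cases y <;> simp
    rcases hy with rfl | rfl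
    · change (1 - bell A.op (tiltB₀ θ)).IsPositive ∧ (1 + bell A.op (tiltB₀ θ)).IsPositive
      rw [A.bell_tiltB₀]
      refine tiltOp_normalized h (fun x => ?_) (A.isObservable 1) fun x y => ?_
      · fin_cases x
        · exact A.isObservable 0 1
        · exact (A.isObservable 0 0).neg
      · fin_cases x
        · exact A.K_commute zero_ne_one 1 y
        · exact (A.K_commute zero_ne_one 0 y).neg_left
    · change (1 - bell A.op (tiltB₁ θ)).IsPositive ∧ (1 + bell A.op (tiltB₁ θ)).IsPositive
      rw [A.bell_tiltB₁]
      exact tiltOp_normalized h (A.isObservable 0) (A.isObservable 1) fun x y =>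
        A.K_commute zero_ne_one x y
  · intro T _ _ _ A ψ hψ hval
    have hval' : tiltOp (tiltAlpha θ) (A.K 0) (A.K 1) ψ = (tiltBeta θ : ℂ) • ψ := by
      have h4 := hval
      rw [A.bell_tiltB₁, smul_apply] at h4
      rw [← h4, smul_smul, mul_inv_cancel₀ hβ0, one_smul, h4]
    have R := tilt_relations (abs_tiltAlpha_lt h) (A.isObservable 0) (A.isObservable 1)
      (fun x y => A.K_commute zero_ne_one x y) hval'
    change TiltRelations (tiltAlpha θ : ℂ) (tiltBeta θ : ℂ) (A.K 0) (A.K 1) ψ at R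
    have c01 : ∀ x y, Commute (A.K 0 x) (A.K 1 y) := fun x y => A.K_commute zero_ne_one x y
    have cS : ∀ x, Commute (A.K 1 0 + A.K 1 1) (A.K 0 x) := fun x =>
      (c01 x 0).symm.add_left (c01 x 1).symm
    have cD : ∀ x, Commute (A.K 1 0 - A.K 1 1) (A.K 0 x) := fun x =>
      (c01 x 0).symm.sub_left (c01 x 1).symm
    refine exists_embeds A hψ (tiltObs_isHermitian θ) (tiltObs_mul_self θ)
      (κ := ![0, ((tiltBeta θ : ℂ) ^ 2 / 4 - 2) / 2]) (tiltObs_anticommutator θ)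
      (tiltObs_irreducible h) ?_ ?_ ?_ hpp
      fun v hv => ⟨_, tiltB₁_fixed h (hv _ hval)⟩
    -- Alice's observables act on `ψ` as polynomials in Bob's by `apply_zero` and `apply_one`; Bob's
    -- are half the sum and half the difference of the expressions in `apply_add` and `apply_sub`.
    · intro k x
      have hk : k = 0 ∨ k = 1 := by fin_cases k <;> simp
      have hx : x = 0 ∨ x = 1 := by fin_cases x <;> simp
      have hadd : ∀ y, Commute ((tiltBeta θ / 2 : ℂ) • A.K 0 0) (A.K 1 y) := fun y =>
        (c01 0 y).smul_left _
      have hsub : ∀ y, Commute ((tiltBeta θ / 2 : ℂ) • A.K 0 1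
          - (tiltAlpha θ : ℂ) • (A.K 0 1 * A.K 0 0)) (A.K 1 y) := fun y =>
        ((c01 1 y).smul_left _).sub_left (((c01 1 y).mul_left (c01 0 y)).smul_left _)
      rcases hk with rfl | rfl <;> rcases hx with rfl | rfl
      · exact ⟨(2 / (tiltBeta θ : ℂ)) • (A.K 1 0 + A.K 1 1), fun y => (cS y).smul_left _,
          R.apply_zero⟩
      · exact ⟨((tiltBeta θ : ℂ) ^ 2 / 4 - (tiltAlpha θ : ℂ) ^ 2)⁻¹ •
          ((tiltBeta θ / 2 : ℂ) • (A.K 1 0 - A.K 1 1) + (2 * tiltAlpha θ / tiltBeta θ : ℂ) •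
            ((A.K 1 0 + A.K 1 1) * (A.K 1 0 - A.K 1 1))),
          fun y => (((cD y).smul_left _).add_left
            (((cS y).mul_left (cD y)).smul_left _)).smul_left _, R.apply_one⟩
      · refine ⟨(2⁻¹ : ℂ) • ((tiltBeta θ / 2 : ℂ) • A.K 0 0 + ((tiltBeta θ / 2 : ℂ) • A.K 0 1
          - (tiltAlpha θ : ℂ) • (A.K 0 1 * A.K 0 0))),
          fun y => ((hadd y).add_left (hsub y)).smul_left _, ?_⟩
        have e1 := R.apply_add
        have e2 := R.apply_sub
        simp only [add_apply, sub_apply, smul_apply, mul_apply_eq_comp] at e1 e2 ⊢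
        linear_combination (norm := module) (2⁻¹ : ℂ) • (e1 + e2)
      · refine ⟨(2⁻¹ : ℂ) • ((tiltBeta θ / 2 : ℂ) • A.K 0 0 - ((tiltBeta θ / 2 : ℂ) • A.K 0 1
          - (tiltAlpha θ : ℂ) • (A.K 0 1 * A.K 0 0))),
          fun y => ((hadd y).sub_left (hsub y)).smul_left _, ?_⟩
        have e1 := R.apply_add
        have e2 := R.apply_sub
        simp only [add_apply, sub_apply, smul_apply, mul_apply_eq_comp] at e1 e2 ⊢
        linear_combination (norm := module) (2⁻¹ : ℂ) • (e1 - e2)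
    · intro k x
      have hk : k = 0 ∨ k = 1 := by fin_cases k <;> simp
      rcases hk with rfl | rfl
      · exact R.sq x
      · exact R.sq' x
    · intro k
      have hk : k = 0 ∨ k = 1 := by fin_cases k <;> simp
      rcases hk with rfl | rfl
      · simpa using R.anti
      · rw [R.anti']
        congr 1
        simp only [Matrix.cons_val_one, Matrix.cons_val_fin_one]
        ring

/-- At `θ = π/4` the tilt vanishes, and `β = 2√2`, `μ = π/4`. -/
theorem tsirelsonComplex_eq : tsirelsonComplex = tiltedComplex (Real.pi / 4) := by
  have e : 2 * (Real.pi / 4) = Real.pi / 2 := by ring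
  have ha : tiltAlpha (Real.pi / 4) = 0 := by
    rw [tiltAlpha, e, Real.cos_pi_div_two]
    simp
  have hb : tiltBeta (Real.pi / 4) = 2 * √2 := by
    rw [tiltBeta, ha, Real.sqrt_eq_iff_mul_self_eq (by norm_num) (by positivity)]
    have := Real.mul_self_sqrt (show (0 : ℝ) ≤ 2 by norm_num)
    nlinarith
  have hm : tiltMu (Real.pi / 4) = Real.pi / 4 := by
    rw [tiltMu, e, Real.sin_pi_div_two, Real.arctan_one]
  have hc : Real.cos (Real.pi / 4) = (√2)⁻¹ := by
    rw [Real.cos_pi_div_four, Real.sqrt_div_self]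
  have hs : Real.sin (Real.pi / 4) = (√2)⁻¹ := by
    rw [Real.sin_pi_div_four, Real.sqrt_div_self]
  rw [tsirelsonComplex, tiltedComplex, ha, hb, hm, hc, hs]
  simp only [zero_smul, zero_add, smul_add, smul_sub, zero_sub]

theorem tsirelsonComplex_isRigid : QubitComplex.IsRigid.{u} tsirelsonComplex ![1, 0] := by
  rw [tsirelsonComplex_eq]
  refine tiltedComplex_isRigid ?_
  have e : 2 * (Real.pi / 4) = Real.pi / 2 := by ring
  rw [e, Real.sin_pi_div_two]
  exact one_ne_zero

end TiltedComplex

/-! ### Correlation functionals with weights -/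

section CorrFunctionals

/-- The functional `∑ c_{xy} K^{(1)}_x K^{(2)}_y`. -/
noncomputable def corrFunctional (c : Fin 2 → Fin 2 → ℝ) : BellFunctional (Fin 2) :=
  ∑ x, ∑ y, c x y • corr x y

/-- Weights for which the correlation functional is at most `1`, with strict slacks. -/
structure CorrWeights (c : Fin 2 → Fin 2 → ℝ) (t k : Fin 2 → ℝ) : Prop where
  pos : ∀ y, 0 < t y
  pos' : ∀ x, 0 < k x
  sum_eq : t 0 + t 1 = 1
  sum_eq' : k 0 + k 1 = 1
  cancel : c 0 0 * c 1 0 / t 0 + c 0 1 * c 1 1 / t 1 = 0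
  eq : ∀ x, k x = c x 0 ^ 2 / t 0 + c x 1 ^ 2 / t 1

theorem CorrWeights.swap {c : Fin 2 → Fin 2 → ℝ} {t k : Fin 2 → ℝ} (h : CorrWeights c t k) :
    CorrWeights (fun x y => c (Equiv.swap 0 1 x) (Equiv.swap 0 1 y)) (fun y => t (Equiv.swap 0 1 y))
      (fun x => k (Equiv.swap 0 1 x)) where
  pos y := h.pos _
  pos' x := h.pos' _
  sum_eq := by simpa [add_comm] using h.sum_eq
  sum_eq' := by simpa [add_comm] using h.sum_eq'
  cancel := by
    have := h.cancel
    simp only [Equiv.swap_apply_left, Equiv.swap_apply_right]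
    linarith [mul_comm (c 0 0) (c 1 0), mul_comm (c 0 1) (c 1 1), mul_comm (c 1 1) (c 0 1),
      congrArg (· / t 0) (mul_comm (c 0 0) (c 1 0)), congrArg (· / t 1) (mul_comm (c 0 1) (c 1 1))]
  eq x := by
    rw [h.eq]
    simp only [Equiv.swap_apply_left, Equiv.swap_apply_right]
    ring

variable {T : Type u} [NormedAddCommGroup T] [InnerProductSpace ℂ T]

/-- The operator `∑ c_{xy} K_x L_y`. -/
noncomputable def corrOp (c : Fin 2 → Fin 2 → ℝ) (K L : Fin 2 → T →L[ℂ] T) : T →L[ℂ] T :=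
  ∑ x, ∑ y, (c x y : ℂ) • (K x * L y)

theorem CommSystem.bell_corrFunctional (A : CommSystem (Fin 2) T) (c : Fin 2 → Fin 2 → ℝ) :
    bell A.op (corrFunctional c) = corrOp c (A.K 0) (A.K 1) := by
  simp only [corrFunctional, corrOp, bell_sum, bell_smul, A.bell_corr]

variable [CompleteSpace T]

theorem corrOp_isSelfAdjoint (c : Fin 2 → Fin 2 → ℝ) {K L : Fin 2 → T →L[ℂ] T}
    (hK : ∀ x, IsObservable (K x)) (hL : ∀ y, IsObservable (L y))
    (hc : ∀ x y, Commute (K x) (L y)) : IsSelfAdjoint (corrOp c K L) := by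
  have h : ∀ x y, IsSelfAdjoint ((c x y : ℂ) • (K x * L y)) := fun x y => by
    have hr : IsSelfAdjoint (c x y : ℂ) := Complex.conj_ofReal _
    exact hr.smul (((hK x).isSelfAdjoint.commute_iff (hL y).isSelfAdjoint).1 (hc x y))
  exact isSelfAdjoint_sum _ fun x _ => isSelfAdjoint_sum _ fun y _ => h x y

/-- The combination of Alice's observables that accompanies `L_y`. -/
noncomputable def aliceOp (c : Fin 2 → Fin 2 → ℝ) (K : Fin 2 → T →L[ℂ] T) (y : Fin 2) : T →L[ℂ] T :=
  (c 0 y : ℂ) • K 0 + (c 1 y : ℂ) • K 1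

theorem norm_aliceOp_sq (c : Fin 2 → Fin 2 → ℝ) (K : Fin 2 → T →L[ℂ] T) (y : Fin 2) (v : T) :
    ‖aliceOp c K y v‖ ^ 2 = c 0 y ^ 2 * ‖K 0 v‖ ^ 2 + c 1 y ^ 2 * ‖K 1 v‖ ^ 2
      + 2 * (c 0 y * c 1 y) * RCLike.re (inner ℂ (K 0 v) (K 1 v)) := by
  rw [aliceOp, add_apply, smul_apply, smul_apply, @norm_add_sq ℂ, norm_smul, norm_smul,
    Complex.norm_real, Complex.norm_real, mul_pow, mul_pow, Real.norm_eq_abs, Real.norm_eq_abs,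
    sq_abs, sq_abs, inner_smul_left, inner_smul_right, Complex.conj_ofReal, ← mul_assoc,
    ← Complex.ofReal_mul]
  have : RCLike.re (((c 0 y * c 1 y : ℝ) : ℂ) * inner ℂ (K 0 v) (K 1 v))
      = c 0 y * c 1 y * RCLike.re (inner ℂ (K 0 v) (K 1 v)) := Complex.re_ofReal_mul _ _
  rw [this]
  ring

theorem re_inner_corrOp (c : Fin 2 → Fin 2 → ℝ) {K L : Fin 2 → T →L[ℂ] T}
    (hL : ∀ y, IsObservable (L y)) (hc : ∀ x y, Commute (K x) (L y)) (v : T) :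
    RCLike.re (inner ℂ (corrOp c K L v) v)
      = RCLike.re (inner ℂ (aliceOp c K 0 v) (L 0 v))
        + RCLike.re (inner ℂ (aliceOp c K 1 v) (L 1 v)) := by
  have e : corrOp c K L = L 0 * aliceOp c K 0 + L 1 * aliceOp c K 1 := by
    simp only [corrOp, aliceOp, Fin.sum_univ_two, mul_add, mul_smul_comm, ← (hc _ _).eq]
    abel
  rw [e, add_apply, mul_apply_eq_comp, mul_apply_eq_comp, inner_add_left, map_add, (hL 0).symm,
    (hL 1).symm]

/-- With `M_y = c_{0y}K₀ + c_{1y}K₁` this is the expectation of `2(1 - B) = Σ_y t_y⁻¹(M_y - t_yL_y)²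
+ Σ_y t_y(1 - L_y²) + Σ_x k_x(1 - K_x²)`. The condition `cancel` removes the anticommutator of `K₀`
and `K₁` from `Σ_y t_y⁻¹M_y²`, and `eq` makes the remainder `Σ_x k_xK_x²`. -/
theorem corr_sos {c : Fin 2 → Fin 2 → ℝ} {t k : Fin 2 → ℝ} (h : CorrWeights c t k)
    {K L : Fin 2 → T →L[ℂ] T} (hL : ∀ y, IsObservable (L y))
    (hc : ∀ x y, Commute (K x) (L y)) (v : T) :
    2 * (‖v‖ ^ 2 - RCLike.re (inner ℂ (corrOp c K L v) v))
      = (t 0)⁻¹ * ‖aliceOp c K 0 v - (t 0 : ℂ) • L 0 v‖ ^ 2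
        + (t 1)⁻¹ * ‖aliceOp c K 1 v - (t 1 : ℂ) • L 1 v‖ ^ 2
        + t 0 * (‖v‖ ^ 2 - ‖L 0 v‖ ^ 2) + t 1 * (‖v‖ ^ 2 - ‖L 1 v‖ ^ 2)
        + k 0 * (‖v‖ ^ 2 - ‖K 0 v‖ ^ 2) + k 1 * (‖v‖ ^ 2 - ‖K 1 v‖ ^ 2) := by
  have e : ∀ y, ‖aliceOp c K y v - (t y : ℂ) • L y v‖ ^ 2 = ‖aliceOp c K y v‖ ^ 2
      - 2 * t y * RCLike.re (inner ℂ (aliceOp c K y v) (L y v)) + t y ^ 2 * ‖L y v‖ ^ 2 := by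
    intro y
    have : RCLike.re ((t y : ℂ) * inner ℂ (aliceOp c K y v) (L y v))
        = t y * RCLike.re (inner ℂ (aliceOp c K y v) (L y v)) := Complex.re_ofReal_mul _ _
    rw [@norm_sub_sq ℂ, norm_smul, Complex.norm_real, mul_pow, Real.norm_eq_abs, sq_abs,
      inner_smul_right, this]
    ring
  rw [re_inner_corrOp c hL hc, e, e, norm_aliceOp_sq, norm_aliceOp_sq]
  have h0 := (h.pos 0).ne'
  have h1 := (h.pos 1).ne'
  have hk := h.sum_eq'
  have ht := h.sum_eq
  have hcan := h.cancel
  have e0 := h.eq 0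
  have e1 := h.eq 1
  generalize RCLike.re (inner ℂ (aliceOp c K 0 v) (L 0 v)) = X₀
  generalize RCLike.re (inner ℂ (aliceOp c K 1 v) (L 1 v)) = X₁
  generalize RCLike.re (inner ℂ (K 0 v) (K 1 v)) = Y
  rw [e0, e1] at hk ⊢
  have i0 : t 0 * (t 0)⁻¹ = 1 := mul_inv_cancel₀ h0
  have i1 : t 1 * (t 1)⁻¹ = 1 := mul_inv_cancel₀ h1
  simp only [div_eq_mul_inv] at hk hcan ⊢
  linear_combination -2 * Y * hcan + (2 * X₀ - ‖L 0 v‖ ^ 2 * t 0) * i0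
    + (2 * X₁ - ‖L 1 v‖ ^ 2 * t 1) * i1 - ‖v‖ ^ 2 * ht - ‖v‖ ^ 2 * hk

theorem corrOp_le {c : Fin 2 → Fin 2 → ℝ} {t k : Fin 2 → ℝ} (h : CorrWeights c t k)
    {K L : Fin 2 → T →L[ℂ] T} (hK : ∀ x, IsObservable (K x)) (hL : ∀ y, IsObservable (L y))
    (hc : ∀ x y, Commute (K x) (L y)) : (1 - corrOp c K L).IsPositive := by
  refine ContinuousLinearMap.isPositive_def'.2
    ⟨(IsSelfAdjoint.one _).sub (corrOp_isSelfAdjoint c hK hL hc), fun v => ?_⟩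
  rw [ContinuousLinearMap.reApplyInnerSelf_apply, sub_apply, inner_sub_left, map_sub,
    one_apply_eq_self, inner_self_eq_norm_sq]
  have hs := corr_sos h hL hc v
  have hn : ∀ {K : T →L[ℂ] T}, IsObservable K → 0 ≤ ‖v‖ ^ 2 - ‖K v‖ ^ 2 := fun hK =>
    sub_nonneg.2 (pow_le_pow_left₀ (norm_nonneg _) (hK.norm_le v) 2)
  have := mul_nonneg (h.pos 0).le (hn (hL 0))
  have := mul_nonneg (h.pos 1).le (hn (hL 1))
  have := mul_nonneg (h.pos' 0).le (hn (hK 0))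
  have := mul_nonneg (h.pos' 1).le (hn (hK 1))
  have := mul_nonneg (inv_nonneg.2 (h.pos 0).le) (sq_nonneg ‖aliceOp c K 0 v - (t 0 : ℂ) • L 0 v‖)
  have := mul_nonneg (inv_nonneg.2 (h.pos 1).le) (sq_nonneg ‖aliceOp c K 1 v - (t 1 : ℂ) • L 1 v‖)
  linarith

/-- The lower bound is the upper bound for the observables `-K_x`, since the operator is odd in
them. -/
theorem corrOp_normalized {c : Fin 2 → Fin 2 → ℝ} {t k : Fin 2 → ℝ} (h : CorrWeights c t k)
    {K L : Fin 2 → T →L[ℂ] T} (hK : ∀ x, IsObservable (K x)) (hL : ∀ y, IsObservable (L y))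
    (hc : ∀ x y, Commute (K x) (L y)) :
    (1 - corrOp c K L).IsPositive ∧ (1 + corrOp c K L).IsPositive := by
  refine ⟨corrOp_le h hK hL hc, ?_⟩
  have h1 := corrOp_le h (K := fun x => -K x) (fun x => (hK x).neg) hL fun x y => (hc x y).neg_left
  have e : corrOp c (fun x => -K x) L = -corrOp c K L := by
    simp only [corrOp, neg_mul, smul_neg, Finset.sum_neg_distrib]
  rwa [e, sub_neg_eq_add] at h1

/-- The relations that hold on a maximizer of a correlation operator. -/
theorem corr_relations {c : Fin 2 → Fin 2 → ℝ} {t k : Fin 2 → ℝ} (h : CorrWeights c t k)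
    {K L : Fin 2 → T →L[ℂ] T} (hK : ∀ x, IsObservable (K x)) (hL : ∀ y, IsObservable (L y))
    (hc : ∀ x y, Commute (K x) (L y)) {ψ : T} (hψ : corrOp c K L ψ = ψ) :
    (∀ y, aliceOp c K y ψ = (t y : ℂ) • L y ψ) ∧ (∀ x, K x (K x ψ) = ψ) ∧
      ∀ y, L y (L y ψ) = ψ := by
  have hs := corr_sos h hL hc ψ
  rw [hψ, inner_self_eq_norm_sq, sub_self, mul_zero] at hs
  have hn : ∀ {K : T →L[ℂ] T}, IsObservable K → 0 ≤ ‖ψ‖ ^ 2 - ‖K ψ‖ ^ 2 := fun hK =>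
    sub_nonneg.2 (pow_le_pow_left₀ (norm_nonneg _) (hK.norm_le ψ) 2)
  have i1 := mul_nonneg (h.pos 0).le (hn (hL 0))
  have i2 := mul_nonneg (h.pos 1).le (hn (hL 1))
  have i3 := mul_nonneg (h.pos' 0).le (hn (hK 0))
  have i4 := mul_nonneg (h.pos' 1).le (hn (hK 1))
  have i5 := mul_nonneg (inv_nonneg.2 (h.pos 0).le)
    (sq_nonneg ‖aliceOp c K 0 ψ - (t 0 : ℂ) • L 0 ψ‖)
  have i6 := mul_nonneg (inv_nonneg.2 (h.pos 1).le)
    (sq_nonneg ‖aliceOp c K 1 ψ - (t 1 : ℂ) • L 1 ψ‖)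
  have hz : ∀ {K : T →L[ℂ] T} {s : ℝ}, IsObservable K → 0 < s →
      s * (‖ψ‖ ^ 2 - ‖K ψ‖ ^ 2) = 0 → K (K ψ) = ψ := by
    intro K s hK hs' h0
    have h2 : ‖K ψ‖ ^ 2 = ‖ψ‖ ^ 2 := by
      have := (mul_eq_zero.1 h0).resolve_left hs'.ne'
      linarith
    exact hK.apply_apply ((pow_left_inj₀ (norm_nonneg _) (norm_nonneg _) two_ne_zero).1 h2)
  have hz' : ∀ {w : T} {s : ℝ}, 0 < s → s⁻¹ * ‖w‖ ^ 2 = 0 → w = 0 := by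
    intro w s hs' h0
    have := (mul_eq_zero.1 h0).resolve_left (inv_ne_zero hs'.ne')
    exact norm_eq_zero.1 (pow_eq_zero_iff two_ne_zero |>.1 this)
  refine ⟨fun y => ?_, fun x => ?_, fun y => ?_⟩
  · have hy : y = 0 ∨ y = 1 := by fin_cases y <;> simp
    rcases hy with rfl | rfl
    · exact sub_eq_zero.1 (hz' (h.pos 0) (by linarith))
    · exact sub_eq_zero.1 (hz' (h.pos 1) (by linarith))
  · have hx : x = 0 ∨ x = 1 := by fin_cases x <;> simp
    rcases hx with rfl | rfl
    · exact hz (hK 0) (h.pos' 0) (by linarith)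
    · exact hz (hK 1) (h.pos' 1) (by linarith)
  · have hy : y = 0 ∨ y = 1 := by fin_cases y <;> simp
    rcases hy with rfl | rfl
    · exact hz (hL 0) (h.pos 0) (by linarith)
    · exact hz (hL 1) (h.pos 1) (by linarith)

/-- Anticommutators on a maximizer of a correlation operator. -/
theorem corr_anticommutators {c : Fin 2 → Fin 2 → ℝ} {t k : Fin 2 → ℝ} (h : CorrWeights c t k)
    {K L : Fin 2 → T →L[ℂ] T} (hK : ∀ x, IsObservable (K x)) (hL : ∀ y, IsObservable (L y))
    (hc : ∀ x y, Commute (K x) (L y)) {ψ : T} (hψ : corrOp c K L ψ = ψ) {κ κ' : ℝ}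
    (h0 : c 0 0 * c 1 0 ≠ 0) (hκ : 2 * (c 0 0 * c 1 0) * κ = t 0 ^ 2 - c 0 0 ^ 2 - c 1 0 ^ 2)
    (hκ' : t 0 * t 1 * κ' = c 0 0 * c 0 1 + c 1 0 * c 1 1
      + (c 0 0 * c 1 1 + c 0 1 * c 1 0) * κ) :
    K 0 (K 1 ψ) + K 1 (K 0 ψ) = (2 * κ : ℂ) • ψ ∧
      L 0 (L 1 ψ) + L 1 (L 0 ψ) = (2 * κ' : ℂ) • ψ := by
  obtain ⟨hM, hK2, hL2⟩ := corr_relations h hK hL hc hψ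
  have comm : ∀ x y w, L y (K x w) = K x (L y w) := fun x y w =>
    (DFunLike.congr_fun (hc x y).eq w).symm
  have hM' : ∀ y, (c 0 y : ℂ) • K 0 ψ + (c 1 y : ℂ) • K 1 ψ = (t y : ℂ) • L y ψ := hM
  -- This is `M_yM_zψ = t_yt_z L_zL_yψ`, obtained by applying `M_yψ = t_yL_yψ` twice. Equal indices
  -- give Alice's anticommutator, distinct ones Bob's.
  have hMM : ∀ y z, (c 0 y * c 0 z + c 1 y * c 1 z : ℂ) • ψ + (c 0 y * c 1 z : ℂ) • K 0 (K 1 ψ)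
      + (c 1 y * c 0 z : ℂ) • K 1 (K 0 ψ) = (t z * t y : ℂ) • L z (L y ψ) := by
    intro y z
    have e1 := congrArg (K 0) (hM' z)
    have e2 := congrArg (K 1) (hM' z)
    have e3 := congrArg (L z) (hM' y)
    simp only [map_add, map_smul, hK2, comm] at e1 e2 e3
    linear_combination (norm := module) (c 0 y : ℂ) • e1 + (c 1 y : ℂ) • e2 + (t z : ℂ) • e3
  have hκc : 2 * ((c 0 0 : ℂ) * c 1 0) * κ = t 0 ^ 2 - c 0 0 ^ 2 - c 1 0 ^ 2 := by
    exact_mod_cast congrArg Complex.ofReal hκ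
  have hκc' : (t 0 : ℂ) * t 1 * κ' = c 0 0 * c 0 1 + c 1 0 * c 1 1
      + (c 0 0 * c 1 1 + c 0 1 * c 1 0) * κ := by
    exact_mod_cast congrArg Complex.ofReal hκ'
  have hanti : K 0 (K 1 ψ) + K 1 (K 0 ψ) = (2 * κ : ℂ) • ψ := by
    have h1 := hMM 0 0
    rw [hL2] at h1
    have h2 : ((c 0 0 : ℂ) * c 1 0) • (K 0 (K 1 ψ) + K 1 (K 0 ψ) - (2 * κ : ℂ) • ψ) = 0 := by
      linear_combination (norm := module) h1 - hκc • ψ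
    have h3 : ((c 0 0 : ℂ) * c 1 0) ≠ 0 := by exact_mod_cast h0
    exact sub_eq_zero.1 ((smul_eq_zero.1 h2).resolve_left h3)
  refine ⟨hanti, ?_⟩
  have h1 := hMM 0 1
  have h2 := hMM 1 0
  have h3 : ((t 0 : ℂ) * t 1) • (L 0 (L 1 ψ) + L 1 (L 0 ψ) - (2 * κ' : ℂ) • ψ) = 0 := by
    linear_combination (norm := module) -h1 - h2 - ((2 : ℂ) * hκc') • ψ
      + ((c 0 0 : ℂ) * c 1 1 + c 0 1 * c 1 0) • hanti
  have h4 : ((t 0 : ℂ) * t 1) ≠ 0 := by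
    exact_mod_cast (mul_pos (h.pos 0) (h.pos 1)).ne'
  exact sub_eq_zero.1 ((smul_eq_zero.1 h3).resolve_left h4)

end CorrFunctionals

/-! ### The Wooltorton-Brown-Colbeck complexes -/

section Wbc

/-- The observable in the equatorial direction `a`. -/
noncomputable def equator (a : ℝ) : QMat := Real.cos a • σ₁ + Real.sin a • σ₂

theorem equator_apply (a : ℝ) : equator a = !![0, (Real.cos a : ℂ) - Real.sin a * Complex.I;
    (Real.cos a : ℂ) + Real.sin a * Complex.I, 0] := by
  ext i j
  fin_cases i <;> fin_cases j <;>
    simp [equator, σ₁, σ₂, -Complex.ofReal_cos, -Complex.ofReal_sin]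
  ring

theorem equator_isHermitian (a : ℝ) : (equator a).IsHermitian := by
  rw [equator_apply]
  ext i j
  fin_cases i <;> fin_cases j <;> simp [-Complex.ofReal_cos, -Complex.ofReal_sin]
  ring

theorem equator_mul_add (a b : ℝ) :
    equator a * equator b + equator b * equator a = (2 * Real.cos (b - a) : ℂ) • (1 : QMat) := by
  rw [equator_apply, equator_apply, Real.cos_sub]
  ext i j
  fin_cases i <;> fin_cases j <;>
    simp [-Complex.ofReal_cos, -Complex.ofReal_sin]
  · linear_combination (-2 * (Real.sin a : ℂ) * Real.sin b) * Complex.I_mul_I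
  · linear_combination (-2 * (Real.sin a : ℂ) * Real.sin b) * Complex.I_mul_I

theorem equator_mul_self (a : ℝ) : equator a * equator a = 1 := by
  have h := equator_mul_add a a
  rw [sub_self, Real.cos_zero] at h
  have h2 : (2 : ℂ) • (equator a * equator a) = (2 : ℂ) • (1 : QMat) := by
    rw [two_smul, h]; simp
  exact smul_right_injective _ (two_ne_zero (α := ℂ)) h2

/-- The commutator of the two equatorial observables is `2i sin(b - a) σ₃`, and the off-diagonal
entries of `equator a` have modulus one. -/
theorem equator_irreducible {a b : ℝ} (h : Real.sin (b - a) ≠ 0) :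
    Algebra.adjoin ℂ {equator a, equator b} = ⊤ := by
  have ha : equator a ∈ Algebra.adjoin ℂ {equator a, equator b} :=
    Algebra.subset_adjoin (Or.inl rfl)
  have hb : equator b ∈ Algebra.adjoin ℂ {equator a, equator b} :=
    Algebra.subset_adjoin (Or.inr rfl)
  have h3 : σ₃ = (2 * Complex.I * Real.sin (b - a))⁻¹ •
      (equator a * equator b - equator b * equator a) := by
    have hs : (2 * Complex.I * Real.sin (b - a) : ℂ) ≠ 0 :=
      mul_ne_zero (mul_ne_zero two_ne_zero Complex.I_ne_zero) (Complex.ofReal_ne_zero.2 h)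
    rw [eq_inv_smul_iff₀ hs, equator_apply, equator_apply, Real.sin_sub]
    ext i j
    fin_cases i <;> fin_cases j <;>
      simp [σ₃, -Complex.ofReal_cos, -Complex.ofReal_sin] <;> ring
  have h0 : (Real.cos a : ℂ) * Real.cos a + Real.sin a * Real.sin a = 1 := by
    have := Real.cos_sq_add_sin_sq a
    rw [sq, sq] at this
    exact_mod_cast this
  refine eq_top_of_sigma_three_mem (N := equator a) ?_ ha ?_ ?_
  · rw [h3]
    exact Subalgebra.smul_mem _ (sub_mem (mul_mem ha hb) (mul_mem hb ha)) _
  · rw [equator_apply]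
    intro h1
    simp only [Matrix.of_apply, Matrix.cons_val_zero, Matrix.cons_val_one, Matrix.cons_val_fin_one]
      at h1
    refine one_ne_zero (α := ℂ) ?_
    linear_combination -h0 + ((Real.cos a : ℂ) + Real.sin a * Complex.I) * h1
      + (Real.sin a : ℂ) * Real.sin a * Complex.I_mul_I
  · rw [equator_apply]
    intro h1
    simp only [Matrix.of_apply, Matrix.cons_val_zero, Matrix.cons_val_one, Matrix.cons_val_fin_one]
      at h1
    refine one_ne_zero (α := ℂ) ?_
    linear_combination -h0 + ((Real.cos a : ℂ) - Real.sin a * Complex.I) * h1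
      + (Real.sin a : ℂ) * Real.sin a * Complex.I_mul_I

/-- The observables of two parties in equatorial directions. -/
noncomputable def equatorObs (a b : Fin 2 → ℝ) (k x : Fin 2) : QMat :=
  equator ((![a, b] k) x)

theorem corrFunctional_mulVec (a b : Fin 2 → ℝ) (c : Fin 2 → Fin 2 → ℝ)
    (v : (Fin 2 → Fin 2) → ℂ) (i j : Fin 2) :
    (bellMatrix (dichotomicMeas (equatorObs a b)) (corrFunctional c) *ᵥ v) ![i, j]
      = ∑ x, ∑ y, (c x y : ℂ) * ∑ k, ∑ l, equator (a x) i k * equator (b y) j l * v ![k, l] := by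
  simp only [corrFunctional, bellMatrix_sum, bellMatrix_smul, Matrix.sum_mulVec, Finset.sum_apply,
    Matrix.smul_mulVec, Pi.smul_apply, corr_mulVec, smul_eq_mul]
  rfl

/-- The four components of the action of a correlation functional on two qubits. -/
theorem corrFunctional_components (a b : Fin 2 → ℝ) (c : Fin 2 → Fin 2 → ℝ)
    {C S C' S' : ℝ} (hC : ∑ x, ∑ y, c x y * Real.cos (a x + b y) = C)
    (hS : ∑ x, ∑ y, c x y * Real.sin (a x + b y) = S)
    (hC' : ∑ x, ∑ y, c x y * Real.cos (a x - b y) = C')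
    (hS' : ∑ x, ∑ y, c x y * Real.sin (a x - b y) = S') (v : (Fin 2 → Fin 2) → ℂ) :
    let w := bellMatrix (dichotomicMeas (equatorObs a b)) (corrFunctional c) *ᵥ v
    w ![0, 0] = (C - S * Complex.I) * v ![1, 1] ∧ w ![1, 1] = (C + S * Complex.I) * v ![0, 0] ∧
    w ![0, 1] = (C' - S' * Complex.I) * v ![1, 0] ∧
      w ![1, 0] = (C' + S' * Complex.I) * v ![0, 1] := by
  have hC1 := congrArg Complex.ofReal hC
  have hS1 := congrArg Complex.ofReal hS
  have hC2 := congrArg Complex.ofReal hC'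
  have hS2 := congrArg Complex.ofReal hS'
  simp only [Complex.ofReal_mul, Real.cos_add, Real.sin_add, Real.cos_sub,
    Real.sin_sub, Complex.ofReal_add, Complex.ofReal_sub, Fin.sum_univ_two] at hC1 hS1 hC2 hS2
  refine ⟨?_, ?_, ?_, ?_⟩ <;> rw [corrFunctional_mulVec] <;>
    simp only [equator_apply, Fin.sum_univ_two, Matrix.of_apply, Matrix.cons_val_zero,
      Matrix.cons_val_one, Matrix.cons_val_fin_one]
  · rw [← hC1, ← hS1]
    ring_nf
    rw [Complex.I_sq]
    ring
  · rw [← hC1, ← hS1]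
    ring_nf
    rw [Complex.I_sq]
    ring
  · rw [← hC2, ← hS2]
    ring_nf
    rw [Complex.I_sq]
    ring
  · rw [← hC2, ← hS2]
    ring_nf
    rw [Complex.I_sq]
    ring

end Wbc

/-! ### Trigonometric identities and weights of the WBC functionals -/

section WbcComplex

section Trigonometry

variable (θ φ ω : ℝ)

theorem cos_mul_cos_sub_cos_mul_cos : Real.cos φ * Real.cos (θ + φ) - Real.cos ω * Real.cos (θ + ω)
    = Real.sin (θ + φ + ω) * Real.sin (ω - φ) := by
  have F := Real.cos_sq_add_sin_sq φ
  have W := Real.cos_sq_add_sin_sq ω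
  simp only [Real.cos_add, Real.sin_add, Real.sin_sub]
  linear_combination (-Real.cos θ * Real.cos φ ^ 2 + Real.sin θ * Real.cos φ * Real.sin φ) * W
    + (Real.cos θ * Real.cos ω ^ 2 - Real.sin θ * Real.cos ω * Real.sin ω) * F

theorem cos_mul_cos_sub_cos_add_mul_cos_add :
    Real.cos φ * Real.cos ω - Real.cos (θ + φ) * Real.cos (θ + ω)
      = Real.sin (θ + φ + ω) * Real.sin θ := by
  have Θ := Real.cos_sq_add_sin_sq θ
  simp only [Real.cos_add, Real.sin_add]
  linear_combination (-Real.cos φ * Real.cos ω) * Θ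

theorem cos_add_mul_cos_sub : Real.cos (θ + φ) * Real.cos ω - Real.cos φ * Real.cos (θ + ω)
    = Real.sin θ * Real.sin (ω - φ) := by
  simp only [Real.cos_add, Real.sin_sub]
  ring

theorem cos_mul_sin_add_sub : Real.cos ω * Real.sin (θ + ω) - Real.cos φ * Real.sin (θ + φ)
    = Real.cos (θ + φ + ω) * Real.sin (ω - φ) := by
  have F := Real.cos_sq_add_sin_sq φ
  have W := Real.cos_sq_add_sin_sq ω
  simp only [Real.cos_add, Real.sin_add, Real.sin_sub]
  linear_combination (-Real.cos θ * Real.cos ω * Real.sin ω - Real.sin θ * Real.cos ω ^ 2) * F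
    + (Real.cos θ * Real.cos φ * Real.sin φ + Real.sin θ * Real.cos φ ^ 2) * W

theorem cos_add_mul_sin_sub : Real.cos (θ + φ) * Real.sin φ - Real.cos (θ + ω) * Real.sin ω
    = -(Real.cos (θ + φ + ω) * Real.sin (ω - φ)) := by
  have F := Real.cos_sq_add_sin_sq φ
  have W := Real.cos_sq_add_sin_sq ω
  simp only [Real.cos_add, Real.sin_add, Real.sin_sub]
  linear_combination (-Real.cos θ * Real.cos φ * Real.sin φ + Real.sin θ * Real.sin φ ^ 2) * W
    + (Real.cos θ * Real.cos ω * Real.sin ω - Real.sin θ * Real.sin ω ^ 2) * F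

theorem cos_add_mul_cos_sub_sub : Real.cos (θ + φ) * Real.cos (θ - ω)
    - Real.cos (θ + ω) * Real.cos (θ - φ) = 2 * Real.sin θ * Real.cos θ * Real.sin (ω - φ) := by
  simp only [Real.cos_add, Real.cos_sub, Real.sin_sub]
  ring

theorem cos_add_mul_sin_sub_sub : Real.cos (θ + φ) * Real.sin (θ - ω)
    - Real.cos (θ + ω) * Real.sin (θ - φ)
      = -((Real.cos θ ^ 2 - Real.sin θ ^ 2) * Real.sin (ω - φ)) := by
  simp only [Real.cos_add, Real.sin_sub]
  ring

theorem cos_add_sq_add_cos_sq : Real.cos (θ + φ) ^ 2 + Real.cos φ ^ 2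
    - 2 * Real.cos (θ + φ) * Real.cos φ * Real.cos θ = Real.sin θ ^ 2 := by
  have Θ := Real.cos_sq_add_sin_sq θ
  have F := Real.cos_sq_add_sin_sq φ
  simp only [Real.cos_add]
  linear_combination -Real.cos φ ^ 2 * Θ + Real.sin θ ^ 2 * F

theorem cos_add_mul_cos_add_add : Real.cos (θ + φ) * Real.cos (θ + ω) + Real.cos φ * Real.cos ω
    - Real.cos θ * (Real.cos (θ + φ) * Real.cos ω + Real.cos φ * Real.cos (θ + ω))
      = Real.sin θ ^ 2 * Real.cos (ω - φ) := by
  have Θ := Real.cos_sq_add_sin_sq θ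
  simp only [Real.cos_add, Real.cos_sub]
  linear_combination -Real.cos φ * Real.cos ω * Θ

variable {θ φ ω}

/-- If one of these sines vanished, a product-to-sine identity would make two complementary factors
of the hypothesis equal, and their product would be a square. -/
theorem wbc_sin_ne_zero (h : Real.cos (θ + φ) * Real.cos φ * Real.cos (θ + ω) * Real.cos ω < 0) :
    Real.sin θ ≠ 0 ∧ Real.sin (ω - φ) ≠ 0 ∧ Real.sin (θ + φ + ω) ≠ 0 := by
  have h1 := cos_mul_cos_sub_cos_mul_cos θ φ ω
  have h2 := cos_mul_cos_sub_cos_add_mul_cos_add θ φ ω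
  have h3 : Real.cos φ * Real.cos ω * (Real.cos (θ + φ) * Real.cos (θ + ω)) < 0 := by linarith
  have h4 : Real.cos φ * Real.cos (θ + φ) * (Real.cos ω * Real.cos (θ + ω)) < 0 := by linarith
  refine ⟨fun h0 => ?_, fun h0 => ?_, fun h0 => ?_⟩
  · rw [h0, mul_zero, sub_eq_zero] at h2
    rw [h2] at h3
    exact h3.not_ge (mul_self_nonneg _)
  · rw [h0, mul_zero, sub_eq_zero] at h1
    rw [h1] at h4
    exact h4.not_ge (mul_self_nonneg _)
  · rw [h0, zero_mul, sub_eq_zero] at h1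
    rw [h1] at h4
    exact h4.not_ge (mul_self_nonneg _)

end Trigonometry

/-- The coefficients of the functional `B₁`. -/
noncomputable def wbcCoeff (θ φ ω : ℝ) : Fin 2 → Fin 2 → ℝ := fun x y =>
  (wbcBeta θ φ ω)⁻¹ *
    ![![Real.cos (θ + φ) * Real.cos (θ + ω) * Real.cos ω,
        -(Real.cos (θ + φ) * Real.cos (θ + ω) * Real.cos φ)],
      ![-(Real.cos φ * Real.cos ω * Real.cos (θ + ω)),
        Real.cos φ * Real.cos ω * Real.cos (θ + φ)]] x y

theorem wbcFunctional_eq (θ φ ω : ℝ) (p : Equiv.Perm (Fin 2)) (hp : ∀ x, p (p x) = x) :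
    wbcFunctional θ φ ω p = corrFunctional fun x y => wbcCoeff θ φ ω (p x) (p y) := by
  have e : corrFunctional (fun x y => wbcCoeff θ φ ω (p x) (p y))
      = ∑ x, ∑ y, wbcCoeff θ φ ω x y • corr (p x) (p y) := by
    rw [corrFunctional, ← Equiv.sum_comp p]
    refine Finset.sum_congr rfl fun x _ => ?_
    rw [← Equiv.sum_comp p]
    simp only [hp]
  rw [e, wbcFunctional]
  simp only [Fin.sum_univ_two, wbcCoeff, Matrix.cons_val_zero, Matrix.cons_val_one,
    Matrix.cons_val_fin_one]
  module

/-- These are the weights forced by `cancel` together with `t₀ + t₁ = 1`. They are positive because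
the hypothesis on the angles says that the two products `cos ω cos(θ+ω)` and `cos φ cos(θ+φ)` have
opposite signs. -/
noncomputable def wbcWeight (θ φ ω : ℝ) : Fin 2 → ℝ :=
  ![Real.cos ω * Real.cos (θ + ω) / (Real.cos ω * Real.cos (θ + ω) - Real.cos φ * Real.cos (θ + φ)),
    Real.cos φ * Real.cos (θ + φ) / (Real.cos φ * Real.cos (θ + φ) - Real.cos ω * Real.cos (θ + ω))]

theorem div_sub_pos_of_mul_neg {x y : ℝ} (h : x * y < 0) : 0 < x / (x - y) := by
  rcases mul_neg_iff.1 h with ⟨h1, h2⟩ | ⟨h1, h2⟩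
  · exact div_pos h1 (by linarith)
  · exact div_pos_of_neg_of_neg h1 (by linarith)

variable {θ φ ω : ℝ}

theorem wbcCoeff_weights
    (h : Real.cos (θ + φ) * Real.cos φ * Real.cos (θ + ω) * Real.cos ω < 0) :
    CorrWeights (wbcCoeff θ φ ω) (wbcWeight θ φ ω) (fun x =>
      wbcCoeff θ φ ω x 0 ^ 2 / wbcWeight θ φ ω 0 + wbcCoeff θ φ ω x 1 ^ 2 / wbcWeight θ φ ω 1) := by
  obtain ⟨hA, hB, hG⟩ := wbc_sin_ne_zero h
  have T1 := cos_mul_cos_sub_cos_mul_cos θ φ ω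
  have T2 := cos_mul_cos_sub_cos_add_mul_cos_add θ φ ω
  have T3 := cos_add_mul_cos_sub θ φ ω
  have hn := h.ne
  simp only [ne_eq, mul_eq_zero, not_or] at hn
  obtain ⟨⟨⟨hp, hf⟩, hq⟩, hw⟩ := hn
  have hβ : wbcBeta θ φ ω = Real.sin θ * Real.sin (ω - φ) * Real.sin (θ + φ + ω) := rfl
  have c00 : wbcCoeff θ φ ω 0 0
      = (wbcBeta θ φ ω)⁻¹ * (Real.cos (θ + φ) * Real.cos (θ + ω) * Real.cos ω) := rfl
  have c01 : wbcCoeff θ φ ω 0 1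
      = (wbcBeta θ φ ω)⁻¹ * (-(Real.cos (θ + φ) * Real.cos (θ + ω) * Real.cos φ)) := rfl
  have c10 : wbcCoeff θ φ ω 1 0
      = (wbcBeta θ φ ω)⁻¹ * (-(Real.cos φ * Real.cos ω * Real.cos (θ + ω))) := rfl
  have c11 : wbcCoeff θ φ ω 1 1
      = (wbcBeta θ φ ω)⁻¹ * (Real.cos φ * Real.cos ω * Real.cos (θ + φ)) := rfl
  rw [hβ] at c00 c01 c10 c11
  have t0 : wbcWeight θ φ ω 0 = Real.cos ω * Real.cos (θ + ω) /
    (Real.cos ω * Real.cos (θ + ω) - Real.cos φ * Real.cos (θ + φ)) := rfl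
  have t1 : wbcWeight θ φ ω 1 = Real.cos φ * Real.cos (θ + φ) /
    (Real.cos φ * Real.cos (θ + φ) - Real.cos ω * Real.cos (θ + ω)) := rfl
  generalize wbcCoeff θ φ ω = c at *
  generalize wbcWeight θ φ ω = t at *
  clear hβ
  generalize Real.cos (θ + φ) = p at *
  generalize Real.cos φ = f at *
  generalize Real.cos (θ + ω) = q at *
  generalize Real.cos ω = w at *
  generalize Real.sin θ = A at *
  generalize Real.sin (ω - φ) = B at *
  generalize Real.sin (θ + φ + ω) = G at *
  have T1' : w * q - f * p = -(G * B) := by linarith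
  have hGB : G * B ≠ 0 := mul_ne_zero hG hB
  have ht0 : 0 < w * q / (w * q - f * p) := div_sub_pos_of_mul_neg (by linarith)
  have ht1 : 0 < f * p / (f * p - w * q) := div_sub_pos_of_mul_neg (by linarith)
  have hβ0 : A * B * G ≠ 0 := mul_ne_zero (mul_ne_zero hA hB) hG
  have hx2 : ∀ {x : Fin 2}, x = 0 ∨ x = 1 := fun {x} => by fin_cases x <;> simp
  constructor
  · intro y
    rcases hx2 (x := y) with rfl | rfl
    · rw [t0]; exact ht0
    · rw [t1]; exact ht1
  · intro x
    have hc : c x 0 ≠ 0 ∧ c x 1 ≠ 0 := by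
      rcases hx2 (x := x) with rfl | rfl
      · rw [c00, c01]; constructor <;> simp [hp, hf, hq, hw, hA, hB, hG]
      · rw [c10, c11]; constructor <;> simp [hp, hf, hq, hw, hA, hB, hG]
    rw [t0, t1]
    exact add_pos (div_pos (sq_pos_of_ne_zero hc.1) ht0) (div_pos (sq_pos_of_ne_zero hc.2) ht1)
  · rw [t0, t1, T1', T1]
    field_simp
    linarith
  -- The expression factors as `(pw - fq)(fw - pq)`, and the factors are `AB` and `GA`. This
  -- explains the normalization `β = ABG`.
  · have key : f * p * (q ^ 2 + w ^ 2) - w * q * (p ^ 2 + f ^ 2) = A ^ 2 * (B * G) := by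
      have : f * p * (q ^ 2 + w ^ 2) - w * q * (p ^ 2 + f ^ 2)
          = (p * w - f * q) * (f * w - p * q) := by ring
      rw [this, T3, T2]
      ring
    rw [t0, t1, T1', T1, c00, c01, c10, c11]
    field_simp
    linear_combination key
  · rw [t0, t1, T1', T1, c00, c01, c10, c11]
    field_simp
    ring
  · intro x
    rfl

end WbcComplex

/-! ### The WBC complexes are rigid -/

section WbcRigidity

variable {θ φ ω : ℝ}

theorem wbcComplex_eq (θ φ ω : ℝ) : wbcComplex θ φ ω = pauliComplex
    (corrFunctional fun x y => wbcCoeff θ φ ω (Equiv.swap 0 1 x) (Equiv.swap 0 1 y))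
    (corrFunctional (wbcCoeff θ φ ω)) (equatorObs ![0, θ] ![φ, ω])
    (((√2)⁻¹ : ℝ) • (ket 0 0 + Complex.I • ket 1 1))
    (((√2)⁻¹ : ℝ) • (ket 0 0 - Complex.I • ket 1 1)) := by
  have hK : equatorObs ![0, θ] ![φ, ω] = ![![σ₁, Real.cos θ • σ₁ + Real.sin θ • σ₂],
      ![Real.cos φ • σ₁ + Real.sin φ • σ₂, Real.cos ω • σ₁ + Real.sin ω • σ₂]] := by
    ext1 k
    ext1 x
    fin_cases k <;> fin_cases x <;> simp [equatorObs, equator]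
  rw [wbcComplex, hK, wbcFunctional_eq _ _ _ _ fun x => by rw [← Equiv.Perm.mul_apply, Equiv.swap_mul_self, Equiv.Perm.one_apply],
    wbcFunctional_eq _ _ _ (Equiv.refl _) fun x => rfl]
  rfl

/-- These sums are the matrix elements on the span of `|00⟩, |11⟩`. Values `0, 1` mean that `φ₊, φ₋`
are eigenvectors of `B₁` with eigenvalues `1, -1`; the other pair gives the entries `a =
-cos(θ+φ+ω)` and `b = i sin(θ+φ+ω)` of `B₀`. -/
theorem wbcCoeff_sums (h : Real.cos (θ + φ) * Real.cos φ * Real.cos (θ + ω) * Real.cos ω < 0) :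
    (∑ x, ∑ y, wbcCoeff θ φ ω x y * Real.cos (![0, θ] x + ![φ, ω] y) = 0) ∧
    (∑ x, ∑ y, wbcCoeff θ φ ω x y * Real.sin (![0, θ] x + ![φ, ω] y) = 1) ∧
    (∑ x, ∑ y, wbcCoeff θ φ ω (Equiv.swap 0 1 x) (Equiv.swap 0 1 y) *
      Real.cos (![0, θ] x + ![φ, ω] y) = Real.sin (θ + φ + ω)) ∧
    (∑ x, ∑ y, wbcCoeff θ φ ω (Equiv.swap 0 1 x) (Equiv.swap 0 1 y) *
      Real.sin (![0, θ] x + ![φ, ω] y) = -Real.cos (θ + φ + ω)) := by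
  obtain ⟨hA, hB, hG⟩ := wbc_sin_ne_zero h
  have T1 := cos_mul_cos_sub_cos_mul_cos θ φ ω
  have T2 := cos_mul_cos_sub_cos_add_mul_cos_add θ φ ω
  have X1 := cos_mul_sin_add_sub θ φ ω
  have X2 := cos_add_mul_sin_sub θ φ ω
  have S1 : Real.cos (θ + φ) * Real.sin (θ + ω) - Real.cos (θ + ω) * Real.sin (θ + φ)
      = Real.sin (ω - φ) := by
    have := Real.sin_sub (θ + ω) (θ + φ)
    rw [show θ + ω - (θ + φ) = ω - φ by ring] at this
    linarith
  have S2 := Real.sin_sub ω φ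
  have hβ : wbcBeta θ φ ω = Real.sin θ * Real.sin (ω - φ) * Real.sin (θ + φ + ω) := rfl
  have hβ0 : wbcBeta θ φ ω ≠ 0 := by
    rw [hβ]; exact mul_ne_zero (mul_ne_zero hA hB) hG
  simp only [Fin.sum_univ_two, wbcCoeff, Matrix.cons_val_zero, Matrix.cons_val_one,
    Matrix.cons_val_fin_one, Equiv.swap_apply_left, Equiv.swap_apply_right, zero_add]
  refine ⟨by ring, ?_, ?_, ?_⟩
  · refine mul_left_cancel₀ hβ0 ?_
    rw [mul_one]
    simp only [mul_add, ← mul_assoc, mul_inv_cancel₀ hβ0, one_mul]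
    rw [hβ]
    linear_combination (Real.cos (θ + φ) * Real.cos (θ + ω)) * S2
      + (Real.cos φ * Real.cos ω) * S1 + Real.sin (ω - φ) * T2
  · refine mul_left_cancel₀ hβ0 ?_
    simp only [mul_add, ← mul_assoc, mul_inv_cancel₀ hβ0, one_mul]
    rw [hβ]
    linear_combination (Real.cos φ * Real.cos ω - Real.cos (θ + φ) * Real.cos (θ + ω)) * T1
      + Real.sin (θ + φ + ω) * Real.sin (ω - φ) * T2
  · refine mul_left_cancel₀ hβ0 ?_
    simp only [mul_add, ← mul_assoc, mul_inv_cancel₀ hβ0, one_mul]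
    rw [hβ]
    linear_combination (Real.cos (θ + φ) * Real.cos (θ + ω)) * X1
      + (Real.cos φ * Real.cos ω) * X2 - Real.cos (θ + φ + ω) * Real.sin (ω - φ) * T2

/-- On the span of `|01⟩, |10⟩` the operator `B₁` is off-diagonal and this is the squared modulus of
its entry, so `1` is not an eigenvalue there. Indeed `β²` times the difference from `1` is `4 sin²θ
sin²(ω-φ)` times the negative product in the hypothesis. -/
theorem wbcCoeff_cross_sums
    (h : Real.cos (θ + φ) * Real.cos φ * Real.cos (θ + ω) * Real.cos ω < 0) :
    (∑ x, ∑ y, wbcCoeff θ φ ω x y * Real.cos (![0, θ] x - ![φ, ω] y)) ^ 2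
      + (∑ x, ∑ y, wbcCoeff θ φ ω x y * Real.sin (![0, θ] x - ![φ, ω] y)) ^ 2 ≠ 1 := by
  obtain ⟨hA, hB, hG⟩ := wbc_sin_ne_zero h
  have T2 := cos_mul_cos_sub_cos_add_mul_cos_add θ φ ω
  have Y1 := cos_add_mul_cos_sub_sub θ φ ω
  have Y2 := cos_add_mul_sin_sub_sub θ φ ω
  have S2 := Real.sin_sub ω φ
  have Θ := Real.cos_sq_add_sin_sq θ
  have hβ : wbcBeta θ φ ω = Real.sin θ * Real.sin (ω - φ) * Real.sin (θ + φ + ω) := rfl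
  have hβ0 : wbcBeta θ φ ω ≠ 0 := by
    rw [hβ]; exact mul_ne_zero (mul_ne_zero hA hB) hG
  have e1 : ∑ x, ∑ y, wbcCoeff θ φ ω x y * Real.cos (![0, θ] x - ![φ, ω] y)
      = (wbcBeta θ φ ω)⁻¹ * (Real.cos φ * Real.cos ω *
        (2 * Real.sin θ * Real.cos θ * Real.sin (ω - φ))) := by
    simp only [Fin.sum_univ_two, wbcCoeff, Matrix.cons_val_zero, Matrix.cons_val_one,
      Matrix.cons_val_fin_one, zero_sub, Real.cos_neg]
    rw [← Y1]
    ring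
  have e2 : ∑ x, ∑ y, wbcCoeff θ φ ω x y * Real.sin (![0, θ] x - ![φ, ω] y)
      = (wbcBeta θ φ ω)⁻¹ * (Real.sin (ω - φ) * (Real.cos (θ + φ) * Real.cos (θ + ω)
        - Real.cos φ * Real.cos ω * (Real.cos θ ^ 2 - Real.sin θ ^ 2))) := by
    simp only [Fin.sum_univ_two, wbcCoeff, Matrix.cons_val_zero, Matrix.cons_val_one,
      Matrix.cons_val_fin_one, zero_sub, Real.sin_neg]
    linear_combination (wbcBeta θ φ ω)⁻¹ * (Real.cos φ * Real.cos ω) * Y2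
      - (wbcBeta θ φ ω)⁻¹ * (Real.cos (θ + φ) * Real.cos (θ + ω)) * S2
  rw [e1, e2]
  intro h1
  rw [mul_pow, mul_pow (wbcBeta θ φ ω)⁻¹, ← mul_add, inv_pow, inv_mul_eq_iff_eq_mul₀ (pow_ne_zero 2 hβ0), mul_one, hβ]
    at h1
  have h2 : Real.sin (ω - φ) ^ 2 * (4 * (Real.cos (θ + φ) * Real.cos φ * Real.cos (θ + ω) *
      Real.cos ω) * Real.sin θ ^ 2) = 0 := by
    linear_combination h1 - Real.sin (ω - φ) ^ 2 * (Real.cos φ * Real.cos ω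
        - Real.cos (θ + φ) * Real.cos (θ + ω) + Real.sin (θ + φ + ω) * Real.sin θ) * T2
      - Real.sin (ω - φ) ^ 2 * ((Real.cos φ * Real.cos ω) ^ 2 *
        (Real.cos θ ^ 2 + Real.sin θ ^ 2 + 1) - 2 * (Real.cos φ * Real.cos ω) *
          (Real.cos (θ + φ) * Real.cos (θ + ω))) * Θ
  have h3 := (mul_eq_zero.1 h2).resolve_left (pow_ne_zero 2 hB)
  have h4 := (mul_eq_zero.1 h3).resolve_right (pow_ne_zero 2 hA)
  linarith

noncomputable def wbcPlus : (Fin 2 → Fin 2) → ℂ := ((√2)⁻¹ : ℝ) • (ket 0 0 + Complex.I • ket 1 1)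

noncomputable def wbcMinus : (Fin 2 → Fin 2) → ℂ := ((√2)⁻¹ : ℝ) • (ket 0 0 - Complex.I • ket 1 1)

theorem wbcPlus_apply (i j : Fin 2) : wbcPlus ![i, j] = (((√2)⁻¹ : ℝ) : ℂ) *
    if i = j then (if i = 0 then 1 else Complex.I) else 0 := by
  simp only [wbcPlus, Pi.add_apply, Pi.smul_apply, ket_apply, Complex.real_smul]
  fin_cases i <;> fin_cases j <;> simp

theorem wbcMinus_apply (i j : Fin 2) : wbcMinus ![i, j] = (((√2)⁻¹ : ℝ) : ℂ) *
    if i = j then (if i = 0 then 1 else -Complex.I) else 0 := by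
  simp only [wbcMinus, Pi.sub_apply, Pi.smul_apply, ket_apply, Complex.real_smul]
  fin_cases i <;> fin_cases j <;> simp

theorem ofReal_inv_sqrt_two_mul_self : (((√2)⁻¹ : ℝ) : ℂ) * (((√2)⁻¹ : ℝ) : ℂ) = 2⁻¹ := by
  rw [← Complex.ofReal_mul, ← mul_inv, Real.mul_self_sqrt (by norm_num)]
  norm_num

theorem equatorObs_irreducible (h : Real.sin θ ≠ 0) (h' : Real.sin (ω - φ) ≠ 0) (k : Fin 2) :
    Algebra.adjoin ℂ {equatorObs ![0, θ] ![φ, ω] k 0, equatorObs ![0, θ] ![φ, ω] k 1} = ⊤ := by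
  fin_cases k
  · exact equator_irreducible (a := 0) (b := θ) (by simpa using h)
  · exact equator_irreducible (a := φ) (b := ω) h'

theorem wbcB₁_fixed (h : Real.cos (θ + φ) * Real.cos φ * Real.cos (θ + ω) * Real.cos ω < 0)
    {v : (Fin 2 → Fin 2) → ℂ} (hv : bellMatrix (dichotomicMeas (equatorObs ![0, θ] ![φ, ω]))
      (corrFunctional (wbcCoeff θ φ ω)) *ᵥ v = v) :
    v = (v ![0, 0] * (√2 : ℝ)) • wbcPlus := by
  obtain ⟨hC, hS, -, -⟩ := wbcCoeff_sums h
  have hz := wbcCoeff_cross_sums h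
  obtain ⟨e00, e11, e01, e10⟩ := corrFunctional_components _ _ _ hC hS rfl rfl v
  rw [hv] at e00 e11 e01 e10
  generalize ∑ x, ∑ y, wbcCoeff θ φ ω x y * Real.cos (![0, θ] x - ![φ, ω] y) = C' at *
  generalize ∑ x, ∑ y, wbcCoeff θ φ ω x y * Real.sin (![0, θ] x - ![φ, ω] y) = S' at *
  have hz' : (C' : ℂ) ^ 2 + (S' : ℂ) ^ 2 - 1 ≠ 0 := by
    intro h0
    exact hz (by exact_mod_cast sub_eq_zero.1 h0)
  have k1 : v ![0, 1] = 0 := by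
    refine (mul_eq_zero.1 ?_).resolve_left hz'
    linear_combination -e01 - ((C' : ℂ) - S' * Complex.I) * e10
      + (S' : ℂ) ^ 2 * v ![0, 1] * Complex.I_mul_I
  have k2 : v ![1, 0] = 0 := by rw [e10, k1, mul_zero]
  have hs : ((√2 : ℝ) : ℂ) * (((√2)⁻¹ : ℝ) : ℂ) = 1 := by
    rw [← Complex.ofReal_mul, mul_inv_cancel₀ (by positivity), Complex.ofReal_one]
  refine ext_fin_two ?_ ?_ ?_ ?_
  · simp only [Pi.smul_apply, wbcPlus_apply, smul_eq_mul, if_true]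
    linear_combination -v ![0, 0] * hs
  · simpa [wbcPlus_apply] using k1
  · simpa [wbcPlus_apply] using k2
  · simp only [Pi.smul_apply, wbcPlus_apply, smul_eq_mul, if_true, one_ne_zero, if_false]
    simp only [Complex.ofReal_zero, Complex.ofReal_one] at e11
    linear_combination e11 - v ![0, 0] * Complex.I * hs

/-- These are the inputs of `corr_anticommutators` with `κ = cos θ` and `κ' = cos(ω - φ)`, the
values of the qubit observables, and the nonvanishing determinant that allows Alice's observables to
be solved for in terms of Bob's. -/
theorem wbcCoeff_relations
    (h : Real.cos (θ + φ) * Real.cos φ * Real.cos (θ + ω) * Real.cos ω < 0) :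
    wbcCoeff θ φ ω 0 0 * wbcCoeff θ φ ω 1 0 ≠ 0 ∧
    2 * (wbcCoeff θ φ ω 0 0 * wbcCoeff θ φ ω 1 0) * Real.cos θ
      = wbcWeight θ φ ω 0 ^ 2 - wbcCoeff θ φ ω 0 0 ^ 2 - wbcCoeff θ φ ω 1 0 ^ 2 ∧
    wbcWeight θ φ ω 0 * wbcWeight θ φ ω 1 * Real.cos (ω - φ)
      = wbcCoeff θ φ ω 0 0 * wbcCoeff θ φ ω 0 1 + wbcCoeff θ φ ω 1 0 * wbcCoeff θ φ ω 1 1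
        + (wbcCoeff θ φ ω 0 0 * wbcCoeff θ φ ω 1 1 + wbcCoeff θ φ ω 0 1 * wbcCoeff θ φ ω 1 0) *
          Real.cos θ ∧
    wbcCoeff θ φ ω 0 0 * wbcCoeff θ φ ω 1 1 - wbcCoeff θ φ ω 0 1 * wbcCoeff θ φ ω 1 0 ≠ 0 := by
  obtain ⟨hA, hB, hG⟩ := wbc_sin_ne_zero h
  have T1 := cos_mul_cos_sub_cos_mul_cos θ φ ω
  have T3 := cos_add_mul_cos_sub θ φ ω
  have K2 := cos_add_sq_add_cos_sq θ φ
  have K3 := cos_add_mul_cos_add_add θ φ ω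
  have hn := h.ne
  simp only [ne_eq, mul_eq_zero, not_or] at hn
  obtain ⟨⟨⟨hp, hf⟩, hq⟩, hw⟩ := hn
  have T1' : Real.cos ω * Real.cos (θ + ω) - Real.cos φ * Real.cos (θ + φ)
    = -(Real.sin (θ + φ + ω) * Real.sin (ω - φ)) := by linarith
  have hβ : wbcBeta θ φ ω = Real.sin θ * Real.sin (ω - φ) * Real.sin (θ + φ + ω) := rfl
  simp only [wbcCoeff, wbcWeight, Matrix.cons_val_zero, Matrix.cons_val_one, Matrix.cons_val_fin_one,
    T1, T1', hβ]
  clear hβ T1 T1' h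
  generalize Real.cos (θ + φ) = p at *
  generalize Real.cos φ = f at *
  generalize Real.cos (θ + ω) = q at *
  generalize Real.cos ω = w at *
  generalize Real.sin θ = A at *
  generalize Real.sin (ω - φ) = B at *
  generalize Real.sin (θ + φ + ω) = G at *
  generalize Real.cos θ = c at *
  generalize Real.cos (ω - φ) = d at *
  refine ⟨by simp [hA, hB, hG, hp, hf, hq, hw], ?_, ?_, ?_⟩
  · field_simp
    linear_combination K2
  · field_simp
    linear_combination K3
  · have e : (A * B * G)⁻¹ * (p * q * w) * ((A * B * G)⁻¹ * (f * w * p))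
        - (A * B * G)⁻¹ * -(p * q * f) * ((A * B * G)⁻¹ * -(f * w * q))
        = ((A * B * G)⁻¹) ^ 2 * (p * q * f * w) * (p * w - f * q) := by ring
    rw [e, T3]
    simp [hA, hB, hG, hp, hf, hq, hw]

theorem wbcComplex_isRigid
    (h : Real.cos (θ + φ) * Real.cos φ * Real.cos (θ + ω) * Real.cos ω < 0) :
    QubitComplex.IsRigid.{u} (wbcComplex θ φ ω) ![1, 0] := by
  obtain ⟨hA, hB, hG⟩ := wbc_sin_ne_zero h
  obtain ⟨hC, hS, hC₀, hS₀⟩ := wbcCoeff_sums h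
  have hw := wbcCoeff_weights h
  obtain ⟨r0, r1, r2, r3⟩ := wbcCoeff_relations h
  have h2 := ofReal_inv_sqrt_two_mul_self
  have c1 := corrFunctional_components _ _ _ hC hS rfl rfl
  have c0 := corrFunctional_components _ _ _ hC₀ hS₀ rfl rfl
  have hpp : star wbcPlus ⬝ᵥ wbcPlus = 1 := by
    rw [dotProduct_fin_two_arrow]
    simp [wbcPlus_apply, -Complex.ofReal_inv]
    linear_combination 2 * h2 - (((√2)⁻¹ : ℝ) : ℂ) ^ 2 * Complex.I_mul_I
  have hobs : ∀ k x, (equatorObs ![0, θ] ![φ, ω] k x).IsHermitian := fun k x =>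
    equator_isHermitian _
  have hsq : ∀ k x, equatorObs ![0, θ] ![φ, ω] k x * equatorObs ![0, θ] ![φ, ω] k x = 1 :=
    fun k x => equator_mul_self _
  rw [wbcComplex_eq]
  refine pauliComplex_isRigid (φp := wbcPlus) (φm := wbcMinus) hobs hsq
    (equatorObs_irreducible hA hB) hpp ?_ ?_ ?_ ?_ (-Real.cos (θ + φ + ω))
    (Real.sin (θ + φ + ω) * Complex.I) ?_ ?_ ?_ ?_ ?_ ?_
  · rw [dotProduct_fin_two_arrow]
    simp [wbcMinus_apply, -Complex.ofReal_inv]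
    linear_combination 2 * h2 - (((√2)⁻¹ : ℝ) : ℂ) ^ 2 * Complex.I_mul_I
  · rw [dotProduct_fin_two_arrow]
    simp [wbcPlus_apply, wbcMinus_apply, -Complex.ofReal_inv]
    linear_combination (((√2)⁻¹ : ℝ) : ℂ) ^ 2 * Complex.I_mul_I
  · obtain ⟨e00, e11, e01, e10⟩ := c1 wbcPlus
    refine ext_fin_two ?_ ?_ ?_ ?_
    · rw [e00]
      simp [wbcPlus_apply, -Complex.ofReal_inv]
      linear_combination -(((√2)⁻¹ : ℝ) : ℂ) * Complex.I_mul_I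
    · rw [e01]; simp [wbcPlus_apply]
    · rw [e10]; simp [wbcPlus_apply]
    · rw [e11]
      simp [wbcPlus_apply, -Complex.ofReal_inv]
      ring
  · obtain ⟨e00, e11, e01, e10⟩ := c1 wbcMinus
    refine ext_fin_two ?_ ?_ ?_ ?_
    · rw [e00]
      simp [wbcMinus_apply, -Complex.ofReal_inv]
      linear_combination (((√2)⁻¹ : ℝ) : ℂ) * Complex.I_mul_I
    · rw [e01]; simp [wbcMinus_apply]
    · rw [e10]; simp [wbcMinus_apply]
    · rw [e11]
      simp [wbcMinus_apply, -Complex.ofReal_inv]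
      ring
  · exact mul_ne_zero (Complex.ofReal_ne_zero.2 hG) Complex.I_ne_zero
  · have := congrArg Complex.ofReal (Real.cos_sq_add_sin_sq (θ + φ + ω))
    simp only [Complex.ofReal_add, Complex.ofReal_pow, Complex.ofReal_one] at this
    simp only [star_mul', RCLike.star_def, Complex.conj_I, Complex.conj_ofReal, Complex.ofReal_neg]
    linear_combination this - (Real.sin (θ + φ + ω) : ℂ) ^ 2 * Complex.I_mul_I
  · obtain ⟨e00, e11, e01, e10⟩ := c0 wbcPlus
    refine ext_fin_two ?_ ?_ ?_ ?_
    · rw [e00]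
      simp [wbcPlus_apply, wbcMinus_apply, -Complex.ofReal_inv, -Complex.ofReal_cos,
        -Complex.ofReal_sin]
      linear_combination (((√2)⁻¹ : ℝ) : ℂ) * Real.cos (θ + φ + ω) * Complex.I_mul_I
    · rw [e01]; simp [wbcPlus_apply, wbcMinus_apply]
    · rw [e10]; simp [wbcPlus_apply, wbcMinus_apply]
    · rw [e11]
      simp [wbcPlus_apply, wbcMinus_apply, -Complex.ofReal_inv, -Complex.ofReal_cos,
        -Complex.ofReal_sin]
      linear_combination (((√2)⁻¹ : ℝ) : ℂ) * Real.sin (θ + φ + ω) * Complex.I_mul_I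
  · obtain ⟨e00, e11, e01, e10⟩ := c0 wbcMinus
    refine ext_fin_two ?_ ?_ ?_ ?_
    · rw [e00]
      simp [wbcPlus_apply, wbcMinus_apply, -Complex.ofReal_inv, -Complex.ofReal_cos,
        -Complex.ofReal_sin]
      linear_combination -(((√2)⁻¹ : ℝ) : ℂ) * Real.cos (θ + φ + ω) * Complex.I_mul_I
    · rw [e01]; simp [wbcPlus_apply, wbcMinus_apply]
    · rw [e10]; simp [wbcPlus_apply, wbcMinus_apply]
    · rw [e11]
      simp [wbcPlus_apply, wbcMinus_apply, -Complex.ofReal_inv, -Complex.ofReal_cos,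
        -Complex.ofReal_sin]
      linear_combination (((√2)⁻¹ : ℝ) : ℂ) * Real.sin (θ + φ + ω) * Complex.I_mul_I
  · intro T _ _ _ A y
    have hy : y = 0 ∨ y = 1 := by fin_cases y <;> simp
    rcases hy with rfl | rfl
    · simp only [Matrix.cons_val_zero]
      rw [A.bell_corrFunctional]
      exact corrOp_normalized hw.swap (A.isObservable 0) (A.isObservable 1) fun x y =>
        A.K_commute zero_ne_one x y
    · simp only [Matrix.cons_val_one, Matrix.cons_val_fin_one]
      rw [A.bell_corrFunctional]
      exact corrOp_normalized hw (A.isObservable 0) (A.isObservable 1) fun x y =>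
        A.K_commute zero_ne_one x y
  · intro T _ _ _ A ψ hψ hval
    have hval' := hval
    rw [A.bell_corrFunctional] at hval'
    have hc : ∀ x y, Commute (A.K 0 x) (A.K 1 y) := fun x y => A.K_commute zero_ne_one x y
    obtain ⟨hM, hK2, hL2⟩ := corr_relations hw (A.isObservable 0) (A.isObservable 1) hc hval'
    obtain ⟨han, han'⟩ := corr_anticommutators hw (A.isObservable 0) (A.isObservable 1) hc hval'
      (κ := Real.cos θ) (κ' := Real.cos (ω - φ)) r0 r1 r2
    refine exists_embeds A hψ hobs hsq (κ := ![(Real.cos θ : ℂ), (Real.cos (ω - φ) : ℂ)]) ?_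
      (equatorObs_irreducible hA hB) ?_ ?_ ?_ hpp fun v hv => ⟨_, wbcB₁_fixed h (hv _ hval)⟩
    · intro k
      fin_cases k
      · have e := equator_mul_add 0 θ
        rw [sub_zero] at e
        exact e
      · exact equator_mul_add φ ω
    · intro k x
      generalize wbcCoeff θ φ ω = c at hM r3
      have ht := hw.pos
      generalize wbcWeight θ φ ω = t at hM ht
      -- The two equations `M_yψ = t_yL_yψ` are solved for `K₀ψ` and `K₁ψ` by Cramer's rule.
      have hd : ((c 0 0 * c 1 1 - c 0 1 * c 1 0 : ℝ) : ℂ) ≠ 0 := Complex.ofReal_ne_zero.2 r3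
      have hM' : ∀ y, (c 0 y : ℂ) • A.K 0 0 ψ + (c 1 y : ℂ) • A.K 0 1 ψ = (t y : ℂ) • A.K 1 y ψ := hM
      have hk : k = 0 ∨ k = 1 := by fin_cases k <;> simp
      rcases hk with rfl | rfl
      · have hx : x = 0 ∨ x = 1 := by fin_cases x <;> simp
        rcases hx with rfl | rfl
        · refine ⟨((c 0 0 * c 1 1 - c 0 1 * c 1 0 : ℝ) : ℂ)⁻¹ •
            ((c 1 1 * t 0 : ℂ) • A.K 1 0 - (c 1 0 * t 1 : ℂ) • A.K 1 1), fun y =>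
            (((hc y 0).symm.smul_left _).sub_left ((hc y 1).symm.smul_left _)).smul_left _, ?_⟩
          rw [smul_apply, eq_inv_smul_iff₀ hd, sub_apply, smul_apply, smul_apply]
          push_cast
          linear_combination (norm := module) (c 1 1 : ℂ) • hM' 0 - (c 1 0 : ℂ) • hM' 1
        · refine ⟨((c 0 0 * c 1 1 - c 0 1 * c 1 0 : ℝ) : ℂ)⁻¹ •
            ((c 0 0 * t 1 : ℂ) • A.K 1 1 - (c 0 1 * t 0 : ℂ) • A.K 1 0), fun y =>
            (((hc y 1).symm.smul_left _).sub_left ((hc y 0).symm.smul_left _)).smul_left _, ?_⟩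
          rw [smul_apply, eq_inv_smul_iff₀ hd, sub_apply, smul_apply, smul_apply]
          push_cast
          linear_combination (norm := module) (c 0 0 : ℂ) • hM' 1 - (c 0 1 : ℂ) • hM' 0
      · refine ⟨(t x : ℂ)⁻¹ • ((c 0 x : ℂ) • A.K 0 0 + (c 1 x : ℂ) • A.K 0 1), fun y =>
          (((hc 0 y).smul_left _).add_left ((hc 1 y).smul_left _)).smul_left _, ?_⟩
        rw [smul_apply, eq_inv_smul_iff₀ (Complex.ofReal_ne_zero.2 (ht x).ne'), add_apply,
          smul_apply, smul_apply, hM']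
    · intro k x
      have hk : k = 0 ∨ k = 1 := by fin_cases k <;> simp
      rcases hk with rfl | rfl
      · exact hK2 x
      · exact hL2 x
    · intro k
      have hk : k = 0 ∨ k = 1 := by fin_cases k <;> simp
      rcases hk with rfl | rfl
      · exact han
      · exact han'

end WbcRigidity

/-! ### Graph states -/

section GraphStates

variable {ι : Type} [Fintype ι] [DecidableEq ι]

theorem mem_nbrs {G : SimpleGraph ι} {i k : ι} : k ∈ nbrs G i ↔ G.Adj i k := by
  simp [nbrs]

theorem notMem_nbrs_self (G : SimpleGraph ι) (i : ι) : i ∉ nbrs G i := by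
  simp [mem_nbrs]

theorem fin_two_eq (x : Fin 2) : x = 0 ∨ x = 1 := by fin_cases x <;> simp

/-- Flip the bit at `i`. -/
def flipBit (i : ι) (x : ι → Fin 2) : ι → Fin 2 := Function.update x i (1 - x i)

/-- Raising the bit at `i` adds exactly the edges from `i` to neighbours already in the support. It
yields the sign in the stabilizer relation. -/
theorem edgeCount_update (G : SimpleGraph ι) (i : ι) (x : ι → Fin 2) :
    edgeCount G (Function.update x i 1) = edgeCount G (Function.update x i 0)
      + ((nbrs G i).filter fun k => x k = 1).card := by
  classical
  rw [edgeCount, edgeCount]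
  have hinj : Set.InjOn (fun k => s(i, k)) ((nbrs G i).filter fun k => x k = 1 : Finset ι) :=
    fun k _ l _ h => Sym2.congr_right.1 h
  rw [← Finset.card_image_of_injOn hinj, ← Finset.card_union_of_disjoint]
  · congr 1
    ext e
    induction e using Sym2.ind with
    | _ a b =>
    simp only [Finset.mem_filter, Finset.mem_univ, true_and, SimpleGraph.mem_edgeSet, Sym2.mem_iff,
      forall_eq_or_imp, forall_eq, Finset.mem_union, Finset.mem_image, mem_nbrs, Sym2.eq_iff]
    constructor
    · rintro ⟨hab, ha, hb⟩
      by_cases hai : a = i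
      · subst hai
        have hba : b ≠ a := hab.ne'
        rw [Function.update_of_ne hba] at hb
        exact Or.inr ⟨b, ⟨hab, hb⟩, Or.inl ⟨rfl, rfl⟩⟩
      · by_cases hbi : b = i
        · subst hbi
          rw [Function.update_of_ne hai] at ha
          exact Or.inr ⟨a, ⟨hab.symm, ha⟩, Or.inr ⟨rfl, rfl⟩⟩
        · rw [Function.update_of_ne hai] at ha
          rw [Function.update_of_ne hbi] at hb
          refine Or.inl ⟨hab, ?_, ?_⟩
          · rwa [Function.update_of_ne hai]
          · rwa [Function.update_of_ne hbi]
    · rintro (⟨hab, ha, hb⟩ | ⟨k, ⟨hik, hk⟩, ⟨rfl, rfl⟩ | ⟨rfl, rfl⟩⟩)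
      · have hai : a ≠ i := by
          rintro rfl
          simp at ha
        have hbi : b ≠ i := by
          rintro rfl
          simp at hb
        rw [Function.update_of_ne hai] at ha
        rw [Function.update_of_ne hbi] at hb
        refine ⟨hab, ?_, ?_⟩
        · rwa [Function.update_of_ne hai]
        · rwa [Function.update_of_ne hbi]
      · refine ⟨hik, by simp, ?_⟩
        rwa [Function.update_of_ne hik.ne']
      · refine ⟨hik.symm, ?_, by simp⟩
        rwa [Function.update_of_ne hik.ne']
  · rw [Finset.disjoint_left]
    intro e he he'
    simp only [Finset.mem_filter, Finset.mem_univ, true_and] at he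
    obtain ⟨k, -, rfl⟩ := Finset.mem_image.1 he'
    have := he.2 i (Sym2.mem_mk_left i k)
    simp at this

theorem prod_ite_neg_one (s : Finset ι) (x : ι → Fin 2) :
    (∏ k ∈ s, if x k = 1 then (-1 : ℂ) else 1) = (-1) ^ (s.filter fun k => x k = 1).card := by
  rw [Finset.prod_ite]
  simp

theorem neg_one_pow_edgeCount_flip (G : SimpleGraph ι) (i : ι) (x : ι → Fin 2) :
    (-1 : ℂ) ^ edgeCount G (flipBit i x)
      = (∏ k ∈ nbrs G i, if x k = 1 then (-1 : ℂ) else 1) * (-1) ^ edgeCount G x := by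
  have h := edgeCount_update G i x
  rw [prod_ite_neg_one]
  rcases fin_two_eq (x i) with hx | hx
  · have e1 : flipBit i x = Function.update x i 1 := by rw [flipBit, hx]; rfl
    have e2 : Function.update x i 0 = x := by rw [← hx, Function.update_eq_self]
    rw [e1, h, e2, pow_add, mul_comm]
  · have e1 : flipBit i x = Function.update x i 0 := by rw [flipBit, hx]; rfl
    have e2 : Function.update x i 1 = x := by rw [← hx, Function.update_eq_self]
    rw [e2] at h
    rw [e1, h, pow_add, mul_left_comm, ← pow_add, ← two_mul, pow_mul]
    simp

theorem neg_one_pow_sum_flip (i : ι) (x : ι → Fin 2) :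
    (-1 : ℂ) ^ (∑ k, (flipBit i x k : ℕ)) = -(-1) ^ (∑ k, (x k : ℕ)) := by
  rw [← Finset.add_sum_erase _ _ (Finset.mem_univ i), ← Finset.add_sum_erase _ (fun k => (x k : ℕ))
    (Finset.mem_univ i)]
  have e : ∑ k ∈ Finset.univ.erase i, (flipBit i x k : ℕ) = ∑ k ∈ Finset.univ.erase i, (x k : ℕ) := by
    refine Finset.sum_congr rfl fun k hk => ?_
    rw [flipBit, Function.update_of_ne (Finset.ne_of_mem_erase hk)]
  rw [e, pow_add, pow_add]
  rcases fin_two_eq (x i) with hx | hx <;> simp [flipBit, hx]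

/-- The stabilizer element of the vertex `i`, as a product operator. -/
noncomputable def stabSite (G : SimpleGraph ι) (i k : ι) : QMat :=
  if k = i then σ₁ else if k ∈ nbrs G i then σ₃ else 1

/-- The factor `σ₁` flips the bit at `i`, while the factors `σ₃` contribute a sign for each raised
neighbour; only one column of the matrix row survives. -/
theorem stab_mulVec (G : SimpleGraph ι) (i : ι) (w : (ι → Fin 2) → ℂ) (x : ι → Fin 2) :
    (tensorMatrix (stabSite G i) *ᵥ w) x
      = (∏ k ∈ nbrs G i, if x k = 1 then (-1 : ℂ) else 1) * w (flipBit i x) := by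
  rw [Matrix.mulVec, dotProduct, Finset.sum_eq_single (flipBit i x)]
  · congr 1
    rw [tensorMatrix, Matrix.of_apply, ← Finset.prod_subset (Finset.subset_univ (nbrs G i))]
    · refine Finset.prod_congr rfl fun k hk => ?_
      have hki : k ≠ i := fun h => notMem_nbrs_self G i (h ▸ hk)
      rcases fin_two_eq (x k) with hx | hx <;> simp [stabSite, hki, hk, flipBit, hx, σ₃]
    · intro k _ hk
      by_cases hki : k = i
      · subst hki
        rcases fin_two_eq (x k) with hx | hx <;> simp [stabSite, flipBit, hx, σ₁]
      · have hx : flipBit i x k = x k := Function.update_of_ne hki _ _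
        rw [stabSite, if_neg hki, if_neg hk, hx, Matrix.one_apply_eq]
  · intro y _ hy
    obtain ⟨k, hk⟩ := Function.ne_iff.1 hy
    rw [tensorMatrix, Matrix.of_apply, Finset.prod_eq_zero (Finset.mem_univ k), zero_mul]
    by_cases hki : k = i
    · subst hki
      rcases fin_two_eq (x k) with hx | hx <;> rcases fin_two_eq (y k) with hyk | hyk <;>
        simp_all [stabSite, flipBit, σ₁]
    · by_cases hkn : k ∈ nbrs G i <;> rcases fin_two_eq (x k) with hx | hx <;>
        rcases fin_two_eq (y k) with hyk | hyk <;> simp_all [stabSite, flipBit, σ₃]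
  · simp

theorem prod_ite_mul_self (s : Finset ι) (x : ι → Fin 2) :
    (∏ k ∈ s, if x k = 1 then (-1 : ℂ) else 1) * (∏ k ∈ s, if x k = 1 then (-1 : ℂ) else 1) = 1 := by
  rw [← Finset.prod_mul_distrib]
  refine Finset.prod_eq_one fun k _ => ?_
  split_ifs <;> simp

theorem stab_graphState (G : SimpleGraph ι) (i : ι) :
    tensorMatrix (stabSite G i) *ᵥ graphState G = graphState G := by
  ext x
  rw [stab_mulVec, graphState, graphState, neg_one_pow_edgeCount_flip]
  linear_combination ((((√(2 ^ Fintype.card ι))⁻¹ : ℝ) : ℂ) * (-1) ^ edgeCount G x) *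
    prod_ite_mul_self (nbrs G i) x

theorem stab_antigraphState (G : SimpleGraph ι) (i : ι) :
    tensorMatrix (stabSite G i) *ᵥ antigraphState G = -antigraphState G := by
  ext x
  rw [stab_mulVec, Pi.neg_apply, antigraphState, antigraphState, pow_add, pow_add,
    neg_one_pow_edgeCount_flip, neg_one_pow_sum_flip]
  linear_combination (-(((√(2 ^ Fintype.card ι))⁻¹ : ℝ) : ℂ) * (-1) ^ edgeCount G x *
    (-1) ^ (∑ k, (x k : ℕ))) * prod_ite_mul_self (nbrs G i) x

/-- The graph state is determined by its stabilizer. -/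
theorem eq_smul_graphState (G : SimpleGraph ι) {w : (ι → Fin 2) → ℂ}
    (h : ∀ i, tensorMatrix (stabSite G i) *ᵥ w = w) : ∃ c : ℂ, w = c • graphState G := by
  -- Once the signs of the graph state are removed, the stabilizer equations say that the function
  -- is invariant under every bit flip, hence constant.
  let r : (ι → Fin 2) → ℂ := fun x => (-1) ^ edgeCount G x * w x
  have hr : ∀ i x, r (flipBit i x) = r x := by
    intro i x
    have h1 := congrFun (h i) x
    rw [stab_mulVec] at h1
    simp only [r]
    rw [neg_one_pow_edgeCount_flip, ← h1]
    ring
  have hr0 : ∀ x, r x = r 0 := by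
    have key : ∀ s : Finset ι, ∀ x : ι → Fin 2, (∀ k, k ∉ s → x k = 0) → r x = r 0 := by
      intro s
      induction s using Finset.induction_on with
      | empty =>
        intro x hx
        congr 1
        ext1 k
        exact hx k (Finset.notMem_empty k)
      | insert i s _ ih =>
        intro x hx
        rcases fin_two_eq (x i) with h0 | h1
        · refine ih x fun k hk => ?_
          by_cases hki : k = i
          · rw [hki, h0]
          · exact hx k (by simp [hki, hk])
        · rw [← hr i x]
          refine ih _ fun k hk => ?_
          by_cases hki : k = i
          · subst hki; simp [flipBit, h1]
          · rw [flipBit, Function.update_of_ne hki]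
            exact hx k (by simp [hki, hk])
    exact fun x => key Finset.univ x fun k hk => absurd (Finset.mem_univ k) hk
  refine ⟨r 0 * (√(2 ^ Fintype.card ι) : ℝ), ?_⟩
  ext x
  have hsq : ((-1 : ℂ) ^ edgeCount G x) * (-1) ^ edgeCount G x = 1 := by
    rw [← pow_add, ← two_mul, pow_mul]; simp
  have hs : ((√(2 ^ Fintype.card ι) : ℝ) : ℂ) * (((√(2 ^ Fintype.card ι))⁻¹ : ℝ) : ℂ) = 1 := by
    rw [← Complex.ofReal_mul, mul_inv_cancel₀ (by positivity), Complex.ofReal_one]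
  rw [Pi.smul_apply, graphState, smul_eq_mul, ← hr0 x]
  simp only [r]
  linear_combination -w x * ((-1 : ℂ) ^ edgeCount G x) * ((-1) ^ edgeCount G x) * hs - w x * hsq

theorem graphState_norm (G : SimpleGraph ι) : star (graphState G) ⬝ᵥ graphState G = 1 := by
  have h : ∀ x, star (graphState G x) * graphState G x = ((2 : ℂ) ^ Fintype.card ι)⁻¹ := by
    intro x
    have hsq : ((-1 : ℂ) ^ edgeCount G x) * (-1) ^ edgeCount G x = 1 := by
      rw [← pow_add, ← two_mul, pow_mul]; simp
    have hs : (((√(2 ^ Fintype.card ι))⁻¹ : ℝ) : ℂ) * (((√(2 ^ Fintype.card ι))⁻¹ : ℝ) : ℂ)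
        = ((2 : ℂ) ^ Fintype.card ι)⁻¹ := by
      rw [← Complex.ofReal_mul, ← mul_inv, Real.mul_self_sqrt (by positivity)]
      push_cast
      rfl
    simp only [graphState, star_mul', RCLike.star_def, Complex.conj_ofReal, map_pow, map_neg,
      map_one]
    linear_combination ((-1 : ℂ) ^ edgeCount G x * (-1) ^ edgeCount G x) * hs
      + ((2 : ℂ) ^ Fintype.card ι)⁻¹ * hsq
  rw [dotProduct]
  simp only [Pi.star_apply, h, Finset.sum_const, Finset.card_univ, Fintype.card_fun, Fintype.card_fin,
    nsmul_eq_mul]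
  push_cast
  exact mul_inv_cancel₀ (by positivity)

/-- The operator `σ₃` at all sites. -/
theorem sigma_three_mulVec (w : (ι → Fin 2) → ℂ) (x : ι → Fin 2) :
    (tensorMatrix (fun _ => σ₃) *ᵥ w) x = (-1) ^ (∑ k, (x k : ℕ)) * w x := by
  rw [Matrix.mulVec, dotProduct, Finset.sum_eq_single x]
  · rw [tensorMatrix, Matrix.of_apply, ← Finset.prod_pow_eq_pow_sum]
    congr 1
    refine Finset.prod_congr rfl fun k _ => ?_
    rcases fin_two_eq (x k) with hx | hx <;> simp [hx, σ₃]
  · intro y _ hy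
    obtain ⟨k, hk⟩ := Function.ne_iff.1 hy
    rw [tensorMatrix, Matrix.of_apply, Finset.prod_eq_zero (Finset.mem_univ k), zero_mul]
    rcases fin_two_eq (x k) with hx | hx <;> rcases fin_two_eq (y k) with hyk | hyk <;>
      simp_all [σ₃]
  · simp

theorem sigma_three_graphState (G : SimpleGraph ι) :
    tensorMatrix (fun _ => σ₃) *ᵥ graphState G = antigraphState G := by
  ext x
  rw [sigma_three_mulVec, graphState, antigraphState, pow_add]
  ring

theorem sigma_three_antigraphState (G : SimpleGraph ι) :
    tensorMatrix (fun _ => σ₃) *ᵥ antigraphState G = graphState G := by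
  ext x
  have hsq : ((-1 : ℂ) ^ ∑ k, (x k : ℕ)) * (-1) ^ ∑ k, (x k : ℕ) = 1 := by
    rw [← pow_add, ← two_mul, pow_mul]; simp
  rw [sigma_three_mulVec, graphState, antigraphState, pow_add]
  linear_combination ((((√(2 ^ Fintype.card ι))⁻¹ : ℝ) : ℂ) * (-1) ^ edgeCount G x) * hsq

end GraphStates

/-! ### The BASTA functionals on qubits -/

section BastaMatrices

variable {ι : Type} [Fintype ι] [DecidableEq ι]

/-- The qubit observables of the BASTA complex. -/
noncomputable def bastaObs (v k : ι) : Fin 2 → QMat :=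
  if k = v then ![((√2)⁻¹ : ℝ) • (σ₁ + σ₃), ((√2)⁻¹ : ℝ) • (σ₁ - σ₃)] else ![σ₁, σ₃]

theorem bastaObs_self (v : ι) :
    bastaObs v v 0 = (((√2)⁻¹ : ℝ) : ℂ) • σ₁ + (((√2)⁻¹ : ℝ) : ℂ) • σ₃ ∧
    bastaObs v v 1 = (((√2)⁻¹ : ℝ) : ℂ) • σ₁ - (((√2)⁻¹ : ℝ) : ℂ) • σ₃ := by
  rw [bastaObs, if_pos rfl, ← smul_add, ← smul_sub]
  exact ⟨rfl, rfl⟩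

theorem bastaObs_of_ne {v k : ι} (h : k ≠ v) : bastaObs v k = ![σ₁, σ₃] := if_neg h

theorem sigma_relations : σ₁ * σ₁ = 1 ∧ σ₃ * σ₃ = 1 ∧ σ₃ * σ₁ = -(σ₁ * σ₃) := by
  refine ⟨?_, ?_, ?_⟩ <;> ext i j <;> fin_cases i <;> fin_cases j <;> simp [σ₁, σ₃]

theorem sigma_one_isHermitian : σ₁.IsHermitian := by
  ext i j; fin_cases i <;> fin_cases j <;> simp [σ₁]

theorem sigma_three_isHermitian : σ₃.IsHermitian := by
  ext i j; fin_cases i <;> fin_cases j <;> simp [σ₃]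

theorem isHermitian_ofReal_smul {M : QMat} (h : M.IsHermitian) (c : ℝ) :
    ((c : ℂ) • M).IsHermitian := by
  rw [Matrix.IsHermitian, Matrix.conjTranspose_smul, h.eq, RCLike.star_def, Complex.conj_ofReal]

theorem bastaObs_isHermitian (v k : ι) (x : Fin 2) : (bastaObs v k x).IsHermitian := by
  by_cases h : k = v
  · subst h
    have h1 := isHermitian_ofReal_smul sigma_one_isHermitian (√2)⁻¹
    have h3 := isHermitian_ofReal_smul sigma_three_isHermitian (√2)⁻¹
    rcases fin_two_eq x with rfl | rfl
    · rw [(bastaObs_self k).1]; exact h1.add h3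
    · rw [(bastaObs_self k).2]; exact h1.sub h3
  · rw [bastaObs_of_ne h]
    rcases fin_two_eq x with rfl | rfl
    · exact sigma_one_isHermitian
    · exact sigma_three_isHermitian

theorem bastaObs_mul_self (v k : ι) (x : Fin 2) : bastaObs v k x * bastaObs v k x = 1 := by
  obtain ⟨r1, r3, r⟩ := sigma_relations
  by_cases h : k = v
  · subst h
    have h2 := ofReal_inv_sqrt_two_mul_self
    rcases fin_two_eq x with rfl | rfl
    · rw [(bastaObs_self k).1]
      simp only [add_mul, mul_add, smul_mul_smul_comm, r1, r3, r, h2]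
      module
    · rw [(bastaObs_self k).2]
      simp only [sub_mul, mul_sub, smul_mul_smul_comm, r1, r3, r, h2]
      module
  · rw [bastaObs_of_ne h]
    rcases fin_two_eq x with rfl | rfl
    · exact r1
    · exact r3

theorem bastaObs_anticommute (v k : ι) :
    bastaObs v k 0 * bastaObs v k 1 + bastaObs v k 1 * bastaObs v k 0 = 0 := by
  obtain ⟨r1, r3, r⟩ := sigma_relations
  by_cases h : k = v
  · subst h
    rw [(bastaObs_self k).1, (bastaObs_self k).2]
    simp only [sub_mul, mul_sub, add_mul, mul_add, smul_mul_smul_comm, r1, r3, r]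
    module
  · rw [bastaObs_of_ne h]
    simp [r]

theorem bastaObs_irreducible (v k : ι) :
    Algebra.adjoin ℂ {bastaObs v k 0, bastaObs v k 1} = ⊤ := by
  have h0 : Algebra.adjoin ℂ {σ₁, σ₃} = ⊤ := by
    rw [Set.pair_comm]
    exact adjoin_eq_top_of_sigma_three (by simp [σ₁]) (by simp [σ₁])
  by_cases h : k = v
  · subst h
    have h2 : (((√2)⁻¹ : ℝ) : ℂ) ≠ 0 := Complex.ofReal_ne_zero.2 (by positivity)
    rw [(bastaObs_self k).1, (bastaObs_self k).2, adjoin_add_sub h2 h2, h0]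
  · rw [bastaObs_of_ne h]
    exact h0

/-- The Pauli operator of a setting. -/
def pauliObs : Option (Fin 2) → QMat
  | none => 1
  | some x => ![σ₁, σ₃] x

theorem bellMatrix_string_of_none {v : ι} {s : ι → Option (Fin 2)} (h : s v = none) :
    bellMatrix (dichotomicMeas (bastaObs v)) (correlator s) = tensorMatrix fun k => pauliObs (s k) := by
  rw [bellMatrix_correlator]
  congr 1
  ext1 k
  by_cases hk : k = v
  · subst hk
    rw [h]
    rfl
  · cases hs : s k with
    | none => rfl
    | some x => simp only [qubitObs, pauliObs, bastaObs_of_ne hk]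

theorem bellMatrix_string (v : ι) (s : ι → Option (Fin 2)) (c : Fin 2) :
    bellMatrix (dichotomicMeas (bastaObs v)) (correlator fun k => if k = v then some c else s k)
      = tensorMatrix (Function.update (fun k => pauliObs (s k)) v (bastaObs v v c)) := by
  rw [bellMatrix_correlator]
  congr 1
  ext1 k
  by_cases hk : k = v
  · subst hk
    simp [qubitObs]
  · rw [if_neg hk, Function.update_of_ne hk]
    cases hs : s k with
    | none => rfl
    | some x => simp only [qubitObs, pauliObs, bastaObs_of_ne hk]

theorem two_mul_ofReal_inv_sqrt_two : 2 * (((√2)⁻¹ : ℝ) : ℂ) = ((√2 : ℝ) : ℂ) := by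
  have h : ((√2 : ℝ) : ℂ) * (((√2)⁻¹ : ℝ) : ℂ) = 1 := by
    rw [← Complex.ofReal_mul, mul_inv_cancel₀ (by positivity), Complex.ofReal_one]
  linear_combination (2 : ℂ) * ((√2 : ℝ) : ℂ) * ofReal_inv_sqrt_two_mul_self
    - 2 * (((√2)⁻¹ : ℝ) : ℂ) * h

/-- At `v` the observables are rotated by 45 degrees, so their sum is `√2 σ₁` and, in
`bellMatrix_string_sub`, their difference is `√2 σ₃`. -/
theorem bellMatrix_string_add (v : ι) (s : ι → Option (Fin 2)) :
    bellMatrix (dichotomicMeas (bastaObs v)) (correlator fun k => if k = v then some 0 else s k)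
      + bellMatrix (dichotomicMeas (bastaObs v)) (correlator fun k => if k = v then some 1 else s k)
      = ((√2 : ℝ) : ℂ) • tensorMatrix (Function.update (fun k => pauliObs (s k)) v σ₁) := by
  rw [bellMatrix_string, bellMatrix_string, (bastaObs_self v).1, (bastaObs_self v).2,
    ← two_mul_ofReal_inv_sqrt_two]
  ext i j
  simp only [Matrix.add_apply, Matrix.sub_apply, Matrix.smul_apply, tensorMatrix_update, smul_eq_mul]
  ring

theorem bellMatrix_string_sub (v : ι) (s : ι → Option (Fin 2)) :
    bellMatrix (dichotomicMeas (bastaObs v)) (correlator fun k => if k = v then some 0 else s k)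
      - bellMatrix (dichotomicMeas (bastaObs v)) (correlator fun k => if k = v then some 1 else s k)
      = ((√2 : ℝ) : ℂ) • tensorMatrix (Function.update (fun k => pauliObs (s k)) v σ₃) := by
  rw [bellMatrix_string, bellMatrix_string, (bastaObs_self v).1, (bastaObs_self v).2,
    ← two_mul_ofReal_inv_sqrt_two]
  ext i j
  simp only [Matrix.add_apply, Matrix.sub_apply, Matrix.smul_apply, tensorMatrix_update, smul_eq_mul]
  ring

variable (G : SimpleGraph ι) (v : ι)

theorem bellMatrix_stabString_self :
    bellMatrix (dichotomicMeas (bastaObs v)) (stabString G v 0 + stabString G v 1)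
      = ((√2 : ℝ) : ℂ) • tensorMatrix (stabSite G v) := by
  rw [bellMatrix_add, stabString, stabString, bellMatrix_string_add]
  congr 2
  ext1 k
  by_cases hk : k = v
  · subst hk; simp [stabSite]
  · by_cases hn : k ∈ nbrs G v <;> simp [stabSite, hk, hn, pauliObs]

theorem bellMatrix_nbrString {i : ι} (hi : i ∈ nbrs G v) :
    bellMatrix (dichotomicMeas (bastaObs v)) (nbrString G v i 0 - nbrString G v i 1)
      = ((√2 : ℝ) : ℂ) • tensorMatrix (stabSite G i) := by
  rw [bellMatrix_sub, nbrString, nbrString, bellMatrix_string_sub]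
  congr 2
  have hvi : v ∈ nbrs G i := mem_nbrs.2 (mem_nbrs.1 hi).symm
  have hne : v ≠ i := (mem_nbrs.1 hi).ne
  ext1 k
  by_cases hk : k = v
  · subst hk; simp [stabSite, hne, hvi]
  · by_cases hki : k = i
    · subst hki; simp [stabSite, hk, pauliObs]
    · by_cases hn : k ∈ nbrs G i <;> simp [stabSite, hk, hki, hn, pauliObs]

theorem bellMatrix_stabString {j : ι} (hj : j ∉ nbrs G v) (hjv : j ≠ v) :
    bellMatrix (dichotomicMeas (bastaObs v)) (stabString G j 0) = tensorMatrix (stabSite G j) := by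
  have hvj : v ∉ nbrs G j := fun h => hj (mem_nbrs.2 (mem_nbrs.1 h).symm)
  rw [stabString, bellMatrix_string_of_none (by simp [hjv.symm, hvj])]
  congr 1
  ext1 k
  by_cases hk : k = j
  · subst hk; simp [stabSite, pauliObs]
  · by_cases hn : k ∈ nbrs G j <;> simp [stabSite, hk, hn, pauliObs]

theorem bellMatrix_fullString :
    bellMatrix (dichotomicMeas (bastaObs v)) (fullString v 0 - fullString v 1)
      = ((√2 : ℝ) : ℂ) • tensorMatrix fun _ => σ₃ := by
  rw [bellMatrix_sub, fullString, fullString, bellMatrix_string_sub]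
  congr 2
  ext1 k
  by_cases hk : k = v
  · subst hk; simp
  · simp [hk, pauliObs]

/-- In the product of `σ₃` at all sites with the two stabilizer elements, a `σ₃` survives away from
`v` and `i` exactly where both or neither contribute another one. The sign is `σ₃σ₁σ₃ = -σ₁` at `v`.
-/
theorem bellMatrix_evenNbrString {i : ι} (hi : i ∈ nbrs G v) :
    bellMatrix (dichotomicMeas (bastaObs v)) (evenNbrString G v i 0 + evenNbrString G v i 1)
      = -(((√2 : ℝ) : ℂ) • (tensorMatrix (fun _ => σ₃) * (tensorMatrix (stabSite G v)
        * tensorMatrix (stabSite G i)))) := by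
  rw [bellMatrix_add, evenNbrString, evenNbrString, bellMatrix_string_add, tensorMatrix_mul,
    tensorMatrix_mul, ← smul_neg]
  congr 1
  obtain ⟨r1, r3, r⟩ := sigma_relations
  have hvi : v ∈ nbrs G i := mem_nbrs.2 (mem_nbrs.1 hi).symm
  have hne : v ≠ i := (mem_nbrs.1 hi).ne
  have e : (fun k => σ₃ * (stabSite G v k * stabSite G i k))
      = Function.update (fun k => pauliObs (if k = i then some 0
        else if k ∈ nbrs G v ↔ k ∈ nbrs G i then some 1 else none)) v (-σ₁) := by
    ext1 k
    by_cases hk : k = v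
    · subst hk
      have : σ₃ * (σ₁ * σ₃) = -σ₁ := by rw [← mul_assoc, r, neg_mul, mul_assoc, r3, mul_one]
      simpa [stabSite, hne, hvi] using this
    · rw [Function.update_of_ne hk]
      by_cases hki : k = i
      · subst hki
        simp [stabSite, hk, hi, pauliObs, ← mul_assoc, r3]
      · by_cases hn : k ∈ nbrs G v <;> by_cases hn' : k ∈ nbrs G i <;>
          simp [stabSite, hk, hki, hn, hn', pauliObs, r3]
  rw [e]
  ext x y
  simp only [Matrix.neg_apply, tensorMatrix_update]
  ring

theorem bastaB₁_weight_pos (h : 0 < (nbrs G v).card) :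
    0 < (2 * √2 - 1) * (nbrs G v).card + Fintype.card ι - 1 := by
  have h1 : (1 : ℝ) ≤ √2 := Real.one_le_sqrt.2 (by norm_num)
  have h2 : (0 : ℝ) < (nbrs G v).card := by exact_mod_cast h
  have h3 : (1 : ℝ) ≤ Fintype.card ι := by
    exact_mod_cast Fintype.card_pos_iff.2 ⟨v⟩
  nlinarith

theorem card_compl_nbrs : ((Finset.univ \ insert v (nbrs G v)).card : ℝ)
    = Fintype.card ι - 1 - (nbrs G v).card := by
  rw [Finset.card_sdiff_of_subset (Finset.subset_univ _), Nat.cast_sub (Finset.card_le_card (Finset.subset_univ _)),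
    Finset.card_insert_of_notMem (notMem_nbrs_self G v)]
  simp
  ring

theorem bellMatrix_bastaB₁ : bellMatrix (dichotomicMeas (bastaObs v)) (bastaB₁ G v)
    = ((((2 * √2 - 1) * (nbrs G v).card + Fintype.card ι - 1 : ℝ)⁻¹ : ℝ) : ℂ) •
      ((((nbrs G v).card : ℝ) : ℂ) • ((√2 : ℝ) : ℂ) • tensorMatrix (stabSite G v)
        + ∑ i ∈ nbrs G v, ((√2 : ℝ) : ℂ) • tensorMatrix (stabSite G i)
        + ∑ j ∈ Finset.univ \ insert v (nbrs G v), tensorMatrix (stabSite G j)) := by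
  rw [bastaB₁, bellMatrix_smul, bellMatrix_add, bellMatrix_add, bellMatrix_smul, bellMatrix_sum,
    bellMatrix_sum, bellMatrix_stabString_self]
  congr 2
  · congr 1
    exact Finset.sum_congr rfl fun i hi => bellMatrix_nbrString G v hi
  · refine Finset.sum_congr rfl fun j hj => ?_
    simp only [Finset.mem_sdiff, Finset.mem_insert, not_or] at hj
    exact bellMatrix_stabString G v hj.2.2 hj.2.1

theorem bastaB₁_mulVec (h : 0 < (nbrs G v).card) {w : (ι → Fin 2) → ℂ} {c : ℂ}
    (hw : ∀ i, tensorMatrix (stabSite G i) *ᵥ w = c • w) :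
    bellMatrix (dichotomicMeas (bastaObs v)) (bastaB₁ G v) *ᵥ w = c • w := by
  rw [bellMatrix_bastaB₁, Matrix.smul_mulVec, Matrix.add_mulVec, Matrix.add_mulVec,
    Matrix.sum_mulVec, Matrix.sum_mulVec]
  simp only [Matrix.smul_mulVec, hw, Finset.sum_const, ← Nat.cast_smul_eq_nsmul ℂ]
  have e : ((Finset.univ \ insert v (nbrs G v)).card : ℂ)
      = (((Finset.univ \ insert v (nbrs G v)).card : ℝ) : ℂ) := by simp
  rw [inv_eq_one_div, Complex.ofReal_div, Complex.ofReal_one, e, card_compl_nbrs,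
    ← inv_eq_one_div, inv_smul_eq_iff₀ (Complex.ofReal_ne_zero.2 (bastaB₁_weight_pos G v h).ne')]
  push_cast
  module

/-- Each neighbour string contains two stabilizer elements, whose eigenvalues multiply to `c² = 1`;
hence on both the graph and the antigraph state `B₀` acts as `σ₃` at all sites, which exchanges
them. -/
theorem bastaB₀_mulVec (h : 0 < (nbrs G v).card) {w : (ι → Fin 2) → ℂ} {c : ℂ} (hc : c * c = 1)
    (hw : ∀ i, tensorMatrix (stabSite G i) *ᵥ w = c • w) :
    bellMatrix (dichotomicMeas (bastaObs v)) (bastaB₀ G v) *ᵥ w = tensorMatrix (fun _ => σ₃) *ᵥ w := by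
  have h1 : (2 * √2 * (nbrs G v).card : ℝ) ≠ 0 := by
    have : (0 : ℝ) < (nbrs G v).card := by exact_mod_cast h
    positivity
  rw [bastaB₀, bellMatrix_smul, bellMatrix_sub, bellMatrix_smul, bellMatrix_sum, bellMatrix_fullString,
    Finset.sum_congr rfl fun i hi => bellMatrix_evenNbrString G v hi, Matrix.smul_mulVec,
    Matrix.sub_mulVec, Matrix.sum_mulVec]
  simp only [Matrix.smul_mulVec, Matrix.neg_mulVec, ← Matrix.mulVec_mulVec, hw, Matrix.mulVec_smul,
    smul_smul, hc, one_smul, Finset.sum_const, ← Nat.cast_smul_eq_nsmul ℂ]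
  rw [inv_eq_one_div, Complex.ofReal_div, Complex.ofReal_one, ← inv_eq_one_div,
    inv_smul_eq_iff₀ (Complex.ofReal_ne_zero.2 h1)]
  push_cast
  module

theorem antigraphState_norm : star (antigraphState G) ⬝ᵥ antigraphState G = 1 := by
  have e := graphState_norm G
  rw [← e, dotProduct, dotProduct]
  refine Finset.sum_congr rfl fun x _ => ?_
  have h : ((-1 : ℂ) ^ ∑ k, (x k : ℕ)) * (-1) ^ ∑ k, (x k : ℕ) = 1 := by
    rw [← pow_add, ← two_mul, pow_mul]; simp
  simp only [Pi.star_apply, graphState, antigraphState, pow_add, star_mul', star_pow, star_neg,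
    star_one]
  linear_combination (star ((((√(2 ^ Fintype.card ι))⁻¹ : ℝ)) : ℂ) * (-1) ^ edgeCount G x *
    (((((√(2 ^ Fintype.card ι))⁻¹ : ℝ)) : ℂ) * (-1) ^ edgeCount G x)) * h

theorem graphState_orthogonal [Nonempty ι] : star (graphState G) ⬝ᵥ antigraphState G = 0 := by
  obtain ⟨v⟩ := ‹Nonempty ι›
  have hS : (tensorMatrix (stabSite G v))ᴴ = tensorMatrix (stabSite G v) := by
    rw [tensorMatrix_conjTranspose]
    congr 1
    ext1 k
    rw [stabSite]
    split_ifs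
    · exact sigma_one_isHermitian
    · exact sigma_three_isHermitian
    · exact Matrix.conjTranspose_one
  have h : star (graphState G) ⬝ᵥ antigraphState G = -(star (graphState G) ⬝ᵥ antigraphState G) := by
    conv_lhs => rw [← stab_graphState G v]
    rw [Matrix.star_mulVec, hS, ← Matrix.dotProduct_mulVec, stab_antigraphState, dotProduct_neg]
  linear_combination h / 2

end BastaMatrices

/-! ### Stabilizer relations on a Hilbert space -/

section Strings

variable {ι : Type} [Fintype ι] [DecidableEq ι]

/-- The product of the commuting operators `z k`, `k ∈ s`. -/
noncomputable def zprod {R : Type*} [Ring R] (z : ι → R) (s : Finset ι) : R :=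
  commProd fun k => if k ∈ s then z k else 1

section Algebra

variable {R : Type*} [Ring R] {z : ι → R}

theorem pairwiseCommute_ite (hz : PairwiseCommute z) (s : Finset ι) :
    PairwiseCommute fun k => if k ∈ s then z k else 1 := by
  intro i j hij
  simp only
  split_ifs
  · exact hz i j hij
  · exact Commute.one_right _
  · exact Commute.one_left _
  · exact Commute.one_left _

theorem zprod_erase (hz : PairwiseCommute z) {s : Finset ι} {k : ι} (hk : k ∈ s) :
    zprod z s = z k * zprod z (s.erase k) := by
  rw [zprod, commProd_split (pairwiseCommute_ite hz s) k, if_pos hk, zprod]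
  congr 2
  ext1 j
  by_cases h : j = k
  · subst h; simp
  · simp [h]

theorem commute_zprod {y : R} {s : Finset ι} (h : ∀ k ∈ s, Commute y (z k)) :
    Commute y (zprod z s) := by
  refine commute_commProd fun k => ?_
  split_ifs with hk
  · exact h k hk
  · exact Commute.one_right _

theorem zprod_commute (hz : PairwiseCommute z) (s t : Finset ι) :
    Commute (zprod z s) (zprod z t) :=
  commute_zprod fun k _ => (commute_zprod fun l _ => hz.commute_all k l).symm

end Algebra

variable {T : Type u} [NormedAddCommGroup T] [InnerProductSpace ℂ T]

/-- Stabilizer relations of the graph `G` and relations of Pauli operators on a vector. -/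
structure StabRelations (G : SimpleGraph ι) (x z : ι → T →L[ℂ] T) (ψ : T) : Prop where
  comm_xx : ∀ i j, i ≠ j → Commute (x i) (x j)
  comm_zz : PairwiseCommute z
  comm_xz : ∀ i j, i ≠ j → Commute (x i) (z j)
  sq_x : ∀ i, x i (x i ψ) = ψ
  sq_z : ∀ i, z i (z i ψ) = ψ
  stab : ∀ i, x i (zprod z (nbrs G i) ψ) = ψ

namespace StabRelations

variable {G : SimpleGraph ι} {x z : ι → T →L[ℂ] T} {ψ : T}

theorem comm_x_zprod (h : StabRelations G x z ψ) {i : ι} {s : Finset ι} (hi : i ∉ s) :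
    Commute (x i) (zprod z s) :=
  commute_zprod fun k hk => h.comm_xz i k fun e => hi (e ▸ hk)

/-- The stabilizer equation expresses an operator of party `i` on `ψ` through other parties.
Together with `z_apply`, which uses the generator of an adjacent vertex, it supplies the exchanges
that `exists_embeds` requires. -/
theorem x_apply (h : StabRelations G x z ψ) (i : ι) : x i ψ = zprod z (nbrs G i) ψ := by
  have hc := DFunLike.congr_fun (h.comm_x_zprod (notMem_nbrs_self G i)).eq
  have e : x i (x i (zprod z (nbrs G i) ψ)) = zprod z (nbrs G i) (x i (x i ψ)) := by
    have h1 := hc ψ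
    have h2 := hc (x i ψ)
    simp only [mul_apply_eq_comp] at h1 h2
    rw [h1, h2]
  rw [h.stab, h.sq_x] at e
  exact e

theorem z_apply (h : StabRelations G x z ψ) {i j : ι} (hij : G.Adj i j) :
    z i ψ = x j (zprod z ((nbrs G j).erase i) ψ) := by
  have hmem : i ∈ nbrs G j := mem_nbrs.2 hij.symm
  have h1 := h.stab j
  rw [zprod_erase h.comm_zz hmem, mul_apply_eq_comp] at h1
  have c1 := DFunLike.congr_fun (h.comm_xz j i hij.ne').eq
  have c3 : Commute (z i) (zprod z ((nbrs G j).erase i)) :=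
    commute_zprod fun k _ => h.comm_zz.commute_all i k
  have c3 := DFunLike.congr_fun c3.eq
  simp only [mul_apply_eq_comp] at c1 c3
  have e : z i (x j (z i (zprod z ((nbrs G j).erase i) ψ)))
      = x j (zprod z ((nbrs G j).erase i) (z i (z i ψ))) := by
    rw [← c1, c3, c3]
  rw [h1, h.sq_z] at e
  exact e

/-- Across an edge the roles of `x` and `z` are exchanged: `x_iψ = z_jRψ` and `z_iψ = x_jSψ` with
strings `R`, `S` of other parties. Thus both products at `i` are `SR` applied to the corresponding
products at `j`. -/
theorem anticommute_of_adj (h : StabRelations G x z ψ) {i j : ι} (hij : G.Adj i j)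
    (hj : x j (z j ψ) + z j (x j ψ) = 0) : x i (z i ψ) + z i (x i ψ) = 0 := by
  have hne := hij.ne
  have hji : j ∈ nbrs G i := mem_nbrs.2 hij
  have hx : x i ψ = z j (zprod z ((nbrs G i).erase j) ψ) := by
    rw [h.x_apply, zprod_erase h.comm_zz hji, mul_apply_eq_comp]
  have hz := h.z_apply hij
  set R := zprod z ((nbrs G i).erase j) with hR
  set S := zprod z ((nbrs G j).erase i) with hS
  have hiR : i ∉ (nbrs G i).erase j := fun hh => notMem_nbrs_self G i (Finset.mem_of_mem_erase hh)
  have hjR : j ∉ (nbrs G i).erase j := Finset.notMem_erase _ _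
  have hiS : i ∉ (nbrs G j).erase i := Finset.notMem_erase _ _
  have hjS : j ∉ (nbrs G j).erase i := fun hh => notMem_nbrs_self G j (Finset.mem_of_mem_erase hh)
  have zc : ∀ k (s : Finset ι), Commute (z k) (zprod z s) := fun k s =>
    commute_zprod fun l _ => h.comm_zz.commute_all k l
  have app : ∀ {M N : T →L[ℂ] T}, Commute M N → ∀ w, M (N w) = N (M w) := fun hc w =>
    DFunLike.congr_fun hc.eq w
  have e1 : x i (z i ψ) = S (R (x j (z j ψ))) := by
    rw [hz, app (h.comm_xx i j hne), app (h.comm_x_zprod hiS), hx, app (h.comm_x_zprod hjS),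
      app (zc j _), app (h.comm_x_zprod hjR)]
  have e2 : z i (x i ψ) = S (R (z j (x j ψ))) := by
    rw [hx, app (h.comm_zz i j hne), app (zc i _), hz, app (h.comm_x_zprod hjS),
      app (zprod_commute h.comm_zz _ _), app (zc j _), app (zc j _)]
  rw [e1, e2, ← map_add, ← map_add, hj, map_zero, map_zero]

/-- Anticommutation is carried along a walk to `v`. -/
theorem anticommute (h : StabRelations G x z ψ) (hG : G.Connected) {v : ι}
    (hv : x v (z v ψ) + z v (x v ψ) = 0) (i : ι) : x i (z i ψ) + z i (x i ψ) = 0 := by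
  obtain ⟨w⟩ := hG.preconnected i v
  induction w with
  | nil => exact hv
  | cons hadj _ ih => exact h.anticommute_of_adj hadj (ih hv)

end StabRelations

end Strings

/-! ### Products and sums of observables at saturation -/

section Observables

variable {T : Type u} [NormedAddCommGroup T] [InnerProductSpace ℂ T] [CompleteSpace T]

theorem IsObservable.commProd {ι : Type} [Fintype ι] [DecidableEq ι] {f : ι → T →L[ℂ] T} (hf : PairwiseCommute f)
    (h : ∀ k, IsObservable (f k)) : IsObservable (commProd f) := by
  have key : ∀ l : List ι, IsObservable (l.map f).prod := by
    intro l
    induction l with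
    | nil => exact IsObservable.one
    | cons a l ih =>
      rw [List.map_cons, List.prod_cons]
      refine (h a).mul ih (Commute.list_prod_right _ _ ?_)
      intro y hy
      obtain ⟨k, -, rfl⟩ := List.mem_map.1 hy
      exact hf.commute_all a k
  exact key _

theorem IsObservable.norm_eq {K : T →L[ℂ] T} (h : IsObservable K) {v : T} (hv : K (K v) = v) :
    ‖K v‖ = ‖v‖ := by
  refine le_antisymm (h.norm_le v) ?_
  have := h.norm_le (K v)
  rwa [hv] at this

/-- If a product of commuting contractions preserves the norm of `v`, then so does each factor. -/
theorem IsObservable.apply_apply_of_mul {K L : T →L[ℂ] T} (hK : IsObservable K) (hL : IsObservable L)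
    (hc : Commute K L) {v : T} (hv : ‖(K * L) v‖ = ‖v‖) : K (K v) = v := by
  refine hK.apply_apply (le_antisymm (hK.norm_le v) ?_)
  rw [← hv, hc.eq, mul_apply_eq_comp]
  exact hL.norm_le _

/-- If a sum of vectors attains the bound that holds for its terms, so does every term. -/
theorem apply_eq_of_sum_eq {κ : Type*} {s : Finset κ} {Y : κ → T} {β : κ → ℝ} {ψ : T}
    (hle : ∀ m ∈ s, ‖Y m‖ ≤ β m * ‖ψ‖) (hsum : ∑ m ∈ s, Y m = ((∑ m ∈ s, β m : ℝ) : ℂ) • ψ)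
    {m : κ} (hm : m ∈ s) : Y m = (β m : ℂ) • ψ := by
  have h1 : ∀ m ∈ s, RCLike.re (inner ℂ (Y m) ψ) ≤ β m * ‖ψ‖ ^ 2 := by
    intro m hm
    refine (RCLike.re_le_norm _).trans ((norm_inner_le_norm _ _).trans ?_)
    rw [sq, ← mul_assoc]
    exact mul_le_mul_of_nonneg_right (hle m hm) (norm_nonneg _)
  have h2 : ∑ m ∈ s, RCLike.re (inner ℂ (Y m) ψ) = ∑ m ∈ s, β m * ‖ψ‖ ^ 2 := by
    rw [← map_sum, ← sum_inner, hsum, re_inner_ofReal_smul, Finset.sum_mul]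
  -- Expectations bounded term by term with equal totals are equal term by term; the norm bound then
  -- turns each equal expectation into an eigenvector equation.
  have h3 := (Finset.sum_eq_sum_iff_of_le h1).1 h2 m hm
  have h4 : ‖Y m - (β m : ℂ) • ψ‖ ^ 2 ≤ 0 := by
    have e : RCLike.re (inner ℂ (Y m) ((β m : ℂ) • ψ)) = β m * RCLike.re (inner ℂ (Y m) ψ) := by
      rw [inner_smul_right]
      exact Complex.re_ofReal_mul _ _
    rw [@norm_sub_sq ℂ, e, h3, norm_smul, Complex.norm_real, mul_pow, Real.norm_eq_abs, sq_abs]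
    have h5 := hle m hm
    have h6 : ‖Y m‖ ^ 2 ≤ (β m * ‖ψ‖) ^ 2 := pow_le_pow_left₀ (norm_nonneg _) h5 2
    nlinarith
  exact sub_eq_zero.1 (norm_eq_zero.1 (pow_eq_zero_iff two_ne_zero |>.1 (le_antisymm h4 (sq_nonneg _))))

end Observables

/-! ### The BASTA operators -/

section BastaOperators

variable {ι : Type} [Fintype ι] [DecidableEq ι] {T : Type u} [NormedAddCommGroup T]
  [InnerProductSpace ℂ T]

/-- The product of the observables of a correlator. -/
noncomputable def CommSystem.str (A : CommSystem ι T) (s : ι → Option (Fin 2)) : T →L[ℂ] T :=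
  commProd fun k => obs A.op k (s k)

theorem CommSystem.bell_correlator (A : CommSystem ι T) (s : ι → Option (Fin 2)) :
    bell A.op (correlator s) = A.str s :=
  BellConnector.bell_correlator A.comm A.sum_op s

theorem CommSystem.str_split (A : CommSystem ι T) (s : ι → Option (Fin 2)) (k : ι) :
    A.str s = obs A.op k (s k) * A.str (fun j => if j = k then none else s j) := by
  rw [CommSystem.str, commProd_split (fun i j hij => A.comm.obs_commute hij _ _) k, CommSystem.str]
  congr 2
  ext1 j
  by_cases h : j = k
  · subst h; simp [obs]
  · simp [h]

theorem CommSystem.K_commute_str (A : CommSystem ι T) {s : ι → Option (Fin 2)} {k : ι}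
    (hs : s k = none) (y : Fin 2) : Commute (A.K k y) (A.str s) := by
  refine commute_commProd fun j => ?_
  by_cases h : j = k
  · subst h; rw [hs]; exact Commute.one_right _
  · exact A.comm.obs_commute (Ne.symm h) (some y) _

theorem CommSystem.bell_string (A : CommSystem ι T) (v : ι) (s : ι → Option (Fin 2)) (c : Fin 2) :
    bell A.op (correlator fun k => if k = v then some c else s k)
      = A.K v c * A.str fun k => if k = v then none else s k := by
  rw [A.bell_correlator, A.str_split _ v, if_pos rfl]
  congr 2
  ext1 j
  by_cases h : j = v <;> simp [h]

/-- The operator `∏_{k ∈ n(v)} K_1`. -/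
noncomputable def CommSystem.stabRest (A : CommSystem ι T) (G : SimpleGraph ι) (v : ι) : T →L[ℂ] T :=
  A.str fun k => if k = v then none else if k ∈ nbrs G v then some 1 else none

/-- The operator `K^{(i)}_0 ∏_{v ≠ k ∈ n(i)} K_1`. -/
noncomputable def CommSystem.nbrRest (A : CommSystem ι T) (G : SimpleGraph ι) (v i : ι) :
    T →L[ℂ] T :=
  A.str fun k => if k = v then none else if k = i then some 0
    else if k ∈ nbrs G i then some 1 else none

theorem CommSystem.bell_stabString (A : CommSystem ι T) (G : SimpleGraph ι) (v : ι) (c : Fin 2) :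
    bell A.op (stabString G v c) = A.K v c * A.stabRest G v := A.bell_string v _ c

theorem CommSystem.bell_nbrString (A : CommSystem ι T) (G : SimpleGraph ι) (v i : ι) (c : Fin 2) :
    bell A.op (nbrString G v i c) = A.K v c * A.nbrRest G v i := A.bell_string v _ c

theorem sqrt_eight : √(8 + 2 * (0 : ℝ) ^ 2) = 2 * √2 := by
  have : (8 + 2 * (0 : ℝ) ^ 2) = 2 ^ 2 * 2 := by norm_num
  rw [this, Real.sqrt_mul (by norm_num), Real.sqrt_sq (by norm_num)]

/-- The terms of the BASTA operator, one for each vertex other than `v`. -/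
noncomputable def CommSystem.bastaTerm (A : CommSystem ι T) (G : SimpleGraph ι) (v i : ι) :
    T →L[ℂ] T :=
  if i ∈ nbrs G v then tiltOp 0 ![A.stabRest G v, A.nbrRest G v i] ![A.K v 0, A.K v 1]
  else A.K i 0 * A.stabRest G i

/-- The maxima of the terms of the BASTA operator. -/
noncomputable def bastaWeight (G : SimpleGraph ι) (v i : ι) : ℝ :=
  if i ∈ nbrs G v then 2 * √2 else 1

theorem sum_erase_eq {E : Type*} [AddCommMonoid E] (G : SimpleGraph ι) (v : ι) (f : ι → E) :
    ∑ i ∈ Finset.univ.erase v, f i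
      = ∑ i ∈ nbrs G v, f i + ∑ j ∈ Finset.univ \ insert v (nbrs G v), f j := by
  have hsub : nbrs G v ⊆ Finset.univ.erase v := fun i hi =>
    Finset.mem_erase.2 ⟨fun h => notMem_nbrs_self G v (h ▸ hi), Finset.mem_univ i⟩
  rw [← Finset.sum_sdiff hsub, add_comm]
  congr 2
  ext i
  simp

theorem sum_bastaWeight (G : SimpleGraph ι) (v : ι) :
    ∑ i ∈ Finset.univ.erase v, bastaWeight G v i
      = (2 * √2 - 1) * (nbrs G v).card + Fintype.card ι - 1 := by
  have h1 : ∀ i ∈ nbrs G v, bastaWeight G v i = 2 * √2 := fun i hi => if_pos hi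
  have h2 : ∀ j ∈ Finset.univ \ insert v (nbrs G v), bastaWeight G v j = 1 := fun j hj => if_neg (by
    simp only [Finset.mem_sdiff, Finset.mem_insert, not_or] at hj
    exact hj.2.2)
  rw [sum_erase_eq G v, Finset.sum_congr rfl h1, Finset.sum_congr rfl h2]
  simp only [Finset.sum_const, nsmul_eq_mul, card_compl_nbrs]
  ring

/-- The `n_v` copies of the stabilizer string of `v` are distributed, one to each neighbour.
Together with the neighbour's own string it forms a CHSH operator between the pair `stabRest`,
`nbrRest` and the two observables of `v`, with maximum `2√2`; each remaining string has maximum `1`.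
-/
theorem CommSystem.bell_bastaB₁ (A : CommSystem ι T) (G : SimpleGraph ι) (v : ι) :
    bell A.op (bastaB₁ G v)
      = (((∑ i ∈ Finset.univ.erase v, bastaWeight G v i : ℝ)⁻¹ : ℝ) : ℂ) •
        ∑ i ∈ Finset.univ.erase v, A.bastaTerm G v i := by
  rw [sum_bastaWeight, bastaB₁, bell_smul, bell_add, bell_add, bell_smul, bell_sum, bell_sum,
    bell_add, A.bell_stabString, A.bell_stabString, sum_erase_eq G v]
  congr 2
  · have e : (((nbrs G v).card : ℝ) : ℂ) • (A.K v 0 * A.stabRest G v + A.K v 1 * A.stabRest G v)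
        = ∑ i ∈ nbrs G v, (A.K v 0 * A.stabRest G v + A.K v 1 * A.stabRest G v) := by
      rw [Finset.sum_const, ← Nat.cast_smul_eq_nsmul ℂ]
      push_cast
      rfl
    rw [e, ← Finset.sum_add_distrib]
    refine Finset.sum_congr rfl fun i hi => ?_
    have h1 : ∀ y, A.K v y * A.stabRest G v = A.stabRest G v * A.K v y := fun y =>
      (A.K_commute_str (by simp) y).eq
    have h2 : ∀ y, A.K v y * A.nbrRest G v i = A.nbrRest G v i * A.K v y := fun y =>
      (A.K_commute_str (by simp) y).eq
    rw [bell_sub, A.bell_nbrString, A.bell_nbrString, CommSystem.bastaTerm, if_pos hi, tiltOp]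
    simp only [Matrix.cons_val_zero, Matrix.cons_val_one, Matrix.cons_val_fin_one, h1, h2,
      Complex.ofReal_zero, zero_smul, zero_add]
    abel
  · refine Finset.sum_congr rfl fun j hj => ?_
    simp only [Finset.mem_sdiff, Finset.mem_insert, not_or] at hj
    rw [A.bell_stabString, CommSystem.bastaTerm, if_neg hj.2.2]

variable [CompleteSpace T]

theorem CommSystem.str_isObservable (A : CommSystem ι T) (s : ι → Option (Fin 2)) :
    IsObservable (A.str s) := by
  refine IsObservable.commProd (fun i j hij => A.comm.obs_commute hij _ _) fun k => ?_
  cases s k with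
  | none => exact IsObservable.one
  | some x => exact A.isObservable k x

theorem CommSystem.sq_of_str (A : CommSystem ι T) {s : ι → Option (Fin 2)} {ψ : T}
    (h : ‖A.str s ψ‖ = ‖ψ‖) {k : ι} {x : Fin 2} (hk : s k = some x) : A.K k x (A.K k x ψ) = ψ := by
  rw [A.str_split s k, hk] at h
  exact (A.isObservable k x).apply_apply_of_mul (A.str_isObservable _)
    (A.K_commute_str (by simp) x) h

section TiltPair

variable {P Q K L : T →L[ℂ] T}

theorem isObservable_pair (hP : IsObservable P) (hQ : IsObservable Q) (x : Fin 2) :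
    IsObservable ((![P, Q] : Fin 2 → T →L[ℂ] T) x) := by
  rcases fin_two_eq x with rfl | rfl
  · exact hP
  · exact hQ

theorem commute_pair (hPK : Commute P K) (hPL : Commute P L) (hQK : Commute Q K)
    (hQL : Commute Q L) (x y : Fin 2) :
    Commute ((![P, Q] : Fin 2 → T →L[ℂ] T) x) ((![K, L] : Fin 2 → T →L[ℂ] T) y) := by
  rcases fin_two_eq x with rfl | rfl <;> rcases fin_two_eq y with rfl | rfl <;> assumption

theorem tiltOp_pair_norm_le (hP : IsObservable P) (hQ : IsObservable Q) (hK : IsObservable K)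
    (hL : IsObservable L) (hPK : Commute P K) (hPL : Commute P L) (hQK : Commute Q K)
    (hQL : Commute Q L) (w : T) : ‖tiltOp 0 ![P, Q] ![K, L] w‖ ≤ 2 * √2 * ‖w‖ := by
  have := tiltOp_norm_le (a := 0) (by simp) (isObservable_pair hP hQ) (isObservable_pair hK hL)
    (commute_pair hPK hPL hQK hQL) w
  rwa [sqrt_eight] at this

/-- The relations that hold on a maximizer of the CHSH operator. -/
structure ChshRelations (P Q K L : T →L[ℂ] T) (ψ : T) : Prop where
  sq_fst : P (P ψ) = ψ
  sq_snd : Q (Q ψ) = ψ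
  sq_zero : K (K ψ) = ψ
  sq_one : L (L ψ) = ψ
  anti : K (L ψ) + L (K ψ) = 0
  fst_apply : P ψ = (((√2)⁻¹ : ℝ) : ℂ) • (K ψ + L ψ)
  snd_apply : Q ψ = (((√2)⁻¹ : ℝ) : ℂ) • (K ψ - L ψ)

/-- This is the untilted case `a = 0` of `tilt_relations`. Writing `b = 4s` with `s = 1/√2` leaves
`s² = 1/2` as the only arithmetic fact. -/
theorem chsh_relations (hP : IsObservable P) (hQ : IsObservable Q) (hK : IsObservable K)
    (hL : IsObservable L) (hPK : Commute P K) (hPL : Commute P L) (hQK : Commute Q K)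
    (hQL : Commute Q L) {ψ : T}
    (h : tiltOp 0 ![P, Q] ![K, L] ψ = ((2 * √2 : ℝ) : ℂ) • ψ) : ChshRelations P Q K L ψ := by
  rw [← sqrt_eight] at h
  have r := tilt_relations (a := 0) (by simp) (isObservable_pair hP hQ) (isObservable_pair hK hL)
    (commute_pair hPK hPL hQK hQL) h
  rw [sqrt_eight] at r
  have h2 := two_mul_ofReal_inv_sqrt_two
  have h3 := ofReal_inv_sqrt_two_mul_self
  have hb : ((2 * √2 : ℝ) : ℂ) = 4 * (((√2)⁻¹ : ℝ) : ℂ) := by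
    rw [Complex.ofReal_mul, ← h2]
    push_cast
    ring
  have hs : (((√2)⁻¹ : ℝ) : ℂ) ≠ 0 := Complex.ofReal_ne_zero.2 (by positivity)
  rw [hb, Complex.ofReal_zero] at r
  obtain ⟨s, hs'⟩ : ∃ s, s = (((√2)⁻¹ : ℝ) : ℂ) := ⟨_, rfl⟩
  rw [← hs'] at r h3 hs
  have hs2 : (4 * s) ^ 2 / 4 = 2 := by linear_combination 4 * h3
  have hs3 : (2 : ℂ) / (4 * s) = s := by
    rw [div_eq_iff (mul_ne_zero four_ne_zero hs)]
    linear_combination -4 * h3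
  obtain ⟨sq, -, sq', anti', e0, e1, -, -⟩ := r
  refine ⟨sq 0, sq 1, sq' 0, sq' 1, ?_, ?_, ?_⟩ <;> try rw [← hs']
  · rw [hs2, sub_self, zero_smul] at anti'
    exact anti'
  · rw [hs3] at e0
    exact e0
  · have e : Q ψ = (2 : ℂ)⁻¹ • ((4 * s / 2) • (K ψ - L ψ)) := by
      simpa [hs2] using e1
    rw [e]
    module

end TiltPair

/-- A sum of self-adjoint operators divided by the sum of bounds for their norms is normalized. -/
theorem isPositive_of_sum {κ : Type*} {s : Finset κ} {Y : κ → T →L[ℂ] T} {β : κ → ℝ}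
    (hY : ∀ m ∈ s, IsSelfAdjoint (Y m)) (hle : ∀ m ∈ s, ∀ w, ‖Y m w‖ ≤ β m * ‖w‖)
    (hβ : 0 < ∑ m ∈ s, β m) :
    (1 - (((∑ m ∈ s, β m)⁻¹ : ℝ) : ℂ) • ∑ m ∈ s, Y m).IsPositive ∧
    (1 + (((∑ m ∈ s, β m)⁻¹ : ℝ) : ℂ) • ∑ m ∈ s, Y m).IsPositive := by
  have hr : IsSelfAdjoint (((∑ m ∈ s, β m)⁻¹ : ℝ) : ℂ) := Complex.conj_ofReal _
  refine isPositive_of_norm_le (hr.smul (isSelfAdjoint_sum _ hY)) fun w => ?_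
  rw [smul_apply, norm_smul, Complex.norm_real, Real.norm_of_nonneg (inv_nonneg.2 hβ.le),
    inv_mul_le_iff₀ hβ, sum_apply, Finset.sum_mul]
  exact (norm_sum_le _ _).trans (Finset.sum_le_sum fun m hm => hle m hm w)

variable (A : CommSystem ι T) (G : SimpleGraph ι) (v : ι)

theorem CommSystem.stabRest_isObservable : IsObservable (A.stabRest G v) := A.str_isObservable _

theorem CommSystem.nbrRest_isObservable (i : ι) : IsObservable (A.nbrRest G v i) :=
  A.str_isObservable _

theorem CommSystem.K_commute_stabRest (y : Fin 2) : Commute (A.K v y) (A.stabRest G v) :=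
  A.K_commute_str (by simp) y

theorem CommSystem.K_commute_nbrRest (i : ι) (y : Fin 2) : Commute (A.K v y) (A.nbrRest G v i) :=
  A.K_commute_str (by simp) y

theorem CommSystem.bastaTerm_isSelfAdjoint (i : ι) : IsSelfAdjoint (A.bastaTerm G v i) := by
  rw [CommSystem.bastaTerm]
  split_ifs
  · exact tiltOp_isSelfAdjoint 0
      (isObservable_pair (A.stabRest_isObservable G v) (A.nbrRest_isObservable G v i))
      (isObservable_pair (A.isObservable v 0) (A.isObservable v 1))
      (commute_pair (A.K_commute_stabRest G v 0).symm (A.K_commute_stabRest G v 1).symm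
        (A.K_commute_nbrRest G v i 0).symm (A.K_commute_nbrRest G v i 1).symm)
  · exact ((A.isObservable i 0).mul (A.stabRest_isObservable G i)
      (A.K_commute_stabRest G i 0)).isSelfAdjoint

theorem CommSystem.bastaTerm_norm_le (i : ι) (w : T) :
    ‖A.bastaTerm G v i w‖ ≤ bastaWeight G v i * ‖w‖ := by
  rw [CommSystem.bastaTerm, bastaWeight]
  split_ifs
  · exact tiltOp_pair_norm_le (A.stabRest_isObservable G v) (A.nbrRest_isObservable G v i)
      (A.isObservable v 0) (A.isObservable v 1)
      (A.K_commute_stabRest G v 0).symm (A.K_commute_stabRest G v 1).symm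
      (A.K_commute_nbrRest G v i 0).symm (A.K_commute_nbrRest G v i 1).symm w
  · rw [one_mul]
    exact ((A.isObservable i 0).mul (A.stabRest_isObservable G i)
      (A.K_commute_stabRest G i 0)).norm_le w

theorem CommSystem.bastaB₁_normalized (h : 0 < (nbrs G v).card) :
    (1 - bell A.op (bastaB₁ G v)).IsPositive ∧ (1 + bell A.op (bastaB₁ G v)).IsPositive := by
  rw [A.bell_bastaB₁]
  refine isPositive_of_sum (fun i _ => A.bastaTerm_isSelfAdjoint G v i)
    (fun i _ => A.bastaTerm_norm_le G v i) ?_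
  rw [sum_bastaWeight]
  exact bastaB₁_weight_pos G v h

theorem CommSystem.bastaB₀_normalized (h : 0 < (nbrs G v).card) :
    (1 - bell A.op (bastaB₀ G v)).IsPositive ∧ (1 + bell A.op (bastaB₀ G v)).IsPositive := by
  let P := A.str fun k => if k = v then none else some 1
  let Q : ι → T →L[ℂ] T := fun i => A.str fun k => if k = v then none else if k = i then some 0
    else if k ∈ nbrs G v ↔ k ∈ nbrs G i then some 1 else none
  have hP : ∀ y, Commute (A.K v y) P := fun y => A.K_commute_str (by simp) y
  have hQ : ∀ i y, Commute (A.K v y) (Q i) := fun i y => A.K_commute_str (by simp) y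
  have oP : IsObservable P := A.str_isObservable _
  have oQ : ∀ i, IsObservable (Q i) := fun i => A.str_isObservable _
  have b1 : ∀ c, bell A.op (fullString v c) = A.K v c * P := fun c => A.bell_string v _ c
  have b2 : ∀ i c, bell A.op (evenNbrString G v i c) = A.K v c * Q i := fun i c =>
    A.bell_string v _ c
  -- `P(K₀ - K₁) - Q(K₀ + K₁)` is the CHSH operator of the pairs `(P, -Q)` and `(K₀, -K₁)`, so `B₀`
  -- is an average of CHSH operators as well.
  have e : bell A.op (bastaB₀ G v) = (((∑ _i ∈ nbrs G v, 2 * √2 : ℝ)⁻¹ : ℝ) : ℂ) •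
      ∑ i ∈ nbrs G v, tiltOp 0 ![P, -Q i] ![A.K v 0, -A.K v 1] := by
    have hw : (∑ _i ∈ nbrs G v, 2 * √2 : ℝ) = 2 * √2 * (nbrs G v).card := by
      rw [Finset.sum_const, nsmul_eq_mul, mul_comm]
    rw [hw, bastaB₀, bell_smul, bell_sub, bell_smul, bell_sum, bell_sub, b1, b1]
    have e1 : (((nbrs G v).card : ℝ) : ℂ) • (A.K v 0 * P - A.K v 1 * P)
        = ∑ i ∈ nbrs G v, (A.K v 0 * P - A.K v 1 * P) := by
      rw [Finset.sum_const, ← Nat.cast_smul_eq_nsmul ℂ]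
      push_cast
      rfl
    rw [e1, ← Finset.sum_sub_distrib]
    congr 1
    refine Finset.sum_congr rfl fun i _ => ?_
    rw [bell_add, b2, b2, tiltOp, (hP 0).eq, (hP 1).eq, (hQ i 0).eq, (hQ i 1).eq]
    simp only [Matrix.cons_val_zero, Matrix.cons_val_one, Matrix.cons_val_fin_one,
      Complex.ofReal_zero, zero_smul, zero_add, neg_mul, mul_neg, neg_neg]
    abel
  rw [e]
  refine isPositive_of_sum (β := fun _ => 2 * √2) (fun i _ => ?_) (fun i _ w => ?_) ?_
  · exact tiltOp_isSelfAdjoint 0 (isObservable_pair oP (oQ i).neg)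
      (isObservable_pair (A.isObservable v 0) (A.isObservable v 1).neg)
      (commute_pair (hP 0).symm (hP 1).symm.neg_right (hQ i 0).symm.neg_left
        (hQ i 1).symm.neg_left.neg_right)
  · exact tiltOp_pair_norm_le oP (oQ i).neg (A.isObservable v 0) (A.isObservable v 1).neg
      (hP 0).symm (hP 1).symm.neg_right (hQ i 0).symm.neg_left (hQ i 1).symm.neg_left.neg_right w
  · rw [Finset.sum_const, nsmul_eq_mul]
    have : (0 : ℝ) < (nbrs G v).card := by exact_mod_cast h
    positivity

end BastaOperators

/-! ### Rigidity of the BASTA complexes -/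

section BastaRigidity

variable {ι : Type} [Fintype ι] [DecidableEq ι] {T : Type u} [NormedAddCommGroup T]
  [InnerProductSpace ℂ T]

/-- The operators that play the role of `σ₁`. -/
noncomputable def CommSystem.pauliX (A : CommSystem ι T) (v k : ι) : T →L[ℂ] T :=
  if k = v then (((√2)⁻¹ : ℝ) : ℂ) • (A.K v 0 + A.K v 1) else A.K k 0

/-- The operators that play the role of `σ₃`. -/
noncomputable def CommSystem.pauliZ (A : CommSystem ι T) (v k : ι) : T →L[ℂ] T :=
  if k = v then (((√2)⁻¹ : ℝ) : ℂ) • (A.K v 0 - A.K v 1) else A.K k 1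

variable (A : CommSystem ι T) (v : ι)

theorem CommSystem.pauliX_self :
    A.pauliX v v = (((√2)⁻¹ : ℝ) : ℂ) • (A.K v 0 + A.K v 1) := if_pos rfl

theorem CommSystem.pauliZ_self :
    A.pauliZ v v = (((√2)⁻¹ : ℝ) : ℂ) • (A.K v 0 - A.K v 1) := if_pos rfl

theorem CommSystem.pauliX_of_ne {v k : ι} (h : k ≠ v) : A.pauliX v k = A.K k 0 := if_neg h

theorem CommSystem.pauliZ_of_ne {v k : ι} (h : k ≠ v) : A.pauliZ v k = A.K k 1 := if_neg h

theorem CommSystem.commute_pauliX {M : T →L[ℂ] T} {k : ι} (h : ∀ y, Commute M (A.K k y)) :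
    Commute M (A.pauliX v k) := by
  by_cases hk : k = v
  · subst hk
    rw [A.pauliX_self]
    exact ((h 0).add_right (h 1)).smul_right _
  · rw [A.pauliX_of_ne hk]
    exact h 0

theorem CommSystem.commute_pauliZ {M : T →L[ℂ] T} {k : ι} (h : ∀ y, Commute M (A.K k y)) :
    Commute M (A.pauliZ v k) := by
  by_cases hk : k = v
  · subst hk
    rw [A.pauliZ_self]
    exact ((h 0).sub_right (h 1)).smul_right _
  · rw [A.pauliZ_of_ne hk]
    exact h 1

theorem CommSystem.zprod_eq_stabRest (G : SimpleGraph ι) {v i : ι} (h : v ∉ nbrs G i) :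
    zprod (A.pauliZ v) (nbrs G i) = A.stabRest G i := by
  rw [zprod, CommSystem.stabRest, CommSystem.str]
  congr 1
  ext1 k
  by_cases hk : k ∈ nbrs G i
  · have hkv : k ≠ v := fun e => h (e ▸ hk)
    have hki : k ≠ i := fun e => notMem_nbrs_self G i (e ▸ hk)
    rw [if_pos hk, A.pauliZ_of_ne hkv, if_neg hki, if_pos hk]
    rfl
  · rw [if_neg hk]
    simp [hk, obs]

theorem CommSystem.mul_zprod_eq_nbrRest (G : SimpleGraph ι) {v i : ι} (h : i ≠ v) :
    A.K i 0 * zprod (A.pauliZ v) ((nbrs G i).erase v) = A.nbrRest G v i := by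
  rw [CommSystem.nbrRest, A.str_split _ i, if_neg h, if_pos rfl, zprod, CommSystem.str]
  congr 2
  ext1 k
  by_cases hk : k ∈ nbrs G i
  · have hki : k ≠ i := fun e => notMem_nbrs_self G i (e ▸ hk)
    by_cases hkv : k = v
    · simp [hkv, obs]
    · simp only [Finset.mem_erase, ne_eq, hkv, not_false_eq_true, hk, and_self, if_true, hki, if_false,
        A.pauliZ_of_ne hkv]
      rfl
  · by_cases hki : k = i
    · subst hki; simp [hk, obs]
    · simp [hk, hki, obs]

theorem exists_adj_of_connected [Nontrivial ι] {G : SimpleGraph ι} (hG : G.Connected) (k : ι) :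
    ∃ j, G.Adj k j := by
  obtain ⟨w, hw⟩ := exists_ne k
  obtain ⟨p⟩ := hG.preconnected k w
  cases p with
  | nil => exact absurd rfl hw
  | cons h _ => exact ⟨_, h⟩

variable [CompleteSpace T]

/-- The relations that hold on a maximizer of the BASTA operator. -/
structure BastaRelations (G : SimpleGraph ι) (ψ : T) : Prop where
  nbr : ∀ i ∈ nbrs G v, ChshRelations (A.stabRest G v) (A.nbrRest G v i) (A.K v 0) (A.K v 1) ψ
  stab : ∀ i, i ≠ v → i ∉ nbrs G v → A.K i 0 (A.stabRest G i ψ) = ψ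

theorem basta_relations {G : SimpleGraph ι} (h : 0 < (nbrs G v).card) {ψ : T}
    (hψ : bell A.op (bastaB₁ G v) ψ = ψ) : BastaRelations A v G ψ := by
  have hw : (∑ i ∈ Finset.univ.erase v, bastaWeight G v i) ≠ 0 := by
    rw [sum_bastaWeight]
    exact (bastaB₁_weight_pos G v h).ne'
  have hs : ∑ i ∈ Finset.univ.erase v, A.bastaTerm G v i ψ
      = ((∑ i ∈ Finset.univ.erase v, bastaWeight G v i : ℝ) : ℂ) • ψ := by
    rw [A.bell_bastaB₁, smul_apply, sum_apply, Complex.ofReal_inv,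
      inv_smul_eq_iff₀ (Complex.ofReal_ne_zero.2 hw)] at hψ
    exact hψ
  have hterm : ∀ i, i ≠ v → A.bastaTerm G v i ψ = (bastaWeight G v i : ℂ) • ψ := fun i hi =>
    apply_eq_of_sum_eq (fun i _ => A.bastaTerm_norm_le G v i ψ) hs
      (Finset.mem_erase.2 ⟨hi, Finset.mem_univ i⟩)
  refine ⟨fun i hi => ?_, fun i hiv hi => ?_⟩
  · have e := hterm i (mem_nbrs.1 hi).ne'
    rw [CommSystem.bastaTerm, bastaWeight, if_pos hi, if_pos hi] at e
    exact chsh_relations (A.stabRest_isObservable G v) (A.nbrRest_isObservable G v i)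
      (A.isObservable v 0) (A.isObservable v 1)
      (A.K_commute_stabRest G v 0).symm (A.K_commute_stabRest G v 1).symm
      (A.K_commute_nbrRest G v i 0).symm (A.K_commute_nbrRest G v i 1).symm e
  · have e := hterm i hiv
    rw [CommSystem.bastaTerm, bastaWeight, if_neg hi, if_neg hi, Complex.ofReal_one, one_smul] at e
    exact e

namespace BastaRelations

variable {A v} {G : SimpleGraph ι} {ψ : T}

theorem norm_stab (h : BastaRelations A v G ψ) {i : ι} (hiv : i ≠ v) (hi : i ∉ nbrs G v) :
    ‖A.str (fun k => if k = i then some 0 else if k ∈ nbrs G i then some 1 else none) ψ‖ = ‖ψ‖ := by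
  rw [← A.bell_correlator, A.bell_string]
  exact congrArg norm (h.stab i hiv hi)

/-- Every observable of a party other than `v` is a factor of some string that preserves the norm of
`ψ`: setting `0` in its own stabilizer string, setting `1` in that of any neighbour. Hence it
squares to one on `ψ`. -/
theorem sq_of_ne (h : BastaRelations A v G ψ)
    (hv : (nbrs G v).Nonempty) (hG : ∀ k, ∃ j, G.Adj k j) {k : ι} (hk : k ≠ v)
    (x : Fin 2) : A.K k x (A.K k x ψ) = ψ := by
  have n1 : ∀ i ∈ nbrs G v, ‖A.nbrRest G v i ψ‖ = ‖ψ‖ := fun i hi =>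
    (A.nbrRest_isObservable G v i).norm_eq (h.nbr i hi).sq_snd
  rcases fin_two_eq x with rfl | rfl
  · by_cases hkn : k ∈ nbrs G v
    · exact A.sq_of_str (n1 k hkn) (by simp [hk])
    · exact A.sq_of_str (h.norm_stab hk hkn) (by simp)
  · obtain ⟨i, hi⟩ := hG k
    have hki : k ∈ nbrs G i := mem_nbrs.2 hi.symm
    have hne : k ≠ i := hi.ne
    by_cases hiv : i = v
    · subst hiv
      obtain ⟨l, hl⟩ := hv
      exact A.sq_of_str ((A.stabRest_isObservable G i).norm_eq (h.nbr l hl).sq_fst)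
        (by simp [hki, hne])
    · by_cases hin : i ∈ nbrs G v
      · exact A.sq_of_str (n1 i hin) (by simp [hk, hki, hne])
      · exact A.sq_of_str (h.norm_stab hiv hin) (by simp [hki, hne])

theorem pauliX_apply (h : BastaRelations A v G ψ)
    {i : ι} (hi : i ∈ nbrs G v) : A.pauliX v v ψ = A.stabRest G v ψ := by
  rw [(h.nbr i hi).fst_apply, A.pauliX_self, smul_apply, add_apply]

theorem pauliZ_apply (h : BastaRelations A v G ψ)
    {i : ι} (hi : i ∈ nbrs G v) : A.pauliZ v v ψ = A.nbrRest G v i ψ := by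
  rw [(h.nbr i hi).snd_apply, A.pauliZ_self, smul_apply, sub_apply]

theorem stabRelations (h : BastaRelations A v G ψ)
    (hv : (nbrs G v).Nonempty) (hG : ∀ k, ∃ j, G.Adj k j) :
    StabRelations G (A.pauliX v) (A.pauliZ v) ψ := by
  have kc : ∀ i j, i ≠ j → ∀ y y', Commute (A.K i y) (A.K j y') := fun i j hij y y' =>
    A.K_commute hij y y'
  have app : ∀ {M N : T →L[ℂ] T}, Commute M N → ∀ w, M (N w) = N (M w) := fun hc w =>
    DFunLike.congr_fun hc.eq w
  obtain ⟨l, hl⟩ := hv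
  have r := h.nbr l hl
  have hs := ofReal_inv_sqrt_two_mul_self
  have zz : PairwiseCommute (A.pauliZ v) := fun i j hij => A.commute_pauliZ v fun y =>
    (A.commute_pauliZ v fun y' => (kc i j hij y' y).symm).symm
  have xz : ∀ i j, i ≠ j → Commute (A.pauliX v i) (A.pauliZ v j) := fun i j hij =>
    A.commute_pauliZ v fun y => (A.commute_pauliX v fun y' => (kc i j hij y' y).symm).symm
  refine
    { comm_xx := fun i j hij => A.commute_pauliX v fun y =>
        (A.commute_pauliX v fun y' => (kc i j hij y' y).symm).symm
      comm_zz := zz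
      comm_xz := xz
      sq_x := fun i => ?_
      sq_z := fun i => ?_
      stab := fun i => ?_ }
  · by_cases hi : i = v
    · subst hi
      simp only [A.pauliX_self, smul_apply, add_apply, map_add, map_smul]
      linear_combination (norm := module) hs • (A.K i 0 (A.K i 0 ψ) + A.K i 0 (A.K i 1 ψ)
        + A.K i 1 (A.K i 0 ψ) + A.K i 1 (A.K i 1 ψ)) + (2⁻¹ : ℂ) • r.sq_zero + (2⁻¹ : ℂ) • r.sq_one
        + (2⁻¹ : ℂ) • r.anti
    · rw [A.pauliX_of_ne hi]
      exact h.sq_of_ne ⟨l, hl⟩ hG hi 0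
  · by_cases hi : i = v
    · subst hi
      simp only [A.pauliZ_self, smul_apply, sub_apply, map_sub, map_smul]
      linear_combination (norm := module) hs • (A.K i 0 (A.K i 0 ψ) - A.K i 0 (A.K i 1 ψ)
        - A.K i 1 (A.K i 0 ψ) + A.K i 1 (A.K i 1 ψ)) + (2⁻¹ : ℂ) • r.sq_zero + (2⁻¹ : ℂ) • r.sq_one
        - (2⁻¹ : ℂ) • r.anti
    · rw [A.pauliZ_of_ne hi]
      exact h.sq_of_ne ⟨l, hl⟩ hG hi 1
  · by_cases hi : i = v
    · subst hi
      rw [A.zprod_eq_stabRest G (notMem_nbrs_self G i),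
        ← app (A.commute_pauliX i fun y => (A.K_commute_stabRest G i y).symm), h.pauliX_apply hl,
        r.sq_fst]
    · rw [A.pauliX_of_ne hi]
      by_cases hin : i ∈ nbrs G v
      · have hvi : v ∈ nbrs G i := mem_nbrs.2 (mem_nbrs.1 hin).symm
        -- At a neighbour `i` of `v` the stabilizer element is `Z_v` times `nbrRest`; as `Z_v` acts
        -- on `ψ` like `nbrRest`, which squares to one there, the element fixes `ψ`.
        have e : A.K i 0 (A.pauliZ v v (zprod (A.pauliZ v) ((nbrs G i).erase v) ψ))
            = A.pauliZ v v (A.nbrRest G v i ψ) := by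
          rw [app (A.commute_pauliZ v fun y => kc i v hi 0 y), ← A.mul_zprod_eq_nbrRest G hi,
            mul_apply_eq_comp]
        rw [zprod_erase zz hvi, mul_apply_eq_comp, e,
          ← app (A.commute_pauliZ v fun y => (A.K_commute_nbrRest G v i y).symm),
          h.pauliZ_apply hin, (h.nbr i hin).sq_snd]
      · have hvi : v ∉ nbrs G i := fun e => hin (mem_nbrs.2 (mem_nbrs.1 e).symm)
        rw [A.zprod_eq_stabRest G hvi]
        exact h.stab i hi hin

/-- At `v` this is a CHSH relation. There the operators `K₀ ± K₁` anticommute on `ψ` because `K₀²ψ =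
K₁²ψ`, and connectedness carries anticommutation to all other vertices. -/
theorem anticommute (h : BastaRelations A v G ψ)
    (hv : (nbrs G v).Nonempty) (hG : G.Connected) (hG' : ∀ k, ∃ j, G.Adj k j)
    (k : ι) : A.K k 0 (A.K k 1 ψ) + A.K k 1 (A.K k 0 ψ) = 0 := by
  obtain ⟨l, hl⟩ := hv
  have r := h.nbr l hl
  by_cases hk : k = v
  · subst hk
    exact r.anti
  · have h0 : A.pauliX v v (A.pauliZ v v ψ) + A.pauliZ v v (A.pauliX v v ψ) = 0 := by
      simp only [A.pauliX_self, A.pauliZ_self, smul_apply, sub_apply, add_apply, map_sub, map_add,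
        map_smul, r.sq_zero, r.sq_one]
      module
    have := (h.stabRelations ⟨l, hl⟩ hG').anticommute hG h0 k
    rwa [A.pauliX_of_ne hk, A.pauliZ_of_ne hk] at this

theorem exists_swap (h : BastaRelations A v G ψ)
    (hv : (nbrs G v).Nonempty) (hG : ∀ k, ∃ j, G.Adj k j) (k : ι) (x : Fin 2) :
    ∃ P : T →L[ℂ] T, (∀ y, Commute P (A.K k y)) ∧ A.K k x ψ = P ψ := by
  have s := h.stabRelations hv hG
  have zc : ∀ t : Finset ι, k ∉ t → ∀ y, Commute (A.K k y) (zprod (A.pauliZ v) t) :=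
    fun t ht y => commute_zprod fun j hj => A.commute_pauliZ v fun y' =>
      A.K_commute (i := k) (j := j) (fun e => ht (e ▸ hj)) y y'
  obtain ⟨X, hX, eX⟩ : ∃ P : T →L[ℂ] T, (∀ y, Commute P (A.K k y)) ∧ A.pauliX v k ψ = P ψ :=
    ⟨_, fun y => (zc _ (notMem_nbrs_self G k) y).symm, s.x_apply k⟩
  obtain ⟨Z, hZ, eZ⟩ : ∃ P : T →L[ℂ] T, (∀ y, Commute P (A.K k y)) ∧ A.pauliZ v k ψ = P ψ := by
    obtain ⟨j, hj⟩ := hG k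
    refine ⟨A.pauliX v j * zprod (A.pauliZ v) ((nbrs G j).erase k), fun y => ?_, s.z_apply hj⟩
    exact ((A.commute_pauliX v fun y' => A.K_commute hj.ne y y').mul_right
      (zc _ (Finset.notMem_erase _ _) y)).symm
  by_cases hk : k = v
  · subst hk
    rw [A.pauliX_self, smul_apply, add_apply] at eX
    rw [A.pauliZ_self, smul_apply, sub_apply] at eZ
    have hs := ofReal_inv_sqrt_two_mul_self
    rcases fin_two_eq x with rfl | rfl
    · refine ⟨(((√2)⁻¹ : ℝ) : ℂ) • (X + Z), fun y => ((hX y).add_left (hZ y)).smul_left _, ?_⟩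
      rw [smul_apply, add_apply, ← eX, ← eZ]
      linear_combination (norm := module) (-hs) • ((2 : ℂ) • A.K k 0 ψ)
    · refine ⟨(((√2)⁻¹ : ℝ) : ℂ) • (X - Z), fun y => ((hX y).sub_left (hZ y)).smul_left _, ?_⟩
      rw [smul_apply, sub_apply, ← eX, ← eZ]
      linear_combination (norm := module) (-hs) • ((2 : ℂ) • A.K k 1 ψ)
  · rw [A.pauliX_of_ne hk] at eX
    rw [A.pauliZ_of_ne hk] at eZ
    rcases fin_two_eq x with rfl | rfl
    · exact ⟨X, hX, eX⟩
    · exact ⟨Z, hZ, eZ⟩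

/-- Each stabilizer element is the qubit operator of an explicit Bell functional that fixes `ψ`; at
`v` and its neighbours the factor `1/√2` normalizes the sum or difference of the two observables of
`v`. -/
theorem stab_fixed (h : BastaRelations A v G ψ) (hv : (nbrs G v).Nonempty) {w : (ι → Fin 2) → ℂ}
    (hw : ∀ B : BellFunctional ι, bell A.op B ψ = ψ →
      bellMatrix (dichotomicMeas (bastaObs v)) B *ᵥ w = w) (i : ι) :
    tensorMatrix (stabSite G i) *ᵥ w = w := by
  obtain ⟨l, hl⟩ := hv
  have hs : (((√2)⁻¹ : ℝ) : ℂ) * ((√2 : ℝ) : ℂ) = 1 := by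
    rw [← Complex.ofReal_mul, inv_mul_cancel₀ (by positivity), Complex.ofReal_one]
  have app : ∀ {M N : T →L[ℂ] T}, Commute M N → ∀ w, M (N w) = N (M w) := fun hc w =>
    DFunLike.congr_fun hc.eq w
  by_cases hi : i = v
  · subst hi
    have := hw ((√2)⁻¹ • (stabString G i 0 + stabString G i 1)) (by
      rw [bell_smul, bell_add, A.bell_stabString, A.bell_stabString, ← add_mul, ← smul_mul_assoc,
        ← A.pauliX_self, mul_apply_eq_comp,
        ← app (A.commute_pauliX i fun y => (A.K_commute_stabRest G i y).symm), h.pauliX_apply hl,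
        (h.nbr l hl).sq_fst])
    rwa [bellMatrix_smul, bellMatrix_stabString_self, smul_smul, hs, one_smul] at this
  · by_cases hin : i ∈ nbrs G v
    · have := hw ((√2)⁻¹ • (nbrString G v i 0 - nbrString G v i 1)) (by
        rw [bell_smul, bell_sub, A.bell_nbrString, A.bell_nbrString, ← sub_mul, ← smul_mul_assoc,
          ← A.pauliZ_self, mul_apply_eq_comp,
          ← app (A.commute_pauliZ v fun y => (A.K_commute_nbrRest G v i y).symm),
          h.pauliZ_apply hin, (h.nbr i hin).sq_snd])
      rwa [bellMatrix_smul, bellMatrix_nbrString G v hin, smul_smul, hs, one_smul] at this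
    · have := hw (stabString G i 0) (by
        rw [A.bell_stabString]
        exact h.stab i hi hin)
      rwa [bellMatrix_stabString G v hin hi] at this

end BastaRelations

theorem bastaComplex_isRigid {ι : Type} [Fintype ι] [DecidableEq ι] [Nontrivial ι]
    {G : SimpleGraph ι} (hG : G.Connected) (v : ι) :
    QubitComplex.IsRigid.{u} (bastaComplex G v) ![1, 0] := by
  have hG' := exists_adj_of_connected hG
  have hv : (nbrs G v).Nonempty := (hG' v).imp fun j hj => mem_nbrs.2 hj
  have hn : 0 < (nbrs G v).card := Finset.card_pos.2 hv
  have sp : ∀ i, tensorMatrix (stabSite G i) *ᵥ graphState G = (1 : ℂ) • graphState G := fun i => by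
    rw [stab_graphState, one_smul]
  have sm : ∀ i, tensorMatrix (stabSite G i) *ᵥ antigraphState G = (-1 : ℂ) • antigraphState G :=
    fun i => by rw [stab_antigraphState, neg_one_smul]
  refine pauliComplex_isRigid (Kb := bastaObs v) (bastaObs_isHermitian v) (bastaObs_mul_self v)
    (bastaObs_irreducible v) (graphState_norm G) (antigraphState_norm G) (graphState_orthogonal G)
    ?_ ?_ 0 1 one_ne_zero (by simp) ?_ ?_ ?_ ?_
  · rw [bastaB₁_mulVec G v hn sp, one_smul]
  · rw [bastaB₁_mulVec G v hn sm, neg_one_smul]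
  · rw [bastaB₀_mulVec G v hn (by norm_num) sp, sigma_three_graphState]
    simp
  · rw [bastaB₀_mulVec G v hn (by norm_num) sm, sigma_three_antigraphState]
    simp
  · intro T _ _ _ A y
    rcases fin_two_eq y with rfl | rfl
    · exact A.bastaB₀_normalized G v hn
    · exact A.bastaB₁_normalized G v hn
  · intro T _ _ _ A ψ hψ hval
    have r := basta_relations A v hn hval
    refine exists_embeds A hψ (bastaObs_isHermitian v) (bastaObs_mul_self v) (κ := fun _ => 0) ?_
      (bastaObs_irreducible v) (r.exists_swap hv hG') ?_ ?_ (graphState_norm G) fun w hw =>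
      eq_smul_graphState G (r.stab_fixed hv hw)
    · intro k
      rw [bastaObs_anticommute, mul_zero, zero_smul]
    · intro k x
      by_cases hk : k = v
      · subst hk
        obtain ⟨l, hl⟩ := hv
        rcases fin_two_eq x with rfl | rfl
        · exact (r.nbr l hl).sq_zero
        · exact (r.nbr l hl).sq_one
      · exact r.sq_of_ne hv hG' hk x
    · intro k
      rw [r.anticommute hv hG hG', mul_zero, zero_smul]

end BastaRigidity

/-! ### Tree networks are rigid -/

theorem TreeNetwork.isRigid {ι : Type} [Fintype ι] [DecidableEq ι] {C : QubitComplex ι}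
    {α : Fin 2 → ℂ} (h : TreeNetwork C α) : QubitComplex.IsRigid.{u} C α := by
  induction h with
  | tsirelson => exact tsirelsonComplex_isRigid
  | tilted θ h => exact tiltedComplex_isRigid h
  | wbc θ φ ω h => exact wbcComplex_isRigid h
  | basta G hG v => exact bastaComplex_isRigid hG v
  | conjugate C α Q W hQ hW _ ih => exact ih.conjugate hQ hW
  | contract C₁ C₂ α₁ α₂ k hc _ _ ih₁ ih₂ => exact ih₁.contract ih₂ hc

end BellConnector

theorem mainTheorem9 :
    BellConnector.QubitComplex.IsFullySelfTesting.{u} BellConnector.tsirelsonComplex ∧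
    (∀ θ : ℝ, Real.sin (2 * θ) ≠ 0 →
      BellConnector.QubitComplex.IsFullySelfTesting.{u} (BellConnector.tiltedComplex θ)) ∧
    (∀ θ φ ω : ℝ, Real.cos (θ + φ) * Real.cos φ * Real.cos (θ + ω) * Real.cos ω < 0 →
      BellConnector.QubitComplex.IsFullySelfTesting.{u} (BellConnector.wbcComplex θ φ ω)) ∧
    (∀ (ι : Type) [Fintype ι] [DecidableEq ι] [Nontrivial ι] (G : SimpleGraph ι) (v : ι),
      G.Connected →
      BellConnector.QubitComplex.IsFullySelfTesting.{u} (BellConnector.bastaComplex G v)) ∧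
    (∀ (ι : Type) [Fintype ι] [DecidableEq ι] (C : BellConnector.QubitComplex ι) (α : Fin 2 → ℂ),
      BellConnector.TreeNetwork C α →
      BellConnector.QubitComplex.FullySelfTestingWith.{u} C BellConnector.rootWeights α) := by
  refine ⟨⟨_, _, BellConnector.tsirelsonComplex_isRigid.fullySelfTestingWith⟩,
    fun θ h => ⟨_, _, (BellConnector.tiltedComplex_isRigid h).fullySelfTestingWith⟩,
    fun θ φ ω h => ⟨_, _, (BellConnector.wbcComplex_isRigid h).fullySelfTestingWith⟩,
    fun ι _ _ _ G v hG => ⟨_, _, (BellConnector.bastaComplex_isRigid hG v).fullySelfTestingWith⟩,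
    fun ι _ _ C α h => h.isRigid.fullySelfTestingWith⟩
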